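/- **Notation.** All graphs are finite and simple. For a graph $G$ on $n$ vertices, $v\in V(G)$ and $S,T\subseteq V(G)$, let $d_S(v)$ be the number of neighbours of $v$ in $S$, let $e_G(S)$ be the number of edges with both endpoints in $S$ and $e_G(S,T)$ the number of edges with one endpoint in $S$ and the other in $T$ (each edge counted once); $\overline S:=V(G)\setminus S$. $G$ is *3-connected* if $n>3$ and deleting fewer than $3$ vertices always leaves a connected graph. For disjoint $S,T$, $G[S,T]$ is the bipartite graph formed by the edges between $S$ and $T$; $\delta$ and $\Delta$ denote minimum and maximum degree. For $S\subseteq U\subseteq V(G)$ let $RN_{\nu,U}(S)$ be the set of vertices of $U$ with at least $\nu|U|$ neighbours in $S$. $G[U]$ is a *$(\rho,\nu,\tau)$-robust expander component* if $|U|\ge\sqrt\rho\,n$, $e_G(U,\overline U)\le\rho n^2$, and $|RN_{\nu,U}(S)|\ge|S|+\nu|U|$ for all $S\subseteq U$ with $\tau|U|\le|S|\le(1-\tau)|U|$. For disjoint $A,B$ with $W=A\cup B$, $G[W]$ is a *bipartite $(\rho,\nu,\tau)$-robust expander component with bipartition $A,B$* if $|A|,|B|\ge\sqrt\rho\,n$,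 $\big||A|-|B|\big|\le\rho n$, $e_G(A,\overline B)+e_G(B,\overline A)\le\rho n^2$, and $|RN_{\nu,W}(S)\cap B|\ge|S|+\nu|W|$ for all $S\subseteq A$ with $\tau|A|\le|S|\le(1-\tau)|A|$. $G$ has a *weak robust partition* $\mathcal V=\{V_1,V_2,W:=A\cup B\}$ *with parameters* $\rho,\nu,\tau,\eta,2,1$ if $\mathcal V$ is a partition of $V(G)$ into three parts, $A$ and $B$ are disjoint, $|A|\ge|B|$, $G[V_1]$ and $G[V_2]$ are $(\rho,\nu,\tau)$-robust expander components, $G[W]$ is a bipartite $(\rho,\nu,\tau)$-robust expander component with bipartition $A,B$, $\delta(G[X])\ge\eta n$ for all $X\in\mathcal V$, and $\delta(G[A,B])\ge\eta n/2$. With $U:=V_1\cup V_2$, we write $\mathrm{char}_{\Delta,\varepsilon}(G)=(\ell,m)$ if $\ell=\lceil e_G(A)/\Delta-\varepsilon\rceil$ and $m$ is the largest even integer that is at most $\lceil e_G(A,U)/\Delta-\varepsilon\rceil$. A *path system* $\mathcal P$ in $G$ is a collection of vertex-disjoint non-trivial paths in $G$; $e(\mathcal P)$, $e_{\mathcal P}(S)$,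 $e_{\mathcal P}(S,T)$ count edges of $\mathcal P$. Put $$\mathrm{bal}_{AB}(\mathcal P):=e_{\mathcal P}(A)-e_{\mathcal P}(B)+\tfrac12\big(e_{\mathcal P}(A,U)-e_{\mathcal P}(B,U)\big).$$ The *reduced multigraph* $R_{\mathcal V}(\mathcal P)$ has vertex set $\mathcal V$ and, for every path in $\mathcal P$, one edge joining the parts that contain its two endpoints (loops and multiple edges are allowed). An *Euler tour* in it is a closed walk that uses each edge exactly once and visits every vertex. The hierarchy $0<1/n\ll\rho\ll\nu\ll\tau\ll\varepsilon\ll1$ means: there is a non-decreasing function $f:(0,1]\to(0,1]$ such that the statement holds for all $n\in\mathbb N$ and $\rho,\nu,\tau,\varepsilon>0$ with $1/n\le f(\rho)$, $\rho\le f(\nu)$, $\nu\le f(\tau)$, $\tau\le f(\varepsilon)$ and $\varepsilon\le f(1)$. **Lemma.** Let $n,D\in\mathbb N$, let $\ell,m\in\mathbb N_0$, and let $0<1/n\ll\rho\ll\nu\ll\tau\ll\varepsilon\ll1$. Let $G$ be a $3$-connected $D$-regular graph on $n$ vertices, where $D\ge n/4$. Suppose that $G$ has a weak robust partition $\mathcal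 V=\{V_1,V_2,W:=A\cup B\}$ with parameters $\rho,\nu,\tau,1/16,2,1$ such that $|V_1|,|V_2|\ge D/2$. Suppose further that $\Delta(G[A,V_1\cup V_2])\le D/2$, that $d_{V_i}(x)\ge d_{V_j}(x)$ for all $x\in V_i$ and $\{i,j\}=\{1,2\}$, and that $d_A(a)\le d_B(a)$ for all $a\in A$. Let $\mathrm{char}_{D/2,\varepsilon}(G)=(\ell,m)$. Then $G$ contains a path system $\mathcal P$ such that 1. $e(\mathcal P)\le\ell+m+6$; 2. $\mathrm{bal}_{AB}(\mathcal P)=|A|-|B|$; 3. $R_{\mathcal V}(\mathcal P)$ has an Euler tour. -/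

import Mathlib

open scoped Finset

namespace SimpleGraph

variable {V : Type*} [Fintype V] [DecidableEq V]

/-- The number of edges of the edge set `E` with both endpoints in `S`. -/
def eWithin (E : Finset (Sym2 V)) (S : Finset V) : ℕ := #{e ∈ E | e ∈ S.sym2}

/-- The number of edges of the edge set `E` with one endpoint in `S` and the other endpoint in `T`,
where `S` and `T` need not be disjoint (every edge is counted once). -/
def eBetween (E : Finset (Sym2 V)) (S T : Finset V) : ℕ :=
  #{e ∈ E | ∃ x ∈ S, ∃ y ∈ T, e = s(x, y)}

/-- A graph is `k`-connected if it has more than `k` vertices and remains connected whenever fewer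
than `k` vertices are deleted. -/
def IsKConnected (G : SimpleGraph V) (k : ℕ) : Prop :=
  k < Fintype.card V ∧ ∀ S : Finset V, #S < k → (G.induce ((S : Set V)ᶜ)).Connected

section Robust

variable (G : SimpleGraph V) [DecidableRel G.Adj]

/-- `d_S(v)`: the number of neighbours of `v` in `S`. -/
def degIn (v : V) (S : Finset V) : ℕ := #{w ∈ S | G.Adj v w}

/-- The `ν`-robust neighbourhood of `S` in the induced graph `G[U]`: the vertices of `U` with at
least `ν |U|` neighbours in `S`. It is only used for `S ⊆ U`. -/
noncomputable def robustNbhd (ν : ℝ) (U S : Finset V) : Finset V :=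
  {x ∈ U | ν * #U ≤ G.degIn x S}

/-- `G[U]` is a robust `(ν, τ)`-expander. -/
def IsRobustExpanderOn (U : Finset V) (ν τ : ℝ) : Prop :=
  ∀ S ⊆ U, τ * #U ≤ #S → (#S : ℝ) ≤ (1 - τ) * #U →
    (#S : ℝ) + ν * #U ≤ #(G.robustNbhd ν U S)

/-- `G[A ∪ B]` is a bipartite robust `(ν, τ)`-expander with bipartition `A, B`. -/
def IsBipRobustExpanderOn (A B : Finset V) (ν τ : ℝ) : Prop :=
  ∀ S ⊆ A, τ * #A ≤ #S → (#S : ℝ) ≤ (1 - τ) * #A →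
    (#S : ℝ) + ν * #(A ∪ B) ≤ #(G.robustNbhd ν (A ∪ B) S ∩ B)

/-- `U` is a `ρ`-component of `G`. -/
def IsRhoComponent (U : Finset V) (ρ : ℝ) : Prop :=
  √ρ * Fintype.card V ≤ #U ∧
    (eBetween G.edgeFinset U Uᶜ : ℝ) ≤ ρ * (Fintype.card V : ℝ) ^ 2

/-- `G[A ∪ B]` is `ρ`-close to bipartite with bipartition `A, B`. -/
structure IsCloseToBipartite (A B : Finset V) (ρ : ℝ) : Prop where
  disjoint : Disjoint A B
  card_left : √ρ * Fintype.card V ≤ #A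
  card_right : √ρ * Fintype.card V ≤ #B
  card_diff : |(#A : ℝ) - #B| ≤ ρ * Fintype.card V
  edges : (eBetween G.edgeFinset A Bᶜ : ℝ) + eBetween G.edgeFinset B Aᶜ
    ≤ ρ * (Fintype.card V : ℝ) ^ 2

/-- `G[U]` is a `(ρ, ν, τ)`-robust expander component of `G`. -/
def IsRobustExpanderComponent (U : Finset V) (ρ ν τ : ℝ) : Prop :=
  G.IsRhoComponent U ρ ∧ G.IsRobustExpanderOn U ν τ

/-- `G[A ∪ B]` is a bipartite `(ρ, ν, τ)`-robust expander component of `G` with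
bipartition `A, B`. -/
def IsBipRobustExpanderComponent (A B : Finset V) (ρ ν τ : ℝ) : Prop :=
  G.IsCloseToBipartite A B ρ ∧ G.IsBipRobustExpanderOn A B ν τ

/-- `𝒱 = {V₁, V₂, W := A ∪ B}` is a weak robust partition of `G` with parameters
`ρ, ν, τ, η, 2, 1`, in which `W` carries the bipartition `A, B` and `|A| ≥ |B|`. -/
structure IsWeakRobustPartition (𝒱 : Finpartition (Finset.univ : Finset V))
    (V₁ V₂ A B : Finset V) (ρ ν τ η : ℝ) : Prop where
  parts_eq : 𝒱.parts = {V₁, V₂, A ∪ B}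
  disjoint₁₂ : Disjoint V₁ V₂
  disjoint₁ : Disjoint V₁ (A ∪ B)
  disjoint₂ : Disjoint V₂ (A ∪ B)
  card_le : #B ≤ #A
  expander₁ : G.IsRobustExpanderComponent V₁ ρ ν τ
  expander₂ : G.IsRobustExpanderComponent V₂ ρ ν τ
  bipExpander : G.IsBipRobustExpanderComponent A B ρ ν τ
  minDegree : ∀ X ∈ 𝒱.parts, ∀ x ∈ X, η * Fintype.card V ≤ G.degIn x X
  minDegree_left : ∀ a ∈ A, η * Fintype.card V / 2 ≤ G.degIn a B
  minDegree_right : ∀ b ∈ B, η * Fintype.card V / 2 ≤ G.degIn b A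

/-- The maximum degree of the bipartite graph `G[S, T]` is at most `r`
(for disjoint `S` and `T`). -/
def MaxDegreeBetweenLE (S T : Finset V) (r : ℝ) : Prop :=
  (∀ x ∈ S, (G.degIn x T : ℝ) ≤ r) ∧ ∀ y ∈ T, (G.degIn y S : ℝ) ≤ r

/-- The relation `char_{Δ,ε}(G) = (ℓ, m)` with respect to the sets `A` and `U`:
`ℓ = ⌈e(A)/Δ - ε⌉` and `m` is the largest even integer that is at most `⌈e(A,U)/Δ - ε⌉`. -/
def IsChar (A U : Finset V) (Δ ε : ℝ) (ℓ m : ℕ) : Prop :=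
  (ℓ : ℤ) = ⌈(eWithin G.edgeFinset A : ℝ) / Δ - ε⌉ ∧
    IsGreatest {k : ℤ | Even k ∧ k ≤ ⌈(eBetween G.edgeFinset A U : ℝ) / Δ - ε⌉} (m : ℤ)

end Robust

/-- A path system in `G`: a finite family of pairwise vertex-disjoint non-trivial paths of `G`. -/
structure PathSystem (G : SimpleGraph V) where
  num : ℕ
  src : Fin num → V
  tgt : Fin num → V
  walk : ∀ i, G.Walk (src i) (tgt i)
  isPath : ∀ i, (walk i).IsPath
  nontrivial : ∀ i, ¬ (walk i).Nil
  disjoint : Pairwise fun i j => (walk i).support.Disjoint (walk j).support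

namespace PathSystem

variable {G : SimpleGraph V} (P : PathSystem G)

/-- The set of all edges on the paths of `P`. -/
def edges : Finset (Sym2 V) := Finset.univ.biUnion fun i => (P.walk i).edges.toFinset

/-- `bal_{AB}(P)` with respect to `A`, `B` and the set `U` of remaining vertices. -/
noncomputable def bal (A B U : Finset V) : ℝ :=
  (eWithin P.edges A : ℝ) - eWithin P.edges B
    + ((eBetween P.edges A U : ℝ) - eBetween P.edges B U) / 2

/-- The reduced multigraph of `P`: its vertices are the parts of `𝒱`, and each path of `P` is an
edge joining the parts that contain the two endpoints of the path. -/
def reducedMultigraph (𝒱 : Finpartition (Finset.univ : Finset V)) :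
    Graph (Finset V) (Fin P.num) where
  vertexSet := {X | X ∈ 𝒱.parts}
  IsLink i X Y := s(X, Y) = s(𝒱.part (P.src i), 𝒱.part (P.tgt i))
  isLink_symm i _ := ⟨fun X Y h => by rw [Sym2.eq_swap]; exact h⟩
  eq_or_eq_of_isLink_of_isLink i X Y Z Z' h h' := by
    have h'' := h.trans h'.symm
    simp only [Sym2.eq_iff] at h''
    tauto
  left_mem_of_isLink i X Y h := by
    simp only [Sym2.eq_iff] at h
    rcases h with ⟨rfl, -⟩ | ⟨rfl, -⟩ <;> simp

end PathSystem

end SimpleGraph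

/-- The multigraph `R` has an Euler tour: a closed walk `v₀ e₀ v₁ e₁ … e_{k-1} v_k = v₀` that uses
every edge exactly once and visits every vertex. -/
def Graph.HasEulerTour {α β : Type*} (R : Graph α β) : Prop :=
  ∃ (k : ℕ) (v : Fin (k + 1) → α) (e : Fin k → β),
    (∀ i : Fin k, R.IsLink (e i) (v i.castSucc) (v i.succ)) ∧
    v 0 = v (Fin.last k) ∧ Function.Injective e ∧
    Set.range e = R.edgeSet ∧ Set.range v = R.vertexSet

/-! Write U = V₁ ∪ V₂ and t = |A| − |B|; call an edge between V₁ and V₂ a cross edge. An Euler tour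
of a multigraph on three vertices that visits all of them exists as soon as the three numbers of
links between pairs of vertices have the same parity and at least two of them are positive
(`hasClosedTrail_of_counts`). The task is therefore to find disjoint paths with admissible link
numbers, balance t and few edges.

Such systems are grown from small patterns: a triangle of edges W–V₁, W–V₂, V₁–V₂; two W–V₁ edges
with two cross edges; two edges from W to each of V₁ and V₂; and a few larger ones. A W–U edge
contributes 1/2 or −1/2 to the balance according to whether it ends in A or in B, and a cross edge
contributes nothing. An edge inside A or inside B can be added afterwards (`HasTour.add_edge`); it
changes the balance by 1 or −1 and no link number. To stay within the integers, twice the balance is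
recorded throughout.

3-connectivity enters through `IsSep`: two vertices never cover all edges leaving a part. Regularity
enters through `nIn_add_nOut`, that is, 2e(A) + e(A,U) = 2e(B) + e(B,U) + Dt. Together with the
definition of the characteristic this yields t ≤ ℓ + m/2 (`IsChar.two_mul_le`).

If t = 0, six edges are available, and if t = 1, seven, because then ℓ + m ≥ 1. In both cases the
cross edges are absent, or form a star, or contain two disjoint edges. In each situation `IsSep`
produces a pattern, and its balance is corrected by edges inside A or B or by exchanging W–U edges.
The degree conditions bound how many edges one or two vertices can cover, so the counting identity
guarantees that the edges needed for the correction exist (`IsFrame.tourLE_zero`,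
`IsFrame.tourLE_two`).

If t ≥ 2, a base of bounded size is built first (`IsSep.hasBase`) and then extended to balance t
(`HasBase.tourLE`). If A contains many edges that are spread out, they suffice. Otherwise few
vertices of large degree, the hubs, carry almost all edges at A that do not go to B. A hub with many
neighbours in A can be the end of two added A-edges, for a gain of 2; any other hub can be the
middle of one path with two edges, for a gain of 1. As d_A ≤ d_B on A and Δ(G[A,U]) ≤ D/2, hubs of
these kinds account for at most about D and D/2 of the sum 2e(A) + e(A,U) ≥ Dt, so their capacity is
about t or more in terms of half-gains 2t, leaving room for t and for the base. The base has to use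
up little of this capacity relative to its own balance, which is the content of `HasBase`. -/

set_option linter.unusedSectionVars false
set_option linter.unusedSimpArgs false

/-! ### Euler tours in multigraphs on three vertices. -/

namespace SimpleGraph

/-- The number of links in a multigraph on three vertices, sorted by the vertex they miss: an Euler
tour visiting all vertices exists if all degrees are even and at least two kinds of links occur. -/
structure EulerCounts (a b c : ℕ) : Prop where
  mod₁ : a % 2 = b % 2
  mod₂ : b % 2 = c % 2
  connected : 0 < a ∧ 0 < b ∨ 0 < a ∧ 0 < c ∨ 0 < b ∧ 0 < c

/-- Two parallel links do not affect parities, and `h3` keeps two kinds of links present after their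
removal. This drives the induction in `hasClosedTrail_of_counts`. -/
theorem EulerCounts.sub_two {f f' : Fin 3 → ℕ} {i j k : Fin 3} (hij : i ≠ j) (hik : i ≠ k)
    (hjk : j ≠ k) (h : EulerCounts (f 0) (f 1) (f 2)) (h3 : 3 ≤ f i ∨ 0 < f j ∧ 0 < f k)
    (hi : f' i + 2 = f i) (hj : f' j = f j) (hk : f' k = f k) :
    EulerCounts (f' 0) (f' 1) (f' 2) := by
  obtain ⟨m₁, m₂, m₃⟩ := h
  fin_cases i <;> fin_cases j <;> fin_cases k <;>
    simp only [Fin.zero_eta, Fin.mk_one, Fin.reduceFinMk, ne_eq, not_true_eq_false] at * <;>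
    constructor <;> omega

section Trail

variable {ι R : Type*} (s t : ι → R)

/-- `l` lists the edges, and the vertices reached, of a walk from `u` to `v` in the multigraph in
which the edge `e` joins `s e` and `t e`. -/
def IsLinkWalk : R → List (ι × R) → R → Prop
  | u, [], v => u = v
  | u, p :: l, v => s(s p.1, t p.1) = s(u, p.2) ∧ IsLinkWalk p.2 l v

variable {s t}

theorem IsLinkWalk.append {u v w : R} {l l' : List (ι × R)} (h : IsLinkWalk s t u l v)
    (h' : IsLinkWalk s t v l' w) : IsLinkWalk s t u (l ++ l') w := by
  induction l generalizing u with
  | nil => cases h; simpa using h'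
  | cons p l ih => exact ⟨h.1, ih h.2⟩

theorem IsLinkWalk.exists_split {u v r : R} {l : List (ι × R)} (h : IsLinkWalk s t u l v)
    (hr : r ∈ l.map Prod.snd) :
    ∃ l₁ l₂, l = l₁ ++ l₂ ∧ IsLinkWalk s t u l₁ r ∧ IsLinkWalk s t r l₂ v := by
  induction l generalizing u with
  | nil => simp at hr
  | cons p l ih =>
    by_cases hp : p.2 = r
    · exact ⟨[p], l, rfl, ⟨h.1, hp⟩, hp ▸ h.2⟩
    · have : r ∈ l.map Prod.snd := by
        simp only [List.map_cons, List.mem_cons] at hr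
        exact hr.resolve_left (Ne.symm hp)
      obtain ⟨l₁, l₂, rfl, h₁, h₂⟩ := ih h.2 this
      exact ⟨p :: l₁, l₂, rfl, ⟨h.1, h₁⟩, h₂⟩

variable (s t) in
/-- A closed walk using exactly the edges in `J`, each of them once, and visiting every vertex. -/
def HasClosedTrail (J : Finset ι) : Prop :=
  ∃ (u : R) (l : List (ι × R)), IsLinkWalk s t u l u ∧ (l.map Prod.fst).Nodup ∧
    (∀ e, e ∈ l.map Prod.fst ↔ e ∈ J) ∧ ∀ r, r ∈ l.map Prod.snd

/-- The given closed trail visits every vertex, in particular `r`, so it can be cut there and the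
closed detour spliced in. -/
theorem HasClosedTrail.insert_detour [DecidableEq ι] {J J' : Finset ι} (h : HasClosedTrail s t J)
    (r : R) (d : List (ι × R)) (hd : IsLinkWalk s t r d r) (hnd : (d.map Prod.fst).Nodup)
    (hJ : ∀ e ∈ d.map Prod.fst, e ∉ J) (hJ' : ∀ e, e ∈ J' ↔ e ∈ J ∨ e ∈ d.map Prod.fst) :
    HasClosedTrail s t J' := by
  obtain ⟨u, l, hl, hn, hm, hv⟩ := h
  obtain ⟨l₁, l₂, rfl, h₁, h₂⟩ := hl.exists_split (hv r)
  refine ⟨u, l₁ ++ (d ++ l₂), h₁.append (hd.append h₂), ?_, ?_, ?_⟩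
  · have hperm : List.Perm ((l₁ ++ (d ++ l₂)).map Prod.fst)
        (d.map Prod.fst ++ (l₁ ++ l₂).map Prod.fst) := by
      simp only [List.map_append]
      exact List.perm_append_comm_assoc _ _ _
    rw [hperm.nodup_iff, List.nodup_append']
    exact ⟨hnd, hn, fun e he he' => hJ e he ((hm e).1 he')⟩
  · intro e
    rw [hJ', ← hm e]
    simp only [List.map_append, List.mem_append]
    tauto
  · intro r'
    have := hv r'
    simp only [List.map_append, List.mem_append] at this ⊢
    tauto

variable {s t : ι → Fin 3}

variable (s t) in
/-- The edges in `J` that join the two vertices other than `i`. -/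
def linksAvoiding (J : Finset ι) (i : Fin 3) : Finset ι :=
  {e ∈ J | s e ≠ t e ∧ s e ≠ i ∧ t e ≠ i}

theorem link_eq_of_mem {J : Finset ι} {i j k : Fin 3} (hij : i ≠ j) (hik : i ≠ k) (hjk : j ≠ k)
    {e : ι} (he : e ∈ linksAvoiding s t J i) : s(s e, t e) = s(j, k) := by
  simp only [linksAvoiding, Finset.mem_filter] at he
  obtain ⟨-, h₁, h₂, h₃⟩ := he
  generalize s e = a at *
  generalize t e = b at *
  revert i j k a b
  decide

theorem disjoint_linksAvoiding {J : Finset ι} {i j : Fin 3} (hij : i ≠ j) {e : ι}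
    (h : e ∈ linksAvoiding s t J i) : e ∉ linksAvoiding s t J j := by
  simp only [linksAvoiding, Finset.mem_filter] at h ⊢
  obtain ⟨-, h₁, h₂, h₃⟩ := h
  rintro ⟨-, -, h₅, h₆⟩
  generalize s e = a at *
  generalize t e = b at *
  revert i j a b
  decide

/-- The trail runs from `i` to `k` and back, then to `j` and back. -/
theorem hasClosedTrail_of_counts_base [DecidableEq ι] {J : Finset ι} {i j k : Fin 3} (hij : i ≠ j) (hik : i ≠ k)
    (hjk : j ≠ k) (hloop : ∀ e ∈ J, s e ≠ t e)
    (hi : #(linksAvoiding s t J i) = 0) (hj : #(linksAvoiding s t J j) = 2)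
    (hk : #(linksAvoiding s t J k) = 2) : HasClosedTrail s t J := by
  have hcov : ∀ e ∈ J, e ∈ linksAvoiding s t J i ∨ e ∈ linksAvoiding s t J j ∨
      e ∈ linksAvoiding s t J k := by
    intro e he
    simp only [linksAvoiding, Finset.mem_filter, he, true_and]
    have := hloop e he
    generalize s e = a at *
    generalize t e = b at *
    clear hi hj hk hloop
    revert i j k a b
    decide
  obtain ⟨e₁, e₂, h12, hJj⟩ := Finset.card_eq_two.1 hj
  obtain ⟨e₃, e₄, h34, hJk⟩ := Finset.card_eq_two.1 hk
  have m₁ : e₁ ∈ linksAvoiding s t J j := by simp [hJj]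
  have m₂ : e₂ ∈ linksAvoiding s t J j := by simp [hJj]
  have m₃ : e₃ ∈ linksAvoiding s t J k := by simp [hJk]
  have m₄ : e₄ ∈ linksAvoiding s t J k := by simp [hJk]
  have l₁ := link_eq_of_mem hij.symm hjk hik m₁
  have l₂ := link_eq_of_mem hjk hij.symm hik.symm m₂
  have l₃ := link_eq_of_mem hik.symm hjk.symm hij m₃
  have l₄ := link_eq_of_mem hjk.symm hik.symm hij.symm m₄
  refine ⟨i, [(e₁, k), (e₂, i), (e₃, j), (e₄, i)], ⟨l₁, l₂, l₃, l₄, rfl⟩, ?_, ?_, ?_⟩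
  · have d₁ := disjoint_linksAvoiding hjk m₁
    have d₂ := disjoint_linksAvoiding hjk m₂
    rw [hJk] at d₁ d₂
    simp at d₁ d₂
    simp
    tauto
  · intro e
    have : e ∈ J ↔ e ∈ linksAvoiding s t J j ∨ e ∈ linksAvoiding s t J k := by
      constructor
      · intro he
        have := hcov e he
        rw [Finset.card_eq_zero] at hi
        simpa [hi] using this
      · rintro (h | h) <;> exact (Finset.mem_filter.1 h).1
    rw [this, hJj, hJk]
    simp
    tauto
  · intro r
    clear * - hij hik hjk
    simp only [List.map_cons, List.map_nil, List.mem_cons, List.not_mem_nil, or_false]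
    revert i j k r
    decide

theorem hasClosedTrail_of_counts_triangle [DecidableEq ι] {J : Finset ι} (hloop : ∀ e ∈ J, s e ≠ t e)
    (h₀ : #(linksAvoiding s t J 0) = 1) (h₁ : #(linksAvoiding s t J 1) = 1)
    (h₂ : #(linksAvoiding s t J 2) = 1) : HasClosedTrail s t J := by
  have hcov : ∀ e ∈ J, e ∈ linksAvoiding s t J 0 ∨ e ∈ linksAvoiding s t J 1 ∨
      e ∈ linksAvoiding s t J 2 := by
    intro e he
    simp only [linksAvoiding, Finset.mem_filter, he, true_and]
    have := hloop e he
    generalize s e = a at *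
    generalize t e = b at *
    clear * - this
    revert a b
    decide
  obtain ⟨e₀, hJ₀⟩ := Finset.card_eq_one.1 h₀
  obtain ⟨e₁, hJ₁⟩ := Finset.card_eq_one.1 h₁
  obtain ⟨e₂, hJ₂⟩ := Finset.card_eq_one.1 h₂
  have m₀ : e₀ ∈ linksAvoiding s t J 0 := by simp [hJ₀]
  have m₁ : e₁ ∈ linksAvoiding s t J 1 := by simp [hJ₁]
  have m₂ : e₂ ∈ linksAvoiding s t J 2 := by simp [hJ₂]
  have l₀ := link_eq_of_mem (j := 1) (k := 2) (by decide) (by decide) (by decide) m₀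
  have l₁ := link_eq_of_mem (j := 2) (k := 0) (by decide) (by decide) (by decide) m₁
  have l₂ := link_eq_of_mem (j := 0) (k := 1) (by decide) (by decide) (by decide) m₂
  refine ⟨0, [(e₂, 1), (e₀, 2), (e₁, 0)], ⟨l₂, l₀, l₁, rfl⟩, ?_, ?_, ?_⟩
  · have d₂₀ := disjoint_linksAvoiding (j := 0) (by decide) m₂
    have d₂₁ := disjoint_linksAvoiding (j := 1) (by decide) m₂
    have d₀₁ := disjoint_linksAvoiding (j := 1) (by decide) m₀
    rw [hJ₀] at d₂₀
    rw [hJ₁] at d₂₁ d₀₁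
    simp at d₂₀ d₂₁ d₀₁
    simp
    tauto
  · intro e
    have : e ∈ J ↔ e ∈ linksAvoiding s t J 0 ∨ e ∈ linksAvoiding s t J 1 ∨
        e ∈ linksAvoiding s t J 2 :=
      ⟨hcov e, by rintro (h | h | h) <;> exact (Finset.mem_filter.1 h).1⟩
    rw [this, hJ₀, hJ₁, hJ₂]
    simp
    tauto
  · intro r
    fin_cases r <;> simp

/-- Loops and superfluous pairs of parallel links are removed and later reinserted as detours. What
remains is a triangle or two double links sharing a vertex. -/
theorem hasClosedTrail_of_counts [DecidableEq ι] (J : Finset ι)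
    (h : EulerCounts #(linksAvoiding s t J 0) #(linksAvoiding s t J 1) #(linksAvoiding s t J 2)) :
    HasClosedTrail s t J := by
  induction hn : #J using Nat.strong_induction_on generalizing J with
  | _ n ih =>
  subst hn
  by_cases hloop : ∀ e ∈ J, s e ≠ t e
  swap
  · push Not at hloop
    obtain ⟨e, he, hst⟩ := hloop
    have key : ∀ i, linksAvoiding s t (J.erase e) i = linksAvoiding s t J i := by
      intro i
      ext e'
      simp only [linksAvoiding, Finset.mem_filter, Finset.mem_erase]
      constructor
      · rintro ⟨⟨-, h₁⟩, h₂⟩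
        exact ⟨h₁, h₂⟩
      · rintro ⟨h₁, h₂⟩
        exact ⟨⟨fun hee => h₂.1 (hee ▸ hst), h₁⟩, h₂⟩
    have := ih _ (Finset.card_erase_lt_of_mem he) (J.erase e) (by simpa only [key] using h) rfl
    refine this.insert_detour (t e) [(e, t e)] ⟨by rw [hst], rfl⟩ (by simp) (by simp) ?_
    intro e'
    by_cases hee : e' = e <;> simp [hee, he]
  by_cases hpair : ∃ i j k : Fin 3, i ≠ j ∧ i ≠ k ∧ j ≠ k ∧ 2 ≤ #(linksAvoiding s t J i) ∧
      (3 ≤ #(linksAvoiding s t J i) ∨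
        0 < #(linksAvoiding s t J j) ∧ 0 < #(linksAvoiding s t J k))
  · obtain ⟨i, j, k, hij, hik, hjk, h2, h3⟩ := hpair
    obtain ⟨e, he, e', he', hee⟩ := Finset.one_lt_card.1 h2
    set J' := (J.erase e).erase e' with hJ'
    have heJ : e ∈ J := (Finset.mem_filter.1 he).1
    have heJ' : e' ∈ J := (Finset.mem_filter.1 he').1
    have key : ∀ r, linksAvoiding s t J' r = ((linksAvoiding s t J r).erase e).erase e' := by
      intro r
      ext f
      simp only [linksAvoiding, Finset.mem_filter, Finset.mem_erase, hJ']
      tauto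
    have keyi : #(linksAvoiding s t J' i) + 2 = #(linksAvoiding s t J i) := by
      rw [key, Finset.card_erase_of_mem (Finset.mem_erase.2 ⟨hee.symm, he'⟩),
        Finset.card_erase_of_mem he]
      omega
    have keyr : ∀ r, i ≠ r → #(linksAvoiding s t J' r) = #(linksAvoiding s t J r) := by
      intro r hr
      rw [key, Finset.erase_eq_of_notMem, Finset.erase_eq_of_notMem]
      · exact disjoint_linksAvoiding hr he
      · exact fun hh => disjoint_linksAvoiding hr he' (Finset.mem_of_mem_erase hh)
    have hJcard : #J' < #J :=
      (Finset.card_le_card (Finset.erase_subset _ _)).trans_lt (Finset.card_erase_lt_of_mem heJ)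
    have hJ'c : EulerCounts #(linksAvoiding s t J' 0) #(linksAvoiding s t J' 1)
        #(linksAvoiding s t J' 2) := by
      obtain ⟨m₁, m₂, m₃⟩ := h
      have hj := keyr j hij
      have hk := keyr k hik
      exact EulerCounts.sub_two (f := fun i => #(linksAvoiding s t J i))
        (f' := fun i => #(linksAvoiding s t J' i)) hij hik hjk ⟨m₁, m₂, m₃⟩ h3 keyi hj hk
    have := ih _ hJcard J' hJ'c rfl
    have l₁ := link_eq_of_mem hij hik hjk he
    have l₂ := link_eq_of_mem hik hij hjk.symm he'
    refine this.insert_detour j [(e, k), (e', j)] ⟨l₁, l₂, rfl⟩ (by simpa using hee)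
      (by simp [hJ']) ?_
    intro f
    simp only [hJ', Finset.mem_erase, List.map_cons, List.map_nil, List.mem_cons,
      List.not_mem_nil, or_false]
    by_cases h1 : f = e
    · simp [h1, heJ]
    · by_cases h2 : f = e'
      · simp [h2, heJ']
      · simp [h1, h2]
  -- Without a removable pair, a vanishing count forces the other two to be positive and even, hence
  -- 2; if no count vanishes, all are 1.
  · push Not at hpair
    obtain ⟨m₁, m₂, m₃⟩ := h
    have p₀ := hpair 0 1 2 (by decide) (by decide) (by decide)
    have p₁ := hpair 1 0 2 (by decide) (by decide) (by decide)
    have p₂ := hpair 2 0 1 (by decide) (by decide) (by decide)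
    by_cases q₀ : #(linksAvoiding s t J 0) = 0
    · exact hasClosedTrail_of_counts_base (i := 0) (j := 1) (k := 2) (by decide) (by decide)
        (by decide) hloop q₀ (by omega) (by omega)
    by_cases q₁ : #(linksAvoiding s t J 1) = 0
    · exact hasClosedTrail_of_counts_base (i := 1) (j := 0) (k := 2) (by decide) (by decide)
        (by decide) hloop q₁ (by omega) (by omega)
    by_cases q₂ : #(linksAvoiding s t J 2) = 0
    · exact hasClosedTrail_of_counts_base (i := 2) (j := 0) (k := 1) (by decide) (by decide)
        (by decide) hloop q₂ (by omega) (by omega)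
    exact hasClosedTrail_of_counts_triangle hloop (by omega) (by omega) (by omega)

end Trail

end SimpleGraph

/-! ### Path systems as lists of vertex lists, and their translation into `PathSystem`. -/

namespace SimpleGraph

/-- The four vertex classes of a weak robust partition. -/
inductive VClass
  | V₁ | V₂ | A | B
  deriving DecidableEq

namespace VClass

/-- The part of the partition containing a class. -/
def part : VClass → Fin 3
  | V₁ => 0
  | V₂ => 1
  | A => 2
  | B => 2

/-- Twice the contribution of an edge between two classes to the balance. -/
def wt : VClass → VClass → ℤ
  | A, A => 2
  | B, B => -2
  | A, V₁ => 1
  | A, V₂ => 1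
  | V₁, A => 1
  | V₂, A => 1
  | B, V₁ => -1
  | B, V₂ => -1
  | V₁, B => -1
  | V₂, B => -1
  | _, _ => 0

theorem wt_comm (c d : VClass) : wt c d = wt d c := by cases c <;> cases d <;> rfl

/-- Whether two classes lie in the two different parts other than `i`. -/
def link (i : Fin 3) (c d : VClass) : ℕ :=
  if c.part ≠ d.part ∧ c.part ≠ i ∧ d.part ≠ i then 1 else 0

end VClass

open VClass

/-- The indexed form of a walk, as required by `Graph.HasEulerTour`. -/
theorem IsLinkWalk.getElem {ι R : Type*} {s t : ι → R} {u v : R} {l : List (ι × R)}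
    (h : IsLinkWalk s t u l v) :
    (∀ i (hi : i < l.length), s(s l[i].1, t l[i].1) =
      s((u :: l.map Prod.snd)[i]'(by simp; omega), (u :: l.map Prod.snd)[i + 1]'(by simpa))) ∧
      (u :: l.map Prod.snd)[l.length]'(by simp) = v := by
  induction l generalizing u with
  | nil => exact ⟨by simp, h⟩
  | cons p l ih =>
    obtain ⟨h₁, h₂⟩ := ih h.2
    refine ⟨fun i hi => ?_, ?_⟩
    · cases i with
      | zero => exact h.1
      | succ i => exact h₁ i (by simpa using hi)
    · exact h₂

variable {V : Type*}

section Lists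

variable (ty : V → VClass)

/-- Twice the balance of a path. -/
def pathWeight : List V → ℤ
  | x :: y :: l => wt (ty x) (ty y) + pathWeight (y :: l)
  | _ => 0

/-- Whether the ends of a path lie in the two different parts other than `i`. -/
def pathLink (i : Fin 3) : List V → ℕ
  | [] => 0
  | x :: l => link i (ty x) (ty (l.getLastD x))

/-- The edges of a path. -/
def pathEdges : List V → List (Sym2 V)
  | x :: y :: l => s(x, y) :: pathEdges (y :: l)
  | _ => []

end Lists

/-- A path system of a graph, as a list of paths given by their vertices, with `k` edges and
twice the balance `c`, for which the reduced multigraph has an Euler tour. -/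
structure IsTourSystem (G : SimpleGraph V) (ty : V → VClass) (L : List (List V)) (k : ℕ)
    (c : ℤ) : Prop where
  chain : ∀ p ∈ L, p.IsChain G.Adj
  two_le : ∀ p ∈ L, 2 ≤ p.length
  nodup : L.flatten.Nodup
  card : (L.map fun p => p.length - 1).sum = k
  weight : (L.map (pathWeight ty)).sum = c
  euler : EulerCounts (L.map (pathLink ty 0)).sum (L.map (pathLink ty 1)).sum
    (L.map (pathLink ty 2)).sum

theorem edges_ofSupport {G : SimpleGraph V} : ∀ (p : List V) (hne : p ≠ [])
    (hc : p.IsChain G.Adj), (Walk.ofSupport p hne hc).edges = pathEdges p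
  | [], hne, _ => absurd rfl hne
  | [x], _, _ => rfl
  | x :: y :: l, _, hc => by
    change s(x, y) :: (Walk.ofSupport (y :: l) _ _).edges = _
    rw [edges_ofSupport]
    rfl

theorem length_pathEdges : ∀ p : List V, (pathEdges p).length = p.length - 1
  | [] => rfl
  | [_] => rfl
  | x :: y :: l => by simp [pathEdges, length_pathEdges (y :: l)]

theorem mem_of_mem_pathEdges {x : V} {e : Sym2 V} : ∀ {p : List V}, e ∈ pathEdges p → x ∈ e → x ∈ p
  | [], h, _ => by simp [pathEdges] at h
  | [_], h, _ => by simp [pathEdges] at h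
  | a :: b :: l, h, hx => by
    simp only [pathEdges, List.mem_cons] at h
    rcases h with rfl | h
    · rcases Sym2.mem_iff.1 hx with rfl | rfl <;> simp
    · exact List.mem_cons_of_mem _ (mem_of_mem_pathEdges h hx)

section Count

variable [Fintype V] [DecidableEq V]

theorem exists_between_iff (S T : Finset V) (x y : V) :
    (∃ a ∈ S, ∃ b ∈ T, s(x, y) = s(a, b)) ↔ x ∈ S ∧ y ∈ T ∨ x ∈ T ∧ y ∈ S := by
  constructor
  · rintro ⟨a, ha, b, hb, h⟩
    rcases Sym2.eq_iff.1 h with ⟨rfl, rfl⟩ | ⟨rfl, rfl⟩ <;> tauto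
  · rintro (h | h)
    · exact ⟨x, h.1, y, h.2, rfl⟩
    · exact ⟨y, h.2, x, h.1, Sym2.eq_swap⟩

theorem pathWeight_eq (ty : V → VClass) (A B U : Finset V) (hA : ∀ v, v ∈ A ↔ ty v = .A)
    (hB : ∀ v, v ∈ B ↔ ty v = .B) (hU : ∀ v, v ∈ U ↔ ty v = .V₁ ∨ ty v = .V₂) (p : List V) :
    pathWeight ty p = 2 * (((pathEdges p).countP fun e => e ∈ A.sym2 : ℕ) : ℤ)
      - 2 * ((pathEdges p).countP fun e => e ∈ B.sym2 : ℕ)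
      + ((pathEdges p).countP fun e => ∃ x ∈ A, ∃ y ∈ U, e = s(x, y) : ℕ)
      - ((pathEdges p).countP fun e => ∃ x ∈ B, ∃ y ∈ U, e = s(x, y) : ℕ) := by
  match p with
  | [] => simp [pathWeight, pathEdges]
  | [_] => simp [pathWeight, pathEdges]
  | x :: y :: l =>
    rw [pathWeight, pathWeight_eq ty A B U hA hB hU (y :: l)]
    simp only [pathEdges, List.countP_cons, Finset.mk_mem_sym2_iff, exists_between_iff]
    have h₁ : (decide (x ∈ A ∧ y ∈ A)) = decide (ty x = .A ∧ ty y = .A) := by simp only [hA]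
    have h₂ : (decide (x ∈ B ∧ y ∈ B)) = decide (ty x = .B ∧ ty y = .B) := by simp only [hB]
    have h₃ : (decide (x ∈ A ∧ y ∈ U ∨ x ∈ U ∧ y ∈ A)) = decide (ty x = .A ∧
      (ty y = .V₁ ∨ ty y = .V₂) ∨ (ty x = .V₁ ∨ ty x = .V₂) ∧ ty y = .A) := by simp only [hA, hU]
    have h₄ : (decide (x ∈ B ∧ y ∈ U ∨ x ∈ U ∧ y ∈ B)) = decide (ty x = .B ∧
      (ty y = .V₁ ∨ ty y = .V₂) ∨ (ty x = .V₁ ∨ ty x = .V₂) ∧ ty y = .B) := by simp only [hB, hU]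
    rw [h₁, h₂, h₃, h₄]
    generalize List.countP (fun e => decide (e ∈ A.sym2)) (pathEdges (y :: l)) = n₁
    generalize List.countP (fun e => decide (e ∈ B.sym2)) (pathEdges (y :: l)) = n₂
    generalize List.countP (fun e => decide (∃ x ∈ A, ∃ y ∈ U, e = s(x, y))) (pathEdges (y :: l))
      = n₃
    generalize List.countP (fun e => decide (∃ x ∈ B, ∃ y ∈ U, e = s(x, y))) (pathEdges (y :: l))
      = n₄
    cases ty x <;> cases ty y <;> simp [wt] <;> ring

end Count

section Realize

variable [Fintype V] [DecidableEq V] {G : SimpleGraph V} {ty : V → VClass}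

theorem sum_map_eq_sum_getElem {α M : Type*} [AddCommMonoid M] (L : List α) (f : α → M) :
    (L.map f).sum = ∑ i : Fin L.length, f L[i] := by
  rw [← List.sum_ofFn]
  congr 1
  apply List.ext_getElem <;> simp

theorem getElem_disjoint_of_nodup_flatten {L : List (List V)} (h : L.flatten.Nodup) {i j : ℕ}
    (hi : i < L.length) (hj : j < L.length) (hij : i ≠ j) : L[i].Disjoint L[j] := by
  rw [List.nodup_flatten] at h
  rcases lt_or_gt_of_ne hij with hlt | hlt
  · exact List.pairwise_iff_getElem.1 h.2 i j hi hj hlt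
  · exact (List.pairwise_iff_getElem.1 h.2 j i hj hi hlt).symm

namespace IsTourSystem

variable {L : List (List V)} {k : ℕ} {c : ℤ}

theorem ne_nil (h : IsTourSystem G ty L k c) {p : List V} (hp : p ∈ L) : p ≠ [] := by
  have := h.two_le p hp
  rintro rfl
  simp at this

theorem nodup_of_mem (h : IsTourSystem G ty L k c) {p : List V} (hp : p ∈ L) : p.Nodup :=
  (List.nodup_flatten.1 h.nodup).1 p hp

/-- The path system given by a list of paths. -/
def toPathSystem (h : IsTourSystem G ty L k c) : G.PathSystem where
  num := L.length
  src i := L[i].head (h.ne_nil (List.getElem_mem i.2))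
  tgt i := L[i].getLast (h.ne_nil (List.getElem_mem i.2))
  walk i := Walk.ofSupport L[i] (h.ne_nil (List.getElem_mem i.2)) (h.chain _ (List.getElem_mem i.2))
  isPath i := by
    rw [Walk.isPath_def, Walk.support_ofSupport]
    exact h.nodup_of_mem (List.getElem_mem i.2)
  nontrivial i := by
    rw [Walk.not_nil_iff_lt_length, Walk.length_ofSupport]
    have := h.two_le _ (List.getElem_mem i.2)
    simp only [Fin.getElem_fin]
    omega
  disjoint i j hij := by
    change (Walk.support _).Disjoint (Walk.support _)
    rw [Walk.support_ofSupport, Walk.support_ofSupport]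
    exact getElem_disjoint_of_nodup_flatten h.nodup i.2 j.2 (fun hh => hij (Fin.ext hh))

theorem toPathSystem_edges (h : IsTourSystem G ty L k c) :
    h.toPathSystem.edges =
      Finset.univ.biUnion fun i : Fin L.length => (pathEdges L[i]).toFinset := by
  simp only [PathSystem.edges, toPathSystem, edges_ofSupport]
  rfl

theorem nodup_pathEdges (h : IsTourSystem G ty L k c) {p : List V} (hp : p ∈ L) :
    (pathEdges p).Nodup := by
  rw [← edges_ofSupport p (h.ne_nil hp) (h.chain p hp)]
  refine Walk.IsTrail.edges_nodup (Walk.IsPath.isTrail ?_)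
  rw [Walk.isPath_def, Walk.support_ofSupport]
  exact h.nodup_of_mem hp

/-- Disjoint paths have disjoint edge sets and a path repeats no edge, so every edge count is
additive over the list of paths. -/
theorem card_filter_edges (h : IsTourSystem G ty L k c) (q : Sym2 V → Prop) [DecidablePred q] :
    #{e ∈ h.toPathSystem.edges | q e} = (L.map fun p => (pathEdges p).countP q).sum := by
  rw [toPathSystem_edges, Finset.filter_biUnion, Finset.card_biUnion, sum_map_eq_sum_getElem]
  · refine Finset.sum_congr rfl fun i _ => ?_
    have : {e ∈ (pathEdges L[i]).toFinset | q e} = ((pathEdges L[i]).filter q).toFinset := by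
      ext e
      simp
    rw [this, List.countP_eq_length_filter]
    exact List.toFinset_card_of_nodup ((h.nodup_pathEdges (List.getElem_mem i.2)).filter _)
  · intro i _ j _ hij
    rw [Function.onFun, Finset.disjoint_left]
    intro e he he'
    simp only [Finset.mem_filter, List.mem_toFinset] at he he'
    induction e using Sym2.ind with
    | _ x y =>
      exact getElem_disjoint_of_nodup_flatten h.nodup i.2 j.2 (fun hh => hij (Fin.ext hh))
        (mem_of_mem_pathEdges he.1 (Sym2.mem_mk_left x y))
        (mem_of_mem_pathEdges he'.1 (Sym2.mem_mk_left x y))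

theorem card_edges (h : IsTourSystem G ty L k c) : #h.toPathSystem.edges = k := by
  have := h.card_filter_edges fun _ => True
  simpa [length_pathEdges, h.card] using this

theorem bal_eq (h : IsTourSystem G ty L k c) {A B U : Finset V} (hA : ∀ v, v ∈ A ↔ ty v = .A)
    (hB : ∀ v, v ∈ B ↔ ty v = .B) (hU : ∀ v, v ∈ U ↔ ty v = .V₁ ∨ ty v = .V₂) :
    h.toPathSystem.bal A B U = (c : ℝ) / 2 := by
  have hc := h.weight
  rw [funext fun p => pathWeight_eq ty A B U hA hB hU p] at hc
  simp only [PathSystem.bal, eWithin, eBetween, h.card_filter_edges]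
  rw [← hc]
  simp only [sum_map_eq_sum_getElem]
  push_cast [Finset.sum_add_distrib, Finset.sum_sub_distrib, ← Finset.mul_sum]
  ring

theorem pathLink_eq (i : Fin 3) {p : List V} (hp : p ≠ []) :
    pathLink ty i p = link i (ty (p.head hp)) (ty (p.getLast hp)) := by
  match p with
  | x :: l => rw [pathLink, List.getLast_eq_getLastD]; rfl

theorem card_linksAvoiding (h : IsTourSystem G ty L k c) (i : Fin 3) :
    #(linksAvoiding (fun j => (ty (h.toPathSystem.src j)).part)
      (fun j => (ty (h.toPathSystem.tgt j)).part) Finset.univ i) =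
      (L.map (pathLink ty i)).sum := by
  rw [sum_map_eq_sum_getElem, linksAvoiding, Finset.card_filter]
  refine Finset.sum_congr rfl fun j _ => ?_
  exact (pathLink_eq i (h.ne_nil (List.getElem_mem j.2))).symm

/-- The link sums of the list are the link counts of the multigraph whose edge `j` joins the indices
of the parts at the ends of path `j`; `φ` turns indices into parts. -/
theorem hasEulerTour (h : IsTourSystem G ty L k c)
    (𝒱 : Finpartition (Finset.univ : Finset V)) (φ : Fin 3 → Finset V)
    (hφ : ∀ v, 𝒱.part v = φ (ty v).part) (hparts : ∀ X, X ∈ 𝒱.parts ↔ ∃ r, φ r = X) :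
    (h.toPathSystem.reducedMultigraph 𝒱).HasEulerTour := by
  obtain ⟨u, l, hl, hn, hm, hv⟩ := hasClosedTrail_of_counts
    (s := fun j => (ty (h.toPathSystem.src j)).part)
    (t := fun j => (ty (h.toPathSystem.tgt j)).part) Finset.univ
    (by simp only [h.card_linksAvoiding]; exact h.euler)
  have hwalk := hl.getElem
  refine ⟨l.length, fun i => φ ((u :: l.map Prod.snd)[(i : ℕ)]'(by simpa using i.2)), fun i => l[i].1,
    ?_, ?_, ?_, ?_, ?_⟩
  · intro i
    have := (hwalk.1 i i.2)
    change s(φ _, φ _) = s(_, _)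
    rw [hφ, hφ]
    have := congrArg (Sym2.map φ) this
    simpa using this.symm
  · have := hwalk.2
    change φ u = φ _
    exact congrArg φ this.symm
  · intro i j hij
    have := hn.getElem_inj_iff (i := i) (j := j) (hi := by simp) (hj := by simp)
    simp only [List.getElem_map] at this
    exact Fin.ext (this.1 hij)
  · ext e
    have he := (hm e).2 (Finset.mem_univ e)
    obtain ⟨i, hi, hie⟩ := List.getElem_of_mem he
    rw [List.length_map] at hi
    have : e ∈ (h.toPathSystem.reducedMultigraph 𝒱).edgeSet := by
      rw [Graph.edge_mem_iff_exists_isLink]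
      exact ⟨_, _, rfl⟩
    simp only [Set.mem_range, this, iff_true]
    exact ⟨⟨i, hi⟩, by simpa using hie⟩
  · ext X
    change _ ↔ X ∈ 𝒱.parts
    rw [hparts]
    constructor
    · rintro ⟨i, rfl⟩
      exact ⟨_, rfl⟩
    · rintro ⟨r, rfl⟩
      obtain ⟨i, hi, hir⟩ := List.getElem_of_mem (hv r)
      rw [List.length_map] at hi
      -- The list `l` records the vertices reached and omits the starting vertex `u`, hence the
      -- shift by one.
      refine ⟨⟨i + 1, by omega⟩, ?_⟩
      exact congrArg φ hir

end IsTourSystem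

end Realize

end SimpleGraph

/-! ### The basic patterns of Eulerian path systems. -/

namespace SimpleGraph

open VClass

namespace VClass

/-- Twice the contribution to the balance of an edge from this class to `V₁ ∪ V₂`. -/
def sgn : VClass → ℤ
  | A => 1
  | B => -1
  | _ => 0

/-- The two classes of the bipartite part. -/
def IsW (c : VClass) : Prop := c = A ∨ c = B

/-- The two classes `V₁` and `V₂`, in some order. -/
def Opp (c d : VClass) : Prop := c = V₁ ∧ d = V₂ ∨ c = V₂ ∧ d = V₁

theorem Opp.symm {c d : VClass} (h : Opp c d) : Opp d c := by
  rcases h with ⟨rfl, rfl⟩ | ⟨rfl, rfl⟩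
  · exact .inr ⟨rfl, rfl⟩
  · exact .inl ⟨rfl, rfl⟩

theorem IsW.part_eq {c : VClass} (h : IsW c) : c.part = 2 := by
  rcases h with rfl | rfl <;> rfl

theorem Opp.wt_eq {c d : VClass} (h : Opp c d) : wt c d = 0 := by
  rcases h with ⟨rfl, rfl⟩ | ⟨rfl, rfl⟩ <;> rfl

theorem IsW.wt_eq {a c d : VClass} (h : IsW a) (hcd : Opp c d) :
    wt a c = sgn a ∧ wt c a = sgn a ∧ wt a d = sgn a ∧ wt d a = sgn a := by
  rcases h with rfl | rfl <;> rcases hcd with ⟨rfl, rfl⟩ | ⟨rfl, rfl⟩ <;> decide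

end VClass

variable {V : Type*}

/-- The inner vertices of the paths in a list. -/
def inner (L : List (List V)) : List V := L.flatMap fun p => p.tail.dropLast

/-- There is an Eulerian path system with `k` edges and twice the balance `c`, all of whose vertices
satisfy `S` and all of whose inner vertices satisfy `I`. -/
def HasTour (G : SimpleGraph V) (ty : V → VClass) (k : ℕ) (c : ℤ) (S I : V → Prop) : Prop :=
  ∃ L, IsTourSystem G ty L k c ∧ (∀ v ∈ L.flatten, S v) ∧ ∀ v ∈ inner L, I v

variable {G : SimpleGraph V} {ty : V → VClass}

theorem HasTour.mono {k : ℕ} {c : ℤ} {S I S' I' : V → Prop} (h : HasTour G ty k c S I)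
    (hS : ∀ v, S v → S' v) (hI : ∀ v, I v → I' v) : HasTour G ty k c S' I' := by
  obtain ⟨L, h, h₁, h₂⟩ := h
  exact ⟨L, h, fun v hv => hS v (h₁ v hv), fun v hv => hI v (h₂ v hv)⟩

/-- One link between each two of the three parts. As in all patterns below, only the W–U edges have
weight, given by the sign of the end in W; the inequalities assumed are those that the classes do
not already imply. -/
theorem hasTour_triangle {c d : VClass} (hcd : Opp c d) {w₁ w₂ u₁ x u₂ y : V}
    (hw₁ : IsW (ty w₁)) (hw₂ : IsW (ty w₂))
    (hu₁ : ty u₁ = c) (hx : ty x = c) (hu₂ : ty u₂ = d) (hy : ty y = d)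
    (e0 : G.Adj w₁ u₁) (e1 : G.Adj w₂ u₂) (e2 : G.Adj x y)
    (n0 : w₁ ≠ w₂) (n1 : x ≠ u₁) (n2 : y ≠ u₂) :
    HasTour G ty 3 (sgn (ty w₁) + sgn (ty w₂))
      (· ∈ [w₁, u₁, w₂, u₂, x, y])
      (fun _ => False) := by
  refine ⟨[[w₁, u₁], [w₂, u₂], [x, y]],
    ⟨?_, by simp, ?_, by simp, ?_, ?_⟩, by simp, by simp [inner]⟩
  · simp [e0, e0.symm, e1, e1.symm, e2, e2.symm]
  · simp only [IsW, Opp] at *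
    simp only [List.flatten_cons, List.flatten_nil, List.cons_append, List.nil_append,
      List.nodup_cons, List.mem_cons, List.not_mem_nil, or_false, not_or, List.nodup_nil]
    and_intros <;> grind
  · simp [pathWeight, hu₁, hx, hu₂, hy, hw₁.wt_eq hcd, hw₂.wt_eq hcd, hcd.wt_eq,
      hcd.symm.wt_eq]
    try ring
  · rcases hcd with ⟨rfl, rfl⟩ | ⟨rfl, rfl⟩ <;>
      simp [pathLink, link, hu₁, hx, hu₂, hy, hw₁.part_eq, hw₂.part_eq] <;>
      constructor <;> simp [part]

/-- Two W–`c` links and two `c`–`d` links. -/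
theorem hasTour_double_disjoint {c d : VClass} (hcd : Opp c d) {w₁ w₂ u₁ u₂ x₁ x₂ y₁ y₂ : V}
    (hw₁ : IsW (ty w₁)) (hw₂ : IsW (ty w₂))
    (hu₁ : ty u₁ = c) (hu₂ : ty u₂ = c) (hx₁ : ty x₁ = c) (hx₂ : ty x₂ = c) (hy₁ : ty y₁ = d) (hy₂ : ty y₂ = d)
    (e0 : G.Adj w₁ u₁) (e1 : G.Adj w₂ u₂) (e2 : G.Adj x₁ y₁) (e3 : G.Adj x₂ y₂)
    (n0 : w₁ ≠ w₂) (n1 : u₁ ≠ u₂) (n2 : x₁ ≠ x₂) (n3 : y₁ ≠ y₂) (n4 : u₁ ≠ x₁) (n5 : u₁ ≠ x₂) (n6 : u₂ ≠ x₁) (n7 : u₂ ≠ x₂) :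
    HasTour G ty 4 (sgn (ty w₁) + sgn (ty w₂))
      (· ∈ [w₁, u₁, w₂, u₂, x₁, y₁, x₂, y₂])
      (fun _ => False) := by
  refine ⟨[[w₁, u₁], [w₂, u₂], [x₁, y₁], [x₂, y₂]],
    ⟨?_, by simp, ?_, by simp, ?_, ?_⟩, by simp, by simp [inner]⟩
  · simp [e0, e0.symm, e1, e1.symm, e2, e2.symm, e3, e3.symm]
  · simp only [IsW, Opp] at *
    simp only [List.flatten_cons, List.flatten_nil, List.cons_append, List.nil_append,
      List.nodup_cons, List.mem_cons, List.not_mem_nil, or_false, not_or, List.nodup_nil]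
    and_intros <;> grind
  · simp [pathWeight, hu₁, hu₂, hx₁, hx₂, hy₁, hy₂, hw₁.wt_eq hcd, hw₂.wt_eq hcd, hcd.wt_eq,
      hcd.symm.wt_eq]
    try ring
  · rcases hcd with ⟨rfl, rfl⟩ | ⟨rfl, rfl⟩ <;>
      simp [pathLink, link, hu₁, hu₂, hx₁, hx₂, hy₁, hy₂, hw₁.part_eq, hw₂.part_eq] <;>
      constructor <;> simp [part]

/-- When a W–`c` edge and a cross edge share `u₁`, they merge into a W–`d` link, and the two double
links become a triangle. -/
theorem hasTour_double_path {c d : VClass} (hcd : Opp c d) {w₁ w₂ u₁ u₂ x₂ y₁ y₂ : V}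
    (hw₁ : IsW (ty w₁)) (hw₂ : IsW (ty w₂))
    (hu₁ : ty u₁ = c) (hu₂ : ty u₂ = c) (hx₂ : ty x₂ = c) (hy₁ : ty y₁ = d) (hy₂ : ty y₂ = d)
    (e0 : G.Adj w₁ u₁) (e1 : G.Adj w₂ u₂) (e2 : G.Adj u₁ y₁) (e3 : G.Adj x₂ y₂)
    (n0 : w₁ ≠ w₂) (n1 : u₁ ≠ u₂) (n2 : u₁ ≠ x₂) (n3 : y₁ ≠ y₂) (n4 : u₂ ≠ x₂) :
    HasTour G ty 4 (sgn (ty w₁) + sgn (ty w₂))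
      (· ∈ [w₁, u₁, w₂, u₂, y₁, x₂, y₂])
      ((· = u₁)) := by
  refine ⟨[[w₁, u₁, y₁], [w₂, u₂], [x₂, y₂]],
    ⟨?_, by simp, ?_, by simp, ?_, ?_⟩, by simp, by simp [inner]⟩
  · simp [e0, e0.symm, e1, e1.symm, e2, e2.symm, e3, e3.symm]
  · simp only [IsW, Opp] at *
    simp only [List.flatten_cons, List.flatten_nil, List.cons_append, List.nil_append,
      List.nodup_cons, List.mem_cons, List.not_mem_nil, or_false, not_or, List.nodup_nil]
    and_intros <;> grind
  · simp [pathWeight, hu₁, hu₂, hx₂, hy₁, hy₂, hw₁.wt_eq hcd, hw₂.wt_eq hcd, hcd.wt_eq,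
      hcd.symm.wt_eq]
    try ring
  · rcases hcd with ⟨rfl, rfl⟩ | ⟨rfl, rfl⟩ <;>
      simp [pathLink, link, hu₁, hu₂, hx₂, hy₁, hy₂, hw₁.part_eq, hw₂.part_eq] <;>
      constructor <;> simp [part]

/-- Two W–`c` links and two W–`d` links. -/
theorem hasTour_square_disjoint {c d : VClass} (hcd : Opp c d) {w₁ w₂ w₃ w₄ u₁ u₂ v₃ v₄ : V}
    (hw₁ : IsW (ty w₁)) (hw₂ : IsW (ty w₂)) (hw₃ : IsW (ty w₃)) (hw₄ : IsW (ty w₄))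
    (hu₁ : ty u₁ = c) (hu₂ : ty u₂ = c) (hv₃ : ty v₃ = d) (hv₄ : ty v₄ = d)
    (e0 : G.Adj w₁ u₁) (e1 : G.Adj w₂ u₂) (e2 : G.Adj w₃ v₃) (e3 : G.Adj w₄ v₄)
    (n0 : u₁ ≠ u₂) (n1 : v₃ ≠ v₄) (n2 : w₁ ≠ w₂) (n3 : w₃ ≠ w₄) (n4 : w₁ ≠ w₃) (n5 : w₁ ≠ w₄) (n6 : w₂ ≠ w₃) (n7 : w₂ ≠ w₄) :
    HasTour G ty 4 (sgn (ty w₁) + sgn (ty w₂) + sgn (ty w₃) + sgn (ty w₄))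
      (· ∈ [w₁, u₁, w₂, u₂, w₃, v₃, w₄, v₄])
      (fun _ => False) := by
  refine ⟨[[w₁, u₁], [w₂, u₂], [w₃, v₃], [w₄, v₄]],
    ⟨?_, by simp, ?_, by simp, ?_, ?_⟩, by simp, by simp [inner]⟩
  · simp [e0, e0.symm, e1, e1.symm, e2, e2.symm, e3, e3.symm]
  · simp only [IsW, Opp] at *
    simp only [List.flatten_cons, List.flatten_nil, List.cons_append, List.nil_append,
      List.nodup_cons, List.mem_cons, List.not_mem_nil, or_false, not_or, List.nodup_nil]
    and_intros <;> grind
  · simp [pathWeight, hu₁, hu₂, hv₃, hv₄, hw₁.wt_eq hcd, hw₂.wt_eq hcd, hw₃.wt_eq hcd, hw₄.wt_eq hcd, hcd.wt_eq,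
      hcd.symm.wt_eq]
    try ring
  · rcases hcd with ⟨rfl, rfl⟩ | ⟨rfl, rfl⟩ <;>
      simp [pathLink, link, hu₁, hu₂, hv₃, hv₄, hw₁.part_eq, hw₂.part_eq, hw₃.part_eq, hw₄.part_eq] <;>
      constructor <;> simp [part]

/-- A common end `w₁` in W turns two of the four edges into one `c`–`d` link, which again leaves a
triangle. -/
theorem hasTour_square_path {c d : VClass} (hcd : Opp c d) {w₁ w₂ w₄ u₁ u₂ v₃ v₄ : V}
    (hw₁ : IsW (ty w₁)) (hw₂ : IsW (ty w₂)) (hw₄ : IsW (ty w₄))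
    (hu₁ : ty u₁ = c) (hu₂ : ty u₂ = c) (hv₃ : ty v₃ = d) (hv₄ : ty v₄ = d)
    (e0 : G.Adj w₁ u₁) (e1 : G.Adj w₂ u₂) (e2 : G.Adj w₁ v₃) (e3 : G.Adj w₄ v₄)
    (n0 : u₁ ≠ u₂) (n1 : v₃ ≠ v₄) (n2 : w₁ ≠ w₂) (n3 : w₁ ≠ w₄) (n4 : w₂ ≠ w₄) :
    HasTour G ty 4 (sgn (ty w₁) + sgn (ty w₂) + sgn (ty w₁) + sgn (ty w₄))
      (· ∈ [w₁, u₁, w₂, u₂, v₃, w₄, v₄])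
      ((· = w₁)) := by
  refine ⟨[[u₁, w₁, v₃], [w₂, u₂], [w₄, v₄]],
    ⟨?_, by simp, ?_, by simp, ?_, ?_⟩, by simp, by simp [inner]⟩
  · simp [e0, e0.symm, e1, e1.symm, e2, e2.symm, e3, e3.symm]
  · simp only [IsW, Opp] at *
    simp only [List.flatten_cons, List.flatten_nil, List.cons_append, List.nil_append,
      List.nodup_cons, List.mem_cons, List.not_mem_nil, or_false, not_or, List.nodup_nil]
    and_intros <;> grind
  · simp [pathWeight, hu₁, hu₂, hv₃, hv₄, hw₁.wt_eq hcd, hw₂.wt_eq hcd, hw₄.wt_eq hcd, hcd.wt_eq,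
      hcd.symm.wt_eq]
    try ring
  · rcases hcd with ⟨rfl, rfl⟩ | ⟨rfl, rfl⟩ <;>
      simp [pathLink, link, hu₁, hu₂, hv₃, hv₄, hw₁.part_eq, hw₂.part_eq, hw₄.part_eq] <;>
      constructor <;> simp [part]

/-- Link numbers 3, 1, 1. -/
theorem hasTour_five_disjoint {c d : VClass} (hcd : Opp c d) {w₁ w₂ w₃ w₄ u₁ u₂ u₃ x v y : V}
    (hw₁ : IsW (ty w₁)) (hw₂ : IsW (ty w₂)) (hw₃ : IsW (ty w₃)) (hw₄ : IsW (ty w₄))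
    (hu₁ : ty u₁ = c) (hu₂ : ty u₂ = c) (hu₃ : ty u₃ = c) (hx : ty x = c) (hv : ty v = d) (hy : ty y = d)
    (e0 : G.Adj w₁ u₁) (e1 : G.Adj w₂ u₂) (e2 : G.Adj w₃ u₃) (e3 : G.Adj w₄ v) (e4 : G.Adj x y)
    (n0 : u₁ ≠ u₂) (n1 : u₁ ≠ u₃) (n2 : u₂ ≠ u₃) (n3 : w₁ ≠ w₂) (n4 : w₁ ≠ w₃) (n5 : w₂ ≠ w₃) (n6 : w₁ ≠ w₄) (n7 : w₂ ≠ w₄) (n8 : w₃ ≠ w₄) (n9 : v ≠ y) (n10 : x ≠ u₁) (n11 : x ≠ u₂) (n12 : x ≠ u₃) :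
    HasTour G ty 5 (sgn (ty w₁) + sgn (ty w₂) + sgn (ty w₃) + sgn (ty w₄))
      (· ∈ [w₁, u₁, w₂, u₂, w₃, u₃, w₄, v, x, y])
      (fun _ => False) := by
  refine ⟨[[w₁, u₁], [w₂, u₂], [w₃, u₃], [w₄, v], [x, y]],
    ⟨?_, by simp, ?_, by simp, ?_, ?_⟩, by simp, by simp [inner]⟩
  · simp [e0, e0.symm, e1, e1.symm, e2, e2.symm, e3, e3.symm, e4, e4.symm]
  · simp only [IsW, Opp] at *
    simp only [List.flatten_cons, List.flatten_nil, List.cons_append, List.nil_append,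
      List.nodup_cons, List.mem_cons, List.not_mem_nil, or_false, not_or, List.nodup_nil]
    and_intros <;> grind
  · simp [pathWeight, hu₁, hu₂, hu₃, hx, hv, hy, hw₁.wt_eq hcd, hw₂.wt_eq hcd, hw₃.wt_eq hcd, hw₄.wt_eq hcd, hcd.wt_eq,
      hcd.symm.wt_eq]
    try ring
  · rcases hcd with ⟨rfl, rfl⟩ | ⟨rfl, rfl⟩ <;>
      simp [pathLink, link, hu₁, hu₂, hu₃, hx, hv, hy, hw₁.part_eq, hw₂.part_eq, hw₃.part_eq, hw₄.part_eq] <;>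
      constructor <;> simp [part]

/-- Merging the cross edge with a W–`c` edge turns the link numbers 3, 1, 1 into 2, 2, 0. -/
theorem hasTour_five_path {c d : VClass} (hcd : Opp c d) {w₁ w₂ w₃ w₄ u₁ u₂ u₃ v y : V}
    (hw₁ : IsW (ty w₁)) (hw₂ : IsW (ty w₂)) (hw₃ : IsW (ty w₃)) (hw₄ : IsW (ty w₄))
    (hu₁ : ty u₁ = c) (hu₂ : ty u₂ = c) (hu₃ : ty u₃ = c) (hv : ty v = d) (hy : ty y = d)
    (e0 : G.Adj w₁ u₁) (e1 : G.Adj w₂ u₂) (e2 : G.Adj w₃ u₃) (e3 : G.Adj w₄ v) (e4 : G.Adj u₁ y)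
    (n0 : u₁ ≠ u₂) (n1 : u₁ ≠ u₃) (n2 : u₂ ≠ u₃) (n3 : w₁ ≠ w₂) (n4 : w₁ ≠ w₃) (n5 : w₂ ≠ w₃) (n6 : w₁ ≠ w₄) (n7 : w₂ ≠ w₄) (n8 : w₃ ≠ w₄) (n9 : v ≠ y) :
    HasTour G ty 5 (sgn (ty w₁) + sgn (ty w₂) + sgn (ty w₃) + sgn (ty w₄))
      (· ∈ [w₁, u₁, w₂, u₂, w₃, u₃, w₄, v, y])
      ((· = u₁)) := by
  refine ⟨[[w₁, u₁, y], [w₂, u₂], [w₃, u₃], [w₄, v]],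
    ⟨?_, by simp, ?_, by simp, ?_, ?_⟩, by simp, by simp [inner]⟩
  · simp [e0, e0.symm, e1, e1.symm, e2, e2.symm, e3, e3.symm, e4, e4.symm]
  · simp only [IsW, Opp] at *
    simp only [List.flatten_cons, List.flatten_nil, List.cons_append, List.nil_append,
      List.nodup_cons, List.mem_cons, List.not_mem_nil, or_false, not_or, List.nodup_nil]
    and_intros <;> grind
  · simp [pathWeight, hu₁, hu₂, hu₃, hv, hy, hw₁.wt_eq hcd, hw₂.wt_eq hcd, hw₃.wt_eq hcd, hw₄.wt_eq hcd, hcd.wt_eq,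
      hcd.symm.wt_eq]
    try ring
  · rcases hcd with ⟨rfl, rfl⟩ | ⟨rfl, rfl⟩ <;>
      simp [pathLink, link, hu₁, hu₂, hu₃, hv, hy, hw₁.part_eq, hw₂.part_eq, hw₃.part_eq, hw₄.part_eq] <;>
      constructor <;> simp [part]

/-- The two paths with two edges are W–`d` links, so the link numbers are those of two double links
at W, although every W–U edge ends in `c`. -/
theorem hasTour_six_paths {c d : VClass} (hcd : Opp c d) {w₁ w₂ w₃ w₄ u₁ u₂ u₃ u₄ y₃ y₄ : V}
    (hw₁ : IsW (ty w₁)) (hw₂ : IsW (ty w₂)) (hw₃ : IsW (ty w₃)) (hw₄ : IsW (ty w₄))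
    (hu₁ : ty u₁ = c) (hu₂ : ty u₂ = c) (hu₃ : ty u₃ = c) (hu₄ : ty u₄ = c) (hy₃ : ty y₃ = d) (hy₄ : ty y₄ = d)
    (e0 : G.Adj w₁ u₁) (e1 : G.Adj w₂ u₂) (e2 : G.Adj w₃ u₃) (e3 : G.Adj w₄ u₄) (e4 : G.Adj u₃ y₃) (e5 : G.Adj u₄ y₄)
    (n0 : u₁ ≠ u₂) (n1 : u₁ ≠ u₃) (n2 : u₁ ≠ u₄) (n3 : u₂ ≠ u₃) (n4 : u₂ ≠ u₄) (n5 : u₃ ≠ u₄) (n6 : w₁ ≠ w₂) (n7 : w₁ ≠ w₃) (n8 : w₂ ≠ w₃) (n9 : w₁ ≠ w₄) (n10 : w₂ ≠ w₄) (n11 : w₃ ≠ w₄) (n12 : y₃ ≠ y₄) :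
    HasTour G ty 6 (sgn (ty w₁) + sgn (ty w₂) + sgn (ty w₃) + sgn (ty w₄))
      (· ∈ [w₁, u₁, w₂, u₂, w₃, u₃, y₃, w₄, u₄, y₄])
      (fun v => v = u₃ ∨ v = u₄) := by
  refine ⟨[[w₁, u₁], [w₂, u₂], [w₃, u₃, y₃], [w₄, u₄, y₄]],
    ⟨?_, by simp, ?_, by simp, ?_, ?_⟩, by simp, by simp [inner]⟩
  · simp [e0, e0.symm, e1, e1.symm, e2, e2.symm, e3, e3.symm, e4, e4.symm, e5, e5.symm]
  · simp only [IsW, Opp] at *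
    simp only [List.flatten_cons, List.flatten_nil, List.cons_append, List.nil_append,
      List.nodup_cons, List.mem_cons, List.not_mem_nil, or_false, not_or, List.nodup_nil]
    and_intros <;> grind
  · simp [pathWeight, hu₁, hu₂, hu₃, hu₄, hy₃, hy₄, hw₁.wt_eq hcd, hw₂.wt_eq hcd, hw₃.wt_eq hcd, hw₄.wt_eq hcd, hcd.wt_eq,
      hcd.symm.wt_eq]
    try ring
  · rcases hcd with ⟨rfl, rfl⟩ | ⟨rfl, rfl⟩ <;>
      simp [pathLink, link, hu₁, hu₂, hu₃, hu₄, hy₃, hy₄, hw₁.part_eq, hw₂.part_eq, hw₃.part_eq, hw₄.part_eq] <;>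
      constructor <;> simp [part]

/-- Four W–`c` links and two W–`d` links. The variants below allow the fourth W–`c` edge to meet the
other three: it then creates a loop at `c`, a loop at W, or a path with three edges, and two W–`c`
links remain. -/
theorem hasTour_four_two_disjoint {c d : VClass} (hcd : Opp c d) {w₁ w₂ w₃ w₄ z₁ z₂ u₁ u₂ u₃ u₄ v₁ v₂ : V}
    (hw₁ : IsW (ty w₁)) (hw₂ : IsW (ty w₂)) (hw₃ : IsW (ty w₃)) (hw₄ : IsW (ty w₄)) (hz₁ : IsW (ty z₁)) (hz₂ : IsW (ty z₂))
    (hu₁ : ty u₁ = c) (hu₂ : ty u₂ = c) (hu₃ : ty u₃ = c) (hu₄ : ty u₄ = c) (hv₁ : ty v₁ = d) (hv₂ : ty v₂ = d)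
    (e0 : G.Adj w₁ u₁) (e1 : G.Adj w₂ u₂) (e2 : G.Adj w₃ u₃) (e3 : G.Adj w₄ u₄) (e4 : G.Adj z₁ v₁) (e5 : G.Adj z₂ v₂)
    (n0 : u₁ ≠ u₂) (n1 : u₁ ≠ u₃) (n2 : u₂ ≠ u₃) (n3 : w₁ ≠ w₂) (n4 : w₁ ≠ w₃) (n5 : w₂ ≠ w₃) (n6 : z₁ ≠ z₂) (n7 : v₁ ≠ v₂) (n8 : w₁ ≠ z₁) (n9 : w₁ ≠ z₂) (n10 : w₂ ≠ z₁) (n11 : w₂ ≠ z₂) (n12 : w₃ ≠ z₁) (n13 : w₃ ≠ z₂) (n14 : w₁ ≠ w₄) (n15 : w₂ ≠ w₄) (n16 : w₃ ≠ w₄) (n17 : u₁ ≠ u₄) (n18 : u₂ ≠ u₄) (n19 : u₃ ≠ u₄) (n20 : w₄ ≠ z₁) (n21 : w₄ ≠ z₂) :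
    HasTour G ty 6 (sgn (ty w₁) + sgn (ty w₂) + sgn (ty w₃) + sgn (ty w₄) + sgn (ty z₁) + sgn (ty z₂))
      (· ∈ [w₁, u₁, w₂, u₂, w₃, u₃, w₄, u₄, z₁, v₁, z₂, v₂])
      (fun _ => True) := by
  refine ⟨[[w₁, u₁], [w₂, u₂], [w₃, u₃], [w₄, u₄], [z₁, v₁], [z₂, v₂]],
    ⟨?_, by simp, ?_, by simp, ?_, ?_⟩, by simp, by simp [inner]⟩
  · simp [e0, e0.symm, e1, e1.symm, e2, e2.symm, e3, e3.symm, e4, e4.symm, e5, e5.symm]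
  · simp only [IsW, Opp] at *
    simp only [List.flatten_cons, List.flatten_nil, List.cons_append, List.nil_append,
      List.nodup_cons, List.mem_cons, List.not_mem_nil, or_false, not_or, List.nodup_nil]
    and_intros <;> grind
  · simp [pathWeight, hu₁, hu₂, hu₃, hu₄, hv₁, hv₂, hw₁.wt_eq hcd, hw₂.wt_eq hcd, hw₃.wt_eq hcd, hw₄.wt_eq hcd, hz₁.wt_eq hcd, hz₂.wt_eq hcd, hcd.wt_eq,
      hcd.symm.wt_eq]
    try ring
  · rcases hcd with ⟨rfl, rfl⟩ | ⟨rfl, rfl⟩ <;>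
      simp [pathLink, link, hu₁, hu₂, hu₃, hu₄, hv₁, hv₂, hw₁.part_eq, hw₂.part_eq, hw₃.part_eq, hw₄.part_eq, hz₁.part_eq, hz₂.part_eq] <;>
      constructor <;> simp [part]

theorem hasTour_four_two_left {c d : VClass} (hcd : Opp c d) {w₁ w₂ w₃ z₁ z₂ u₁ u₂ u₃ u₄ v₁ v₂ : V}
    (hw₁ : IsW (ty w₁)) (hw₂ : IsW (ty w₂)) (hw₃ : IsW (ty w₃)) (hz₁ : IsW (ty z₁)) (hz₂ : IsW (ty z₂))
    (hu₁ : ty u₁ = c) (hu₂ : ty u₂ = c) (hu₃ : ty u₃ = c) (hu₄ : ty u₄ = c) (hv₁ : ty v₁ = d) (hv₂ : ty v₂ = d)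
    (e0 : G.Adj w₁ u₁) (e1 : G.Adj w₂ u₂) (e2 : G.Adj w₃ u₃) (e3 : G.Adj w₁ u₄) (e4 : G.Adj z₁ v₁) (e5 : G.Adj z₂ v₂)
    (n0 : u₁ ≠ u₂) (n1 : u₁ ≠ u₃) (n2 : u₂ ≠ u₃) (n3 : w₁ ≠ w₂) (n4 : w₁ ≠ w₃) (n5 : w₂ ≠ w₃) (n6 : z₁ ≠ z₂) (n7 : v₁ ≠ v₂) (n8 : w₁ ≠ z₁) (n9 : w₁ ≠ z₂) (n10 : w₂ ≠ z₁) (n11 : w₂ ≠ z₂) (n12 : w₃ ≠ z₁) (n13 : w₃ ≠ z₂) (n14 : u₁ ≠ u₄) (n15 : u₂ ≠ u₄) (n16 : u₃ ≠ u₄) :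
    HasTour G ty 6 (sgn (ty w₁) + sgn (ty w₂) + sgn (ty w₃) + sgn (ty w₁) + sgn (ty z₁) + sgn (ty z₂))
      (· ∈ [w₁, u₁, w₂, u₂, w₃, u₃, u₄, z₁, v₁, z₂, v₂])
      (fun _ => True) := by
  refine ⟨[[u₁, w₁, u₄], [w₂, u₂], [w₃, u₃], [z₁, v₁], [z₂, v₂]],
    ⟨?_, by simp, ?_, by simp, ?_, ?_⟩, by simp, by simp [inner]⟩
  · simp [e0, e0.symm, e1, e1.symm, e2, e2.symm, e3, e3.symm, e4, e4.symm, e5, e5.symm]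
  · simp only [IsW, Opp] at *
    simp only [List.flatten_cons, List.flatten_nil, List.cons_append, List.nil_append,
      List.nodup_cons, List.mem_cons, List.not_mem_nil, or_false, not_or, List.nodup_nil]
    and_intros <;> grind
  · simp [pathWeight, hu₁, hu₂, hu₃, hu₄, hv₁, hv₂, hw₁.wt_eq hcd, hw₂.wt_eq hcd, hw₃.wt_eq hcd, hz₁.wt_eq hcd, hz₂.wt_eq hcd, hcd.wt_eq,
      hcd.symm.wt_eq]
    try ring
  · rcases hcd with ⟨rfl, rfl⟩ | ⟨rfl, rfl⟩ <;>
      simp [pathLink, link, hu₁, hu₂, hu₃, hu₄, hv₁, hv₂, hw₁.part_eq, hw₂.part_eq, hw₃.part_eq, hz₁.part_eq, hz₂.part_eq] <;>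
      constructor <;> simp [part]

theorem hasTour_four_two_right {c d : VClass} (hcd : Opp c d) {w₁ w₂ w₃ w₄ z₁ z₂ u₁ u₂ u₃ v₁ v₂ : V}
    (hw₁ : IsW (ty w₁)) (hw₂ : IsW (ty w₂)) (hw₃ : IsW (ty w₃)) (hw₄ : IsW (ty w₄)) (hz₁ : IsW (ty z₁)) (hz₂ : IsW (ty z₂))
    (hu₁ : ty u₁ = c) (hu₂ : ty u₂ = c) (hu₃ : ty u₃ = c) (hv₁ : ty v₁ = d) (hv₂ : ty v₂ = d)
    (e0 : G.Adj w₁ u₁) (e1 : G.Adj w₂ u₂) (e2 : G.Adj w₃ u₃) (e3 : G.Adj w₄ u₁) (e4 : G.Adj z₁ v₁) (e5 : G.Adj z₂ v₂)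
    (n0 : u₁ ≠ u₂) (n1 : u₁ ≠ u₃) (n2 : u₂ ≠ u₃) (n3 : w₁ ≠ w₂) (n4 : w₁ ≠ w₃) (n5 : w₂ ≠ w₃) (n6 : z₁ ≠ z₂) (n7 : v₁ ≠ v₂) (n8 : w₁ ≠ z₁) (n9 : w₁ ≠ z₂) (n10 : w₂ ≠ z₁) (n11 : w₂ ≠ z₂) (n12 : w₃ ≠ z₁) (n13 : w₃ ≠ z₂) (n14 : w₁ ≠ w₄) (n15 : w₂ ≠ w₄) (n16 : w₃ ≠ w₄) (n17 : w₄ ≠ z₁) (n18 : w₄ ≠ z₂) :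
    HasTour G ty 6 (sgn (ty w₁) + sgn (ty w₂) + sgn (ty w₃) + sgn (ty w₄) + sgn (ty z₁) + sgn (ty z₂))
      (· ∈ [w₁, u₁, w₂, u₂, w₃, u₃, w₄, z₁, v₁, z₂, v₂])
      (fun _ => True) := by
  refine ⟨[[w₁, u₁, w₄], [w₂, u₂], [w₃, u₃], [z₁, v₁], [z₂, v₂]],
    ⟨?_, by simp, ?_, by simp, ?_, ?_⟩, by simp, by simp [inner]⟩
  · simp [e0, e0.symm, e1, e1.symm, e2, e2.symm, e3, e3.symm, e4, e4.symm, e5, e5.symm]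
  · simp only [IsW, Opp] at *
    simp only [List.flatten_cons, List.flatten_nil, List.cons_append, List.nil_append,
      List.nodup_cons, List.mem_cons, List.not_mem_nil, or_false, not_or, List.nodup_nil]
    and_intros <;> grind
  · simp [pathWeight, hu₁, hu₂, hu₃, hv₁, hv₂, hw₁.wt_eq hcd, hw₂.wt_eq hcd, hw₃.wt_eq hcd, hw₄.wt_eq hcd, hz₁.wt_eq hcd, hz₂.wt_eq hcd, hcd.wt_eq,
      hcd.symm.wt_eq]
    try ring
  · rcases hcd with ⟨rfl, rfl⟩ | ⟨rfl, rfl⟩ <;>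
      simp [pathLink, link, hu₁, hu₂, hu₃, hv₁, hv₂, hw₁.part_eq, hw₂.part_eq, hw₃.part_eq, hw₄.part_eq, hz₁.part_eq, hz₂.part_eq] <;>
      constructor <;> simp [part]

theorem hasTour_four_two_path {c d : VClass} (hcd : Opp c d) {w₁ w₂ w₃ z₁ z₂ u₁ u₂ u₃ v₁ v₂ : V}
    (hw₁ : IsW (ty w₁)) (hw₂ : IsW (ty w₂)) (hw₃ : IsW (ty w₃)) (hz₁ : IsW (ty z₁)) (hz₂ : IsW (ty z₂))
    (hu₁ : ty u₁ = c) (hu₂ : ty u₂ = c) (hu₃ : ty u₃ = c) (hv₁ : ty v₁ = d) (hv₂ : ty v₂ = d)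
    (e0 : G.Adj w₁ u₁) (e1 : G.Adj w₂ u₂) (e2 : G.Adj w₃ u₃) (e3 : G.Adj w₁ u₂) (e4 : G.Adj z₁ v₁) (e5 : G.Adj z₂ v₂)
    (n0 : u₁ ≠ u₂) (n1 : u₁ ≠ u₃) (n2 : u₂ ≠ u₃) (n3 : w₁ ≠ w₂) (n4 : w₁ ≠ w₃) (n5 : w₂ ≠ w₃) (n6 : z₁ ≠ z₂) (n7 : v₁ ≠ v₂) (n8 : w₁ ≠ z₁) (n9 : w₁ ≠ z₂) (n10 : w₂ ≠ z₁) (n11 : w₂ ≠ z₂) (n12 : w₃ ≠ z₁) (n13 : w₃ ≠ z₂) :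
    HasTour G ty 6 (sgn (ty w₁) + sgn (ty w₂) + sgn (ty w₃) + sgn (ty w₁) + sgn (ty z₁) + sgn (ty z₂))
      (· ∈ [w₁, u₁, w₂, u₂, w₃, u₃, z₁, v₁, z₂, v₂])
      (fun _ => True) := by
  refine ⟨[[u₁, w₁, u₂, w₂], [w₃, u₃], [z₁, v₁], [z₂, v₂]],
    ⟨?_, by simp, ?_, by simp, ?_, ?_⟩, by simp, by simp [inner]⟩
  · simp [e0, e0.symm, e1, e1.symm, e2, e2.symm, e3, e3.symm, e4, e4.symm, e5, e5.symm]
  · simp only [IsW, Opp] at *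
    simp only [List.flatten_cons, List.flatten_nil, List.cons_append, List.nil_append,
      List.nodup_cons, List.mem_cons, List.not_mem_nil, or_false, not_or, List.nodup_nil]
    and_intros <;> grind
  · simp [pathWeight, hu₁, hu₂, hu₃, hv₁, hv₂, hw₁.wt_eq hcd, hw₂.wt_eq hcd, hw₃.wt_eq hcd, hz₁.wt_eq hcd, hz₂.wt_eq hcd, hcd.wt_eq,
      hcd.symm.wt_eq]
    try ring
  · rcases hcd with ⟨rfl, rfl⟩ | ⟨rfl, rfl⟩ <;>
      simp [pathLink, link, hu₁, hu₂, hu₃, hv₁, hv₂, hw₁.part_eq, hw₂.part_eq, hw₃.part_eq, hz₁.part_eq, hz₂.part_eq] <;>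
      constructor <;> simp [part]

end SimpleGraph

/-! ### Extending Eulerian path systems. -/

namespace SimpleGraph

open VClass

variable {V : Type*} {G : SimpleGraph V} {ty : V → VClass}

theorem IsTourSystem.perm {L L' : List (List V)} {k : ℕ} {c : ℤ} (h : IsTourSystem G ty L k c)
    (hp : L.Perm L') : IsTourSystem G ty L' k c where
  chain p hp' := h.chain p (hp.mem_iff.2 hp')
  two_le p hp' := h.two_le p (hp.mem_iff.2 hp')
  nodup := hp.flatten.nodup_iff.1 h.nodup
  card := by rw [← (hp.map _).sum_eq]; exact h.card
  weight := by rw [← (hp.map _).sum_eq]; exact h.weight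
  euler := by
    rw [← (hp.map (pathLink ty 0)).sum_eq, ← (hp.map (pathLink ty 1)).sum_eq,
      ← (hp.map (pathLink ty 2)).sum_eq]
    exact h.euler

theorem EulerCounts.add_even {a b c a' b' c' : ℕ} (h : EulerCounts a b c) (ha : a' % 2 = 0)
    (hb : b' % 2 = 0) (hc : c' % 2 = 0) : EulerCounts (a' + a) (b' + b) (c' + c) := by
  obtain ⟨h₁, h₂, h₃⟩ := h
  constructor <;> omega

/-- Adding disjoint paths which join each pair of parts an even number of times. -/
theorem HasTour.append {k : ℕ} {c : ℤ} {S I : V → Prop} (h : HasTour G ty k c S I)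
    (M : List (List V)) (hchain : ∀ p ∈ M, p.IsChain G.Adj) (hlen : ∀ p ∈ M, 2 ≤ p.length)
    (hM : M.flatten.Nodup) (hfresh : ∀ v ∈ M.flatten, ¬ S v)
    (heven : ∀ i, (M.map (pathLink ty i)).sum % 2 = 0) :
    HasTour G ty ((M.map fun p => p.length - 1).sum + k) ((M.map (pathWeight ty)).sum + c)
      (fun v => S v ∨ v ∈ M.flatten) (fun v => I v ∨ v ∈ inner M) := by
  obtain ⟨L, h, hS, hI⟩ := h
  refine ⟨M ++ L, ⟨?_, ?_, ?_, ?_, ?_, ?_⟩, ?_, ?_⟩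
  · intro p hp
    rcases List.mem_append.1 hp with hp | hp
    exacts [hchain p hp, h.chain p hp]
  · intro p hp
    rcases List.mem_append.1 hp with hp | hp
    exacts [hlen p hp, h.two_le p hp]
  · rw [List.flatten_append]
    exact hM.append h.nodup fun v hv hv' => hfresh v hv (hS v hv')
  · rw [List.map_append, List.sum_append, h.card]
  · rw [List.map_append, List.sum_append, h.weight]
  · simp only [List.map_append, List.sum_append]
    exact h.euler.add_even (heven 0) (heven 1) (heven 2)
  · intro v hv
    rw [List.flatten_append, List.mem_append] at hv
    exact hv.symm.imp (hS v) id
  · intro v hv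
    rw [inner, List.flatMap_append, List.mem_append] at hv
    exact hv.symm.imp (hI v) id

theorem pathLink_eq_zero (i : Fin 3) {x y z : V} (h : (ty x).part = (ty z).part) :
    pathLink ty i [x, y, z] = 0 ∧ pathLink ty i [x, z] = 0 := by
  simp [pathLink, link, h]

/-- Adding a disjoint path with two edges and ends in the same part. -/
theorem HasTour.add_cherry {k : ℕ} {c : ℤ} {S I : V → Prop} (h : HasTour G ty k c S I) {x y z : V}
    (hxy : G.Adj x y) (hyz : G.Adj y z) (hxz : x ≠ z) (hx : ¬ S x) (hy : ¬ S y) (hz : ¬ S z)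
    (hp : (ty x).part = (ty z).part) :
    HasTour G ty (k + 2) (c + (wt (ty x) (ty y) + wt (ty y) (ty z)))
      (fun v => S v ∨ v ∈ [x, y, z]) (fun v => I v ∨ v = y) := by
  have := h.append [[x, y, z]] (by simp [hxy, hyz]) (by simp)
    (by simp [hxy.ne, hyz.ne, hxz]) (by simp [hx, hy, hz])
    (by simp [pathLink_eq_zero _ hp])
  simpa [pathWeight, inner, add_comm] using this

/-- Adding two disjoint edges between the same two parts. -/
theorem HasTour.add_pair {k : ℕ} {c : ℤ} {S I : V → Prop} (h : HasTour G ty k c S I) {x y x' y' : V}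
    (hxy : G.Adj x y) (hxy' : G.Adj x' y') (hn : [x, y, x', y'].Nodup)
    (hS : ∀ v ∈ [x, y, x', y'], ¬ S v)
    (hp : (ty x).part = (ty x').part) (hq : (ty y).part = (ty y').part) :
    HasTour G ty (k + 2) (c + (wt (ty x) (ty y) + wt (ty x') (ty y')))
      (fun v => S v ∨ v ∈ [x, y, x', y']) I := by
  have := h.append [[x, y], [x', y']] (by simp [hxy, hxy']) (by simp)
    (by simpa using hn) (by simpa using hS)
    (by intro i; simp [pathLink, link, hp, hq]; omega)
  simpa [pathWeight, inner, add_comm] using this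

theorem pathWeight_append_pair (ty : V → VClass) (x y : V) : ∀ l : List V,
    pathWeight ty (l ++ [x, y]) = pathWeight ty (l ++ [x]) + wt (ty x) (ty y)
  | [] => by simp [pathWeight]
  | [a] => by simp [pathWeight]
  | a :: b :: l => by
    have := pathWeight_append_pair ty x y (b :: l)
    simp only [List.cons_append, pathWeight] at this ⊢
    rw [this]
    ring

/-- Adding an edge inside a part, one end of which is new and the other end of which is not an
inner vertex. -/
theorem HasTour.add_edge {k : ℕ} {c : ℤ} {S I : V → Prop} (h : HasTour G ty k c S I) {a a' : V}
    (haa : G.Adj a a') (hp : (ty a).part = (ty a').part) (ha : ¬ S a) (ha' : ¬ I a') :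
    HasTour G ty (k + 1) (c + wt (ty a) (ty a'))
      (fun v => S v ∨ v = a ∨ v = a') (fun v => I v ∨ v = a') := by
  -- If `a'` is new, the edge becomes a path of its own, which is a loop in the reduced multigraph;
  -- otherwise `a'` is an end of some path, which is prolonged to `a`.
  by_cases hmem : S a'
  swap
  · have := h.append [[a, a']] (by simp [haa]) (by simp)
      (by simp [haa.ne]) (by simp [ha, hmem])
      (by simp [pathLink, link, hp])
    refine HasTour.mono (k := k + 1) (by simpa [pathWeight, add_comm] using this) ?_ ?_
    · exact fun v hv => hv
    · intro v hv
      left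
      simpa [inner] using hv
  obtain ⟨L, h, hS, hI⟩ := h
  have haL : a ∉ L.flatten := fun hh => ha (hS a hh)
  -- `S` is only an upper bound for the vertices in use, so `a'` may still be new.
  by_cases hmem : a' ∈ L.flatten
  swap
  · have h' : HasTour G ty k c (· ∈ L.flatten) I := ⟨L, h, fun v hv => hv, hI⟩
    have := h'.append [[a, a']] (by simp [haa]) (by simp)
      (by simp [haa.ne]) (by simp [-List.mem_flatten, haL, hmem])
      (by simp [pathLink, link, hp])
    refine HasTour.mono (k := k + 1) (by simpa [-List.mem_flatten, pathWeight, add_comm] using this) ?_ ?_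
    · rintro v (hv | hv)
      · exact .inl (hS v hv)
      · exact .inr (by simpa using hv)
    · intro v hv
      left
      simpa [inner] using hv
  obtain ⟨p, hpL, hap⟩ := List.mem_flatten.1 hmem
  obtain ⟨L', hL'⟩ : ∃ L', L.Perm (p :: L') := by
    obtain ⟨s, t, rfl⟩ := List.append_of_mem hpL
    exact ⟨s ++ t, List.perm_middle⟩
  have hin : ∀ v, v ∈ inner (p :: L') → I v := fun v hv => hI v <| by
    rw [inner, List.mem_flatMap] at hv ⊢
    obtain ⟨q, hq, hv⟩ := hv
    exact ⟨q, hL'.mem_iff.2 hq, hv⟩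
  have hS' : ∀ v ∈ (p :: L').flatten, S v := fun v hv => hS v (hL'.flatten.mem_iff.2 hv)
  have haL' : a ∉ (p :: L').flatten := fun hh => haL (hL'.flatten.mem_iff.2 hh)
  replace h := h.perm hL'
  clear hL' hpL hmem haL hS hI
  have h2 := h.two_le p (by simp)
  -- A vertex of a path that is not an inner vertex is its first or its last vertex.
  have hend : (∃ l, p = a' :: l) ∨ ∃ l, p = l ++ [a'] := by
    by_contra! hcon
    refine ha' (hin a' ?_)
    match p with
    | [] => simp at h2
    | x :: l =>
      rw [inner, List.flatMap_cons, List.mem_append]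
      left
      have hx : a' ≠ x := fun hx => hcon.1 l (by rw [hx])
      have hal : a' ∈ l := by simpa [hx] using hap
      rcases List.eq_nil_or_concat l with rfl | ⟨l', y, rfl⟩
      · simp at hal
      · have hy : a' ≠ y := fun hy => hcon.2 (x :: l') (by rw [hy]; simp)
        simpa [hy] using hal
  -- Since `a` and `a'` lie in the same part, moving the end of the path from `a'` to `a` leaves its
  -- link unchanged; only `a'` becomes a new inner vertex.
  have key : ∃ p', p'.Perm (a :: p) ∧ p'.IsChain G.Adj ∧
      pathWeight ty p' = pathWeight ty p + wt (ty a) (ty a') ∧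
      (∀ i, pathLink ty i p' = pathLink ty i p) ∧
      ∀ v ∈ p'.tail.dropLast, v ∈ p.tail.dropLast ∨ v = a' := by
    have hc := h.chain p (by simp)
    rcases hend with ⟨l, rfl⟩ | ⟨l, rfl⟩
    · refine ⟨a :: a' :: l, .refl _, ?_, ?_, ?_, ?_⟩
      · simp only [List.isChain_cons_cons]
        exact ⟨haa, hc⟩
      · rw [pathWeight, add_comm]
      · intro i
        simp only [pathLink, List.getLastD_cons, link, hp]
      · intro v hv
        match l with
        | [] => simp at h2
        | x :: l => simpa [or_comm] using hv
    · refine ⟨l ++ [a', a], ?_, ?_, ?_, ?_, ?_⟩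
      · have : l ++ [a', a] = (l ++ [a']) ++ [a] := by simp
        rw [this]
        exact List.perm_append_singleton _ _
      · rw [List.isChain_append_cons_cons]
        exact ⟨hc, haa.symm, List.isChain_singleton _⟩
      · rw [pathWeight_append_pair, wt_comm]
      · intro i
        match l with
        | [] => simp at h2
        | x :: l =>
          simp only [List.cons_append, pathLink, List.getLastD_eq_getLast?]
          simp [link, hp]
      · intro v hv
        match l with
        | [] => simp at h2
        | x :: l =>
          have : l ++ [a', a] = (l ++ [a']) ++ [a] := by simp
          simp only [List.cons_append, List.tail_cons, this] at hv ⊢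
          rw [List.dropLast_concat] at hv ⊢
          simpa using hv
  obtain ⟨p', hperm, hc', hw', hl', hin'⟩ := key
  have hflat : (p' :: L').flatten.Perm (a :: (p :: L').flatten) := by
    simp only [List.flatten_cons, ← List.cons_append]
    exact hperm.append_right _
  refine ⟨p' :: L', ⟨?_, ?_, ?_, ?_, ?_, ?_⟩, ?_, ?_⟩
  · intro q hq
    rcases List.mem_cons.1 hq with rfl | hq
    exacts [hc', h.chain q (by simp [hq])]
  · intro q hq
    rcases List.mem_cons.1 hq with rfl | hq
    · rw [hperm.length_eq]
      simp only [List.length_cons]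
      omega
    · exact h.two_le q (by simp [hq])
  · rw [hflat.nodup_iff, List.nodup_cons]
    exact ⟨haL', h.nodup⟩
  · have := h.card
    simp only [List.map_cons, List.sum_cons, hperm.length_eq, List.length_cons] at this ⊢
    omega
  · have := h.weight
    simp only [List.map_cons, List.sum_cons, hw'] at this ⊢
    rw [← this]
    ring
  · have := h.euler
    simp only [List.map_cons, List.sum_cons, hl'] at this ⊢
    exact this
  · intro v hv
    rw [hflat.mem_iff, List.mem_cons] at hv
    rcases hv with rfl | hv
    exacts [.inr (.inl rfl), .inl (hS' v hv)]
  · intro v hv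
    rw [inner, List.flatMap_cons, List.mem_append] at hv
    rcases hv with hv | hv
    · refine (hin' v hv).imp (fun hv => hin v ?_) id
      rw [inner, List.flatMap_cons, List.mem_append]
      exact .inl hv
    · refine .inl (hin v ?_)
      rw [inner, List.flatMap_cons, List.mem_append]
      exact .inr hv

theorem HasTour.exists_pathSystem [Fintype V] [DecidableEq V] {k : ℕ} {c : ℤ} {S I : V → Prop}
    (h : HasTour G ty k c S I) {A B U : Finset V} (hA : ∀ v, v ∈ A ↔ ty v = .A)
    (hB : ∀ v, v ∈ B ↔ ty v = .B) (hU : ∀ v, v ∈ U ↔ ty v = .V₁ ∨ ty v = .V₂)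
    (𝒱 : Finpartition (Finset.univ : Finset V)) (φ : Fin 3 → Finset V)
    (hφ : ∀ v, 𝒱.part v = φ (ty v).part) (hparts : ∀ X, X ∈ 𝒱.parts ↔ ∃ r, φ r = X) :
    ∃ P : G.PathSystem, #P.edges = k ∧ P.bal A B U = (c : ℝ) / 2 ∧
      (P.reducedMultigraph 𝒱).HasEulerTour := by
  obtain ⟨L, h, -, -⟩ := h
  exact ⟨h.toPathSystem, h.card_edges, h.bal_eq hA hB hU, h.hasEulerTour 𝒱 φ hφ hparts⟩

end SimpleGraph

/-! ### Patterns with coinciding ends, and connectors. -/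

namespace SimpleGraph

open VClass

variable {V : Type*} {G : SimpleGraph V} {ty : V → VClass}

theorem HasTour.of_eq {k k' : ℕ} {c c' : ℤ} {S I S' I' : V → Prop} (h : HasTour G ty k c S I)
    (hk : k = k') (hc : c = c') (hS : ∀ v, S v → S' v) (hI : ∀ v, I v → I' v) :
    HasTour G ty k' c' S' I' := by
  subst hk hc
  exact h.mono hS hI

/-- The two W–`c` edges and the two cross edges may share one vertex of `c`, but not both: with both
shared, only two W–`d` links would remain and `c` would not be visited. -/
theorem hasTour_double {c d : VClass} (hcd : Opp c d) {w₁ w₂ u₁ u₂ x₁ x₂ y₁ y₂ : V}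
    (hw₁ : IsW (ty w₁)) (hw₂ : IsW (ty w₂))
    (hu₁ : ty u₁ = c) (hu₂ : ty u₂ = c) (hx₁ : ty x₁ = c) (hx₂ : ty x₂ = c)
    (hy₁ : ty y₁ = d) (hy₂ : ty y₂ = d)
    (e0 : G.Adj w₁ u₁) (e1 : G.Adj w₂ u₂) (e2 : G.Adj x₁ y₁) (e3 : G.Adj x₂ y₂)
    (hw : w₁ ≠ w₂) (hu : u₁ ≠ u₂) (hx : x₁ ≠ x₂) (hy : y₁ ≠ y₂)
    (h1 : ¬ (u₁ = x₁ ∧ u₂ = x₂)) (h2 : ¬ (u₁ = x₂ ∧ u₂ = x₁)) :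
    HasTour G ty 4 (sgn (ty w₁) + sgn (ty w₂))
      (· ∈ [w₁, u₁, w₂, u₂, x₁, y₁, x₂, y₂])
      (fun v => (v = u₁ ∨ v = u₂) ∧ (v = x₁ ∨ v = x₂)) := by
  by_cases h11 : u₁ = x₁
  · subst h11
    exact (hasTour_double_path hcd hw₁ hw₂ hu₁ hu₂ hx₂ hy₁ hy₂ e0 e1 e2 e3 hw hu hx hy
      (fun h => h1 ⟨rfl, h⟩)).of_eq rfl (by ring) (by simp) (by grind)
  by_cases h12 : u₁ = x₂
  · subst h12
    exact (hasTour_double_path hcd hw₁ hw₂ hu₁ hu₂ hx₁ hy₂ hy₁ e0 e1 e3 e2 hw hu hx.symm hy.symm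
      (fun h => h2 ⟨rfl, h⟩)).of_eq rfl (by ring) (by simp) (by grind)
  by_cases h21 : u₂ = x₁
  · subst h21
    exact (hasTour_double_path hcd hw₂ hw₁ hu₂ hu₁ hx₂ hy₁ hy₂ e1 e0 e2 e3 hw.symm hu.symm hx hy
      h12).of_eq rfl (by ring) (by simp) (by grind)
  by_cases h22 : u₂ = x₂
  · subst h22
    exact (hasTour_double_path hcd hw₂ hw₁ hu₂ hu₁ hx₁ hy₂ hy₁ e1 e0 e3 e2 hw.symm hu.symm hx.symm
      hy.symm h11).of_eq rfl (by ring) (by simp) (by grind)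
  exact (hasTour_double_disjoint hcd hw₁ hw₂ hu₁ hu₂ hx₁ hx₂ hy₁ hy₂ e0 e1 e2 e3 hw hu hx hy
    h11 h12 h21 h22).of_eq rfl (by ring) (by simp) (by simp)

/-- One common end in W is allowed. With two, only two `c`–`d` links would remain and W would not be
visited. -/
theorem hasTour_square {c d : VClass} (hcd : Opp c d) {w₁ w₂ w₃ w₄ u₁ u₂ v₃ v₄ : V}
    (hw₁ : IsW (ty w₁)) (hw₂ : IsW (ty w₂)) (hw₃ : IsW (ty w₃)) (hw₄ : IsW (ty w₄))
    (hu₁ : ty u₁ = c) (hu₂ : ty u₂ = c) (hv₃ : ty v₃ = d) (hv₄ : ty v₄ = d)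
    (e0 : G.Adj w₁ u₁) (e1 : G.Adj w₂ u₂) (e2 : G.Adj w₃ v₃) (e3 : G.Adj w₄ v₄)
    (hu : u₁ ≠ u₂) (hv : v₃ ≠ v₄) (hw : w₁ ≠ w₂) (hw' : w₃ ≠ w₄)
    (h1 : ¬ (w₁ = w₃ ∧ w₂ = w₄)) (h2 : ¬ (w₁ = w₄ ∧ w₂ = w₃)) :
    HasTour G ty 4 (sgn (ty w₁) + sgn (ty w₂) + sgn (ty w₃) + sgn (ty w₄))
      (· ∈ [w₁, u₁, w₂, u₂, w₃, v₃, w₄, v₄])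
      (fun v => (v = w₁ ∨ v = w₂) ∧ (v = w₃ ∨ v = w₄)) := by
  by_cases h11 : w₁ = w₃
  · subst h11
    exact (hasTour_square_path hcd hw₁ hw₂ hw₄ hu₁ hu₂ hv₃ hv₄ e0 e1 e2 e3 hu hv hw hw'
      (fun h => h1 ⟨rfl, h⟩)).of_eq rfl (by ring) (by simp) (by grind)
  by_cases h12 : w₁ = w₄
  · subst h12
    exact (hasTour_square_path hcd hw₁ hw₂ hw₃ hu₁ hu₂ hv₄ hv₃ e0 e1 e3 e2 hu hv.symm hw hw'.symm
      (fun h => h2 ⟨rfl, h⟩)).of_eq rfl (by ring) (by simp) (by grind)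
  by_cases h21 : w₂ = w₃
  · subst h21
    exact (hasTour_square_path hcd hw₂ hw₁ hw₄ hu₂ hu₁ hv₃ hv₄ e1 e0 e2 e3 hu.symm hv hw.symm hw'
      h12).of_eq rfl (by ring) (by simp) (by grind)
  by_cases h22 : w₂ = w₄
  · subst h22
    exact (hasTour_square_path hcd hw₂ hw₁ hw₃ hu₂ hu₁ hv₄ hv₃ e1 e0 e3 e2 hu.symm hv.symm hw.symm
      hw'.symm h11).of_eq rfl (by ring) (by simp) (by grind)
  exact (hasTour_square_disjoint hcd hw₁ hw₂ hw₃ hw₄ hu₁ hu₂ hv₃ hv₄ e0 e1 e2 e3 hu hv hw hw'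
    h11 h12 h21 h22).of_eq rfl (by ring) (by simp) (by simp)

/-- The cross edge meets at most one of the three W–`c` edges, as these are disjoint. -/
theorem hasTour_five {c d : VClass} (hcd : Opp c d) {w₁ w₂ w₃ w₄ u₁ u₂ u₃ x v y : V}
    (hw₁ : IsW (ty w₁)) (hw₂ : IsW (ty w₂)) (hw₃ : IsW (ty w₃)) (hw₄ : IsW (ty w₄))
    (hu₁ : ty u₁ = c) (hu₂ : ty u₂ = c) (hu₃ : ty u₃ = c) (hx : ty x = c) (hv : ty v = d)
    (hy : ty y = d)
    (e0 : G.Adj w₁ u₁) (e1 : G.Adj w₂ u₂) (e2 : G.Adj w₃ u₃) (e3 : G.Adj w₄ v) (e4 : G.Adj x y)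
    (n0 : u₁ ≠ u₂) (n1 : u₁ ≠ u₃) (n2 : u₂ ≠ u₃) (n3 : w₁ ≠ w₂) (n4 : w₁ ≠ w₃) (n5 : w₂ ≠ w₃)
    (n6 : w₁ ≠ w₄) (n7 : w₂ ≠ w₄) (n8 : w₃ ≠ w₄) (n9 : v ≠ y) :
    HasTour G ty 5 (sgn (ty w₁) + sgn (ty w₂) + sgn (ty w₃) + sgn (ty w₄))
      (fun _ => True) (fun _ => True) := by
  by_cases h1 : x = u₁
  · subst h1
    exact (hasTour_five_path hcd hw₁ hw₂ hw₃ hw₄ hu₁ hu₂ hu₃ hv hy e0 e1 e2 e3 e4 n0 n1 n2 n3 n4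
      n5 n6 n7 n8 n9).of_eq rfl (by ring) (by simp) (by simp)
  by_cases h2 : x = u₂
  · subst h2
    exact (hasTour_five_path hcd hw₂ hw₁ hw₃ hw₄ hu₂ hu₁ hu₃ hv hy e1 e0 e2 e3 e4 n0.symm n2 n1
      n3.symm n5 n4 n7 n6 n8 n9).of_eq rfl (by ring) (by simp) (by simp)
  by_cases h3 : x = u₃
  · subst h3
    exact (hasTour_five_path hcd hw₃ hw₁ hw₂ hw₄ hu₃ hu₁ hu₂ hv hy e2 e0 e1 e3 e4 n1.symm n2.symm n0
      n4.symm n5.symm n3 n8 n6 n7 n9).of_eq rfl (by ring) (by simp) (by simp)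
  exact (hasTour_five_disjoint hcd hw₁ hw₂ hw₃ hw₄ hu₁ hu₂ hu₃ hx hv hy e0 e1 e2 e3 e4 n0 n1 n2 n3
    n4 n5 n6 n7 n8 n9 h1 h2 h3).of_eq rfl (by ring) (by simp) (by simp)

/-- Two disjoint edges from the bipartite part to the class `c`, with the given ends in the
bipartite part. -/
def IsPair (G : SimpleGraph V) (ty : V → VClass) (c : VClass) (w w' : V) : Prop :=
  IsW (ty w) ∧ IsW (ty w') ∧ w ≠ w' ∧
    ∃ u u', u ≠ u' ∧ ty u = c ∧ ty u' = c ∧ G.Adj w u ∧ G.Adj w' u'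

theorem IsPair.mk {c : VClass} {w w' u u' : V} (hw : IsW (ty w)) (hw' : IsW (ty w'))
    (hu : ty u = c) (hu' : ty u' = c) (h : G.Adj w u) (h' : G.Adj w' u') (hne : w ≠ w')
    (hne' : u ≠ u') : IsPair G ty c w w' :=
  ⟨hw, hw', hne, u, u', hne', hu, hu', h, h'⟩

theorem IsPair.symm {c : VClass} {w w' : V} (h : IsPair G ty c w w') : IsPair G ty c w' w := by
  obtain ⟨h1, h2, h3, u, u', h4, h5, h6, h7, h8⟩ := h
  exact ⟨h2, h1, h3.symm, u', u, h4.symm, h6, h5, h8, h7⟩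

/-- Only the vertices in W are recorded precisely, because the edges added later lie inside A or B.
-/
theorem IsPair.hasTour {c d : VClass} (hcd : Opp c d) {w₁ w₂ w₃ w₄ : V}
    (h : IsPair G ty c w₁ w₂) (h' : IsPair G ty d w₃ w₄)
    (h1 : ¬ (w₁ = w₃ ∧ w₂ = w₄)) (h2 : ¬ (w₁ = w₄ ∧ w₂ = w₃)) :
    HasTour G ty 4 (sgn (ty w₁) + sgn (ty w₂) + sgn (ty w₃) + sgn (ty w₄))
      (fun v => ¬ IsW (ty v) ∨ v ∈ [w₁, w₂, w₃, w₄])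
      (fun v => (v = w₁ ∨ v = w₂) ∧ (v = w₃ ∨ v = w₄)) := by
  obtain ⟨hw₁, hw₂, hw, u₁, u₂, hu, hu₁, hu₂, e0, e1⟩ := h
  obtain ⟨hw₃, hw₄, hw', v₃, v₄, hv, hv₃, hv₄, e2, e3⟩ := h'
  refine (hasTour_square hcd hw₁ hw₂ hw₃ hw₄ hu₁ hu₂ hv₃ hv₄ e0 e1 e2 e3 hu hv hw hw' h1 h2).mono
    ?_ (fun v => id)
  have hc : ∀ v, ty v = c → ¬ IsW (ty v) := by
    intro v hv
    rw [hv, IsW]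
    rcases hcd with ⟨rfl, rfl⟩ | ⟨rfl, rfl⟩ <;> decide
  have hd : ∀ v, ty v = d → ¬ IsW (ty v) := by
    intro v hv
    rw [hv, IsW]
    rcases hcd with ⟨rfl, rfl⟩ | ⟨rfl, rfl⟩ <;> decide
  intro v hv
  simp only [List.mem_cons, List.not_mem_nil, or_false] at hv ⊢
  rcases hv with rfl | rfl | rfl | rfl | rfl | rfl | rfl | rfl <;> tauto

theorem VClass.Opp.not_isW {c d : VClass} (h : Opp c d) : ¬ IsW c ∧ ¬ IsW d := by
  rcases h with ⟨rfl, rfl⟩ | ⟨rfl, rfl⟩ <;> simp [IsW]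

/-- Two disjoint edges at `w` and at `w'` from the bipartite part to `V₁ ∪ V₂` that can be completed
by one or two edges between `V₁` and `V₂` to an Eulerian path system. -/
def IsConn (G : SimpleGraph V) (ty : V → VClass) (w w' : V) : Prop :=
  IsW (ty w) ∧ IsW (ty w') ∧ w ≠ w' ∧ ∃ c d u u', Opp c d ∧ G.Adj w u ∧ G.Adj w' u' ∧ ty u = c ∧
    ((ty u' = d ∧ ∃ x y, ty x = c ∧ ty y = d ∧ G.Adj x y ∧ x ≠ u ∧ y ≠ u') ∨
      (ty u' = c ∧ u ≠ u' ∧ ∃ x₁ x₂ y₁ y₂, ty x₁ = c ∧ ty x₂ = c ∧ ty y₁ = d ∧ ty y₂ = d ∧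
        G.Adj x₁ y₁ ∧ G.Adj x₂ y₂ ∧ x₁ ≠ x₂ ∧ y₁ ≠ y₂ ∧ ¬ (u = x₁ ∧ u' = x₂) ∧
        ¬ (u = x₂ ∧ u' = x₁)))

/-- Paths are merged only at vertices of V₁ ∪ V₂, so no vertex of W is an inner vertex and edges
inside A and B can still be attached at `w` and `w'`. -/
theorem IsConn.hasTour {w w' : V} (h : IsConn G ty w w') :
    ∃ k ≤ 4, HasTour G ty k (sgn (ty w) + sgn (ty w'))
      (fun v => ¬ IsW (ty v) ∨ v = w ∨ v = w') (fun v => ¬ IsW (ty v)) := by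
  obtain ⟨hw, hw', hne, c, d, u, u', hcd, e, e', hu, ⟨hu', x, y, hx, hy, f, n1, n2⟩ |
    ⟨hu', huu, x₁, x₂, y₁, y₂, hx₁, hx₂, hy₁, hy₂, f1, f2, n1, n2, n3, n4⟩⟩ := h
  · obtain ⟨hc, hd⟩ := hcd.not_isW
    refine ⟨3, by omega,
      (hasTour_triangle hcd hw hw' hu hx hu' hy e e' f hne n1 n2).mono ?_ ?_⟩
    · intro v hv
      simp only [List.mem_cons, List.not_mem_nil, or_false] at hv
      rcases hv with rfl | rfl | rfl | rfl | rfl | rfl <;> simp [*]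
    · simp
  · obtain ⟨hc, hd⟩ := hcd.not_isW
    refine ⟨4, by omega,
      (hasTour_double hcd hw hw' hu hu' hx₁ hx₂ hy₁ hy₂ e e' f1 f2 hne huu n1 n2 n3 n4).mono ?_ ?_⟩
    · intro v hv
      simp only [List.mem_cons, List.not_mem_nil, or_false] at hv
      rcases hv with rfl | rfl | rfl | rfl | rfl | rfl | rfl | rfl <;> simp [*]
    · rintro v ⟨rfl | rfl, -⟩ <;> simp [*]

theorem isConn_triangle {c d : VClass} (hcd : Opp c d) {w₁ w₂ u₁ x u₂ y : V}
    (hw₁ : IsW (ty w₁)) (hw₂ : IsW (ty w₂))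
    (hu₁ : ty u₁ = c) (hx : ty x = c) (hu₂ : ty u₂ = d) (hy : ty y = d)
    (e0 : G.Adj w₁ u₁) (e1 : G.Adj w₂ u₂) (e2 : G.Adj x y)
    (n0 : w₁ ≠ w₂) (n1 : x ≠ u₁) (n2 : y ≠ u₂) : IsConn G ty w₁ w₂ :=
  ⟨hw₁, hw₂, n0, c, d, u₁, u₂, hcd, e0, e1, hu₁, .inl ⟨hu₂, x, y, hx, hy, e2, n1, n2⟩⟩

theorem isConn_double {c d : VClass} (hcd : Opp c d) {w₁ w₂ u₁ u₂ x₁ x₂ y₁ y₂ : V}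
    (hw₁ : IsW (ty w₁)) (hw₂ : IsW (ty w₂))
    (hu₁ : ty u₁ = c) (hu₂ : ty u₂ = c) (hx₁ : ty x₁ = c) (hx₂ : ty x₂ = c)
    (hy₁ : ty y₁ = d) (hy₂ : ty y₂ = d)
    (e0 : G.Adj w₁ u₁) (e1 : G.Adj w₂ u₂) (e2 : G.Adj x₁ y₁) (e3 : G.Adj x₂ y₂)
    (hw : w₁ ≠ w₂) (hu : u₁ ≠ u₂) (hx : x₁ ≠ x₂) (hy : y₁ ≠ y₂)
    (h1 : ¬ (u₁ = x₁ ∧ u₂ = x₂)) (h2 : ¬ (u₁ = x₂ ∧ u₂ = x₁)) : IsConn G ty w₁ w₂ :=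
  ⟨hw₁, hw₂, hw, c, d, u₁, u₂, hcd, e0, e1, hu₁,
    .inr ⟨hu₂, hu, x₁, x₂, y₁, y₂, hx₁, hx₂, hy₁, hy₂, e2, e3, hx, hy, h1, h2⟩⟩

theorem IsConn.symm {w w' : V} (h : IsConn G ty w w') : IsConn G ty w' w := by
  obtain ⟨h1, h2, h3, c, d, u, u', hcd, e, e', hu, ⟨hu', x, y, hx, hy, f, n1, n2⟩ |
    ⟨hu', huu, x₁, x₂, y₁, y₂, hx₁, hx₂, hy₁, hy₂, f1, f2, n1, n2, n3, n4⟩⟩ := h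
  · exact isConn_triangle hcd.symm h2 h1 hu' hy hu hx e' e f.symm h3.symm n2 n1
  · exact isConn_double hcd h2 h1 hu' hu hx₁ hx₂ hy₁ hy₂ e' e f1 f2 h3.symm huu.symm n1 n2
      (fun h => n4 ⟨h.2, h.1⟩) (fun h => n3 ⟨h.2, h.1⟩)

end SimpleGraph

/-! ### Finding connectors by 3-connectivity. -/

namespace SimpleGraph

open VClass

variable {V : Type*} {G : SimpleGraph V} {ty : V → VClass}

/-- Each part sends an edge to its complement that avoids any two given vertices. -/
def IsSep (G : SimpleGraph V) (ty : V → VClass) : Prop :=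
  ∀ (r : Fin 3) (s t : V), ∃ x y, G.Adj x y ∧ (ty x).part = r ∧ (ty y).part ≠ r ∧
    x ≠ s ∧ x ≠ t ∧ y ≠ s ∧ y ≠ t

theorem VClass.Opp.cases {c d : VClass} (h : Opp c d) (e : VClass) : e = c ∨ e = d ∨ IsW e := by
  rcases h with ⟨rfl, rfl⟩ | ⟨rfl, rfl⟩ <;> cases e <;> simp [IsW]

theorem VClass.Opp.ne {c d : VClass} (h : Opp c d) : c ≠ d := by
  rcases h with ⟨rfl, rfl⟩ | ⟨rfl, rfl⟩ <;> simp

theorem IsSep.exists_class (hsep : IsSep G ty) {c d : VClass} (hcd : Opp c d) (s t : V) :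
    ∃ x y, G.Adj x y ∧ ty x = c ∧ (ty y = d ∨ IsW (ty y)) ∧ x ≠ s ∧ x ≠ t ∧ y ≠ s ∧ y ≠ t := by
  obtain ⟨x, y, hxy, hx, hy, h⟩ := hsep c.part s t
  refine ⟨x, y, hxy, ?_, ?_, h⟩
  · revert hx
    rcases hcd with ⟨rfl, rfl⟩ | ⟨rfl, rfl⟩ <;> cases ty x <;> simp [part]
  · rcases hcd.cases (ty y) with h | h
    · exact absurd (by rw [h]) hy
    · exact h

theorem IsSep.exists_bip (hsep : IsSep G ty) (s t : V) :
    ∃ w u, G.Adj w u ∧ IsW (ty w) ∧ ¬ IsW (ty u) ∧ w ≠ s ∧ w ≠ t ∧ u ≠ s ∧ u ≠ t := by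
  obtain ⟨x, y, hxy, hx, hy, h⟩ := hsep 2 s t
  refine ⟨x, y, hxy, ?_, ?_, h⟩
  · revert hx
    cases ty x <;> simp [part, IsW]
  · revert hy
    cases ty y <;> simp [part, IsW]

/-- If `u₁` and `u₂` lie in different classes, the cross edge `xy` completes a triangle. If they lie
in the same class, the two disjoint cross edges work unless their ends there are exactly `u₁` and
`u₂`; in that case `xy` replaces one of them, keeping one that it does not meet. -/
theorem isConn_of_not_cover {c d : VClass} (hcd : Opp c d) {x₁ x₂ y₁ y₂ : V}
    (hx₁ : ty x₁ = c) (hx₂ : ty x₂ = c) (hy₁ : ty y₁ = d) (hy₂ : ty y₂ = d)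
    (e1 : G.Adj x₁ y₁) (e2 : G.Adj x₂ y₂) (hx : x₁ ≠ x₂) (hy : y₁ ≠ y₂)
    {w₁ w₂ u₁ u₂ : V} (hw₁ : IsW (ty w₁)) (hw₂ : IsW (ty w₂)) (hu₁ : ¬ IsW (ty u₁))
    (hu₂ : ¬ IsW (ty u₂)) (f1 : G.Adj w₁ u₁) (f2 : G.Adj w₂ u₂) (hw : w₁ ≠ w₂) (hu : u₁ ≠ u₂)
    {x y : V} (hxc : ty x = c) (hyd : ty y = d) (hxy : G.Adj x y)
    (hx1 : x ≠ u₁) (hx2 : x ≠ u₂) (hy1 : y ≠ u₁) (hy2 : y ≠ u₂) : IsConn G ty w₁ w₂ := by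
  have same : ∀ {c d : VClass} (hcd : Opp c d) {x₁ x₂ y₁ y₂ x y : V}
      (hx₁ : ty x₁ = c) (hx₂ : ty x₂ = c) (hy₁ : ty y₁ = d) (hy₂ : ty y₂ = d)
      (e1 : G.Adj x₁ y₁) (e2 : G.Adj x₂ y₂) (hx : x₁ ≠ x₂) (hy : y₁ ≠ y₂)
      (hxc : ty x = c) (hyd : ty y = d) (hxy : G.Adj x y)
      (hx1 : x ≠ u₁) (hx2 : x ≠ u₂) (hc₁ : ty u₁ = c) (hc₂ : ty u₂ = c), IsConn G ty w₁ w₂ := by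
    intro c d hcd x₁ x₂ y₁ y₂ x y hx₁ hx₂ hy₁ hy₂ e1 e2 hx hy hxc hyd hxy hx1 hx2 hc₁ hc₂
    by_cases h : (u₁ = x₁ ∧ u₂ = x₂) ∨ (u₁ = x₂ ∧ u₂ = x₁)
    · by_cases hyy : y = y₁
      · exact isConn_double hcd hw₁ hw₂ hc₁ hc₂ hxc hx₂ hyd hy₂ f1 f2 hxy e2 hw hu
          (by grind) (by grind) (by grind) (by grind)
      · exact isConn_double hcd hw₁ hw₂ hc₁ hc₂ hxc hx₁ hyd hy₁ f1 f2 hxy e1 hw hu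
          (by grind) (by grind) (by grind) (by grind)
    · exact isConn_double hcd hw₁ hw₂ hc₁ hc₂ hx₁ hx₂ hy₁ hy₂ f1 f2 e1 e2 hw hu
          (by grind) (by grind) (by grind) (by grind)
  rcases hcd.cases (ty u₁) with h₁ | h₁ | h₁ <;> rcases hcd.cases (ty u₂) with h₂ | h₂ | h₂ <;>
    try contradiction
  · exact same hcd hx₁ hx₂ hy₁ hy₂ e1 e2 hx hy hxc hyd hxy hx1 hx2 h₁ h₂
  · exact isConn_triangle hcd hw₁ hw₂ h₁ hxc h₂ hyd f1 f2 hxy hw hx1 hy2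
  · exact (isConn_triangle hcd hw₂ hw₁ h₂ hxc h₁ hyd f2 f1 hxy hw.symm hx2 hy1).symm
  · exact same hcd.symm hy₁ hy₂ hx₁ hx₂ e1.symm e2.symm hy hx hyd hxc hxy.symm hy1 hy2 h₁ h₂

/-- If `w₁` and `w₂` are not connected, then `u₁` and `u₂` cover all cross edges. Hence an edge that
leaves V₁ or V₂ and avoids them must go to W, and its end there can be connected to both `w₁` and
`w₂`. The class of this third vertex is not controlled, so applications have to cope with both
possibilities. -/
theorem IsSep.exists_isConn (hsep : IsSep G ty) {c d : VClass} (hcd : Opp c d) {x₁ x₂ y₁ y₂ : V}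
    (hx₁ : ty x₁ = c) (hx₂ : ty x₂ = c) (hy₁ : ty y₁ = d) (hy₂ : ty y₂ = d)
    (e1 : G.Adj x₁ y₁) (e2 : G.Adj x₂ y₂) (hx : x₁ ≠ x₂) (hy : y₁ ≠ y₂)
    {w₁ w₂ u₁ u₂ : V} (hw₁ : IsW (ty w₁)) (hw₂ : IsW (ty w₂)) (hu₁ : ¬ IsW (ty u₁))
    (hu₂ : ¬ IsW (ty u₂)) (f1 : G.Adj w₁ u₁) (f2 : G.Adj w₂ u₂) (hw : w₁ ≠ w₂) (hu : u₁ ≠ u₂) :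
    IsConn G ty w₁ w₂ ∨ ∃ w₃, IsW (ty w₃) ∧ (w₃ ≠ w₁ → IsConn G ty w₁ w₃) ∧
      (w₃ ≠ w₂ → IsConn G ty w₂ w₃) := by
  by_cases hcov : ∃ x y, ty x = c ∧ ty y = d ∧ G.Adj x y ∧ x ≠ u₁ ∧ x ≠ u₂ ∧ y ≠ u₁ ∧ y ≠ u₂
  · obtain ⟨x, y, hxc, hyd, hxy, h1, h2, h3, h4⟩ := hcov
    exact .inl (isConn_of_not_cover hcd hx₁ hx₂ hy₁ hy₂ e1 e2 hx hy hw₁ hw₂ hu₁ hu₂ f1 f2 hw hu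
      hxc hyd hxy h1 h2 h3 h4)
  right
  push Not at hcov
  -- both ends in the same class
  have same : ∀ {c d : VClass} (hcd : Opp c d) {x₁ x₂ y₁ y₂ : V}
      (hx₁ : ty x₁ = c) (hx₂ : ty x₂ = c) (hy₁ : ty y₁ = d) (hy₂ : ty y₂ = d)
      (e1 : G.Adj x₁ y₁) (e2 : G.Adj x₂ y₂) (hx : x₁ ≠ x₂) (hy : y₁ ≠ y₂)
      (hcov : ∀ x y, ty x = c → ty y = d → G.Adj x y → x ≠ u₁ → x = u₂)
      (hc₁ : ty u₁ = c) (hc₂ : ty u₂ = c), ∃ w₃, IsW (ty w₃) ∧ (w₃ ≠ w₁ → IsConn G ty w₁ w₃) ∧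
      (w₃ ≠ w₂ → IsConn G ty w₂ w₃) := by
    intro c d hcd x₁ x₂ y₁ y₂ hx₁ hx₂ hy₁ hy₂ e1 e2 hx hy hcov hc₁ hc₂
    obtain ⟨z₁, hz₁, g1⟩ : ∃ z, ty z = d ∧ G.Adj u₁ z := by
      by_cases k1 : x₁ = u₁
      · exact ⟨y₁, hy₁, k1 ▸ e1⟩
      by_cases k2 : x₂ = u₁
      · exact ⟨y₂, hy₂, k2 ▸ e2⟩
      exact absurd ((hcov x₁ y₁ hx₁ hy₁ e1 k1).trans (hcov x₂ y₂ hx₂ hy₂ e2 k2).symm) hx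
    obtain ⟨z₂, hz₂, g2⟩ : ∃ z, ty z = d ∧ G.Adj u₂ z := by
      by_cases k1 : x₁ = u₁
      · have k2 : x₂ ≠ u₁ := fun h => hx (k1.trans h.symm)
        exact ⟨y₂, hy₂, hcov x₂ y₂ hx₂ hy₂ e2 k2 ▸ e2⟩
      · exact ⟨y₁, hy₁, hcov x₁ y₁ hx₁ hy₁ e1 k1 ▸ e1⟩
    -- An edge `vw` from `d` to W is wanted such that both `u₁` and `u₂` keep a cross edge avoiding
    -- `v`. In `IsSep` one avoids `uᵢ` itself if it has several neighbours in `d`, and its only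
    -- neighbour there otherwise.
    have key : ∃ v w z₁ z₂, G.Adj w v ∧ ty v = d ∧ IsW (ty w) ∧ ty z₁ = d ∧ G.Adj u₁ z₁ ∧
        z₁ ≠ v ∧ ty z₂ = d ∧ G.Adj u₂ z₂ ∧ z₂ ≠ v := by
      have hne := hcd.ne
      by_cases h1 : ∃ z, ty z = d ∧ G.Adj u₁ z ∧ z ≠ z₁ <;>
        by_cases h2 : ∃ z, ty z = d ∧ G.Adj u₂ z ∧ z ≠ z₂
      · obtain ⟨z₁', h11, h12, h13⟩ := h1
        obtain ⟨z₂', h21, h22, h23⟩ := h2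
        obtain ⟨v, w, hvw, hv, hw, n1, n2, n3, n4⟩ := hsep.exists_class hcd.symm u₁ u₂
        have hw' : IsW (ty w) := hw.resolve_left fun h => n4 (hcov w v h hv hvw.symm n3)
        by_cases hz1 : z₁ = v <;> by_cases hz2 : z₂ = v
        · exact ⟨v, w, z₁', z₂', hvw.symm, hv, hw', h11, h12, by grind, h21, h22, by grind⟩
        · exact ⟨v, w, z₁', z₂, hvw.symm, hv, hw', h11, h12, by grind, hz₂, g2, hz2⟩
        · exact ⟨v, w, z₁, z₂', hvw.symm, hv, hw', hz₁, g1, hz1, h21, h22, by grind⟩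
        · exact ⟨v, w, z₁, z₂, hvw.symm, hv, hw', hz₁, g1, hz1, hz₂, g2, hz2⟩
      · obtain ⟨z₁', h11, h12, h13⟩ := h1
        push Not at h2
        obtain ⟨v, w, hvw, hv, hw, n1, n2, n3, n4⟩ := hsep.exists_class hcd.symm z₂ u₁
        have hw' : IsW (ty w) := hw.resolve_left fun h => by
          have := hcov w v h hv hvw.symm n4
          subst this
          exact n1 (h2 v hv hvw.symm)
        by_cases hz1 : z₁ = v
        · exact ⟨v, w, z₁', z₂, hvw.symm, hv, hw', h11, h12, by grind, hz₂, g2, n1.symm⟩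
        · exact ⟨v, w, z₁, z₂, hvw.symm, hv, hw', hz₁, g1, hz1, hz₂, g2, n1.symm⟩
      · obtain ⟨z₂', h21, h22, h23⟩ := h2
        push Not at h1
        obtain ⟨v, w, hvw, hv, hw, n1, n2, n3, n4⟩ := hsep.exists_class hcd.symm z₁ u₂
        have hw' : IsW (ty w) := hw.resolve_left fun h => by
          by_cases hwu : w = u₁
          · subst hwu
            exact n1 (h1 v hv hvw.symm)
          · exact n4 (hcov w v h hv hvw.symm hwu)
        by_cases hz2 : z₂ = v
        · exact ⟨v, w, z₁, z₂', hvw.symm, hv, hw', hz₁, g1, n1.symm, h21, h22, by grind⟩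
        · exact ⟨v, w, z₁, z₂, hvw.symm, hv, hw', hz₁, g1, n1.symm, hz₂, g2, hz2⟩
      · push Not at h1 h2
        obtain ⟨v, w, hvw, hv, hw, n1, n2, n3, n4⟩ := hsep.exists_class hcd.symm z₁ z₂
        have hw' : IsW (ty w) := hw.resolve_left fun h => by
          by_cases hwu : w = u₁
          · subst hwu
            exact n1 (h1 v hv hvw.symm)
          · have := hcov w v h hv hvw.symm hwu
            subst this
            exact n2 (h2 v hv hvw.symm)
        exact ⟨v, w, z₁, z₂, hvw.symm, hv, hw', hz₁, g1, n1.symm, hz₂, g2, n2.symm⟩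
    obtain ⟨v, w, z₁, z₂, hwv, hv, hw', hz₁, g1, n1, hz₂, g2, n2⟩ := key
    exact ⟨w, hw',
      fun h => isConn_triangle hcd hw₁ hw' hc₁ hc₂ hv hz₂ f1 hwv g2 h.symm hu.symm n2,
      fun h => isConn_triangle hcd hw₂ hw' hc₂ hc₁ hv hz₁ f2 hwv g1 h.symm hu n1⟩
  have diff : ∀ {c d : VClass} (hcd : Opp c d) {x₁ x₂ y₁ y₂ w₁ w₂ u₁ u₂ : V}
      (hw₁ : IsW (ty w₁)) (hw₂ : IsW (ty w₂)) (f1 : G.Adj w₁ u₁) (f2 : G.Adj w₂ u₂)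
      (hx₁ : ty x₁ = c) (hx₂ : ty x₂ = c) (hy₁ : ty y₁ = d) (hy₂ : ty y₂ = d)
      (e1 : G.Adj x₁ y₁) (e2 : G.Adj x₂ y₂) (hx : x₁ ≠ x₂) (hy : y₁ ≠ y₂)
      (hcov : ∀ x y, ty x = c → ty y = d → G.Adj x y → x ≠ u₁ → y = u₂)
      (hc₁ : ty u₁ = c) (hc₂ : ty u₂ = d), ∃ w₃, IsW (ty w₃) ∧ (w₃ ≠ w₁ → IsConn G ty w₁ w₃) ∧
      (w₃ ≠ w₂ → IsConn G ty w₂ w₃) := by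
    intro c d hcd x₁ x₂ y₁ y₂ w₁ w₂ u₁ u₂ hw₁ hw₂ f1 f2 hx₁ hx₂ hy₁ hy₂ e1 e2 hx hy hcov hc₁ hc₂
    have hne := hcd.ne
    obtain ⟨z₁, z₂, hz₁, hz₂, g1, g2, n1, n2⟩ : ∃ z₁ z₂, ty z₁ = d ∧ ty z₂ = c ∧ G.Adj u₁ z₁ ∧
        G.Adj z₂ u₂ ∧ z₁ ≠ u₂ ∧ z₂ ≠ u₁ := by
      by_cases k1 : x₁ = u₁
      · have k2 := hcov x₂ y₂ hx₂ hy₂ e2 fun h => hx (k1.trans h.symm)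
        exact ⟨y₁, x₂, hy₁, hx₂, k1 ▸ e1, k2 ▸ e2, fun h => hy (h.trans k2.symm),
          fun h => hx (k1.trans h.symm)⟩
      · have k2 := hcov x₁ y₁ hx₁ hy₁ e1 k1
        have k3 : x₂ = u₁ := by
          by_contra k3
          exact hy (k2.trans (hcov x₂ y₂ hx₂ hy₂ e2 k3).symm)
        exact ⟨y₂, x₁, hy₂, hx₁, k3 ▸ e2, k2 ▸ e1, fun h => hy (k2.trans h.symm), k1⟩
    -- Now `u₁` and `u₂` lie in different classes. An edge from `c` to W is needed whose end `u₃`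
    -- differs from `u₁` and leaves `u₂` a cross edge avoiding both `u₁` and `u₃`.
    have key : ∃ w₃ u₃ z₂, IsW (ty w₃) ∧ ty u₃ = c ∧ G.Adj w₃ u₃ ∧ ty z₂ = c ∧ G.Adj z₂ u₂ ∧
        z₂ ≠ u₁ ∧ z₂ ≠ u₃ ∧ u₃ ≠ u₁ := by
      by_cases h2 : ∃ z, ty z = c ∧ G.Adj z u₂ ∧ z ≠ u₁ ∧ z ≠ z₂
      · obtain ⟨z₂', h21, h22, h23, h24⟩ := h2
        obtain ⟨u₃, w₃, huw, hu₃, hw₃, m1, m2, m3, m4⟩ := hsep.exists_class hcd u₁ u₂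
        have hw' : IsW (ty w₃) := hw₃.resolve_left fun h => m4 (hcov u₃ w₃ hu₃ h huw m1)
        by_cases hz : z₂ = u₃
        · exact ⟨w₃, u₃, z₂', hw', hu₃, huw.symm, h21, h22, h23, by grind, m1⟩
        · exact ⟨w₃, u₃, z₂, hw', hu₃, huw.symm, hz₂, g2, n2, hz, m1⟩
      · push Not at h2
        obtain ⟨u₃, w₃, huw, hu₃, hw₃, m1, m2, m3, m4⟩ := hsep.exists_class hcd u₁ z₂
        have hw' : IsW (ty w₃) := hw₃.resolve_left fun h => by
          have := hcov u₃ w₃ hu₃ h huw m1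
          subst this
          exact m2 (h2 u₃ hu₃ huw m1)
        exact ⟨w₃, u₃, z₂, hw', hu₃, huw.symm, hz₂, g2, n2, m2.symm, m1⟩
    obtain ⟨w₃, u₃, z₂, hw₃, hu₃, f3, hz₂, g2, n2, n3, n4⟩ := key
    exact ⟨w₃, hw₃,
      fun h => isConn_double hcd hw₁ hw₃ hc₁ hu₃ hc₁ hz₂ hz₁ hc₂ f1 f3 g1 g2 h.symm n4.symm n2.symm
        n1 (fun h => n3 h.2.symm) (fun h => n2 h.1.symm),
      fun h => (isConn_triangle hcd hw₃ hw₂ hu₃ hc₁ hc₂ hz₁ f3 f2 g1 h n4.symm n1).symm⟩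
  have hne := hcd.ne
  rcases hcd.cases (ty u₁) with h₁ | h₁ | h₁ <;> rcases hcd.cases (ty u₂) with h₂ | h₂ | h₂ <;>
    try contradiction
  · exact same hcd hx₁ hx₂ hy₁ hy₂ e1 e2 hx hy (fun x y a b e h => by
      by_contra h'
      exact absurd (hcov x y a b e h h' (by grind)) (by grind)) h₁ h₂
  · exact diff hcd hw₁ hw₂ f1 f2 hx₁ hx₂ hy₁ hy₂ e1 e2 hx hy (fun x y a b e h => by
      by_contra h'
      exact h' (hcov x y a b e h (by grind) (by grind))) h₁ h₂
  · obtain ⟨w₃, h3, h4, h5⟩ := diff hcd hw₂ hw₁ f2 f1 hx₁ hx₂ hy₁ hy₂ e1 e2 hx hy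
      (fun x y a b e h => by
        by_contra h'
        exact absurd (hcov x y a b e (by grind) h h') (by grind)) h₂ h₁
    exact ⟨w₃, h3, h5, h4⟩
  · exact same hcd.symm hy₁ hy₂ hx₁ hx₂ e1.symm e2.symm hy hx (fun x y a b e h =>
      hcov y x b a e.symm (by grind) (by grind) h) h₁ h₂

end SimpleGraph

/-! ### The case |A| = |B| with cross edges. -/

namespace SimpleGraph

open VClass

variable {V : Type*} {G : SimpleGraph V} {ty : V → VClass}

/-- The classes `A` and `B`, in some order. -/
def VClass.OppW (p q : VClass) : Prop := p = A ∧ q = B ∨ p = B ∧ q = A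

theorem VClass.OppW.symm {p q : VClass} (h : OppW p q) : OppW q p := by
  rcases h with ⟨rfl, rfl⟩ | ⟨rfl, rfl⟩
  exacts [.inr ⟨rfl, rfl⟩, .inl ⟨rfl, rfl⟩]

theorem VClass.OppW.ne {p q : VClass} (h : OppW p q) : p ≠ q := by
  rcases h with ⟨rfl, rfl⟩ | ⟨rfl, rfl⟩ <;> simp

theorem VClass.OppW.isW {p q : VClass} (h : OppW p q) : IsW p ∧ IsW q := by
  rcases h with ⟨rfl, rfl⟩ | ⟨rfl, rfl⟩ <;> simp [IsW]

theorem VClass.OppW.isW_iff {p q e : VClass} (h : OppW p q) : IsW e ↔ e = p ∨ e = q := by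
  rcases h with ⟨rfl, rfl⟩ | ⟨rfl, rfl⟩ <;> simp [IsW, or_comm]

theorem VClass.OppW.sgn_eq {p q : VClass} (h : OppW p q) : sgn q = - sgn p := by
  rcases h with ⟨rfl, rfl⟩ | ⟨rfl, rfl⟩ <;> rfl

theorem VClass.IsW.wt_self {p : VClass} (h : IsW p) : wt p p = 2 * sgn p := by
  rcases h with rfl | rfl <;> rfl

/-- An edge inside the class `p`. -/
def InEdge (G : SimpleGraph V) (ty : V → VClass) (p : VClass) (a a' : V) : Prop :=
  G.Adj a a' ∧ ty a = p ∧ ty a' = p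

/-- An edge from the class `p` to `V₁ ∪ V₂`. -/
def OutEdge (G : SimpleGraph V) (ty : V → VClass) (p : VClass) (w u : V) : Prop :=
  G.Adj w u ∧ ty w = p ∧ ¬ IsW (ty u)

theorem InEdge.symm {p : VClass} {a a' : V} (h : InEdge G ty p a a') : InEdge G ty p a' a :=
  ⟨h.1.symm, h.2.2, h.2.1⟩

/-- There is an Eulerian path system with at most `E` edges and twice the balance `c`. -/
def TourLE (G : SimpleGraph V) (ty : V → VClass) (E : ℕ) (c : ℤ) : Prop :=
  ∃ k ≤ E, HasTour G ty k c (fun _ => True) (fun _ => True)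

theorem HasTour.tourLE {E k : ℕ} {c c' : ℤ} {S I : V → Prop} (h : HasTour G ty k c S I)
    (hk : k ≤ E) (hc : c = c') : TourLE G ty E c' :=
  ⟨k, hk, h.of_eq rfl hc (by simp) (by simp)⟩

/-- The only vertices of `p` in use are `s` and `t`, and neither is inner. An edge inside `p` other
than `st` has a new end, and its other end is free or an end of a path. -/
theorem HasTour.add_inEdge {p : VClass} (hp : IsW p) {k : ℕ} {c : ℤ} {S I : V → Prop}
    (h : HasTour G ty k c S I) {s t a a' : V} (hS : ∀ v, ty v = p → S v → v = s ∨ v = t)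
    (hI : ∀ v, ty v = p → ¬ I v) (ha : InEdge G ty p a a') (h1 : ¬ (a = s ∧ a' = t))
    (h2 : ¬ (a = t ∧ a' = s)) :
    HasTour G ty (k + 1) (c + 2 * sgn p) (fun _ => True) (fun _ => True) := by
  obtain ⟨haa, h3, h4⟩ := ha
  have hne := haa.ne
  by_cases hf : S a
  · have hf' : ¬ S a' := fun hf' => by
      have := hS a h3 hf
      have := hS a' h4 hf'
      grind
    exact (h.add_edge haa.symm (by rw [h3, h4]) hf' (hI a h3)).of_eq rfl
      (by rw [h3, h4, hp.wt_self]) (by simp) (by simp)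
  · exact (h.add_edge haa (by rw [h3, h4]) hf (hI a' h4)).of_eq rfl
      (by rw [h3, h4, hp.wt_self]) (by simp) (by simp)

/-- Here only `s` is in use, and the first edge avoids it. Two edges sharing a vertex form a path,
which is attached edge by edge starting from the far side; disjoint edges are added one after the
other. -/
theorem HasTour.add_two_inEdges {p : VClass} (hp : IsW p) {k : ℕ} {c : ℤ} {S I : V → Prop}
    (h : HasTour G ty k c S I) {s a a' b b' : V} (hS : ∀ v, ty v = p → S v → v = s)
    (hI : ∀ v, ty v = p → ¬ I v) (ha : InEdge G ty p a a') (hb : InEdge G ty p b b')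
    (h1 : a ≠ s) (h2 : a' ≠ s) (h3 : ¬ (a = b ∧ a' = b')) (h4 : ¬ (a = b' ∧ a' = b)) :
    HasTour G ty (k + 2) (c + 4 * sgn p) (fun _ => True) (fun _ => True) := by
  have path : ∀ {x y z : V}, InEdge G ty p x y → InEdge G ty p y z → x ≠ s → y ≠ s → x ≠ z →
      HasTour G ty (k + 2) (c + 4 * sgn p) (fun _ => True) (fun _ => True) := by
    intro x y z hxy hyz hx hy hxz
    have hne := hxy.1.ne
    have hne' := hyz.1.ne
    have g := h.add_edge hyz.1 (by rw [hyz.2.1, hyz.2.2]) (fun hh => hy (hS y hyz.2.1 hh))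
      (hI z hyz.2.2)
    have g' := g.add_edge hxy.1 (by rw [hxy.2.1, hxy.2.2])
      (fun hh => by
        rcases hh with hh | hh | hh
        exacts [hx (hS x hxy.2.1 hh), hne hh, hxz hh])
      (fun hh => by
        rcases hh with hh | hh
        exacts [hI y hxy.2.2 hh, hne' hh])
    exact g'.of_eq rfl (by rw [hxy.2.1, hxy.2.2, hyz.2.2, hp.wt_self]; ring) (by simp) (by simp)
  have hne := ha.1.ne
  have hne' := hb.1.ne
  by_cases e1 : a = b
  · subst e1
    exact path ha.symm hb h2 h1 (by grind)
  by_cases e2 : a = b'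
  · subst e2
    exact path ha.symm hb.symm h2 h1 (by grind)
  by_cases e3 : a' = b
  · subst e3
    exact path ha hb h1 h2 (by grind)
  by_cases e4 : a' = b'
  · subst e4
    exact path ha hb.symm h1 h2 (by grind)
  have g := h.add_edge ha.1 (by rw [ha.2.1, ha.2.2]) (fun hh => h1 (hS a ha.2.1 hh))
    (hI a' ha.2.2)
  by_cases hbs : b = s
  · have hbs' : b' ≠ s := by grind
    have g' := g.add_edge hb.symm.1 (by rw [hb.2.1, hb.2.2])
      (fun hh => by
        rcases hh with hh | hh | hh
        exacts [hbs' (hS _ hb.2.2 hh), e2 hh.symm, e4 hh.symm])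
      (fun hh => by
        rcases hh with hh | hh
        exacts [hI _ hb.2.1 hh, e3 hh.symm])
    exact g'.of_eq rfl (by rw [hb.2.1, ha.2.1, ha.2.2, hb.2.2, hp.wt_self]; ring) (by simp)
      (by simp)
  · have g' := g.add_edge hb.1 (by rw [hb.2.1, hb.2.2])
      (fun hh => by
        rcases hh with hh | hh | hh
        exacts [hbs (hS _ hb.2.1 hh), e1 hh.symm, e3 hh.symm])
      (fun hh => by
        rcases hh with hh | hh
        exacts [hI _ hb.2.2 hh, e4 hh.symm])
    exact g'.of_eq rfl (by rw [hb.2.1, ha.2.1, ha.2.2, hb.2.2, hp.wt_self]; ring) (by simp)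
      (by simp)

theorem IsConn.add_inEdge {p : VClass} (hp : IsW p) {w w' a a' : V} (h : IsConn G ty w w')
    (hne : ¬ (ty w = p ∧ ty w' = p)) (ha : InEdge G ty p a a') :
    TourLE G ty 5 (sgn (ty w) + sgn (ty w') + 2 * sgn p) := by
  obtain ⟨k, hk, h⟩ := h.hasTour
  by_cases hw : ty w = p
  · refine (h.add_inEdge hp (s := w) (t := w) ?_ ?_ ha ?_ ?_).tourLE (by omega) rfl
    · rintro v hv (hh | rfl | rfl)
      · exact absurd (hv ▸ hp) hh
      · exact .inl rfl
      · exact absurd ⟨hw, hv⟩ hne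
    · intro v hv
      simp [hv, hp]
    · exact fun h => ha.1.ne (h.1.trans h.2.symm)
    · exact fun h => ha.1.ne (h.1.trans h.2.symm)
  · refine (h.add_inEdge hp (s := w') (t := w') ?_ ?_ ha ?_ ?_).tourLE (by omega) rfl
    · rintro v hv (hh | rfl | rfl)
      · exact absurd (hv ▸ hp) hh
      · exact absurd hv hw
      · exact .inl rfl
    · intro v hv
      simp [hv, hp]
    · exact fun h => ha.1.ne (h.1.trans h.2.symm)
    · exact fun h => ha.1.ne (h.1.trans h.2.symm)

theorem IsConn.add_two_inEdges {p : VClass} (hp : IsW p) {w w' a a' b b' : V}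
    (h : IsConn G ty w w') (hw : ty w ≠ p) (hw' : ty w' ≠ p) (ha : InEdge G ty p a a')
    (hb : InEdge G ty p b b') (h3 : ¬ (a = b ∧ a' = b')) (h4 : ¬ (a = b' ∧ a' = b)) :
    TourLE G ty 6 (sgn (ty w) + sgn (ty w') + 4 * sgn p) := by
  obtain ⟨k, hk, h⟩ := h.hasTour
  refine (h.add_two_inEdges hp (s := w) ?_ ?_ ha hb ?_ ?_ h3 h4).tourLE (by omega) rfl
  · rintro v hv (hh | rfl | rfl)
    · exact absurd (hv ▸ hp) hh
    · rfl
    · exact absurd hv hw'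
  · intro v hv
    simp [hv, hp]
  · rintro rfl
    exact hw ha.2.1
  · rintro rfl
    exact hw ha.2.2

theorem IsConn.tourLE {w w' : V} (h : IsConn G ty w w') :
    TourLE G ty 4 (sgn (ty w) + sgn (ty w')) := by
  obtain ⟨k, hk, h⟩ := h.hasTour
  exact h.tourLE hk rfl

theorem TourLE.of_le {E E' : ℕ} {c c' : ℤ} (h : TourLE G ty E c) (hE : E ≤ E') (hc : c = c') :
    TourLE G ty E' c' := by
  obtain ⟨k, hk, h⟩ := h
  exact ⟨k, hk.trans hE, hc ▸ h⟩

/-- If both A and B send edges to V₁ ∪ V₂, the third vertex from `IsSep.exists_isConn` can always be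
paired with a vertex of the opposite class, which gives balance 0. If only `q` does, a connector
with both ends in `q` is corrected by one edge inside `p`. -/
theorem IsSep.tourLE_zero_of_matching (hsep : IsSep G ty) {c d : VClass} (hcd : Opp c d)
    {x₁ x₂ y₁ y₂ : V}
    (hx₁ : ty x₁ = c) (hx₂ : ty x₂ = c) (hy₁ : ty y₁ = d) (hy₂ : ty y₂ = d)
    (e1 : G.Adj x₁ y₁) (e2 : G.Adj x₂ y₂) (hx : x₁ ≠ x₂) (hy : y₁ ≠ y₂)
    (hin : ∀ p, IsW p → (∀ w u, ¬ OutEdge G ty p w u) → ∃ a a', InEdge G ty p a a') :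
    TourLE G ty 6 0 := by
  -- the mixed case
  have mixed : ∀ a u b v, OutEdge G ty A a u → OutEdge G ty B b v → u ≠ v → TourLE G ty 6 0 := by
    rintro a u b v ⟨f1, ha, hu⟩ ⟨f2, hb, hv⟩ huv
    have hab : a ≠ b := by grind
    rcases hsep.exists_isConn hcd hx₁ hx₂ hy₁ hy₂ e1 e2 hx hy (by simp [ha, IsW])
      (by simp [hb, IsW]) hu hv f1 f2 hab huv with h | ⟨w, hw, h1, h2⟩
    · exact h.tourLE.of_le (by omega) (by simp [ha, hb, sgn])
    · rcases hw with hw | hw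
      · exact (h2 (by grind)).tourLE.of_le (by omega) (by simp [hb, hw, sgn])
      · exact (h1 (by grind)).tourLE.of_le (by omega) (by simp [ha, hw, sgn])
  -- the case where only one class sends edges
  have pure : ∀ p q, OppW p q → (∀ w u, ¬ OutEdge G ty p w u) → TourLE G ty 6 0 := by
    intro p q hpq hno
    obtain ⟨a, a', haa⟩ := hin p hpq.isW.1 hno
    have hq : ∀ w u, G.Adj w u → IsW (ty w) → ¬ IsW (ty u) → ty w = q := fun w u h hw hu =>
      ((hpq.isW_iff.1 hw).resolve_left fun hp => hno w u ⟨h, hp, hu⟩)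
    obtain ⟨w₁, u₁, f1, hw₁, hu₁, -⟩ := hsep.exists_bip x₁ x₁
    obtain ⟨w₂, u₂, f2, hw₂, hu₂, n1, n2, n3, n4⟩ := hsep.exists_bip w₁ u₁
    have fin : ∀ w w', ty w = q → ty w' = q → IsConn G ty w w' → TourLE G ty 6 0 := by
      intro w w' hw hw' h
      exact (h.add_inEdge hpq.isW.1 (by rw [hw]; exact fun h => hpq.ne h.1.symm) haa).of_le
        (by omega) (by rw [hw, hw', hpq.sgn_eq]; ring)
    have hq₁ := hq w₁ u₁ f1 hw₁ hu₁
    have hq₂ := hq w₂ u₂ f2 hw₂ hu₂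
    rcases hsep.exists_isConn hcd hx₁ hx₂ hy₁ hy₂ e1 e2 hx hy hw₁ hw₂ hu₁ hu₂ f1 f2 n1.symm n4.symm
      with h | ⟨w, hw, h1, h2⟩
    · exact fin _ _ hq₁ hq₂ h
    · have hne : w ≠ w₁ ∨ w ≠ w₂ := by grind
      rcases hpq.isW_iff.1 hw with hw' | hw'
      · have h11 := h1 (by rintro rfl; exact hpq.ne (hw'.symm.trans hq₁))
        exact h11.tourLE.of_le (by omega) (by rw [hq₁, hw', hpq.sgn_eq]; ring)
      · rcases hne with hne | hne
        · exact fin _ _ hq₁ hw' (h1 hne)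
        · exact fin _ _ hq₂ hw' (h2 hne)
  by_cases hA : ∃ a u, OutEdge G ty A a u
  · by_cases hB : ∃ b v, OutEdge G ty B b v
    · obtain ⟨a, u, hau⟩ := hA
      obtain ⟨b, v, hbv⟩ := hB
      -- If the two edges share their end in V₁ ∪ V₂, `IsSep` gives a W–U edge avoiding that end,
      -- and it replaces the one from its own class.
      by_cases huv : u = v
      · subst huv
        obtain ⟨w, u', f, hw, hu', -, -, n, -⟩ := hsep.exists_bip u u
        rcases hw with hw | hw
        · exact mixed w u' b u ⟨f, hw, hu'⟩ hbv n
        · exact mixed a u w u' hau ⟨f, hw, hu'⟩ n.symm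
      · exact mixed a u b v hau hbv huv
    · push Not at hB
      exact pure B A (.inr ⟨rfl, rfl⟩) hB
  · push Not at hA
    exact pure A B (.inl ⟨rfl, rfl⟩) hA

theorem IsSep.exists_left_of_star (hsep : IsSep G ty) {c d : VClass} (hcd : Opp c d) {x : V}
    (hx : ty x = c) (hstar : ∀ x' y', ty x' = c → ty y' = d → G.Adj x' y' → x' = x) (s : V) :
    ∃ w u, G.Adj w u ∧ IsW (ty w) ∧ ty u = c ∧ u ≠ x ∧ w ≠ s := by
  obtain ⟨u, w, huw, hu, hw, n1, n2, n3, n4⟩ := hsep.exists_class hcd x s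
  exact ⟨w, u, huw.symm, hw.resolve_left fun h => n1 (hstar u w hu h huw), hu, n1, n4⟩

/-- A W–`d` edge together with a cross edge at `x` that avoids its end `v`. If `x` has only one
neighbour in `d`, the edge leaving `d` must avoid that neighbour; otherwise it must avoid `x`. -/
theorem IsSep.exists_right_of_star (hsep : IsSep G ty) {c d : VClass} (hcd : Opp c d) {x y : V}
    (hx : ty x = c) (hy : ty y = d) (hxy : G.Adj x y)
    (hstar : ∀ x' y', ty x' = c → ty y' = d → G.Adj x' y' → x' = x) (s : V) :
    ∃ w v v', G.Adj w v ∧ IsW (ty w) ∧ ty v = d ∧ ty v' = d ∧ G.Adj x v' ∧ v' ≠ v ∧ w ≠ s := by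
  by_cases h : ∃ y', ty y' = d ∧ G.Adj x y' ∧ y' ≠ y
  · obtain ⟨y', hy', hxy', hne⟩ := h
    obtain ⟨v, w, hvw, hv, hw, n1, n2, n3, n4⟩ := hsep.exists_class hcd.symm x s
    have hw' := hw.resolve_left fun h => n3 (hstar w v h hv hvw.symm)
    by_cases hyv : y = v
    · exact ⟨w, v, y', hvw.symm, hw', hv, hy', hxy', by grind, n4⟩
    · exact ⟨w, v, y, hvw.symm, hw', hv, hy, hxy, hyv, n4⟩
  · push Not at h
    obtain ⟨v, w, hvw, hv, hw, n1, n2, n3, n4⟩ := hsep.exists_class hcd.symm y s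
    have hw' := hw.resolve_left fun hh => by
      have := hstar w v hh hv hvw.symm
      subst this
      exact n1 (h v hv hvw.symm)
    exact ⟨w, v, y, hvw.symm, hw', hv, hy, hxy, n1.symm, n4⟩

/-- Each suitable W–`c` edge forms a triangle with each suitable W–`d` edge. If two of them have
ends of opposite class in W, the balance is 0. Otherwise all these ends lie in one class, and the
opposite class `q` must correct: by an edge inside `q`, or, by `hout`, by two edges from `q` to V₁ ∪
V₂ that avoid the triangles only by ending in `x` and in its only neighbour `v` in `d`; these give
two mixed pairs and hence a square. -/
theorem IsSep.tourLE_zero_of_star (hsep : IsSep G ty) {c d : VClass} (hcd : Opp c d) {x y : V}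
    (hx : ty x = c) (hy : ty y = d) (hxy : G.Adj x y)
    (hstar : ∀ x' y', ty x' = c → ty y' = d → G.Adj x' y' → x' = x)
    (hout : ∀ p, IsW p → (∃ a a', InEdge G ty p a a') ∨ ∀ z, ¬ IsW (ty z) →
      (∃ w u, OutEdge G ty p w u ∧ u ≠ z) ∨
      ∃ x' y', ty x' = c ∧ ty y' = d ∧ G.Adj x' y' ∧ x' ≠ z ∧ y' ≠ z) :
    TourLE G ty 6 0 := by
  obtain ⟨hc, hd⟩ := hcd.not_isW
  by_cases hmix : ∃ w u w' v v', G.Adj w u ∧ IsW (ty w) ∧ ty u = c ∧ u ≠ x ∧ G.Adj w' v ∧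
      IsW (ty w') ∧ ty v = d ∧ ty v' = d ∧ G.Adj x v' ∧ v' ≠ v ∧ ty w ≠ ty w'
  · obtain ⟨w, u, w', v, v', f1, hw, hu, hux, f2, hw', hv, hv', f3, hvv, hne⟩ := hmix
    have := isConn_triangle hcd hw hw' hu hx hv hv' f1 f2 f3 (by grind) hux.symm hvv
    refine this.tourLE.of_le (by omega) ?_
    rcases hw with h | h <;> rcases hw' with h' | h' <;> simp [h, h', sgn] at hne ⊢
  push Not at hmix
  obtain ⟨w₁, u₁, f1, hw₁, hu₁, hux, -⟩ := hsep.exists_left_of_star hcd hx hstar x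
  obtain ⟨w₂, v₂, v', f2, hw₂, hv₂, hv', f3, hvv, hne⟩ :=
    hsep.exists_right_of_star hcd hx hy hxy hstar w₁
  have hty := hmix w₁ u₁ w₂ v₂ v' f1 hw₁ hu₁ hux f2 hw₂ hv₂ hv' f3 hvv
  obtain ⟨q, hpq⟩ : ∃ q, OppW (ty w₁) q := by
    rcases hw₁ with h | h <;> rw [h]
    exacts [⟨B, .inl ⟨rfl, rfl⟩⟩, ⟨A, .inr ⟨rfl, rfl⟩⟩]
  have hconn := isConn_triangle hcd hw₁ hw₂ hu₁ hx hv₂ hv' f1 f2 f3 hne.symm hux.symm hvv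
  by_cases hin : ∃ a a', InEdge G ty q a a'
  · obtain ⟨a, a', haa⟩ := hin
    exact (hconn.add_inEdge hpq.isW.2 (fun h => hpq.ne h.1) haa).of_le (by omega)
      (by rw [← hty, hpq.sgn_eq]; ring)
  have hout' := (hout q hpq.isW.2).resolve_left hin
  have hcl : ∀ {u : V}, ¬ IsW (ty u) → ty u = c ∨ ty u = d := fun {u} h =>
    (hcd.cases (ty u)).imp id (fun h' => h'.resolve_right h)
  have hx' : ¬ IsW (ty x) := by rwa [hx]
  obtain ⟨b', v, ⟨g1, hb', hv⟩, hvx⟩ := (hout' x hx').resolve_right (by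
    rintro ⟨x', y', h1, h2, h3, h4, -⟩
    exact h4 (hstar x' y' h1 h2 h3))
  have hbW : IsW (ty b') := by rw [hb']; exact hpq.isW.2
  -- An end of this edge in `c` different from `x` would make a mixed triangle.
  have hvd : ty v = d := (hcl hv).resolve_left fun hvc => by
    have := hmix b' v w₂ v₂ v' g1 hbW hvc hvx f2 hw₂ hv₂ hv' f3 hvv
    exact hpq.ne (hty.trans (this.symm.trans hb'))
  have honly : ∀ z, ty z = d → G.Adj x z → z = v := by
    intro z hz hxz
    by_contra hzv
    exact hpq.ne ((hmix w₁ u₁ b' v z f1 hw₁ hu₁ hux g1 hbW hvd hz hxz hzv).trans hb')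
  obtain ⟨b, u, ⟨g2, hb, hu⟩, huv⟩ := (hout' v hv).resolve_right (by
    rintro ⟨x', y', h1, h2, h3, h4, h5⟩
    have := hstar x' y' h1 h2 h3
    subst this
    exact h5 (honly y' h2 h3))
  have hbW' : IsW (ty b) := by rw [hb]; exact hpq.isW.2
  -- Any other end would again make a mixed triangle.
  have hux' : u = x := by
    rcases hcl hu with huc | hud
    · by_contra hux'
      have := hmix b u w₂ v₂ v' g2 hbW' huc hux' f2 hw₂ hv₂ hv' f3 hvv
      exact hpq.ne (hty.trans (this.symm.trans hb))
    · exfalso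
      have := hmix w₁ u₁ b u v f1 hw₁ hu₁ hux g2 hbW' hud hvd (honly y hy hxy ▸ hxy) huv.symm
      exact hpq.ne (this.trans hb)
  subst hux'
  have hv'v : v' = v := honly v' hv' f3
  subst hv'v
  have p1 : IsPair G ty c b w₁ := .mk hbW' hw₁ hx hu₁ g2 f1
    (by rintro rfl; exact hpq.ne hb) hux.symm
  have p2 : IsPair G ty d b' w₂ := .mk hbW hw₂ hvd hv₂ g1 f2
    (by rintro rfl; exact hpq.ne (hty.trans hb')) hvv
  refine (p1.hasTour hcd p2 (fun h => hne h.2.symm) ?_).tourLE (by omega) ?_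
  · rintro ⟨rfl, -⟩
    exact hpq.ne (hty.trans hb)
  · rw [hb, hb', ← hty, hpq.sgn_eq]
    ring

end SimpleGraph

/-! ### Quadruples: two edges from W to each of V₁ and V₂, without cross edges. -/

namespace SimpleGraph

open VClass

variable {V : Type*} {G : SimpleGraph V} {ty : V → VClass}

/-- Two disjoint edges from the bipartite part to each of `V₁` and `V₂`, where the two pairs of
ends in the bipartite part are different. -/
def IsQuad (G : SimpleGraph V) (ty : V → VClass) (w₁ w₂ w₃ w₄ : V) : Prop :=
  ∃ c d, Opp c d ∧ IsPair G ty c w₁ w₂ ∧ IsPair G ty d w₃ w₄ ∧ ¬ (w₁ = w₃ ∧ w₂ = w₄) ∧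
    ¬ (w₁ = w₄ ∧ w₂ = w₃)

theorem IsQuad.hasTour {w₁ w₂ w₃ w₄ : V} (h : IsQuad G ty w₁ w₂ w₃ w₄) :
    HasTour G ty 4 (sgn (ty w₁) + sgn (ty w₂) + sgn (ty w₃) + sgn (ty w₄))
      (fun v => ¬ IsW (ty v) ∨ v ∈ [w₁, w₂, w₃, w₄])
      (fun v => (v = w₁ ∨ v = w₂) ∧ (v = w₃ ∨ v = w₄)) := by
  obtain ⟨c, d, hcd, h1, h2, h3, h4⟩ := h
  exact h1.hasTour hcd h2 h3 h4

theorem IsQuad.swap_left {w₁ w₂ w₃ w₄ : V} (h : IsQuad G ty w₁ w₂ w₃ w₄) :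
    IsQuad G ty w₂ w₁ w₃ w₄ := by
  obtain ⟨c, d, hcd, h1, h2, h3, h4⟩ := h
  exact ⟨c, d, hcd, h1.symm, h2, by tauto, by tauto⟩

theorem IsQuad.swap {w₁ w₂ w₃ w₄ : V} (h : IsQuad G ty w₁ w₂ w₃ w₄) :
    IsQuad G ty w₃ w₄ w₁ w₂ := by
  obtain ⟨c, d, hcd, h1, h2, h3, h4⟩ := h
  exact ⟨d, c, hcd.symm, h2, h1, by grind, by grind⟩

/-- There are no edges between `V₁` and `V₂`. -/
def NoCross (G : SimpleGraph V) (ty : V → VClass) : Prop :=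
  ∀ x y, ty x = V₁ → ty y = V₂ → ¬ G.Adj x y

theorem IsSep.exists_outEdge (hsep : IsSep G ty) (hno : NoCross G ty) {c d : VClass}
    (hcd : Opp c d) (s t : V) :
    ∃ w u, G.Adj w u ∧ IsW (ty w) ∧ ty u = c ∧ w ≠ s ∧ w ≠ t ∧ u ≠ s ∧ u ≠ t := by
  obtain ⟨u, w, huw, hu, hw, n1, n2, n3, n4⟩ := hsep.exists_class hcd s t
  refine ⟨w, u, huw.symm, hw.resolve_left fun h => ?_, hu, n3, n4, n1, n2⟩
  rcases hcd with ⟨rfl, rfl⟩ | ⟨rfl, rfl⟩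
  · exact hno u w hu h huw
  · exact hno w u h hu huw.symm

/-- A pair in one class extends to a quadruple. -/
theorem IsSep.exists_quad (hsep : IsSep G ty) (hno : NoCross G ty) {c d : VClass}
    (hcd : Opp c d) {w₁ w₂ : V} (h : IsPair G ty c w₁ w₂) : ∃ w₃ w₄, IsQuad G ty w₁ w₂ w₃ w₄ := by
  obtain ⟨w₃, v₃, e₃, hw₃, hv₃, n1, n2, -, -⟩ := hsep.exists_outEdge hno hcd.symm w₁ w₂
  obtain ⟨w₄, v₄, e₄, hw₄, hv₄, m1, m2, m3, m4⟩ := hsep.exists_outEdge hno hcd.symm w₃ v₃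
  exact ⟨w₃, w₄, c, d, hcd, h, .mk hw₃ hw₄ hv₃ hv₄ e₃ e₄ m1.symm m4.symm,
    fun hh => n1 hh.1.symm, fun hh => n2 hh.2.symm⟩

/-- An edge extends to a quadruple. -/
theorem IsSep.exists_quad_of_edge (hsep : IsSep G ty) (hno : NoCross G ty) {c d : VClass}
    (hcd : Opp c d) {w u : V} (h : G.Adj w u) (hw : IsW (ty w)) (hu : ty u = c) :
    ∃ w₂ w₃ w₄, IsQuad G ty w w₂ w₃ w₄ := by
  obtain ⟨w₂, u₂, e₂, hw₂, hu₂, n1, n2, n3, n4⟩ := hsep.exists_outEdge hno hcd w u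
  have hp : IsPair G ty c w w₂ := .mk hw hw₂ hu hu₂ h e₂ n1.symm n4.symm
  exact ⟨w₂, hsep.exists_quad hno hcd hp⟩

theorem VClass.Opp.class_cases {c : VClass} (h : ¬ IsW c) : ∃ d, Opp c d := by
  cases c
  · exact ⟨V₂, .inl ⟨rfl, rfl⟩⟩
  · exact ⟨V₁, .inr ⟨rfl, rfl⟩⟩
  · simp [IsW] at h
  · simp [IsW] at h

/-- Two disjoint edges from the class `q` to `V₁ ∪ V₂` extend to a quadruple. -/
theorem IsSep.exists_quad_of_matching (hsep : IsSep G ty) (hno : NoCross G ty) {q : VClass}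
    (hq : IsW q) {b₁ b₂ u₁ u₂ : V} (h1 : OutEdge G ty q b₁ u₁) (h2 : OutEdge G ty q b₂ u₂)
    (hb : b₁ ≠ b₂) (hu : u₁ ≠ u₂) :
    ∃ w₁ w₂ w₃ w₄, IsQuad G ty w₁ w₂ w₃ w₄ ∧ ty w₁ = q ∧ (ty w₂ = q ∨ ty w₃ = q) := by
  obtain ⟨f1, hb₁, hu₁⟩ := h1
  obtain ⟨f2, hb₂, hu₂⟩ := h2
  obtain ⟨d, hcd⟩ := VClass.Opp.class_cases hu₁
  rcases hcd.cases (ty u₂) with h | h | h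
  · obtain ⟨w₃, w₄, hQ⟩ := hsep.exists_quad hno hcd
      (IsPair.mk (by rwa [hb₁]) (by rwa [hb₂]) rfl h f1 f2 hb hu)
    exact ⟨b₁, b₂, w₃, w₄, hQ, hb₁, .inl hb₂⟩
  · obtain ⟨w, u, f, hw, hu', n1, n2, n3, n4⟩ := hsep.exists_outEdge hno hcd b₁ u₁
    have hp : IsPair G ty (ty u₁) b₁ w := .mk (by rwa [hb₁]) hw rfl hu' f1 f n1.symm n4.symm
    by_cases hwb : w = b₂
    · subst hwb
      obtain ⟨w₃, w₄, hQ⟩ := hsep.exists_quad hno hcd hp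
      exact ⟨b₁, w, w₃, w₄, hQ, hb₁, .inl hb₂⟩
    · obtain ⟨w', v, f', hw', hv, m1, m2, m3, m4⟩ := hsep.exists_outEdge hno hcd.symm b₂ u₂
      exact ⟨b₁, w, b₂, w', ⟨_, d, hcd, hp, .mk (by rwa [hb₂]) hw' h hv f2 f' m1.symm m4.symm,
        fun hh => hb hh.1, fun hh => hwb hh.2⟩, hb₁, .inr hb₂⟩
  · contradiction

theorem IsQuad.tourLE_add_one {p q : VClass} {w₁ w₂ w₃ w₄ : V} (hpq : OppW p q) (h : IsQuad G ty w₁ w₂ w₃ w₄) {s t a a' : V}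
    (hS : ∀ v, ty v = p → v ∈ [w₁, w₂, w₃, w₄] → v = s ∨ v = t)
    (hI : ∀ v, ty v = p → ¬ ((v = w₁ ∨ v = w₂) ∧ (v = w₃ ∨ v = w₄)))
    (ha : InEdge G ty p a a') (h1 : ¬ (a = s ∧ a' = t)) (h2 : ¬ (a = t ∧ a' = s)) :
    TourLE G ty 5 (sgn (ty w₁) + sgn (ty w₂) + sgn (ty w₃) + sgn (ty w₄) + 2 * sgn p) := by
  refine (h.hasTour.add_inEdge hpq.isW.1 (s := s) (t := t) ?_ hI ha h1 h2).tourLE (by omega) rfl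
  rintro v hv (hh | hh)
  · exact absurd (hv ▸ hpq.isW.1) hh
  · exact hS v hv hh

theorem IsQuad.tourLE_add_two {p q : VClass} {w₁ w₂ w₃ w₄ : V} (hpq : OppW p q) (h : IsQuad G ty w₁ w₂ w₃ w₄) {s a a' b b' : V}
    (hS : ∀ v, ty v = p → v ∈ [w₁, w₂, w₃, w₄] → v = s)
    (hI : ∀ v, ty v = p → ¬ ((v = w₁ ∨ v = w₂) ∧ (v = w₃ ∨ v = w₄)))
    (ha : InEdge G ty p a a') (hb : InEdge G ty p b b') (h1 : a ≠ s) (h2 : a' ≠ s)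
    (h3 : ¬ (a = b ∧ a' = b')) (h4 : ¬ (a = b' ∧ a' = b)) :
    TourLE G ty 6 (sgn (ty w₁) + sgn (ty w₂) + sgn (ty w₃) + sgn (ty w₄) + 4 * sgn p) := by
  refine (h.hasTour.add_two_inEdges hpq.isW.1 (s := s) ?_ hI ha hb h1 h2 h3 h4).tourLE
    (by omega) rfl
  rintro v hv (hh | hh)
  · exact absurd (hv ▸ hpq.isW.1) hh
  · exact hS v hv hh

theorem IsQuad.isW {w₁ w₂ w₃ w₄ : V} (h : IsQuad G ty w₁ w₂ w₃ w₄) :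
    IsW (ty w₁) ∧ IsW (ty w₂) ∧ IsW (ty w₃) ∧ IsW (ty w₄) := by
  obtain ⟨c, d, -, h1, h2, -⟩ := h
  exact ⟨h1.1, h1.2.1, h2.1, h2.2.1⟩

/-- One vertex in `p` and three in `q`, or a balanced quadruple. -/
theorem IsQuad.tourLE_zero_of_first {p q : VClass} {w₁ w₂ w₃ w₄ : V} (hpq : OppW p q) (h : IsQuad G ty w₁ w₂ w₃ w₄) {a a' : V}
    (ha : InEdge G ty p a a') (hw₁ : ty w₁ = p) (h2 : ty w₂ = q)
    (h34 : ty w₃ = q ∨ ty w₄ = q) : TourLE G ty 6 0 := by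
  have hne := hpq.ne
  obtain ⟨-, -, i3, i4⟩ := h.isW
  rw [hpq.isW_iff] at i3 i4
  by_cases hb : ty w₃ = q ∧ ty w₄ = q
  · refine (h.tourLE_add_one hpq (s := w₁) (t := w₁) ?_ ?_ ha ?_ ?_).of_le (by omega) ?_
    · intro v hv hm
      simp only [List.mem_cons, List.not_mem_nil, or_false] at hm
      grind
    · grind
    · exact fun h => ha.1.ne (h.1.trans h.2.symm)
    · exact fun h => ha.1.ne (h.1.trans h.2.symm)
    · rw [hw₁, h2, hb.1, hb.2, hpq.sgn_eq]
      ring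
  · refine h.hasTour.tourLE (by omega) ?_
    rw [hw₁, h2]
    rcases i3 with i3 | i3 <;> rcases i4 with i4 | i4 <;> rw [i3, i4, hpq.sgn_eq] <;> grind

/-- A quadruple with two vertices in `q`, when there is an edge inside `p`. -/
theorem IsSep.tourLE_zero_of_inEdge (hsep : IsSep G ty) (hno : NoCross G ty) {p q : VClass}
    (hpq : OppW p q) {a a' : V} (ha : InEdge G ty p a a')
    (hout : (∀ w u, ¬ OutEdge G ty p w u) → ∃ a₁ a₂ a₃ a₄, InEdge G ty p a₁ a₂ ∧
      InEdge G ty p a₃ a₄ ∧ ¬ (a₁ = a₃ ∧ a₂ = a₄) ∧ ¬ (a₁ = a₄ ∧ a₂ = a₃))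
    {w₁ w₂ w₃ w₄ : V} (h : IsQuad G ty w₁ w₂ w₃ w₄) (h1 : ty w₁ = q)
    (h2 : ty w₂ = q ∨ ty w₃ = q) : TourLE G ty 6 0 := by
  have hne := hpq.ne
  obtain ⟨-, i2, i3, i4⟩ := h.isW
  rw [hpq.isW_iff] at i2 i3 i4
  rcases i2 with i2 | i2
  · -- now the third is in `q`
    have i3 : ty w₃ = q := h2.resolve_left fun hh => hne (i2.symm.trans hh)
    exact h.swap_left.tourLE_zero_of_first hpq ha i2 h1 (.inl i3)
  by_cases h34 : ty w₃ = q ∧ ty w₄ = q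
  -- All four vertices lie in `q`. An edge leaving `p` allows one of the two pairs to be replaced by
  -- a pair with a vertex in `p`; without such an edge, two edges inside `p` compensate.
  · by_cases hex : ∃ w u, OutEdge G ty p w u
    · obtain ⟨w, u, f, hw, hu⟩ := hex
      obtain ⟨c, d, hcd, p1, p2, -, -⟩ := h
      have key : ∀ {c d : VClass}, Opp c d → ty u = c → ∀ {b₁ b₂ : V}, IsPair G ty d b₁ b₂ →
          ty b₁ = q → ty b₂ = q → TourLE G ty 6 0 := by
        intro c d hcd huc b₁ b₂ hb hb₁ hb₂
        obtain ⟨w', u', f', hw', hu', n1, n2, n3, n4⟩ := hsep.exists_outEdge hno hcd w u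
        have hp : IsPair G ty c w w' :=
          .mk (by rw [hw]; exact hpq.isW.1) hw' huc hu' f f' n1.symm n4.symm
        have hQ : IsQuad G ty w w' b₁ b₂ := ⟨c, d, hcd, hp, hb, by grind, by grind⟩
        rcases hpq.isW_iff.1 hw' with hw'' | hw''
        · exact hQ.hasTour.tourLE (by omega) (by rw [hw, hw'', hb₁, hb₂, hpq.sgn_eq]; ring)
        · exact hQ.tourLE_zero_of_first hpq ha hw hw'' (.inl hb₁)
      rcases hcd.cases (ty u) with huc | huc | huc
      · exact key hcd huc p2 h34.1 h34.2
      · exact key hcd.symm huc p1 h1 i2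
      · contradiction
    · push Not at hex
      obtain ⟨a₁, a₂, a₃, a₄, g1, g2, g3, g4⟩ := hout hex
      refine (h.tourLE_add_two hpq (s := w₁) ?_ ?_ g1 g2 ?_ ?_ g3 g4).of_le (by omega) ?_
      · intro v hv hm
        simp only [List.mem_cons, List.not_mem_nil, or_false] at hm
        grind
      · grind
      · rintro rfl; exact hne (g1.2.1.symm.trans h1)
      · rintro rfl; exact hne (g1.2.2.symm.trans h1)
      · rw [h1, i2, h34.1, h34.2, hpq.sgn_eq]
        ring
  · rcases i3 with i3 | i3
    · rcases i4 with i4 | i4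
      · exact h.hasTour.tourLE (by omega) (by rw [h1, i2, i3, i4, hpq.sgn_eq]; ring)
      · exact h.swap.tourLE_zero_of_first hpq ha i3 i4 (.inl h1)
    · have i4 : ty w₄ = p := i4.resolve_right fun hh => h34 ⟨i3, hh⟩
      have hQ : IsQuad G ty w₄ w₃ w₁ w₂ := by
        have := h.swap.swap_left
        exact this
      exact hQ.tourLE_zero_of_first hpq ha i4 i3 (.inl h1)

end SimpleGraph

/-! ### The case |A| = |B| without cross edges, and its conclusion. -/

namespace SimpleGraph

open VClass

variable {V : Type*} {G : SimpleGraph V} {ty : V → VClass}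

/-- Two of the first three vertices lie in the same class `q`; the symmetries of a quadruple bring
one of them to the first position. -/
theorem IsQuad.exists_majority {w₁ w₂ w₃ w₄ : V} (h : IsQuad G ty w₁ w₂ w₃ w₄) :
    ∃ p q, OppW p q ∧ ∃ w₁ w₂ w₃ w₄, IsQuad G ty w₁ w₂ w₃ w₄ ∧ ty w₁ = q ∧
      (ty w₂ = q ∨ ty w₃ = q) := by
  obtain ⟨i1, i2, i3, i4⟩ := h.isW
  by_cases h12 : ty w₁ = ty w₂
  · obtain ⟨p, hp⟩ : ∃ p, OppW p (ty w₁) := by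
      rcases i1 with h | h <;> rw [h]
      exacts [⟨B, .inr ⟨rfl, rfl⟩⟩, ⟨A, .inl ⟨rfl, rfl⟩⟩]
    exact ⟨p, _, hp, w₁, w₂, w₃, w₄, h, rfl, .inl h12.symm⟩
  · have h3 : ty w₁ = ty w₃ ∨ ty w₂ = ty w₃ := by
      rcases i1 with i1 | i1 <;> rcases i2 with i2 | i2 <;> rcases i3 with i3 | i3 <;> simp_all
    obtain ⟨p, hp⟩ : ∃ p, OppW p (ty w₃) := by
      rcases i3 with h | h <;> rw [h]
      exacts [⟨B, .inr ⟨rfl, rfl⟩⟩, ⟨A, .inl ⟨rfl, rfl⟩⟩]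
    rcases h3 with h3 | h3
    · exact ⟨p, _, hp, w₁, w₂, w₃, w₄, h, h3, .inr rfl⟩
    · exact ⟨p, _, hp, w₂, w₁, w₃, w₄, h.swap_left, h3, .inr rfl⟩

theorem IsPair.tourLE_zero {c d : VClass} (hcd : Opp c d) {w₁ w₂ w₃ w₄ : V}
    (h : IsPair G ty c w₁ w₂) (h' : IsPair G ty d w₃ w₄)
    (h1 : ¬ (w₁ = w₃ ∧ w₂ = w₄)) (h2 : ¬ (w₁ = w₄ ∧ w₂ = w₃))
    (hs : sgn (ty w₁) + sgn (ty w₂) + sgn (ty w₃) + sgn (ty w₄) = 0) : TourLE G ty 6 0 :=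
  (h.hasTour hcd h' h1 h2).tourLE (by omega) hs

/-- No edge inside W is used here. The two `p`-edges form a pair in `c`, which is matched with a
pair of `q`-vertices in `d`; where no such pair is available, `IsSep` provides edges to `d`, and
either the `q`-edges form a pair in `c` against two `p`-vertices, or both classes receive a mixed
pair. -/
theorem IsSep.tourLE_zero_of_same (hsep : IsSep G ty) (hno : NoCross G ty) {p q c d : VClass}
    (hpq : OppW p q) (hcd : Opp c d) {a₁ a₂ b₁ b₂ u₁ u₂ v₁ v₂ : V}
    (hu₁ : ty u₁ = c) (hu₂ : ty u₂ = c) (ha₁ : ty a₁ = p) (ha₂ : ty a₂ = p)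
    (e₁ : G.Adj a₁ u₁) (e₂ : G.Adj a₂ u₂) (ha : a₁ ≠ a₂) (hu : u₁ ≠ u₂)
    (hb₁ : ty b₁ = q) (hb₂ : ty b₂ = q) (f₁ : G.Adj b₁ v₁) (f₂ : G.Adj b₂ v₂) (hb : b₁ ≠ b₂)
    (hv : v₁ ≠ v₂) (hv₁ : ¬ IsW (ty v₁)) (hv₂ : ¬ IsW (ty v₂)) : TourLE G ty 6 0 := by
  have hne := hpq.ne
  have hs := hpq.sgn_eq
  have wp : ∀ {x}, ty x = p → IsW (ty x) := fun h => h ▸ hpq.isW.1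
  have wq : ∀ {x}, ty x = q → IsW (ty x) := fun h => h ▸ hpq.isW.2
  have hA : IsPair G ty c a₁ a₂ := .mk (wp ha₁) (wp ha₂) hu₁ hu₂ e₁ e₂ ha hu
  -- one `q`-edge on each side
  have split : ∀ {b₁ b₂ v₁ v₂ : V}, ty b₁ = q → ty b₂ = q → G.Adj b₁ v₁ → G.Adj b₂ v₂ → b₁ ≠ b₂ →
      ty v₁ = c → ty v₂ = d → TourLE G ty 6 0 := by
    intro b₁ b₂ v₁ v₂ hb₁ hb₂ f₁ f₂ hb hv₁ hv₂
    obtain ⟨w, v, f, hw, hv, n1, n2, n3, n4⟩ := hsep.exists_outEdge hno hcd.symm b₂ v₂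
    have hP : IsPair G ty d b₂ w := .mk (wq hb₂) hw hv₂ hv f₂ f n1.symm n4.symm
    rcases hpq.isW_iff.1 hw with hw' | hw'
    · have key : ∀ {a u : V}, ty a = p → ty u = c → G.Adj a u → u ≠ v₁ → TourLE G ty 6 0 := by
        intro a u ha hu e huv
        have hP' : IsPair G ty c b₁ a := .mk (wq hb₁) (wp ha) hv₁ hu f₁ e (by grind) huv.symm
        exact hP'.tourLE_zero hcd hP (by grind) (by grind) (by rw [hb₁, ha, hb₂, hw', hs]; ring)
      by_cases h : u₁ = v₁
      · exact key ha₂ hu₂ e₂ (by grind)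
      · exact key ha₁ hu₁ e₁ h
    · exact hA.tourLE_zero hcd hP (by grind) (by grind) (by rw [ha₁, ha₂, hb₂, hw', hs]; ring)
  rcases hcd.cases (ty v₁) with h₁ | h₁ | h₁ <;> rcases hcd.cases (ty v₂) with h₂ | h₂ | h₂ <;>
    try contradiction
  · have hB : IsPair G ty c b₁ b₂ := .mk (wq hb₁) (wq hb₂) h₁ h₂ f₁ f₂ hb hv
    have mixed : ∀ {w₃ w₄ : V}, IsPair G ty d w₃ w₄ → ty w₃ = p → ty w₄ = q → TourLE G ty 6 0 := by
      intro w₃ w₄ hP h3 h4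
      have key : ∀ {a u : V}, ty a = p → ty u = c → G.Adj a u → a ≠ w₃ → TourLE G ty 6 0 := by
        intro a u ha hu e haw
        have key' : ∀ {b v : V}, ty b = q → ty v = c → G.Adj b v → u ≠ v → TourLE G ty 6 0 := by
          intro b v hb hv f huv
          have hP' : IsPair G ty c a b := .mk (wp ha) (wq hb) hu hv e f (by grind) huv
          exact hP'.tourLE_zero hcd hP (by grind) (by grind) (by rw [ha, hb, h3, h4, hs]; ring)
        by_cases h : u = v₁
        · exact key' hb₂ h₂ f₂ (by grind)
        · exact key' hb₁ h₁ f₁ h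
      by_cases h : a₁ = w₃
      · exact key ha₂ hu₂ e₂ (by grind)
      · exact key ha₁ hu₁ e₁ h
    obtain ⟨w₃, v₃, f3, hw₃, hv₃, -⟩ := hsep.exists_outEdge hno hcd.symm a₁ a₁
    obtain ⟨w₄, v₄, f4, hw₄, hv₄, n1, n2, n3, n4⟩ := hsep.exists_outEdge hno hcd.symm w₃ v₃
    have hP : IsPair G ty d w₃ w₄ := .mk hw₃ hw₄ hv₃ hv₄ f3 f4 n1.symm n4.symm
    rcases hpq.isW_iff.1 hw₃ with h3 | h3 <;> rcases hpq.isW_iff.1 hw₄ with h4 | h4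
    · exact hB.tourLE_zero hcd hP (by grind) (by grind) (by rw [hb₁, hb₂, h3, h4, hs]; ring)
    · exact mixed hP h3 h4
    · exact mixed hP.symm h4 h3
    · exact hA.tourLE_zero hcd hP (by grind) (by grind) (by rw [ha₁, ha₂, h3, h4, hs]; ring)
  · exact split hb₁ hb₂ f₁ f₂ hb h₁ h₂
  · exact split hb₂ hb₁ f₂ f₁ hb.symm h₂ h₁
  · have hB : IsPair G ty d b₁ b₂ := .mk (wq hb₁) (wq hb₂) h₁ h₂ f₁ f₂ hb hv
    exact hA.tourLE_zero hcd hB (by grind) (by grind) (by rw [ha₁, ha₂, hb₁, hb₂, hs]; ring)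

/-- Each of V₁ and V₂ receives a pair with one vertex in `p` and one in `q`. -/
theorem IsSep.tourLE_zero_of_split (hsep : IsSep G ty) (hno : NoCross G ty) {p q c d : VClass}
    (hpq : OppW p q) (hcd : Opp c d) {a₁ a₂ b₁ b₂ u₁ u₂ v₁ v₂ : V}
    (hu₁ : ty u₁ = c) (hu₂ : ty u₂ = d) (ha₁ : ty a₁ = p) (ha₂ : ty a₂ = p)
    (e₁ : G.Adj a₁ u₁) (e₂ : G.Adj a₂ u₂) (ha : a₁ ≠ a₂)
    (hb₁ : ty b₁ = q) (hb₂ : ty b₂ = q) (f₁ : G.Adj b₁ v₁) (f₂ : G.Adj b₂ v₂) (hb : b₁ ≠ b₂)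
    (hv₁ : ty v₁ = c) (hv₂ : ty v₂ = d) : TourLE G ty 6 0 := by
  have hne := hpq.ne
  have hs := hpq.sgn_eq
  have wp : ∀ {x}, ty x = p → IsW (ty x) := fun h => h ▸ hpq.isW.1
  have wq : ∀ {x}, ty x = q → IsW (ty x) := fun h => h ▸ hpq.isW.2
  -- The last clause ensures that this pair and the pair chosen next for `d` do not have the same
  -- two ends in W.
  obtain ⟨α, β, hP, hα, hβ, h1⟩ : ∃ α β, IsPair G ty c α β ∧ ty α = p ∧ ty β = q ∧
      (α = a₁ ∨ β = b₁ ∧ α ≠ a₂) := by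
    obtain ⟨w, u, e, hw, hu, n1, n2, n3, n4⟩ := hsep.exists_outEdge hno hcd u₁ a₂
    by_cases h : u₁ = v₁
    · rcases hpq.isW_iff.1 hw with hw' | hw'
      · exact ⟨w, b₁, .mk hw (wq hb₁) hu hv₁ e f₁ (by grind) (by grind), hw', hb₁, .inr ⟨rfl, n2⟩⟩
      · exact ⟨a₁, w, .mk (wp ha₁) hw hu₁ hu e₁ e (by grind) (by grind), ha₁, hw', .inl rfl⟩
    · exact ⟨a₁, b₁, .mk (wp ha₁) (wq hb₁) hu₁ hv₁ e₁ f₁ (by grind) h, ha₁, hb₁, .inl rfl⟩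
  obtain ⟨α', β', hP', hα', hβ', h2⟩ : ∃ α β, IsPair G ty d α β ∧ ty α = p ∧ ty β = q ∧
      (α = a₂ ∨ β = b₂ ∧ α ≠ a₁) := by
    obtain ⟨w, u, e, hw, hu, n1, n2, n3, n4⟩ := hsep.exists_outEdge hno hcd.symm u₂ a₁
    by_cases h : u₂ = v₂
    · rcases hpq.isW_iff.1 hw with hw' | hw'
      · exact ⟨w, b₂, .mk hw (wq hb₂) hu hv₂ e f₂ (by grind) (by grind), hw', hb₂, .inr ⟨rfl, n2⟩⟩
      · exact ⟨a₂, w, .mk (wp ha₂) hw hu₂ hu e₂ e (by grind) (by grind), ha₂, hw', .inl rfl⟩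
    · exact ⟨a₂, b₂, .mk (wp ha₂) (wq hb₂) hu₂ hv₂ e₂ f₂ (by grind) h, ha₂, hb₂, .inl rfl⟩
  exact hP.tourLE_zero hcd hP' (by grind) (by grind) (by rw [hα, hβ, hα', hβ', hs]; ring)

/-- If both A and B contain edges, any quadruple has two vertices in some class `q`, and edges
inside the other class correct it. A class without inner edges sends out two disjoint edges by
`hin`, so it can play the role of `q`. If neither class has inner edges, both send out two disjoint
edges. -/
theorem IsSep.tourLE_zero_of_noCross (hsep : IsSep G ty) (hno : NoCross G ty)
    (hin : ∀ p, IsW p → (∀ a a', ¬ InEdge G ty p a a') →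
      ∃ a₁ a₂ u₁ u₂, OutEdge G ty p a₁ u₁ ∧ OutEdge G ty p a₂ u₂ ∧ a₁ ≠ a₂ ∧ u₁ ≠ u₂)
    (hout : ∀ p, IsW p → (∀ w u, ¬ OutEdge G ty p w u) → ∃ a₁ a₂ a₃ a₄, InEdge G ty p a₁ a₂ ∧
      InEdge G ty p a₃ a₄ ∧ ¬ (a₁ = a₃ ∧ a₂ = a₄) ∧ ¬ (a₁ = a₄ ∧ a₂ = a₃)) :
    TourLE G ty 6 0 := by
  by_cases hall : ∀ p, IsW p → ∃ a a', InEdge G ty p a a'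
  · obtain ⟨w, u, e, hw, hu, -⟩ := hsep.exists_bip (hall A (.inl rfl)).choose
      (hall A (.inl rfl)).choose
    obtain ⟨d, hcd⟩ := VClass.Opp.class_cases hu
    obtain ⟨w₂, w₃, w₄, hQ⟩ := hsep.exists_quad_of_edge hno hcd e hw rfl
    obtain ⟨p, q, hpq, w₁, w₂, w₃, w₄, hQ, h1, h2⟩ := hQ.exists_majority
    obtain ⟨a, a', ha⟩ := hall p hpq.isW.1
    exact hsep.tourLE_zero_of_inEdge hno hpq ha (hout p hpq.isW.1) hQ h1 h2
  push Not at hall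
  obtain ⟨q, hq, hqin⟩ := hall
  obtain ⟨p, hpq⟩ : ∃ p, OppW p q := by
    rcases hq with rfl | rfl
    exacts [⟨B, .inr ⟨rfl, rfl⟩⟩, ⟨A, .inl ⟨rfl, rfl⟩⟩]
  obtain ⟨b₁, b₂, v₁, v₂, f₁, f₂, hb, hv⟩ := hin q hq hqin
  by_cases hp : ∃ a a', InEdge G ty p a a'
  · obtain ⟨a, a', ha⟩ := hp
    obtain ⟨w₁, w₂, w₃, w₄, hQ, h1, h2⟩ := hsep.exists_quad_of_matching hno hq f₁ f₂ hb hv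
    exact hsep.tourLE_zero_of_inEdge hno hpq ha (hout p hpq.isW.1) hQ h1 h2
  push Not at hp
  obtain ⟨a₁, a₂, u₁, u₂, e₁, e₂, ha, hu⟩ := hin p hpq.isW.1 hp
  obtain ⟨d, hcd⟩ := VClass.Opp.class_cases e₁.2.2
  rcases hcd.cases (ty u₂) with h | h | h
  · exact hsep.tourLE_zero_of_same hno hpq hcd rfl h e₁.2.1 e₂.2.1 e₁.1 e₂.1 ha hu f₁.2.1 f₂.2.1
      f₁.1 f₂.1 hb hv f₁.2.2 f₂.2.2
  · have h₁ := hcd.cases (ty v₁)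
    have h₂ := hcd.cases (ty v₂)
    rcases h₁ with h₁ | h₁ | h₁ <;> rcases h₂ with h₂ | h₂ | h₂
    · exact hsep.tourLE_zero_of_same hno hpq.symm hcd h₁ h₂ f₁.2.1 f₂.2.1 f₁.1 f₂.1 hb hv e₁.2.1
        e₂.2.1 e₁.1 e₂.1 ha hu e₁.2.2 e₂.2.2
    · exact hsep.tourLE_zero_of_split hno hpq hcd rfl h e₁.2.1 e₂.2.1 e₁.1 e₂.1 ha f₁.2.1 f₂.2.1
        f₁.1 f₂.1 hb h₁ h₂
    · exact absurd h₂ f₂.2.2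
    · exact hsep.tourLE_zero_of_split hno hpq hcd rfl h e₁.2.1 e₂.2.1 e₁.1 e₂.1 ha f₂.2.1 f₁.2.1
        f₂.1 f₁.1 hb.symm h₂ h₁
    · exact hsep.tourLE_zero_of_same hno hpq.symm hcd.symm h₁ h₂ f₁.2.1 f₂.2.1 f₁.1 f₂.1 hb hv
        e₁.2.1 e₂.2.1 e₁.1 e₂.1 ha hu e₁.2.2 e₂.2.2
    all_goals first | exact absurd h₂ f₂.2.2 | exact absurd h₁ f₁.2.2
  · exact absurd h e₂.2.2

/-- The case where the two classes of the bipartite part have the same size. -/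
theorem IsSep.tourLE_zero (hsep : IsSep G ty)
    (hin : NoCross G ty → ∀ p, IsW p → (∀ a a', ¬ InEdge G ty p a a') →
      ∃ a₁ a₂ u₁ u₂, OutEdge G ty p a₁ u₁ ∧ OutEdge G ty p a₂ u₂ ∧ a₁ ≠ a₂ ∧ u₁ ≠ u₂)
    (hout : NoCross G ty → ∀ p, IsW p → (∀ w u, ¬ OutEdge G ty p w u) →
      ∃ a₁ a₂ a₃ a₄, InEdge G ty p a₁ a₂ ∧
      InEdge G ty p a₃ a₄ ∧ ¬ (a₁ = a₃ ∧ a₂ = a₄) ∧ ¬ (a₁ = a₄ ∧ a₂ = a₃))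
    (hout' : ∀ p, IsW p → (∀ w u, ¬ OutEdge G ty p w u) → ∃ a a', InEdge G ty p a a')
    (hstar : ∀ p, IsW p → (∃ a a', InEdge G ty p a a') ∨ ∀ z, ¬ IsW (ty z) →
      (∃ w u, OutEdge G ty p w u ∧ u ≠ z) ∨
      ∃ x' y', ty x' = V₁ ∧ ty y' = V₂ ∧ G.Adj x' y' ∧ x' ≠ z ∧ y' ≠ z) :
    TourLE G ty 6 0 := by
  have hcd : Opp V₁ V₂ := .inl ⟨rfl, rfl⟩
  by_cases hno : NoCross G ty
  · exact hsep.tourLE_zero_of_noCross hno (hin hno) (hout hno)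
  simp only [NoCross, not_forall, not_not] at hno
  obtain ⟨x, y, hx, hy, hxy⟩ := hno
  by_cases hx' : ∀ x' y', ty x' = V₁ → ty y' = V₂ → G.Adj x' y' → x' = x
  · exact hsep.tourLE_zero_of_star hcd hx hy hxy hx' hstar
  by_cases hy' : ∀ y' x', ty y' = V₂ → ty x' = V₁ → G.Adj y' x' → y' = y
  · refine hsep.tourLE_zero_of_star hcd.symm hy hx hxy.symm hy' fun p hp => (hstar p hp).imp id ?_
    intro h z hz
    refine (h z hz).imp id ?_
    rintro ⟨x', y', h1, h2, h3, h4, h5⟩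
    exact ⟨y', x', h2, h1, h3.symm, h5, h4⟩
  push Not at hx' hy'
  obtain ⟨x₁, y₁, hx₁, hy₁, e₁, n₁⟩ := hx'
  obtain ⟨y₂, x₂, hy₂, hx₂, e₂, n₂⟩ := hy'
  -- The cross edges form a star neither at `x` nor at `y`, so two of the three edges `xy`, `x₁y₁`,
  -- `x₂y₂` are disjoint.
  by_cases hyy : y₁ = y
  · by_cases hxx : x₂ = x
    · exact hsep.tourLE_zero_of_matching hcd hx₁ hx₂ hy₁ hy₂ e₁ e₂.symm (by grind) (by grind) hout'
    · exact hsep.tourLE_zero_of_matching hcd hx hx₂ hy hy₂ hxy e₂.symm (by grind) (by grind) hout'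
  · exact hsep.tourLE_zero_of_matching hcd hx hx₁ hy hy₁ hxy e₁ (by grind) (by grind) hout'

end SimpleGraph

/-! ### The case |A| = |B| + 1 with two disjoint cross edges. -/

namespace SimpleGraph

open VClass

variable {V : Type*} {G : SimpleGraph V} {ty : V → VClass}

/-- There are at least two edges inside the class `p`. -/
def TwoIn (G : SimpleGraph V) (ty : V → VClass) (p : VClass) : Prop :=
  ∃ a a' b b', InEdge G ty p a a' ∧ InEdge G ty p b b' ∧ ¬ (a = b ∧ a' = b') ∧
    ¬ (a = b' ∧ a' = b)

/-- Three disjoint edges from the class `p` to `V₁ ∪ V₂`. -/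
def OutTriple (G : SimpleGraph V) (ty : V → VClass) (p : VClass) (a₁ u₁ a₂ u₂ a₃ u₃ : V) : Prop :=
  OutEdge G ty p a₁ u₁ ∧ OutEdge G ty p a₂ u₂ ∧ OutEdge G ty p a₃ u₃ ∧
    a₁ ≠ a₂ ∧ a₁ ≠ a₃ ∧ a₂ ≠ a₃ ∧ u₁ ≠ u₂ ∧ u₁ ≠ u₃ ∧ u₂ ≠ u₃

theorem OutTriple.swap {p : VClass} {a₁ u₁ a₂ u₂ a₃ u₃ : V}
    (h : OutTriple G ty p a₁ u₁ a₂ u₂ a₃ u₃) : OutTriple G ty p a₂ u₂ a₁ u₁ a₃ u₃ := by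
  obtain ⟨h1, h2, h3, h4, h5, h6, h7, h8, h9⟩ := h
  exact ⟨h2, h1, h3, h4.symm, h6, h5, h7.symm, h9, h8⟩

theorem OutTriple.rotate {p : VClass} {a₁ u₁ a₂ u₂ a₃ u₃ : V}
    (h : OutTriple G ty p a₁ u₁ a₂ u₂ a₃ u₃) : OutTriple G ty p a₂ u₂ a₃ u₃ a₁ u₁ := by
  obtain ⟨h1, h2, h3, h4, h5, h6, h7, h8, h9⟩ := h
  exact ⟨h2, h3, h1, h6, h4.symm, h5.symm, h9, h7.symm, h8.symm⟩

/-- Without three disjoint edges, two vertices cover all edges. -/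
theorem exists_cover_of_no_outTriple [Nonempty V] {p : VClass} (hp : IsW p)
    (h : ∀ a₁ u₁ a₂ u₂ a₃ u₃, ¬ OutTriple G ty p a₁ u₁ a₂ u₂ a₃ u₃) :
    ∃ s t, ∀ a u, OutEdge G ty p a u → a = s ∨ a = t ∨ u = s ∨ u = t := by
  by_contra! hcon
  obtain ⟨v₀⟩ := ‹Nonempty V›
  have hbip : ∀ {a u a' u' : V}, OutEdge G ty p a u → OutEdge G ty p a' u' → a ≠ u' := by
    rintro a u a' u' ⟨-, h1, -⟩ ⟨-, -, h2⟩ rfl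
    exact h2 (h1 ▸ hp)
  have noT : ∀ {a₁ u₁ a₂ u₂ a₃ u₃ : V}, OutEdge G ty p a₁ u₁ → OutEdge G ty p a₂ u₂ →
      OutEdge G ty p a₃ u₃ → a₁ ≠ a₂ → a₁ ≠ a₃ → a₂ ≠ a₃ → u₁ ≠ u₂ → u₁ ≠ u₃ → u₂ ≠ u₃ → False :=
    fun h1 h2 h3 h4 h5 h6 h7 h8 h9 => h _ _ _ _ _ _ ⟨h1, h2, h3, h4, h5, h6, h7, h8, h9⟩
  obtain ⟨w₁, u₁, e1, -⟩ := hcon v₀ v₀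
  obtain ⟨w₂, u₂, e2, n1, n2, n3, n4⟩ := hcon w₁ u₁
  obtain ⟨w₃, u₃, e3, m1, m2, m3, m4⟩ := hcon w₁ w₂
  -- from an edge at `u₁` leaving `{w₁, w₂}` derive a contradiction
  have main : ∀ {w₁ u₁ w₂ u₂ w₃ : V}, OutEdge G ty p w₁ u₁ → OutEdge G ty p w₂ u₂ →
      OutEdge G ty p w₃ u₁ → w₁ ≠ w₂ → u₁ ≠ u₂ → w₃ ≠ w₁ → w₃ ≠ w₂ → False := by
    intro w₁ u₁ w₂ u₂ w₃ e1 e2 e3 n1 n2 n3 n4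
    obtain ⟨w₄, u₄, e4, k1, k2, k3, k4⟩ := hcon u₁ u₂
    have b1 := hbip e4 e1
    have b2 := hbip e4 e2
    have h4 : w₄ = w₁ ∨ w₄ = w₂ := by
      by_contra! hh
      exact noT e1 e2 e4 n1 hh.1.symm hh.2.symm n2 k3.symm k4.symm
    rcases h4 with rfl | rfl
    · exact noT e4 e3 e2 n3.symm n1 n4 k3 k4 n2
    · obtain ⟨w₅, u₅, e5, l1, l2, l3, l4⟩ := hcon u₁ w₄
      by_cases h5 : w₅ = w₁
      · subst h5
        by_cases h6 : u₅ = u₂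
        · subst h6
          exact noT e5 e4 e3 l2 n3.symm n4.symm k4.symm n2.symm k3
        · exact noT e5 e3 e2 n3.symm n1 n4 l3 h6 n2
      · by_cases h6 : u₅ = u₂
        · subst h6
          exact noT e5 e4 e1 l2 h5 n1.symm k4.symm n2.symm k3
        · exact noT e5 e2 e1 l2 h5 n1.symm h6 l3 n2.symm
  by_cases h1 : u₃ = u₁
  · subst h1
    exact main e1 e2 e3 n1.symm n4.symm m1 m2
  by_cases h2 : u₃ = u₂
  · subst h2
    exact main e2 e1 e3 n1 n4 m2 m1
  exact noT e1 e2 e3 n1.symm m1.symm m2.symm n4.symm (Ne.symm h1) (Ne.symm h2)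

theorem IsConn.tourLE_two_of_left {w w' a a' : V} (h : IsConn G ty w w') (ha : InEdge G ty A a a')
    (hw : ty w = A) : TourLE G ty 7 2 := by
  rcases h.2.1 with hw' | hw'
  · exact h.tourLE.of_le (by omega) (by rw [hw, hw']; rfl)
  · exact (h.add_inEdge (.inl rfl) (by simp [hw']) ha).of_le (by omega) (by rw [hw, hw']; rfl)

/-- A connector has twice the balance 2, 0 or −2, so zero, one or two edges inside A are missing. -/
theorem IsConn.tourLE_two_of_twoIn {w w' : V} (h : IsConn G ty w w') (ha : TwoIn G ty A) :
    TourLE G ty 7 2 := by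
  obtain ⟨a, a', b, b', h1, h2, h3, h4⟩ := ha
  rcases h.1 with hw | hw
  · exact h.tourLE_two_of_left h1 hw
  rcases h.2.1 with hw' | hw'
  · exact h.symm.tourLE_two_of_left h1 hw'
  exact (h.add_two_inEdges (.inl rfl) (by simp [hw]) (by simp [hw']) h1 h2 h3 h4).of_le (by omega)
    (by rw [hw, hw']; rfl)

/-- In the first two cases a connector, in the second one with an end in A, is completed by edges
inside A. In the third case two of the three disjoint edges already form a connector with both ends
in A. -/
theorem IsSep.tourLE_two_of_matching (hsep : IsSep G ty) {c d : VClass} (hcd : Opp c d)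
    {x₁ x₂ y₁ y₂ : V}
    (hx₁ : ty x₁ = c) (hx₂ : ty x₂ = c) (hy₁ : ty y₁ = d) (hy₂ : ty y₂ = d)
    (e1 : G.Adj x₁ y₁) (e2 : G.Adj x₂ y₂) (hx : x₁ ≠ x₂) (hy : y₁ ≠ y₂)
    (hyp : TwoIn G ty A ∨
      (∃ a a' a₁ u₁ a₂ u₂, InEdge G ty A a a' ∧ OutEdge G ty A a₁ u₁ ∧ OutEdge G ty A a₂ u₂ ∧
        a₁ ≠ a₂ ∧ u₁ ≠ u₂) ∨
      ∃ a₁ u₁ a₂ u₂ a₃ u₃, OutTriple G ty A a₁ u₁ a₂ u₂ a₃ u₃) :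
    TourLE G ty 7 2 := by
  have triple : ∀ {a₁ u₁ a₂ u₂ a₃ u₃ : V}, OutEdge G ty A a₁ u₁ → OutEdge G ty A a₂ u₂ →
      OutEdge G ty A a₃ u₃ → a₁ ≠ a₂ → a₁ ≠ a₃ → a₂ ≠ a₃ → u₁ ≠ u₂ → u₁ ≠ u₃ → u₂ ≠ u₃ →
      TourLE G ty 7 2 := by
    rintro a₁ u₁ a₂ u₂ a₃ u₃ ⟨f1, h1, h1'⟩ ⟨f2, h2, h2'⟩ ⟨f3, h3, h3'⟩ n1 n2 n3 m1 m2 m3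
    have key : ∀ {a₁ u₁ a₂ u₂ x y : V}, G.Adj a₁ u₁ → G.Adj a₂ u₂ → ty a₁ = A → ty a₂ = A →
        ¬ IsW (ty u₁) → ¬ IsW (ty u₂) → a₁ ≠ a₂ → u₁ ≠ u₂ → ty x = c → ty y = d → G.Adj x y →
        x ≠ u₁ → x ≠ u₂ → y ≠ u₁ → y ≠ u₂ → TourLE G ty 7 2 := by
      intro a₁ u₁ a₂ u₂ x y f1 f2 h1 h2 h1' h2' ha hu hxc hyd hxy k1 k2 k3 k4
      exact (isConn_of_not_cover hcd hx₁ hx₂ hy₁ hy₂ e1 e2 hx hy (by simp [h1, IsW])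
        (by simp [h2, IsW]) h1' h2' f1 f2 ha hu hxc hyd hxy k1 k2 k3 k4).tourLE.of_le (by omega)
        (by rw [h1, h2]; rfl)
    have hne := hcd.ne
    have hxy12 : x₁ ≠ y₂ := by grind
    have hxy21 : x₂ ≠ y₁ := by grind
    have hxy11 : x₁ ≠ y₁ := by grind
    have hxy22 : x₂ ≠ y₂ := by grind
    by_cases c1 : x₁ ≠ u₁ ∧ x₁ ≠ u₂ ∧ y₁ ≠ u₁ ∧ y₁ ≠ u₂
    · exact key f1 f2 h1 h2 h1' h2' n1 m1 hx₁ hy₁ e1 c1.1 c1.2.1 c1.2.2.1 c1.2.2.2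
    by_cases c2 : x₁ ≠ u₁ ∧ x₁ ≠ u₃ ∧ y₁ ≠ u₁ ∧ y₁ ≠ u₃
    · exact key f1 f3 h1 h3 h1' h3' n2 m2 hx₁ hy₁ e1 c2.1 c2.2.1 c2.2.2.1 c2.2.2.2
    by_cases c3 : x₁ ≠ u₂ ∧ x₁ ≠ u₃ ∧ y₁ ≠ u₂ ∧ y₁ ≠ u₃
    · exact key f2 f3 h2 h3 h2' h3' n3 m3 hx₁ hy₁ e1 c3.1 c3.2.1 c3.2.2.1 c3.2.2.2
    by_cases c1' : x₂ ≠ u₁ ∧ x₂ ≠ u₂ ∧ y₂ ≠ u₁ ∧ y₂ ≠ u₂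
    · exact key f1 f2 h1 h2 h1' h2' n1 m1 hx₂ hy₂ e2 c1'.1 c1'.2.1 c1'.2.2.1 c1'.2.2.2
    by_cases c2' : x₂ ≠ u₁ ∧ x₂ ≠ u₃ ∧ y₂ ≠ u₁ ∧ y₂ ≠ u₃
    · exact key f1 f3 h1 h3 h1' h3' n2 m2 hx₂ hy₂ e2 c2'.1 c2'.2.1 c2'.2.2.1 c2'.2.2.2
    by_cases c3' : x₂ ≠ u₂ ∧ x₂ ≠ u₃ ∧ y₂ ≠ u₂ ∧ y₂ ≠ u₃
    · exact key f2 f3 h2 h3 h2' h3' n3 m3 hx₂ hy₂ e2 c3'.1 c3'.2.1 c3'.2.2.1 c3'.2.2.2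
    -- Each of the two disjoint cross edges would contain at least two of `u₁`, `u₂`, `u₃`, which is
    -- impossible.
    exfalso
    clear key
    grind
  rcases hyp with hyp | ⟨a, a', a₁, u₁, a₂, u₂, haa, ⟨f1, h1, h1'⟩, ⟨f2, h2, h2'⟩, ha, hu⟩ |
    ⟨a₁, u₁, a₂, u₂, a₃, u₃, h1, h2, h3, n1, n2, n3, m1, m2, m3⟩
  · obtain ⟨w₁, u₁, f1, hw₁, hu₁, -⟩ := hsep.exists_bip x₁ x₁
    obtain ⟨w₂, u₂, f2, hw₂, hu₂, n1, n2, n3, n4⟩ := hsep.exists_bip w₁ u₁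
    rcases hsep.exists_isConn hcd hx₁ hx₂ hy₁ hy₂ e1 e2 hx hy hw₁ hw₂ hu₁ hu₂ f1 f2 n1.symm n4.symm
      with h | ⟨w, hw, h1, h2⟩
    · exact h.tourLE_two_of_twoIn hyp
    · by_cases hne : w = w₁
      · exact (h2 (by grind)).tourLE_two_of_twoIn hyp
      · exact (h1 hne).tourLE_two_of_twoIn hyp
  · rcases hsep.exists_isConn hcd hx₁ hx₂ hy₁ hy₂ e1 e2 hx hy (by simp [h1, IsW])
      (by simp [h2, IsW]) h1' h2' f1 f2 ha hu with h | ⟨w, hw, g1, g2⟩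
    · exact h.tourLE_two_of_left haa h1
    · by_cases hne : w = a₁
      · exact (g2 (by grind)).tourLE_two_of_left haa h2
      · exact (g1 hne).tourLE_two_of_left haa h1
  · exact triple h1 h2 h3 n1 n2 n3 m1 m2 m3

end SimpleGraph

/-! ### The case |A| = |B| + 1 when the cross edges form a star. -/

namespace SimpleGraph

open VClass

variable {V : Type*} {G : SimpleGraph V} {ty : V → VClass}

/-- Call an A–`c` edge good if it avoids `x`, and an A–`d` edge good if some cross edge avoids it.
Good edges of the two kinds at different vertices of A would form a triangle with both ends in A,
excluded by `hnot`. So one kind is missing, or all good edges sit at one vertex of A. In each case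
three edges from A and one edge from B give a square, or a pattern with one more cross edge. -/
theorem IsSep.tourLE_two_of_triple_of_star (hsep : IsSep G ty) {c d : VClass} (hcd : Opp c d)
    {x y : V} (hx : ty x = c) (hy : ty y = d) (hxy : G.Adj x y)
    (hstar : ∀ x' y', ty x' = c → ty y' = d → G.Adj x' y' → x' = x)
    (hnot : ∀ w w', ty w = A → ty w' = A → ¬ IsConn G ty w w')
    {a₁ u₁ a₂ u₂ a₃ u₃ : V} (hN : OutTriple G ty A a₁ u₁ a₂ u₂ a₃ u₃) : TourLE G ty 7 2 := by
  obtain ⟨hc, hd⟩ := hcd.not_isW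
  have hcdne := hcd.ne
  have wA : ∀ {v}, ty v = A → IsW (ty v) := fun h => .inl h
  have cls : ∀ {v}, ¬ IsW (ty v) → ty v = c ∨ ty v = d := fun {v} h =>
    (hcd.cases (ty v)).imp id fun h' => h'.resolve_right h
  have square : ∀ {w₁ w₂ w₃ w₄ u₁ u₂ u₃ u₄ : V}, ty w₁ = A → ty w₂ = A → ty w₃ = A → ty w₄ = B →
      ty u₁ = c → ty u₂ = c → ty u₃ = d → ty u₄ = d →
      G.Adj w₁ u₁ → G.Adj w₂ u₂ → G.Adj w₃ u₃ → G.Adj w₄ u₄ → w₁ ≠ w₂ → u₁ ≠ u₂ → u₃ ≠ u₄ →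
      TourLE G ty 7 2 := by
    intro w₁ w₂ w₃ w₄ u₁ u₂ u₃ u₄ h1 h2 h3 h4 g1 g2 g3 g4 f1 f2 f3 f4 n1 n2 n3
    exact ((IsPair.mk (wA h1) (wA h2) g1 g2 f1 f2 n1 n2).hasTour hcd
      (IsPair.mk (wA h3) (.inr h4) g3 g4 f3 f4 (by grind) n3) (by grind) (by grind)).tourLE
      (by omega) (by rw [h1, h2, h3, h4]; rfl)
  have square' : ∀ {w₁ w₂ w₃ w₄ u₁ u₂ u₃ u₄ : V}, ty w₁ = A → ty w₂ = A → ty w₃ = A → ty w₄ = B →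
      ty u₁ = d → ty u₂ = d → ty u₃ = c → ty u₄ = c →
      G.Adj w₁ u₁ → G.Adj w₂ u₂ → G.Adj w₃ u₃ → G.Adj w₄ u₄ → w₁ ≠ w₂ → u₁ ≠ u₂ → u₃ ≠ u₄ →
      TourLE G ty 7 2 := by
    intro w₁ w₂ w₃ w₄ u₁ u₂ u₃ u₄ h1 h2 h3 h4 g1 g2 g3 g4 f1 f2 f3 f4 n1 n2 n3
    exact ((IsPair.mk (wA h1) (wA h2) g1 g2 f1 f2 n1 n2).hasTour hcd.symm
      (IsPair.mk (wA h3) (.inr h4) g3 g4 f3 f4 (by grind) n3) (by grind) (by grind)).tourLE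
      (by omega) (by rw [h1, h2, h3, h4]; rfl)
  -- two good edges at different vertices of `A` give a tour
  have hgood : ∀ {a u a' v v' : V}, ty a = A → ty u = c → u ≠ x → G.Adj a u → ty a' = A →
      ty v = d → G.Adj a' v → ty v' = d → G.Adj x v' → v' ≠ v → a = a' := by
    intro a u a' v v' h1 h2 h3 h4 h5 h6 h7 h8 h9 h10
    by_contra hne
    exact hnot a a' h1 h5
      (isConn_triangle hcd (wA h1) (wA h5) h2 hx h6 h8 h4 h7 h9 hne h3.symm h10)
  by_cases hE2 : ∃ a v v', ty a = A ∧ ty v = d ∧ G.Adj a v ∧ ty v' = d ∧ G.Adj x v' ∧ v' ≠ v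
  swap
  · push Not at hE2
    obtain ⟨b, v, v', f, hb, hv, hv', hxv, hne, -⟩ :=
      hsep.exists_right_of_star hcd hx hy hxy hstar x
    have hb' : ty b = B := hb.resolve_left fun h => hne (hE2 b v v' h hv f hv' hxv)
    -- one of the three edges goes to `d`
    have key : ∀ {a₁ u₁ a₂ u₂ a₃ u₃ : V}, OutTriple G ty A a₁ u₁ a₂ u₂ a₃ u₃ → ty u₁ = d →
        TourLE G ty 7 2 := by
      rintro a₁ u₁ a₂ u₂ a₃ u₃ ⟨⟨f1, h1, g1⟩, ⟨f2, h2, g2⟩, ⟨f3, h3, g3⟩, n1, n2, n3, m1, m2, m3⟩ hd1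
      have hv1 := hE2 a₁ u₁ v' h1 hd1 f1 hv' hxv
      have hc2 : ty u₂ = c := (cls g2).resolve_right fun h =>
        m1 (hv1.symm.trans (hE2 a₂ u₂ v' h2 h f2 hv' hxv))
      have hc3 : ty u₃ = c := (cls g3).resolve_right fun h =>
        m2 (hv1.symm.trans (hE2 a₃ u₃ v' h3 h f3 hv' hxv))
      exact square h2 h3 h1 hb' hc2 hc3 hd1 hv f2 f3 f1 f n3 m3 (by grind)
    by_cases d1 : ty u₁ = d
    · exact key hN d1
    by_cases d2 : ty u₂ = d
    · exact key hN.rotate d2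
    by_cases d3 : ty u₃ = d
    · exact key hN.rotate.rotate d3
    obtain ⟨⟨f1, h1, g1⟩, ⟨f2, h2, g2⟩, ⟨f3, h3, g3⟩, n1, n2, n3, m1, m2, m3⟩ := hN
    exact (hasTour_five hcd (wA h1) (wA h2) (wA h3) hb ((cls g1).resolve_right d1)
      ((cls g2).resolve_right d2) ((cls g3).resolve_right d3) hx hv hv' f1 f2 f3 f hxv m1 m2 m3
      n1 n2 n3 (by grind) (by grind) (by grind) hne.symm).tourLE (by omega)
      (by rw [h1, h2, h3, hb']; rfl)
  by_cases hE1 : ∃ a u, ty a = A ∧ ty u = c ∧ u ≠ x ∧ G.Adj a u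
  swap
  · push Not at hE1
    obtain ⟨b, u, f, hb, hu, hux, -⟩ := hsep.exists_left_of_star hcd hx hstar x
    have hb' : ty b = B := hb.resolve_left fun h => hE1 b u h hu hux f
    have atx : ∀ {a u}, OutEdge G ty A a u → u = x ∨ ty u = d := fun {a u} ⟨f, h, g⟩ => by
      by_contra! hh
      exact hE1 a u h ((cls g).resolve_right hh.2) hh.1 f
    have key : ∀ {a₁ u₁ a₂ u₂ a₃ u₃ : V}, OutTriple G ty A a₁ u₁ a₂ u₂ a₃ u₃ → u₁ = x →
        TourLE G ty 7 2 := by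
      rintro a₁ u₁ a₂ u₂ a₃ u₃ ⟨⟨f1, h1, g1⟩, e2, e3, n1, n2, n3, m1, m2, m3⟩ rfl
      exact square' e2.2.1 e3.2.1 h1 hb' ((atx e2).resolve_left m1.symm)
        ((atx e3).resolve_left m2.symm) hx hu e2.1 e3.1 f1 f n3 m3 hux.symm
    by_cases d1 : u₁ = x
    · exact key hN d1
    by_cases d2 : u₂ = x
    · exact key hN.rotate d2
    by_cases d3 : u₃ = x
    · exact key hN.rotate.rotate d3
    obtain ⟨e1, e2, e3, n1, n2, n3, m1, m2, m3⟩ := hN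
    have h1 := e1.2.1
    have h2 := e2.2.1
    have h3 := e3.2.1
    exact (hasTour_five hcd.symm (wA h1) (wA h2) (wA h3) hb ((atx e1).resolve_left d1)
      ((atx e2).resolve_left d2) ((atx e3).resolve_left d3) hy hu hx e1.1 e2.1 e3.1 f hxy.symm
      m1 m2 m3 n1 n2 n3 (by grind) (by grind) (by grind) hux).tourLE (by omega)
      (by rw [h1, h2, h3, hb']; rfl)
  obtain ⟨a, v₀, v₀', ha, hv₀, f₀, hv₀', hxv₀, hne₀⟩ := hE2
  obtain ⟨a', u₀, ha', hu₀, hux₀, f₀'⟩ := hE1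
  obtain rfl := hgood ha' hu₀ hux₀ f₀' ha hv₀ f₀ hv₀' hxv₀ hne₀
  have left : ∀ {w u}, ty w = A → ty u = c → u ≠ x → G.Adj w u → w = a' := fun h1 h2 h3 h4 =>
    hgood h1 h2 h3 h4 ha hv₀ f₀ hv₀' hxv₀ hne₀
  have right : ∀ {w v v'}, ty w = A → ty v = d → G.Adj w v → ty v' = d → G.Adj x v' → v' ≠ v →
      w = a' := fun h1 h2 h3 h4 h5 h6 => (hgood ha' hu₀ hux₀ f₀' h1 h2 h3 h4 h5 h6).symm
  obtain ⟨b, u, f, hb, hu, hux, hba⟩ := hsep.exists_left_of_star hcd hx hstar a'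
  have hb' : ty b = B := hb.resolve_left fun h => hba (left h hu hux f)
  obtain ⟨b₂, v, v', f', hb₂, hv, hv', hxv, hne, hba₂⟩ :=
    hsep.exists_right_of_star hcd hx hy hxy hstar a'
  have hb₂' : ty b₂ = B := hb₂.resolve_left fun h => hba₂ (right h hv f' hv' hxv hne)
  have kinds : ∀ {a u}, OutEdge G ty A a u → u = x ∨ u = v' ∨ a = a' := fun {a u} ⟨e, h, g⟩ => by
    rcases cls g with hc | hd
    · by_cases hux : u = x
      · exact .inl hux
      · exact .inr (.inr (left h hc hux e))
    · by_cases huv : u = v'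
      · exact .inr (.inl huv)
      · exact .inr (.inr (right h hd e hv' hxv (by grind)))
  have key : ∀ {a₁ u₁ a₂ u₂ a₃ u₃ : V}, OutTriple G ty A a₁ u₁ a₂ u₂ a₃ u₃ → u₁ = x → u₂ = v' →
      TourLE G ty 7 2 := by
    rintro a₁ u₁ a₂ u₂ a₃ u₃ ⟨⟨f1, h1, g1⟩, ⟨f2, h2, g2⟩, ⟨f3, h3, g3⟩, n1, n2, n3, m1, m2, m3⟩ rfl rfl
    rcases cls g3 with hc | hd
    · exact square h3 h1 h2 hb₂' hc hx hv' hv f3 f1 f2 f' n2.symm m2.symm hne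
    · exact square' h3 h2 h1 hb' hd hv' hx hu f3 f2 f1 f n3.symm m3.symm hux.symm
  have k1 := kinds hN.1
  have k2 := kinds hN.2.1
  have k3 := kinds hN.2.2.1
  obtain ⟨-, -, -, n1, n2, n3, m1, m2, m3⟩ := id hN
  by_cases x1 : u₁ = x
  · by_cases v2 : u₂ = v'
    · exact key hN x1 v2
    · exact key hN.rotate.rotate.swap x1 (by grind)
  by_cases x2 : u₂ = x
  · by_cases v1 : u₁ = v'
    · exact key hN.swap x2 v1
    · exact key hN.rotate x2 (by grind)
  have x3 : u₃ = x := by grind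
  by_cases v1 : u₁ = v'
  · exact key hN.rotate.rotate x3 v1
  · exact key hN.rotate.swap x3 (by grind)

/-- A connector with an end in A, or any connector if A has two edges, is completed by edges inside
A. If this fails, B sends out enough edges for `h0` or `h1` to supply three disjoint edges from A.
-/
theorem IsSep.tourLE_two_of_star (hsep : IsSep G ty) {c d : VClass} (hcd : Opp c d)
    {x y : V} (hx : ty x = c) (hy : ty y = d) (hxy : G.Adj x y)
    (hstar : ∀ x' y', ty x' = c → ty y' = d → G.Adj x' y' → x' = x)
    (h0 : (∀ a a', ¬ InEdge G ty A a a') → (∃ b u, OutEdge G ty B b u) →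
      ∃ a₁ u₁ a₂ u₂ a₃ u₃, OutTriple G ty A a₁ u₁ a₂ u₂ a₃ u₃)
    (h1 : ¬ TwoIn G ty A → (∃ b₁ u₁ b₂ u₂ b₃ u₃, OutEdge G ty B b₁ u₁ ∧ OutEdge G ty B b₂ u₂ ∧
      OutEdge G ty B b₃ u₃ ∧ (b₁, u₁) ≠ (b₂, u₂) ∧ (b₁, u₁) ≠ (b₃, u₃) ∧ (b₂, u₂) ≠ (b₃, u₃)) →
      ∃ a₁ u₁ a₂ u₂ a₃ u₃, OutTriple G ty A a₁ u₁ a₂ u₂ a₃ u₃) : TourLE G ty 7 2 := by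
  obtain ⟨hc, hd⟩ := hcd.not_isW
  by_cases hAA : ∃ w w', ty w = A ∧ ty w' = A ∧ IsConn G ty w w'
  · obtain ⟨w, w', hw, hw', h⟩ := hAA
    exact h.tourLE.of_le (by omega) (by rw [hw, hw']; rfl)
  push Not at hAA
  obtain ⟨w₁, u₁, f1, hw₁, hu₁, hux, -⟩ := hsep.exists_left_of_star hcd hx hstar x
  obtain ⟨w₂, v₂, v', f2, hw₂, hv₂, hv', f3, hvv, hne⟩ :=
    hsep.exists_right_of_star hcd hx hy hxy hstar w₁
  have hconn := isConn_triangle hcd hw₁ hw₂ hu₁ hx hv₂ hv' f1 f2 f3 hne.symm hux.symm hvv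
  have out : ∀ {w u}, G.Adj w u → ty w = B → (ty u = c ∨ ty u = d) → OutEdge G ty B w u := by
    intro w u f h h'
    refine ⟨f, h, ?_⟩
    rcases h' with h' | h' <;> rwa [h']
  by_cases h2 : TwoIn G ty A
  · exact hconn.tourLE_two_of_twoIn h2
  by_cases hin : ∃ a a', InEdge G ty A a a'
  · obtain ⟨a, a', ha⟩ := hin
    by_cases hw₁A : ty w₁ = A
    · exact hconn.tourLE_two_of_left ha hw₁A
    by_cases hw₂A : ty w₂ = A
    · exact hconn.symm.tourLE_two_of_left ha hw₂A
    have hw₁B := hw₁.resolve_left hw₁A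
    have hw₂B := hw₂.resolve_left hw₂A
    obtain ⟨w₃, u₃, f4, hw₃, hu₃, hux₃, hne₃⟩ := hsep.exists_left_of_star hcd hx hstar w₁
    by_cases hw₃A : ty w₃ = A
    · exact (isConn_triangle hcd hw₃ hw₂ hu₃ hx hv₂ hv' f4 f2 f3 (by grind) hux₃.symm
        hvv).tourLE_two_of_left ha hw₃A
    have hw₃B := hw₃.resolve_left hw₃A
    have hcdne := hcd.ne
    obtain ⟨a₁, u₁, a₂, u₂, a₃, u₃, hN⟩ := h1 h2 ⟨w₁, u₁, w₂, v₂, w₃, u₃, out f1 hw₁B (.inl hu₁),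
      out f2 hw₂B (.inr hv₂), out f4 hw₃B (.inl hu₃), by grind, by grind, by grind⟩
    exact hsep.tourLE_two_of_triple_of_star hcd hx hy hxy hstar hAA hN
  push Not at hin
  by_cases hw₁A : ty w₁ = A
  · have hw₂B : ty w₂ = B := hw₂.resolve_left fun h => hAA _ _ hw₁A h hconn
    obtain ⟨a₁, u₁, a₂, u₂, a₃, u₃, hN⟩ := h0 hin ⟨w₂, v₂, out f2 hw₂B (.inr hv₂)⟩
    exact hsep.tourLE_two_of_triple_of_star hcd hx hy hxy hstar hAA hN
  · obtain ⟨a₁, u₁, a₂, u₂, a₃, u₃, hN⟩ := h0 hin ⟨w₁, u₁,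
      out f1 (hw₁.resolve_left hw₁A) (.inl hu₁)⟩
    exact hsep.tourLE_two_of_triple_of_star hcd hx hy hxy hstar hAA hN

end SimpleGraph

/-! ### The case |A| = |B| + 1 without cross edges. -/

namespace SimpleGraph

open VClass

variable {V : Type*} {G : SimpleGraph V} {ty : V → VClass}

/-- The inequalities describe an order in which each new edge has a new first vertex and a second
vertex that is not yet inner. -/
theorem HasTour.add_linear_forest {p : VClass} (hp : IsW p) {k : ℕ} {c : ℤ} {S I : V → Prop}
    (h : HasTour G ty k c S I) (hS : ∀ v, ty v = p → ¬ S v) (hI : ∀ v, ty v = p → ¬ I v)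
    {x₁ y₁ x₂ y₂ x₃ y₃ : V} (e1 : InEdge G ty p x₁ y₁) (e2 : InEdge G ty p x₂ y₂)
    (e3 : InEdge G ty p x₃ y₃) (n1 : x₂ ≠ x₁) (n2 : x₂ ≠ y₁) (n3 : x₃ ≠ x₁) (n4 : x₃ ≠ y₁)
    (n5 : x₃ ≠ x₂) (n6 : x₃ ≠ y₂) (m1 : y₂ ≠ y₁) (m2 : y₃ ≠ y₁) (m3 : y₃ ≠ y₂) :
    HasTour G ty (k + 3) (c + 6 * sgn p) (fun _ => True) (fun _ => True) := by
  obtain ⟨a1, b1, c1⟩ := e1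
  obtain ⟨a2, b2, c2⟩ := e2
  obtain ⟨a3, b3, c3⟩ := e3
  have g1 := h.add_edge a1 (by rw [b1, c1]) (hS _ b1) (hI _ c1)
  have g2 := g1.add_edge a2 (by rw [b2, c2])
    (by rintro (hh | hh | hh); exacts [hS _ b2 hh, n1 hh, n2 hh])
    (by rintro (hh | hh); exacts [hI _ c2 hh, m1 hh])
  have g3 := g2.add_edge a3 (by rw [b3, c3])
    (by rintro ((hh | hh | hh) | hh | hh); exacts [hS _ b3 hh, n3 hh, n4 hh, n5 hh, n6 hh])
    (by rintro ((hh | hh) | hh); exacts [hI _ c3 hh, m2 hh, m3 hh])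
  exact g3.of_eq rfl (by rw [b1, c1, b2, c2, b3, c3, hp.wt_self]; ring) (by simp) (by simp)

/-- `hmany` says that no vertex together with one more edge covers the edges inside `p`. So a path
`xyz` is completed by an edge that misses `y` and is not `xz`: neither a star nor a triangle
results. -/
theorem HasTour.add_three_inEdges {p : VClass} (hp : IsW p) {k : ℕ} {c : ℤ} {S I : V → Prop}
    (h : HasTour G ty k c S I) (hS : ∀ v, ty v = p → ¬ S v) (hI : ∀ v, ty v = p → ¬ I v)
    {v₀ : V} (hmany : ∀ y s t, ∃ a a', InEdge G ty p a a' ∧ a ≠ y ∧ a' ≠ y ∧ ¬ (a = s ∧ a' = t) ∧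
      ¬ (a = t ∧ a' = s)) :
    HasTour G ty (k + 3) (c + 6 * sgn p) (fun _ => True) (fun _ => True) := by
  obtain ⟨a, a', e, -⟩ := hmany v₀ v₀ v₀
  obtain ⟨b, b', f, n1, n2, -⟩ := hmany a a a
  have cherry : ∀ {x y z : V}, InEdge G ty p x y → InEdge G ty p y z → x ≠ z →
      HasTour G ty (k + 3) (c + 6 * sgn p) (fun _ => True) (fun _ => True) := by
    intro x y z e f hne
    obtain ⟨u, v, g, m1, m2, m3, m4⟩ := hmany y x z
    have key : ∀ {u v : V}, InEdge G ty p u v → u ≠ y → v ≠ y → u ≠ x → u ≠ z →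
        HasTour G ty (k + 3) (c + 6 * sgn p) (fun _ => True) (fun _ => True) := by
      intro u v g m1 m2 m3 m4
      have := e.1.ne
      have := f.1.ne
      have := g.1.ne
      by_cases hv : v = z
      · exact h.add_linear_forest hp hS hI e.symm f.symm g (by grind) (by grind) (by grind)
          (by grind) (by grind) (by grind) (by grind) (by grind) (by grind)
      · exact h.add_linear_forest hp hS hI f e g (by grind) (by grind) (by grind)
          (by grind) (by grind) (by grind) (by grind) (by grind) (by grind)
    by_cases hu : u = x ∨ u = z
    · have := g.1.ne
      exact key g.symm m2 m1 (by grind) (by grind)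
    · push Not at hu
      exact key g m1 m2 hu.1 hu.2
  by_cases h1 : a' = b
  · subst h1
    exact cherry e f n2.symm
  by_cases h2 : a' = b'
  · subst h2
    exact cherry e f.symm n1.symm
  obtain ⟨u, v, g, m1, m2, m3, m4⟩ := hmany a b b'
  have := g.1.ne
  have := e.1.ne
  have := f.1.ne
  by_cases h3 : u = a'
  · subst h3
    exact cherry e g m2.symm
  by_cases h4 : v = a'
  · subst h4
    exact cherry e g.symm m1.symm
  by_cases h5 : u = b
  · subst h5
    exact cherry f.symm g (by grind)
  by_cases h6 : u = b'
  · subst h6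
    exact cherry f g (by grind)
  by_cases h7 : v = b
  · subst h7
    exact cherry f.symm g.symm (by grind)
  by_cases h8 : v = b'
  · subst h8
    exact cherry f g.symm (by grind)
  exact h.add_linear_forest hp hS hI e f g (by grind) (by grind) (by grind)
    (by grind) (by grind) (by grind) (by grind) (by grind) (by grind)

/-- If the fourth vertex lies in B, nothing is missing. If all four lie in A, the weight is too
large by 2: an edge inside B reduces it, or an edge from B to V₁ ∪ V₂ replaces one of the four
edges. -/
theorem IsQuad.tourLE_two_of_three {w₁ w₂ w₃ w₄ : V} (h : IsQuad G ty w₁ w₂ w₃ w₄)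
    (hB : (∃ b b', InEdge G ty B b b') ∨ ∃ b u, OutEdge G ty B b u)
    (h1 : ty w₁ = A) (h2 : ty w₂ = A) (h3 : ty w₃ = A) : TourLE G ty 7 2 := by
  rcases h.isW.2.2.2 with h4 | h4
  swap
  · exact h.hasTour.tourLE (by omega) (by rw [h1, h2, h3, h4]; rfl)
  rcases hB with ⟨b, b', hb⟩ | ⟨b, u, f, hb, hu⟩
  · refine (h.tourLE_add_one (p := B) (.inr ⟨rfl, rfl⟩) (s := w₁) (t := w₁) ?_ ?_ hb ?_ ?_).of_le
      (by omega) (by rw [h1, h2, h3, h4]; rfl)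
    · intro v hv hm
      simp only [List.mem_cons, List.not_mem_nil, or_false] at hm
      grind
    · grind
    · exact fun hh => hb.1.ne (hh.1.trans hh.2.symm)
    · exact fun hh => hb.1.ne (hh.1.trans hh.2.symm)
  · have key : ∀ {c d : VClass} {w₁ w₂ w₃ w₄ : V}, Opp c d → IsPair G ty c w₁ w₂ →
        IsPair G ty d w₃ w₄ → ty w₁ = A → ty w₂ = A → ty w₃ = A → ty w₄ = A → ty u = c →
        TourLE G ty 7 2 := by
      intro c d w₁ w₂ w₃ w₄ hcd p1 p2 h1 h2 h3 h4 huc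
      obtain ⟨i1, i2, hne, u₁, u₂, m, hu₁, hu₂, f1, f2⟩ := p1
      have fin : ∀ {a v : V}, ty a = A → ty v = c → G.Adj a v → v ≠ u → TourLE G ty 7 2 := by
        intro a v ha hv e hvu
        have p : IsPair G ty c a b := .mk (.inl ha) (.inr hb) hv huc e f (by grind) hvu
        exact (p.hasTour hcd p2 (by grind) (by grind)).tourLE (by omega)
          (by rw [ha, hb, h3, h4]; rfl)
      by_cases hc : u₁ = u
      · exact fin h2 hu₂ f2 (by grind)
      · exact fin h1 hu₁ f1 hc
    obtain ⟨c, d, hcd, p1, p2, -, -⟩ := h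
    rcases hcd.cases (ty u) with huc | huc | huc
    · exact key hcd p1 p2 h1 h2 h3 h4 huc
    · exact key hcd.symm p2 p1 h3 h4 h1 h2 huc
    · contradiction

/-- Two edges to one class and one to the other class, from three vertices of `A`. -/
theorem IsSep.tourLE_two_of_two_one (hsep : IsSep G ty) (hno : NoCross G ty)
    (hB : (∃ b b', InEdge G ty B b b') ∨ ∃ b u, OutEdge G ty B b u) {c d : VClass} (hcd : Opp c d)
    {a₁ a₂ a₃ u₁ u₂ v₃ : V} (h1 : ty a₁ = A) (h2 : ty a₂ = A) (h3 : ty a₃ = A)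
    (hu₁ : ty u₁ = c) (hu₂ : ty u₂ = c) (hv₃ : ty v₃ = d)
    (e1 : G.Adj a₁ u₁) (e2 : G.Adj a₂ u₂) (e3 : G.Adj a₃ v₃) (n1 : a₁ ≠ a₂) (n2 : u₁ ≠ u₂)
    (n3 : a₃ ≠ a₁) (n4 : a₃ ≠ a₂) : TourLE G ty 7 2 := by
  obtain ⟨w, v, f, hw, hv, m1, m2, m3, m4⟩ := hsep.exists_outEdge hno hcd.symm a₃ v₃
  have hQ : IsQuad G ty a₁ a₂ a₃ w := ⟨c, d, hcd, .mk (.inl h1) (.inl h2) hu₁ hu₂ e1 e2 n1 n2,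
    .mk (.inl h3) hw hv₃ hv e3 f m1.symm m4.symm, by grind, by grind⟩
  exact hQ.tourLE_two_of_three hB h1 h2 h3

/-- Weight 4 − 2. The fourth edge may share one end or both ends with edges of the triple, and each
way of meeting has its own pattern. -/
theorem tourLE_two_of_four_two {c d : VClass} (hcd : Opp c d)
    {a₁ u₁ a₂ u₂ a₃ u₃ a u b₁ v₁ b₂ v₂ : V} (hN : OutTriple G ty A a₁ u₁ a₂ u₂ a₃ u₃)
    (hu₁ : ty u₁ = c) (hu₂ : ty u₂ = c) (hu₃ : ty u₃ = c)
    (ha : ty a = A) (hu : ty u = c) (e : G.Adj a u) (n1 : (a, u) ≠ (a₁, u₁))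
    (n2 : (a, u) ≠ (a₂, u₂)) (n3 : (a, u) ≠ (a₃, u₃)) (hb₁ : ty b₁ = B) (hb₂ : ty b₂ = B)
    (hv₁ : ty v₁ = d) (hv₂ : ty v₂ = d) (f1 : G.Adj b₁ v₁) (f2 : G.Adj b₂ v₂) (hb : b₁ ≠ b₂)
    (hv : v₁ ≠ v₂) : TourLE G ty 7 2 := by
  have wA : ∀ {v}, ty v = A → IsW (ty v) := fun h => .inl h
  have wB : ∀ {v}, ty v = B → IsW (ty v) := fun h => .inr h
  have hne : ∀ {x y}, ty x = A → ty y = B → x ≠ y := by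
    rintro x _ h h' rfl
    simp [h] at h'
  have left : ∀ {a₁ u₁ a₂ u₂ a₃ u₃ : V}, OutTriple G ty A a₁ u₁ a₂ u₂ a₃ u₃ → ty u₁ = c →
      ty u₂ = c → ty u₃ = c → a = a₁ → u ≠ u₁ → u ≠ u₂ → u ≠ u₃ → TourLE G ty 7 2 := by
    rintro a₁ u₁ a₂ u₂ a₃ u₃ ⟨⟨e1, h1, -⟩, ⟨e2, h2, -⟩, ⟨e3, h3, -⟩, n1, n2, n3, m1, m2, m3⟩ c1 c2 c3
      rfl k1 k2 k3
    exact (hasTour_four_two_left hcd (wA h1) (wA h2) (wA h3) (wB hb₁) (wB hb₂) c1 c2 c3 hu hv₁ hv₂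
      e1 e2 e3 e f1 f2 m1 m2 m3 n1 n2 n3 hb hv (hne h1 hb₁) (hne h1 hb₂) (hne h2 hb₁) (hne h2 hb₂)
      (hne h3 hb₁) (hne h3 hb₂) k1.symm k2.symm k3.symm).tourLE (by omega)
      (by rw [h1, h2, h3, hb₁, hb₂]; rfl)
  have right : ∀ {a₁ u₁ a₂ u₂ a₃ u₃ : V}, OutTriple G ty A a₁ u₁ a₂ u₂ a₃ u₃ → ty u₁ = c →
      ty u₂ = c → ty u₃ = c → u = u₁ → a ≠ a₁ → a ≠ a₂ → a ≠ a₃ → TourLE G ty 7 2 := by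
    rintro a₁ u₁ a₂ u₂ a₃ u₃ ⟨⟨e1, h1, -⟩, ⟨e2, h2, -⟩, ⟨e3, h3, -⟩, n1, n2, n3, m1, m2, m3⟩ c1 c2 c3
      rfl k1 k2 k3
    exact (hasTour_four_two_right hcd (wA h1) (wA h2) (wA h3) (wA ha) (wB hb₁) (wB hb₂) c1 c2 c3
      hv₁ hv₂ e1 e2 e3 e f1 f2 m1 m2 m3 n1 n2 n3 hb hv (hne h1 hb₁) (hne h1 hb₂) (hne h2 hb₁)
      (hne h2 hb₂) (hne h3 hb₁) (hne h3 hb₂) k1.symm k2.symm k3.symm (hne ha hb₁)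
      (hne ha hb₂)).tourLE (by omega) (by rw [h1, h2, h3, ha, hb₁, hb₂]; rfl)
  have path : ∀ {a₁ u₁ a₂ u₂ a₃ u₃ : V}, OutTriple G ty A a₁ u₁ a₂ u₂ a₃ u₃ → ty u₁ = c →
      ty u₂ = c → ty u₃ = c → a = a₁ → u = u₂ → TourLE G ty 7 2 := by
    rintro a₁ u₁ a₂ u₂ a₃ u₃ ⟨⟨e1, h1, -⟩, ⟨e2, h2, -⟩, ⟨e3, h3, -⟩, n1, n2, n3, m1, m2, m3⟩ c1 c2 c3
      rfl rfl
    exact (hasTour_four_two_path hcd (wA h1) (wA h2) (wA h3) (wB hb₁) (wB hb₂) c1 c2 c3 hv₁ hv₂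
      e1 e2 e3 e f1 f2 m1 m2 m3 n1 n2 n3 hb hv (hne h1 hb₁) (hne h1 hb₂) (hne h2 hb₁) (hne h2 hb₂)
      (hne h3 hb₁) (hne h3 hb₂)).tourLE (by omega) (by rw [h1, h2, h3, hb₁, hb₂]; rfl)
  have hR := hN.rotate
  have hL := hN.rotate.rotate
  by_cases a1 : a = a₁
  · by_cases c2 : u = u₂
    · exact path hN hu₁ hu₂ hu₃ a1 c2
    by_cases c3 : u = u₃
    · exact path hR.swap.rotate.rotate hu₁ hu₃ hu₂ a1 c3
    · exact left hN hu₁ hu₂ hu₃ a1 (by grind) c2 c3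
  by_cases a2 : a = a₂
  · by_cases c1 : u = u₁
    · exact path hN.swap hu₂ hu₁ hu₃ a2 c1
    by_cases c3 : u = u₃
    · exact path hR hu₂ hu₃ hu₁ a2 c3
    · exact left hR hu₂ hu₃ hu₁ a2 (by grind) c3 c1
  by_cases a3 : a = a₃
  · by_cases c1 : u = u₁
    · exact path hL hu₃ hu₁ hu₂ a3 c1
    by_cases c2 : u = u₂
    · exact path hR.swap hu₃ hu₂ hu₁ a3 c2
    · exact left hL hu₃ hu₁ hu₂ a3 (by grind) c1 c2
  by_cases c1 : u = u₁
  · exact right hN hu₁ hu₂ hu₃ c1 a1 a2 a3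
  by_cases c2 : u = u₂
  · exact right hR hu₂ hu₃ hu₁ c2 a2 a3 a1
  by_cases c3 : u = u₃
  · exact right hL hu₃ hu₁ hu₂ c3 a3 a1 a2
  obtain ⟨⟨e1, h1, -⟩, ⟨e2, h2, -⟩, ⟨e3, h3, -⟩, n1, n2, n3, m1, m2, m3⟩ := hN
  exact (hasTour_four_two_disjoint hcd (wA h1) (wA h2) (wA h3) (wA ha) (wB hb₁) (wB hb₂) hu₁ hu₂
    hu₃ hu hv₁ hv₂ e1 e2 e3 e f1 f2 m1 m2 m3 n1 n2 n3 hb hv (hne h1 hb₁) (hne h1 hb₂) (hne h2 hb₁)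
    (hne h2 hb₂) (hne h3 hb₁) (hne h3 hb₂) (Ne.symm a1) (Ne.symm a2) (Ne.symm a3) (Ne.symm c1)
    (Ne.symm c2) (Ne.symm c3) (hne ha hb₁) (hne ha hb₂)).tourLE (by omega)
    (by rw [h1, h2, h3, ha, hb₁, hb₂]; rfl)

/-- If the triple meets both classes, or some A-edge goes to the other class, there are two edges to
one class and one to the other from three vertices of A. Otherwise all W-edges to the other class
come from B, and the fourth edge is used. -/
theorem IsSep.tourLE_two_of_triple (hsep : IsSep G ty) (hno : NoCross G ty)
    (hB : (∃ b b', InEdge G ty B b b') ∨ ∃ b u, OutEdge G ty B b u)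
    {a₁ u₁ a₂ u₂ a₃ u₃ a u : V} (hN : OutTriple G ty A a₁ u₁ a₂ u₂ a₃ u₃)
    (e : OutEdge G ty A a u) (n1 : (a, u) ≠ (a₁, u₁)) (n2 : (a, u) ≠ (a₂, u₂))
    (n3 : (a, u) ≠ (a₃, u₃)) : TourLE G ty 7 2 := by
  have mixed : ∀ {a₁ u₁ a₂ u₂ a₃ u₃ : V} {c d : VClass}, Opp c d →
      OutTriple G ty A a₁ u₁ a₂ u₂ a₃ u₃ → ty u₁ = c → ty u₂ = c → ty u₃ = d → TourLE G ty 7 2 := by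
    rintro a₁ u₁ a₂ u₂ a₃ u₃ c d hcd ⟨⟨e1, h1, -⟩, ⟨e2, h2, -⟩, ⟨e3, h3, -⟩, n1, n2, n3, m1, m2, m3⟩
      c1 c2 c3
    exact hsep.tourLE_two_of_two_one hno hB hcd h1 h2 h3 c1 c2 c3 e1 e2 e3 n1 m1 n2.symm n3.symm
  obtain ⟨d, hcd⟩ := VClass.Opp.class_cases hN.1.2.2
  have cl : ∀ {v}, ¬ IsW (ty v) → ty v = ty u₁ ∨ ty v = d := fun {v} h =>
    (hcd.cases (ty v)).imp id fun h' => h'.resolve_right h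
  rcases cl hN.2.1.2.2 with c2 | c2 <;> rcases cl hN.2.2.1.2.2 with c3 | c3
  · by_cases hd : ∃ a v, ty a = A ∧ ty v = d ∧ G.Adj a v
    · obtain ⟨a', v, ha', hv, f⟩ := hd
      obtain ⟨⟨e1, h1, -⟩, ⟨e2, h2, -⟩, ⟨e3, h3, -⟩, n1, n2, n3, m1, m2, m3⟩ := hN
      by_cases k1 : a' = a₁
      · exact hsep.tourLE_two_of_two_one hno hB hcd h2 h3 ha' c2 c3 hv e2 e3 f n3 m3 (by grind)
          (by grind)
      by_cases k2 : a' = a₂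
      · exact hsep.tourLE_two_of_two_one hno hB hcd h1 h3 ha' rfl c3 hv e1 e3 f n2 m2 (by grind)
          (by grind)
      exact hsep.tourLE_two_of_two_one hno hB hcd h1 h2 ha' rfl c2 hv e1 e2 f n1 m1 k1 k2
    · push Not at hd
      obtain ⟨b₁, v₁, f1, hb₁, hv₁, -⟩ := hsep.exists_outEdge hno hcd.symm a a
      obtain ⟨b₂, v₂, f2, hb₂, hv₂, k1, -, -, k4⟩ := hsep.exists_outEdge hno hcd.symm b₁ v₁
      exact tourLE_two_of_four_two hcd hN rfl c2 c3 e.2.1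
        ((cl e.2.2).resolve_right fun h => hd a u e.2.1 h e.1) e.1 n1 n2 n3
        (hb₁.resolve_left fun h => hd _ _ h hv₁ f1) (hb₂.resolve_left fun h => hd _ _ h hv₂ f2)
        hv₁ hv₂ f1 f2 k1.symm k4.symm
  · exact mixed hcd hN rfl c2 c3
  · exact mixed hcd hN.rotate.rotate c3 rfl c2
  · exact mixed hcd.symm hN.rotate c2 c3 rfl

/-- By `IsSep`, each of V₁ and V₂ receives an edge avoiding `s` and `t`, which must come from B; by
`hfew`, the B-edges into one class all have the same end there. Edges avoiding this end and one of
`s`, `t` then show that `s` and `t` are distinct vertices of A with neighbours in both classes.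
Since `t` has three neighbours in V₁ ∪ V₂, two are in one class; the pair `s`, `t` in that class and
the pair of `s` with a vertex of B in the other have weight 3 − 1. -/
theorem IsSep.tourLE_two_of_cover (hsep : IsSep G ty) (hno : NoCross G ty) {s t : V}
    (hcov : ∀ a u, OutEdge G ty A a u → a = s ∨ a = t ∨ u = s ∨ u = t)
    (hfew : ∀ b₁ u₁ b₂ u₂ b₃ u₃, OutEdge G ty B b₁ u₁ → OutEdge G ty B b₂ u₂ →
      OutEdge G ty B b₃ u₃ → (b₁, u₁) = (b₂, u₂) ∨ (b₁, u₁) = (b₃, u₃) ∨ (b₂, u₂) = (b₃, u₃))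
    (hmany : ∀ z, ∃ a₁ u₁ a₂ u₂ a₃ u₃, OutEdge G ty A a₁ u₁ ∧ OutEdge G ty A a₂ u₂ ∧
      OutEdge G ty A a₃ u₃ ∧ (a₁, u₁) ≠ (a₂, u₂) ∧ (a₁, u₁) ≠ (a₃, u₃) ∧ (a₂, u₂) ≠ (a₃, u₃) ∧
      a₁ ≠ z ∧ a₂ ≠ z ∧ a₃ ≠ z) : TourLE G ty 7 2 := by
  have hout : ∀ {p c d : VClass}, Opp c d → ∀ {w u : V}, G.Adj w u → ty w = p → ty u = c →
      OutEdge G ty p w u := fun hcd _ _ f hw hu => ⟨f, hw, by rw [hu]; exact hcd.not_isW.1⟩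
  have exB : ∀ {c d : VClass}, Opp c d → ∃ b u, G.Adj b u ∧ ty b = B ∧ ty u = c := by
    intro c d hcd
    obtain ⟨w, u, f, hw, hu, n1, n2, n3, n4⟩ := hsep.exists_outEdge hno hcd s t
    refine ⟨w, u, f, hw.resolve_left fun h => ?_, hu⟩
    rcases hcov w u (hout hcd f h hu) with h | h | h | h <;> contradiction
  have onlyB : ∀ {c d : VClass} {b u b' u' : V}, Opp c d → G.Adj b u → ty b = B → ty u = c →
      G.Adj b' u' → ty b' = B → ty u' = c → u' = u := by
    intro c d b u b' u' hcd f hb hu f' hb' hu'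
    obtain ⟨b₂, v, f2, hb₂, hv⟩ := exB hcd.symm
    have := hcd.ne
    rcases hfew b u b' u' b₂ v (hout hcd f hb hu) (hout hcd f' hb' hu') (hout hcd.symm f2 hb₂ hv)
      with h | h | h <;> grind
  -- both covering vertices lie in `A` and have suitable neighbours in both classes
  have half : ∀ {s t : V}, (∀ a u, OutEdge G ty A a u → a = s ∨ a = t ∨ u = s ∨ u = t) →
      ∀ {c d : VClass} {b u : V}, Opp c d → G.Adj b u → ty b = B → ty u = c →
      ∃ w y, G.Adj w y ∧ ty w = A ∧ ty y = c ∧ w ≠ t ∧ y ≠ u ∧ (w = s ∨ y = s) := by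
    intro s t hcov c d b u hcd f hb hu
    obtain ⟨w, y, e, hw, hy, n1, n2, n3, n4⟩ := hsep.exists_outEdge hno hcd t u
    have hwA : ty w = A := hw.resolve_right fun h => n4 (onlyB hcd f hb hu e h hy)
    have := hcov w y (hout hcd e hwA hy)
    exact ⟨w, y, e, hwA, hy, n1, n4, by tauto⟩
  have full : ∀ {s t : V}, (∀ a u, OutEdge G ty A a u → a = s ∨ a = t ∨ u = s ∨ u = t) →
      ty s = A ∧ s ≠ t ∧ ∀ {c d : VClass} {b u : V}, Opp c d → G.Adj b u → ty b = B → ty u = c →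
        ∃ y, G.Adj s y ∧ ty y = c ∧ y ≠ u := by
    intro s t hcov
    have hcd : Opp V₁ V₂ := .inl ⟨rfl, rfl⟩
    obtain ⟨b, u, f, hb, hu⟩ := exB hcd
    obtain ⟨b', v, f', hb', hv⟩ := exB hcd.symm
    obtain ⟨w, y, e, hw, hy, n1, n2, h1⟩ := half hcov hcd f hb hu
    obtain ⟨w', y', e', hw', hy', n1', n2', h1'⟩ := half hcov hcd.symm f' hb' hv
    have hsA : ty s = A := by
      rcases h1 with rfl | rfl
      · exact hw
      · rcases h1' with rfl | rfl
        · exact hw'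
        · simp [hy] at hy'
    refine ⟨hsA, ?_, ?_⟩
    · rcases h1 with rfl | rfl
      · exact n1
      · simp [hsA] at hy
    · intro c d b u hcd f hb hu
      obtain ⟨w, y, e, hw, hy, n1, n2, h1⟩ := half hcov hcd f hb hu
      rcases h1 with rfl | rfl
      · exact ⟨y, e, hy, n2⟩
      · exact absurd (by rw [← hy, hsA]; exact .inl rfl) hcd.not_isW.1
  obtain ⟨hsA, hst, hs⟩ := full hcov
  obtain ⟨htA, -, -⟩ := full (s := t) (t := s) (fun a u h => by have := hcov a u h; tauto)
  have fin : ∀ {c d : VClass}, Opp c d → ∀ {y₁ y₂ : V}, ty y₁ = c → ty y₂ = c → G.Adj t y₁ →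
      G.Adj t y₂ → y₁ ≠ y₂ → TourLE G ty 7 2 := by
    intro c d hcd y₁ y₂ h1 h2 e1 e2 hne
    obtain ⟨b, u, f, hb, hu⟩ := exB hcd
    obtain ⟨b', v, f', hb', hv⟩ := exB hcd.symm
    obtain ⟨y, e, hy, -⟩ := hs hcd f hb hu
    obtain ⟨y', e', hy', hne'⟩ := hs hcd.symm f' hb' hv
    have key : ∀ {z : V}, ty z = c → G.Adj t z → y ≠ z → TourLE G ty 7 2 := by
      intro z hz g hyz
      exact ((IsPair.mk (.inl hsA) (.inl htA) hy hz e g hst hyz).hasTour hcd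
        (IsPair.mk (.inl hsA) (.inr hb') hy' hv e' f' (by grind) hne') (by grind)
        (by grind)).tourLE (by omega) (by rw [hsA, htA, hb']; rfl)
    by_cases h : y = y₁
    · exact key h2 e2 (by grind)
    · exact key h1 e1 h
  obtain ⟨a₁, u₁, a₂, u₂, a₃, u₃, e1, e2, e3, n1, n2, n3, m1, m2, m3⟩ := hmany s
  have att : ∀ {a u : V}, OutEdge G ty A a u → a ≠ s → a = t := by
    rintro a u ⟨e, ha, hu⟩ hne
    have hus : u ≠ s := by rintro rfl; exact hu (by rw [hsA]; exact .inl rfl)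
    have hut : u ≠ t := by rintro rfl; exact hu (by rw [htA]; exact .inl rfl)
    have := hcov a u ⟨e, ha, hu⟩
    tauto
  obtain rfl := att e1 m1
  obtain rfl := att e2 m2
  obtain rfl := att e3 m3
  obtain ⟨d, hcd⟩ := VClass.Opp.class_cases e1.2.2
  have cl : ∀ {v}, ¬ IsW (ty v) → ty v = ty u₁ ∨ ty v = d := fun {v} h =>
    (hcd.cases (ty v)).imp id fun h' => h'.resolve_right h
  rcases cl e2.2.2 with c2 | c2
  · exact fin hcd rfl c2 e1.1 e2.1 (by grind)
  rcases cl e3.2.2 with c3 | c3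
  · exact fin hcd rfl c3 e1.1 e3.1 (by grind)
  · exact fin hcd.symm c2 c3 e2.1 e3.1 (by grind)

end SimpleGraph

/-! ### The conclusion of the case |A| = |B| + 1. -/

namespace SimpleGraph

open VClass

variable {V : Type*} {G : SimpleGraph V} {ty : V → VClass}

/-- If A sends no edge to V₁ ∪ V₂, a quadruple has all its vertices in B and three edges inside A
raise −4 to 2. Otherwise a quadruple through the vertex `a` from `h4` is used; according to its
number of vertices in A, edges inside A are added or `IsQuad.tourLE_two_of_three` applies. -/
theorem IsSep.tourLE_two_of_twoIn (hsep : IsSep G ty) (hno : NoCross G ty)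
    (hB : (∃ b b', InEdge G ty B b b') ∨ ∃ b u, OutEdge G ty B b u)
    (h2 : TwoIn G ty A)
    (h3 : (∀ a u, ¬ OutEdge G ty A a u) → ∀ y s t, ∃ a a', InEdge G ty A a a' ∧ a ≠ y ∧ a' ≠ y ∧
      ¬ (a = s ∧ a' = t) ∧ ¬ (a = t ∧ a' = s))
    (h4 : (∃ a u, OutEdge G ty A a u) → ∃ a u e e', OutEdge G ty A a u ∧ InEdge G ty A e e' ∧
      e ≠ a ∧ e' ≠ a) : TourLE G ty 7 2 := by
  have hcd : Opp V₁ V₂ := .inl ⟨rfl, rfl⟩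
  have hAB : OppW A B := .inl ⟨rfl, rfl⟩
  by_cases hex : ∃ a u, OutEdge G ty A a u
  swap
  · push Not at hex
    obtain ⟨a, a', -⟩ := h2
    obtain ⟨w, u, f, hw, hu, -⟩ := hsep.exists_outEdge hno hcd a a
    obtain ⟨w₂, w₃, w₄, hQ⟩ := hsep.exists_quad_of_edge hno hcd f hw hu
    have isB : ∀ {c d : VClass} {w w' : V}, Opp c d → IsPair G ty c w w' → ty w = B ∧ ty w' = B := by
      rintro c d w w' hcd ⟨i1, i2, -, u, u', -, hu, hu', f, f'⟩
      exact ⟨i1.resolve_left fun h => hex w u ⟨f, h, by rw [hu]; exact hcd.not_isW.1⟩,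
        i2.resolve_left fun h => hex w' u' ⟨f', h, by rw [hu']; exact hcd.not_isW.1⟩⟩
    have hT := hQ.hasTour
    obtain ⟨c, d, hcd', p1, p2, -, -⟩ := hQ
    obtain ⟨b1, b2⟩ := isB hcd' p1
    obtain ⟨b3, b4⟩ := isB hcd'.symm p2
    refine (hT.add_three_inEdges (p := A) (.inl rfl) ?_ ?_ (v₀ := a) (h3 hex)).tourLE
      (by omega) (by rw [b1, b2, b3, b4]; rfl)
    · rintro v hv (h | h)
      · exact h (.inl hv)
      · simp only [List.mem_cons, List.not_mem_nil, or_false] at h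
        grind
    · grind
  obtain ⟨a, u, e, e', ⟨f, ha, hu⟩, he, n1, n2⟩ := h4 hex
  obtain ⟨d, hcd'⟩ := VClass.Opp.class_cases hu
  obtain ⟨w₂, w₃, w₄, hQ⟩ := hsep.exists_quad_of_edge hno hcd' f (.inl ha) rfl
  obtain ⟨a₁, a₁', a₂, a₂', g1, g2, m1, m2⟩ := h2
  have other : ∀ s t, ∃ x y, InEdge G ty A x y ∧ ¬ (x = s ∧ y = t) ∧ ¬ (x = t ∧ y = s) := by
    intro s t
    by_cases h : (a₁ = s ∧ a₁' = t) ∨ (a₁ = t ∧ a₁' = s)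
    · exact ⟨a₂, a₂', g2, by grind, by grind⟩
    · exact ⟨a₁, a₁', g1, by tauto, by tauto⟩
  have balanced : ∀ {w₁ w₂ w₃ w₄ s t : V}, IsQuad G ty w₁ w₂ w₃ w₄ →
      sgn (ty w₁) + sgn (ty w₂) + sgn (ty w₃) + sgn (ty w₄) = 0 →
      (∀ v, ty v = A → v ∈ [w₁, w₂, w₃, w₄] → v = s ∨ v = t) →
      (∀ v, ty v = A → ¬ ((v = w₁ ∨ v = w₂) ∧ (v = w₃ ∨ v = w₄))) → TourLE G ty 7 2 := by
    intro w₁ w₂ w₃ w₄ s t hQ hs hS hI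
    obtain ⟨x, y, hxy, k1, k2⟩ := other s t
    exact (hQ.tourLE_add_one hAB hS hI hxy k1 k2).of_le (by omega) (by rw [hs]; rfl)
  -- If the two vertices in A coincide, the vertex `a` is inner and the edge `ee'` is needed, which
  -- avoids it.
  have third : ∀ {w₃ w₄ : V}, IsQuad G ty a w₂ w₃ w₄ → ty w₂ = B → ty w₃ = A → ty w₄ = B →
      TourLE G ty 7 2 := by
    intro w₃ w₄ hQ h2 h3 h4
    by_cases h : w₃ = a
    · subst h
      refine ((hQ.hasTour.add_edge he.1 (by rw [he.2.1, he.2.2]) ?_ ?_).tourLE (c' := 2)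
        (by omega) (by rw [h3, h2, h4, he.2.1, he.2.2]; rfl))
      · rintro (h | h)
        · exact h (.inl he.2.1)
        · simp only [List.mem_cons, List.not_mem_nil, or_false] at h
          have := he.2.1
          grind
      · have := he.2.2
        grind
    · refine balanced (s := a) (t := w₃) hQ (by rw [ha, h2, h3, h4]; rfl) ?_ ?_
      · intro v hv hm
        simp only [List.mem_cons, List.not_mem_nil, or_false] at hm
        grind
      · grind
  obtain ⟨-, i2, i3, i4⟩ := hQ.isW
  rcases i2 with h2 | h2 <;> rcases i3 with h3 | h3 <;> rcases i4 with h4 | h4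
  · exact hQ.tourLE_two_of_three hB ha h2 h3
  · exact hQ.tourLE_two_of_three hB ha h2 h3
  · exact hQ.swap.swap_left.swap.tourLE_two_of_three hB ha h2 h4
  · refine balanced (s := a) (t := w₂) hQ (by rw [ha, h2, h3, h4]; rfl) ?_ ?_
    · intro v hv hm
      simp only [List.mem_cons, List.not_mem_nil, or_false] at hm
      grind
    · grind
  · exact hQ.swap.tourLE_two_of_three hB h3 h4 ha
  · exact third hQ h2 h3 h4
  · exact third hQ.swap.swap_left.swap h2 h4 h3
  · obtain ⟨x, y, hxy, k1, k2⟩ := other e e'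
    refine (hQ.tourLE_add_two hAB (s := a) ?_ ?_ he hxy n1 n2 (by grind) (by grind)).of_le
      (by omega) (by rw [ha, h2, h3, h4]; rfl)
    · intro v hv hm
      simp only [List.mem_cons, List.not_mem_nil, or_false] at hm
      grind
    · grind

/-- Two disjoint edges exist unless some vertex covers all edges. -/
theorem exists_disjoint_outEdges {p : VClass} (hp : IsW p) (v₀ : V)
    (h : ∀ z, ∃ a u, OutEdge G ty p a u ∧ a ≠ z ∧ u ≠ z) :
    ∃ a₁ u₁ a₂ u₂, OutEdge G ty p a₁ u₁ ∧ OutEdge G ty p a₂ u₂ ∧ a₁ ≠ a₂ ∧ u₁ ≠ u₂ := by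
  obtain ⟨a₁, u₁, e₁, -⟩ := h v₀
  obtain ⟨a₂, u₂, e₂, n, -⟩ := h a₁
  by_cases hu : u₁ = u₂
  · subst hu
    obtain ⟨a₃, u₃, e₃, -, n'⟩ := h u₁
    by_cases ha : a₃ = a₁
    · exact ⟨a₂, u₁, a₃, u₃, e₂, e₃, fun h => n (h.trans ha), n'.symm⟩
    · exact ⟨a₁, u₁, a₃, u₃, e₁, e₃, Ne.symm ha, n'.symm⟩
  · exact ⟨a₁, u₁, a₂, u₂, e₁, e₂, n.symm, hu⟩

/-- The case where the two classes of the bipartite part differ by one in size. -/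
theorem IsSep.tourLE_two [Nonempty V] (hsep : IsSep G ty)
    (hB : NoCross G ty → (∃ b b', InEdge G ty B b b') ∨ ∃ b u, OutEdge G ty B b u)
    (h0 : (∀ a a', ¬ InEdge G ty A a a') →
      ((∃ b b', InEdge G ty B b b') ∨ ∃ b u, OutEdge G ty B b u) →
      ¬ ∃ s t, ∀ a u, OutEdge G ty A a u → a = s ∨ a = t ∨ u = s ∨ u = t)
    (h1 : ¬ TwoIn G ty A → (∃ b₁ u₁ b₂ u₂ b₃ u₃, OutEdge G ty B b₁ u₁ ∧ OutEdge G ty B b₂ u₂ ∧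
      OutEdge G ty B b₃ u₃ ∧ (b₁, u₁) ≠ (b₂, u₂) ∧ (b₁, u₁) ≠ (b₃, u₃) ∧ (b₂, u₂) ≠ (b₃, u₃)) →
      ¬ ∃ s t, ∀ a u, OutEdge G ty A a u → a = s ∨ a = t ∨ u = s ∨ u = t)
    (h2 : (∃ a a', InEdge G ty A a a') ∨ NoCross G ty → ¬ TwoIn G ty A → ∀ z,
      ∃ a₁ u₁ a₂ u₂ a₃ u₃, OutEdge G ty A a₁ u₁ ∧ OutEdge G ty A a₂ u₂ ∧
      OutEdge G ty A a₃ u₃ ∧ (a₁, u₁) ≠ (a₂, u₂) ∧ (a₁, u₁) ≠ (a₃, u₃) ∧ (a₂, u₂) ≠ (a₃, u₃) ∧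
      (a₁ ≠ z ∧ u₁ ≠ z) ∧ (a₂ ≠ z ∧ u₂ ≠ z) ∧ a₃ ≠ z ∧ u₃ ≠ z)
    (h3 : (∀ a u, ¬ OutEdge G ty A a u) → ∀ y s t, ∃ a a', InEdge G ty A a a' ∧ a ≠ y ∧ a' ≠ y ∧
      ¬ (a = s ∧ a' = t) ∧ ¬ (a = t ∧ a' = s))
    (h4 : NoCross G ty → TwoIn G ty A → (∃ a u, OutEdge G ty A a u) →
      ∃ a u e e', OutEdge G ty A a u ∧ InEdge G ty A e e' ∧ e ≠ a ∧ e' ≠ a) :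
    TourLE G ty 7 2 := by
  have triple : (¬ ∃ s t, ∀ a u, OutEdge G ty A a u → a = s ∨ a = t ∨ u = s ∨ u = t) →
      ∃ a₁ u₁ a₂ u₂ a₃ u₃, OutTriple G ty A a₁ u₁ a₂ u₂ a₃ u₃ := by
    intro h
    by_contra! hcon
    exact h (exists_cover_of_no_outTriple (.inl rfl) hcon)
  have hcd : Opp V₁ V₂ := .inl ⟨rfl, rfl⟩
  by_cases hno : NoCross G ty
  · by_cases hT : TwoIn G ty A
    · exact hsep.tourLE_two_of_twoIn hno (hB hno) hT h3 (h4 hno hT)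
    have h2' := h2 (.inr hno) hT
    by_cases hM : ∃ a₁ u₁ a₂ u₂ a₃ u₃, OutTriple G ty A a₁ u₁ a₂ u₂ a₃ u₃
    · obtain ⟨a₁, u₁, a₂, u₂, a₃, u₃, hN⟩ := hM
      obtain ⟨b₁, v₁, b₂, v₂, b₃, v₃, e1, e2, e3, n1, n2, n3, m1, m2, m3⟩ := h2' a₁
      -- None of these three edges starts at `a₁`, so at least one of them is not in the triple.
      by_cases k1 : (b₁, v₁) ≠ (a₂, u₂) ∧ (b₁, v₁) ≠ (a₃, u₃)
      · exact hsep.tourLE_two_of_triple hno (hB hno) hN e1 (by grind) k1.1 k1.2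
      by_cases k2 : (b₂, v₂) ≠ (a₂, u₂) ∧ (b₂, v₂) ≠ (a₃, u₃)
      · exact hsep.tourLE_two_of_triple hno (hB hno) hN e2 (by grind) k2.1 k2.2
      · exact hsep.tourLE_two_of_triple hno (hB hno) hN e3 (by grind) (by grind) (by grind)
    · have hin : ∃ a a', InEdge G ty A a a' := by
        by_contra! hin
        exact hM (triple (h0 hin (hB hno)))
      have hcov := mt triple hM
      push Not at hcov
      obtain ⟨s, t, hst⟩ := hcov
      refine hsep.tourLE_two_of_cover hno hst ?_ ?_
      · intro b₁ u₁ b₂ u₂ b₃ u₃ e1 e2 e3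
        by_contra! hcon
        exact h1 hT ⟨b₁, u₁, b₂, u₂, b₃, u₃, e1, e2, e3, hcon.1, hcon.2.1, hcon.2.2⟩ ⟨s, t, hst⟩
      · intro z
        obtain ⟨b₁, v₁, b₂, v₂, b₃, v₃, e1, e2, e3, n1, n2, n3, m1, m2, m3⟩ := h2' z
        exact ⟨b₁, v₁, b₂, v₂, b₃, v₃, e1, e2, e3, n1, n2, n3, m1.1, m2.1, m3.1⟩
  simp only [NoCross, not_forall, not_not] at hno
  obtain ⟨x, y, hx, hy, hxy⟩ := hno
  have hstar0 : (∀ a a', ¬ InEdge G ty A a a') → (∃ b u, OutEdge G ty B b u) →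
      ∃ a₁ u₁ a₂ u₂ a₃ u₃, OutTriple G ty A a₁ u₁ a₂ u₂ a₃ u₃ :=
    fun h h' => triple (h0 h (.inr h'))
  have hstar1 := fun h h' => triple (h1 h h')
  by_cases hx' : ∀ x' y', ty x' = V₁ → ty y' = V₂ → G.Adj x' y' → x' = x
  · exact hsep.tourLE_two_of_star hcd hx hy hxy hx' hstar0 hstar1
  by_cases hy' : ∀ y' x', ty y' = V₂ → ty x' = V₁ → G.Adj y' x' → y' = y
  · exact hsep.tourLE_two_of_star hcd.symm hy hx hxy.symm hy' hstar0 hstar1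
  push Not at hx' hy'
  obtain ⟨x₁, y₁, hx₁, hy₁, e₁, n₁⟩ := hx'
  obtain ⟨y₂, x₂, hy₂, hx₂, e₂, n₂⟩ := hy'
  have hyp : TwoIn G ty A ∨
      (∃ a a' a₁ u₁ a₂ u₂, InEdge G ty A a a' ∧ OutEdge G ty A a₁ u₁ ∧ OutEdge G ty A a₂ u₂ ∧
        a₁ ≠ a₂ ∧ u₁ ≠ u₂) ∨
      ∃ a₁ u₁ a₂ u₂ a₃ u₃, OutTriple G ty A a₁ u₁ a₂ u₂ a₃ u₃ := by
    by_cases hT : TwoIn G ty A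
    · exact .inl hT
    right
    by_cases hin : ∃ a a', InEdge G ty A a a'
    · left
      obtain ⟨a, a', ha⟩ := hin
      obtain ⟨a₁, u₁, a₂, u₂, e1, e2, n1, n2⟩ := exists_disjoint_outEdges (p := A) (.inl rfl) a
        fun z => by
          obtain ⟨a₁, u₁, -, -, -, -, e, -, -, -, -, -, m, -⟩ := h2 (.inl ⟨a, a', ha⟩) hT z
          exact ⟨a₁, u₁, e, m.1, m.2⟩
      exact ⟨a, a', a₁, u₁, a₂, u₂, ha, e1, e2, n1, n2⟩
    · right
      push Not at hin
      by_cases hB' : ∃ b u, OutEdge G ty B b u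
      · exact hstar0 hin hB'
      · push Not at hB'
        refine triple ?_
        rintro ⟨s, t, hst⟩
        obtain ⟨w, u, f, hw, hu, k1, k2, k3, k4⟩ := hsep.exists_bip s t
        rcases hw with hw | hw
        · rcases hst w u ⟨f, hw, hu⟩ with h | h | h | h <;> contradiction
        · exact hB' w u ⟨f, hw, hu⟩
  by_cases hyy : y₁ = y
  · by_cases hxx : x₂ = x
    · exact hsep.tourLE_two_of_matching hcd hx₁ hx₂ hy₁ hy₂ e₁ e₂.symm (by grind) (by grind) hyp
    · exact hsep.tourLE_two_of_matching hcd hx hx₂ hy hy₂ hxy e₂.symm (by grind) (by grind) hyp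
  · exact hsep.tourLE_two_of_matching hcd hx hx₁ hy hy₁ hxy e₁ (by grind) (by grind) hyp

end SimpleGraph

/-! ### Bases for the case |A| ≥ |B| + 2. -/

namespace SimpleGraph

open VClass

variable {V : Type*} {G : SimpleGraph V} {ty : V → VClass}

/-- The path through `x₂` is a W–`d` link, so there are two W–`c` and two W–`d` links. -/
theorem hasTour_five_two_paths {c d : VClass} (hcd : Opp c d) {w₁ w₂ w₃ w₄ u₁ u₂ x₂ y₂ y₁ : V}
    (hw₁ : IsW (ty w₁)) (hw₂ : IsW (ty w₂)) (hw₃ : IsW (ty w₃)) (hw₄ : IsW (ty w₄))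
    (hu₁ : ty u₁ = c) (hu₂ : ty u₂ = c) (hx₂ : ty x₂ = c) (hy₂ : ty y₂ = d) (hy₁ : ty y₁ = d)
    (e0 : G.Adj w₁ u₁) (e1 : G.Adj w₂ u₂) (e2 : G.Adj w₃ x₂) (e3 : G.Adj x₂ y₂) (e4 : G.Adj w₄ y₁)
    (n0 : u₁ ≠ u₂) (n1 : u₁ ≠ x₂) (n2 : u₂ ≠ x₂) (n3 : y₁ ≠ y₂) (n4 : w₁ ≠ w₂) (n5 : w₁ ≠ w₃) (n6 : w₂ ≠ w₃) (n7 : w₁ ≠ w₄) (n8 : w₂ ≠ w₄) (n9 : w₃ ≠ w₄) :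
    HasTour G ty 5 (sgn (ty w₁) + sgn (ty w₂) + sgn (ty w₃) + sgn (ty w₄))
      (· ∈ [w₁, u₁, w₂, u₂, w₃, x₂, y₂, w₄, y₁])
      ((· = x₂)) := by
  refine ⟨[[w₁, u₁], [w₂, u₂], [w₃, x₂, y₂], [w₄, y₁]],
    ⟨?_, by simp, ?_, by simp, ?_, ?_⟩, by simp, by simp [inner]⟩
  · simp [e0, e0.symm, e1, e1.symm, e2, e2.symm, e3, e3.symm, e4, e4.symm]
  · simp only [IsW, Opp] at *
    simp only [List.flatten_cons, List.flatten_nil, List.cons_append, List.nil_append,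
      List.nodup_cons, List.mem_cons, List.not_mem_nil, or_false, not_or, List.nodup_nil]
    and_intros <;> grind
  · simp [pathWeight, hu₁, hu₂, hx₂, hy₂, hy₁, hw₁.wt_eq hcd, hw₂.wt_eq hcd, hw₃.wt_eq hcd, hw₄.wt_eq hcd, hcd.wt_eq,
      hcd.symm.wt_eq]
    try ring
  · rcases hcd with ⟨rfl, rfl⟩ | ⟨rfl, rfl⟩ <;>
      simp [pathLink, link, hu₁, hu₂, hx₂, hy₂, hy₁, hw₁.part_eq, hw₂.part_eq, hw₃.part_eq, hw₄.part_eq] <;>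
      constructor <;> simp [part]


/-- A set `X` of vertices outside the class `B` such that each vertex of `X` in `V₁ ∪ V₂` has
neighbours in the class `A` outside `X` and outside any given set of at most `M` vertices. -/
structure IsBig (G : SimpleGraph V) (ty : V → VClass) (M : ℕ) (X : Finset V) : Prop where
  ne_B : ∀ v ∈ X, ty v ≠ B
  exists_fresh : ∀ u ∈ X, ¬ IsW (ty u) → ∀ F : Finset V, #F ≤ M →
    ∃ a, ty a = A ∧ G.Adj a u ∧ a ∉ X ∧ a ∉ F

/-- An Eulerian path system with few edges, few vertices in `X`, and few inner vertices in `X₁`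
relative to its balance. -/
def HasBase [DecidableEq V] (G : SimpleGraph V) (ty : V → VClass) (X X₁ : Finset V) : Prop :=
  ∃ (k : ℕ) (c : ℤ) (S I : Finset V), HasTour G ty k c (· ∈ S) (· ∈ I) ∧ #S ≤ 16 ∧
    2 * ((#(X ∩ S) : ℤ) + #(X₁ ∩ I)) ≤ 4 + c ∧
    ((k : ℤ) + #(X₁ ∩ I) ≤ 6 + c ∨ ∀ w u, ¬ OutEdge G ty A w u) ∧ 2 * (k : ℤ) ≤ 12 + c ∧ Even c ∧
    c ≤ 4

variable [DecidableEq V] {X X₁ : Finset V} {M : ℕ}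

/-- The indicator function of a finite set. -/
def ind (X : Finset V) (v : V) : ℤ := if v ∈ X then 1 else 0

theorem ind_of_mem {v : V} (h : v ∈ X) : ind X v = 1 := by simp [ind, h]

theorem ind_of_notMem {v : V} (h : v ∉ X) : ind X v = 0 := by simp [ind, h]

theorem card_inter_toFinset_le (X : Finset V) (l : List V) :
    (#(X ∩ l.toFinset) : ℤ) ≤ (l.map (ind X)).sum := by
  induction l with
  | nil => simp
  | cons a l ih =>
    rw [List.toFinset_cons, List.map_cons, List.sum_cons]
    by_cases h : a ∈ X
    · rw [Finset.inter_insert_of_mem h, ind_of_mem h]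
      have := Finset.card_insert_le a (X ∩ l.toFinset)
      push_cast [← Int.ofNat_le] at this
      linarith
    · rw [Finset.inter_insert_of_notMem h, ind_of_notMem h]
      linarith

/-- Replacing the end of an edge in the bipartite part so that the vertices of `X` on the edge are
paid for by the weight of the edge. -/
theorem IsBig.exists_clean (hX : IsBig G ty M X) {w u : V} (e : G.Adj w u) (hw : IsW (ty w))
    (hu : ¬ IsW (ty u)) (F : Finset V) (hF : #F ≤ M) :
    ∃ w', G.Adj w' u ∧ IsW (ty w') ∧ (w' = w ∨ w' ∉ F) ∧
      2 * (ind X w' + ind X u) ≤ 1 + sgn (ty w') ∧ (ty w = A → ty w' = A) := by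
  -- An end `u` in `X` is paid for by a new end in A outside `X`. If `u` is not in `X`, only an end
  -- `w` in A can lie in `X`, and it pays for itself.
  by_cases h : u ∈ X
  · obtain ⟨a, ha, hau, haX, haF⟩ := hX.exists_fresh u h hu F hF
    refine ⟨a, hau, .inl ha, .inr haF, ?_, fun _ => ha⟩
    rw [ind_of_mem h, ind_of_notMem haX, ha]
    decide
  · refine ⟨w, e, hw, .inl rfl, ?_, id⟩
    rw [ind_of_notMem h]
    rcases hw with hw | hw
    · rw [hw]
      by_cases h' : w ∈ X
      · rw [ind_of_mem h']
        decide
      · rw [ind_of_notMem h']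
        decide
    · rw [hw, ind_of_notMem fun h' => hX.ne_B w h' hw]
      decide

/-- A criterion for the existence of a base when no vertex of `X₁` is an inner vertex. -/
theorem HasTour.hasBase {k : ℕ} {c : ℤ} {I : V → Prop} {l i l' : List V}
    (h : HasTour G ty k c (· ∈ l) I) (hl : l.length ≤ 16) (hI : ∀ v, I v → v ∈ i)
    (hi : ∀ v ∈ i, v ∉ X₁) (hl' : ∀ v ∈ l, v ∈ X → v ∈ l')
    (hs : 2 * (l'.map (ind X)).sum ≤ 4 + c) (hk : (k : ℤ) ≤ 6 + c) (hk' : 2 * (k : ℤ) ≤ 12 + c)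
    (hc : Even c ∧ c ≤ 4) :
    HasBase G ty X X₁ := by
  have h0 : X₁ ∩ i.toFinset = ∅ := by
    ext v
    simp only [Finset.mem_inter, List.mem_toFinset, Finset.notMem_empty, iff_false, not_and]
    exact fun h1 h2 => hi v h2 h1
  refine ⟨k, c, l.toFinset, i.toFinset, h.mono (by simp) (by simpa using hI),
    l.toFinset_card_le.trans hl, ?_, .inl ?_, hk', hc⟩
  · have h1 : #(X ∩ l.toFinset) ≤ #(X ∩ l'.toFinset) := by
      apply Finset.card_le_card
      intro v
      simp only [Finset.mem_inter, List.mem_toFinset]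
      exact fun hv => ⟨hv.1, hl' v hv.2 hv.1⟩
    have h2 := card_inter_toFinset_le X l'
    rw [h0, Finset.card_empty]
    push_cast
    have : (#(X ∩ l.toFinset) : ℤ) ≤ #(X ∩ l'.toFinset) := by exact_mod_cast h1
    linarith
  · rw [h0, Finset.card_empty]
    simpa using hk

theorem VClass.IsW.sgn_eq {c : VClass} (h : IsW c) : sgn c = 1 ∨ sgn c = -1 := by
  rcases h with rfl | rfl <;> simp [sgn]

theorem even_sgn_add {a b : VClass} (ha : IsW a) (hb : IsW b) :
    Even (sgn a + sgn b) ∧ sgn a + sgn b ≤ 4 := by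
  rcases ha.sgn_eq with h | h <;> rcases hb.sgn_eq with h' | h' <;> rw [h, h'] <;> decide

theorem even_sgn_add_four {a b c d : VClass} (ha : IsW a) (hb : IsW b) (hc : IsW c) (hd : IsW d) :
    Even (sgn a + sgn b + sgn c + sgn d) ∧ sgn a + sgn b + sgn c + sgn d ≤ 4 := by
  rcases ha.sgn_eq with h | h <;> rcases hb.sgn_eq with h' | h' <;> rcases hc.sgn_eq with k | k <;>
    rcases hd.sgn_eq with k' | k' <;> rw [h, h', k, k'] <;> decide

theorem sgn_bounds (c : VClass) : -1 ≤ sgn c ∧ sgn c ≤ 1 := by cases c <;> simp [sgn]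

/-- The base obtained from two paid edges to each of `V₁` and `V₂`. -/
theorem hasBase_square {c d : VClass} (hcd : Opp c d) (hX₁ : ∀ v ∈ X₁, ty v = A) (hXX : X₁ ⊆ X)
    {w₁ w₂ w₃ w₄ u₁ u₂ v₃ v₄ : V}
    (hw₁ : IsW (ty w₁)) (hw₂ : IsW (ty w₂)) (hw₃ : IsW (ty w₃)) (hw₄ : IsW (ty w₄))
    (hu₁ : ty u₁ = c) (hu₂ : ty u₂ = c) (hv₃ : ty v₃ = d) (hv₄ : ty v₄ = d)
    (e0 : G.Adj w₁ u₁) (e1 : G.Adj w₂ u₂) (e2 : G.Adj w₃ v₃) (e3 : G.Adj w₄ v₄)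
    (hu : u₁ ≠ u₂) (hv : v₃ ≠ v₄) (hw : w₁ ≠ w₂) (hw' : w₃ ≠ w₄)
    (h1 : ¬ (w₁ = w₃ ∧ w₂ = w₄)) (h2 : ¬ (w₁ = w₄ ∧ w₂ = w₃))
    (hs : 2 * (ind X w₁ + ind X u₁ + (ind X w₂ + ind X u₂) + (ind X w₃ + ind X v₃) +
      (ind X w₄ + ind X v₄)) ≤ 4 + (sgn (ty w₁) + sgn (ty w₂) + sgn (ty w₃) + sgn (ty w₄)))
    (hA : ty w₁ = A ∨ ty w₂ = A ∨ ty w₃ = A ∨ ty w₄ = A ∨ ∀ w u, ¬ OutEdge G ty A w u) :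
    HasBase G ty X X₁ := by
  have b1 := sgn_bounds (ty w₁)
  have b2 := sgn_bounds (ty w₂)
  have b3 := sgn_bounds (ty w₃)
  have b4 := sgn_bounds (ty w₄)
  refine ⟨4, _, [w₁, u₁, w₂, u₂, w₃, v₃, w₄, v₄].toFinset,
    [w₁, w₂].toFinset ∩ [w₃, w₄].toFinset, (hasTour_square hcd hw₁ hw₂ hw₃ hw₄ hu₁ hu₂ hv₃ hv₄
      e0 e1 e2 e3 hu hv hw hw' h1 h2).mono (by simp) (by simp), ?_, ?_, ?_, by push_cast; omega,
      even_sgn_add_four hw₁ hw₂ hw₃ hw₄⟩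
  · exact (List.toFinset_card_le _).trans (by simp)
  · have c1 := card_inter_toFinset_le X [w₁, u₁, w₂, u₂]
    have c2 := card_inter_toFinset_le X [w₃, v₃, w₄, v₄]
    simp only [List.map_cons, List.map_nil, List.sum_cons, List.sum_nil] at c1 c2
    -- A vertex of `X₁` that is inner belongs to both pairs, so inclusion and exclusion accounts for
    -- the term `#(X₁ ∩ I)`.
    have c3 := Finset.card_union_add_card_inter (X ∩ [w₁, u₁, w₂, u₂].toFinset)
      (X ∩ [w₃, v₃, w₄, v₄].toFinset)
    have c4 : #(X₁ ∩ ([w₁, w₂].toFinset ∩ [w₃, w₄].toFinset)) ≤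
        #((X ∩ [w₁, u₁, w₂, u₂].toFinset) ∩ (X ∩ [w₃, v₃, w₄, v₄].toFinset)) := by
      apply Finset.card_le_card
      intro v
      simp only [Finset.mem_inter, List.mem_toFinset, List.mem_cons, List.not_mem_nil, or_false]
      rintro ⟨hv, h3, h4⟩
      refine ⟨⟨hXX hv, ?_⟩, hXX hv, ?_⟩
      · rcases h3 with h3 | h3 <;> simp [h3]
      · rcases h4 with h4 | h4 <;> simp [h4]
    have c5 : X ∩ [w₁, u₁, w₂, u₂, w₃, v₃, w₄, v₄].toFinset =
        (X ∩ [w₁, u₁, w₂, u₂].toFinset) ∪ (X ∩ [w₃, v₃, w₄, v₄].toFinset) := by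
      rw [← Finset.inter_union_distrib_left, ← List.toFinset_append]
      rfl
    rw [c5]
    zify at c3 c4
    linarith
  · by_cases hA' : ∀ w u, ¬ OutEdge G ty A w u
    · exact .inr hA'
    left
    have hA := fun h => hA.imp_right fun hA => hA.imp_right fun hA => hA.imp_right fun hA =>
      hA.resolve_right h
    specialize hA hA'
    -- One end in A gives weight at least −2, which suffices if no vertex of `X₁` is inner. An inner
    -- vertex of `X₁` contributes two ends in A, so the weight is at least 0, and there are at most
    -- two such vertices.
    by_cases h0 : X₁ ∩ ([w₁, w₂].toFinset ∩ [w₃, w₄].toFinset) = ∅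
    · rw [h0, Finset.card_empty]
      have : sgn A = 1 := rfl
      rcases hA with h | h | h | h <;> rw [h] at * <;> push_cast <;> omega
    · obtain ⟨v, hv⟩ := Finset.nonempty_iff_ne_empty.2 h0
      have hc : #(X₁ ∩ ([w₁, w₂].toFinset ∩ [w₃, w₄].toFinset)) ≤ 2 :=
        (Finset.card_le_card (Finset.inter_subset_right.trans Finset.inter_subset_left)).trans
          (List.toFinset_card_le _)
      simp only [Finset.mem_inter, List.mem_toFinset, List.mem_cons, List.not_mem_nil,
        or_false] at hv
      obtain ⟨hv, hv1, hv2⟩ := hv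
      have hvA := hX₁ v hv
      have : sgn A = 1 := rfl
      rcases hv1 with rfl | rfl <;> rcases hv2 with rfl | rfl <;> rw [hvA] at * <;> push_cast <;>
        omega

/-- Cross edges form a star or contain two disjoint edges. For a star, a triangle is found directly;
for two disjoint edges, `IsSep.exists_isConn` applies. -/
theorem IsSep.exists_isConn_of_cross (hsep : IsSep G ty) (hno : ¬ NoCross G ty) :
    ∃ w w', IsConn G ty w w' := by
  have star : ∀ {c d : VClass}, Opp c d → ∀ {x y : V}, ty x = c → ty y = d → G.Adj x y →
      (∀ x' y', ty x' = c → ty y' = d → G.Adj x' y' → x' = x) → ∃ w w', IsConn G ty w w' := by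
    intro c d hcd x y hx hy hxy hstar
    obtain ⟨w, u, e, hw, hu, n1, -⟩ := hsep.exists_left_of_star hcd hx hstar x
    obtain ⟨w', v, v', e', hw', hv, hv', f, n2, n3⟩ :=
      hsep.exists_right_of_star hcd hx hy hxy hstar w
    exact ⟨w, w', isConn_triangle hcd hw hw' hu hx hv hv' e e' f n3.symm n1.symm n2⟩
  rw [NoCross] at hno
  push Not at hno
  obtain ⟨x, y, hx, hy, hxy⟩ := hno
  have hcd : Opp V₁ V₂ := .inl ⟨rfl, rfl⟩
  have mat : ∀ {x y x' y' : V}, ty x = V₁ → ty y = V₂ → G.Adj x y → ty x' = V₁ → ty y' = V₂ →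
      G.Adj x' y' → x ≠ x' → y ≠ y' → ∃ w w', IsConn G ty w w' := by
    intro x y x' y' hx hy hxy hx' hy' hxy' n1 n2
    obtain ⟨w₁, u₁, f₁, hw₁, hu₁, -⟩ := hsep.exists_bip x x
    obtain ⟨w₂, u₂, f₂, hw₂, hu₂, m1, -, -, m2⟩ := hsep.exists_bip w₁ u₁
    rcases hsep.exists_isConn hcd hx hx' hy hy' hxy hxy' n1 n2 hw₁ hw₂ hu₁ hu₂ f₁ f₂
      m1.symm m2.symm with h | ⟨w₃, -, h1, h2⟩
    · exact ⟨_, _, h⟩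
    · by_cases hw : w₃ = w₁
      · exact ⟨_, _, h2 (hw ▸ m1.symm)⟩
      · exact ⟨_, _, h1 hw⟩
  by_cases h : ∃ x' y', ty x' = V₁ ∧ ty y' = V₂ ∧ G.Adj x' y' ∧ x' ≠ x ∧ y' ≠ y
  · obtain ⟨x', y', hx', hy', hxy', n1, n2⟩ := h
    exact mat hx hy hxy hx' hy' hxy' n1.symm n2.symm
  push Not at h
  by_cases h1 : ∀ x' y', ty x' = V₁ → ty y' = V₂ → G.Adj x' y' → x' = x
  · exact star hcd hx hy hxy h1
  push Not at h1
  obtain ⟨x₁, y₁, hx₁, hy₁, e₁, n1⟩ := h1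
  have hy1 := h x₁ y₁ hx₁ hy₁ e₁ n1
  subst hy1
  by_contra hcon
  refine hcon (star hcd.symm hy hx hxy.symm fun y' x' hy' hx' e => ?_)
  by_contra hne
  have h2 : x' = x := by
    by_contra h3
    exact hne (h x' y' hx' hy' e.symm h3)
  subst h2
  exact hcon (mat hx' hy' e.symm hx₁ hy e₁ n1.symm hne)

/-- The two W–U edges are paid for and the bound in `HasBase` leaves room for one more vertex of
`X`. If both ends of the cross edge lie in `X`, it is replaced by fresh edges from A to these ends,
which turns the triangle into a square. -/
theorem IsBig.hasBase_of_triangle (hX : IsBig G ty M X) (hM : 4 ≤ M) (hX₁ : ∀ v ∈ X₁, ty v = A)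
    (hXX : X₁ ⊆ X) {c d : VClass} (hcd : Opp c d) {w₁ w₂ u₁ x u₂ y : V}
    (hw₁ : IsW (ty w₁)) (hw₂ : IsW (ty w₂))
    (hu₁ : ty u₁ = c) (hx : ty x = c) (hu₂ : ty u₂ = d) (hy : ty y = d)
    (e0 : G.Adj w₁ u₁) (e1 : G.Adj w₂ u₂) (e2 : G.Adj x y)
    (n0 : w₁ ≠ w₂) (n1 : x ≠ u₁) (n2 : y ≠ u₂)
    (s₁ : 2 * (ind X w₁ + ind X u₁) ≤ 1 + sgn (ty w₁))
    (s₂ : 2 * (ind X w₂ + ind X u₂) ≤ 1 + sgn (ty w₂)) : HasBase G ty X X₁ := by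
  obtain ⟨hc, hd⟩ := hcd.not_isW
  have b1 := sgn_bounds (ty w₁)
  have b2 := sgn_bounds (ty w₂)
  by_cases h : x ∈ X ∧ y ∈ X
  · obtain ⟨a, ha, hax, haX, haF⟩ := hX.exists_fresh x h.1 (hx ▸ hc) {w₁, w₂}
      ((Finset.card_le_two).trans (by omega))
    obtain ⟨a', ha', hay, haX', haF'⟩ := hX.exists_fresh y h.2 (hy ▸ hd) {w₁, w₂, a}
      ((Finset.card_le_three).trans (by omega))
    simp only [Finset.mem_insert, Finset.mem_singleton, not_or] at haF haF'
    refine hasBase_square hcd hX₁ hXX hw₁ (.inl ha) hw₂ (.inl ha') hu₁ hx hu₂ hy e0 hax e1 hay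
      n1.symm n2.symm (Ne.symm haF.1) (Ne.symm haF'.2.1) (fun h => n0 h.1)
      (fun h => haF.2 h.2) ?_ (.inr (.inl ha))
    rw [ind_of_notMem haX, ind_of_notMem haX', ind_of_mem h.1, ind_of_mem h.2, ha, ha',
      show sgn A = 1 from rfl]
    linarith
  · refine (hasTour_triangle hcd hw₁ hw₂ hu₁ hx hu₂ hy e0 e1 e2 n0 n1 n2).hasBase (i := [])
      (l' := [w₁, u₁, w₂, u₂, x, y]) (by simp) (by simp) (by simp) (by simp) ?_
      (by push_cast; linarith) (by push_cast; linarith) (even_sgn_add hw₁ hw₂)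
    have : ind X x + ind X y ≤ 1 := by
      unfold ind
      split <;> split <;> first | exact absurd ⟨‹_›, ‹_›⟩ h | norm_num
    simp only [List.map_cons, List.map_nil, List.sum_cons, List.sum_nil]
    linarith

/-- Again one vertex of `X` on the cross edges need not be paid for. If there are more, fresh edges
from A to two of them are added and pay for them; depending on their position, this gives a square,
a triangle, or a pattern with paths of two edges. -/
theorem IsBig.hasBase_of_double (hX : IsBig G ty M X) (hM : 4 ≤ M) (hX₁ : ∀ v ∈ X₁, ty v = A)
    (hXX : X₁ ⊆ X) {c d : VClass} (hcd : Opp c d) {w₁ w₂ u₁ u₂ x₁ x₂ y₁ y₂ : V}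
    (hw₁ : IsW (ty w₁)) (hw₂ : IsW (ty w₂))
    (hu₁ : ty u₁ = c) (hu₂ : ty u₂ = c) (hx₁ : ty x₁ = c) (hx₂ : ty x₂ = c)
    (hy₁ : ty y₁ = d) (hy₂ : ty y₂ = d)
    (e0 : G.Adj w₁ u₁) (e1 : G.Adj w₂ u₂) (e2 : G.Adj x₁ y₁) (e3 : G.Adj x₂ y₂)
    (hw : w₁ ≠ w₂) (hu : u₁ ≠ u₂) (hx : x₁ ≠ x₂) (hy : y₁ ≠ y₂)
    (h1 : ¬ (u₁ = x₁ ∧ u₂ = x₂)) (h2 : ¬ (u₁ = x₂ ∧ u₂ = x₁))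
    (s₁ : 2 * (ind X w₁ + ind X u₁) ≤ 1 + sgn (ty w₁))
    (s₂ : 2 * (ind X w₂ + ind X u₂) ≤ 1 + sgn (ty w₂)) : HasBase G ty X X₁ := by
  obtain ⟨hc, hd⟩ := hcd.not_isW
  have b1 := sgn_bounds (ty w₁)
  have b2 := sgn_bounds (ty w₂)
  have hcX : ∀ v, ty v = c → v ∉ X₁ := fun v hv h => hc (by rw [← hv, hX₁ v h]; exact .inl rfl)
  have sA : sgn A = 1 := rfl
  have fresh : ∀ u v : V, u ∈ X → ¬ IsW (ty u) → v ∈ X → ¬ IsW (ty v) → ∃ a a', ty a = A ∧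
      ty a' = A ∧ G.Adj a u ∧ G.Adj a' v ∧ a ∉ X ∧ a' ∉ X ∧ a ≠ w₁ ∧ a ≠ w₂ ∧ a' ≠ w₁ ∧ a' ≠ w₂ ∧
      a ≠ a' := by
    intro u v hu hu' hv hv'
    obtain ⟨a, ha, hax, haX, haF⟩ := hX.exists_fresh u hu hu' {w₁, w₂}
      ((Finset.card_le_two).trans (by omega))
    obtain ⟨a', ha', hay, haX', haF'⟩ := hX.exists_fresh v hv hv' {w₁, w₂, a}
      ((Finset.card_le_three).trans (by omega))
    simp only [Finset.mem_insert, Finset.mem_singleton, not_or] at haF haF'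
    exact ⟨a, a', ha, ha', hax, hay, haX, haX', haF.1, haF.2, haF'.1, haF'.2.1, Ne.symm haF'.2.2⟩
  -- a system with the given cross edges
  have double : ∀ l' : List V, (∀ v ∈ [w₁, u₁, w₂, u₂, x₁, y₁, x₂, y₂], v ∈ X →
      v ∈ w₁ :: u₁ :: w₂ :: u₂ :: l') → (l'.map (ind X)).sum ≤ 1 → HasBase G ty X X₁ := by
    intro l' hl' hs
    refine (hasTour_double hcd hw₁ hw₂ hu₁ hu₂ hx₁ hx₂ hy₁ hy₂ e0 e1 e2 e3 hw hu hx hy h1 h2).hasBase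
      (i := [x₁, x₂]) (by simp) (by simp) (by simp [hcX, hx₁, hx₂]) hl' ?_
      (by push_cast; linarith) (by push_cast; linarith) (even_sgn_add hw₁ hw₂)
    simp only [List.map_cons, List.sum_cons]
    linarith
  by_cases hyX : y₁ ∈ X ∧ y₂ ∈ X
  · obtain ⟨a, a', ha, ha', e, e', haX, haX', m1, m2, m3, m4, m5⟩ :=
      fresh y₁ y₂ hyX.1 (hy₁ ▸ hd) hyX.2 (hy₂ ▸ hd)
    refine hasBase_square hcd hX₁ hXX hw₁ hw₂ (.inl ha) (.inl ha') hu₁ hu₂ hy₁ hy₂ e0 e1 e e'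
      hu hy hw m5 (fun h => m1 h.1.symm) (fun h => m3 h.1.symm) ?_ (.inr (.inr (.inl ha)))
    rw [ind_of_notMem haX, ind_of_notMem haX', ind_of_mem hyX.1, ind_of_mem hyX.2, ha, ha', sA]
    linarith
  have half : ∀ {x₁ x₂ y₁ y₂ : V}, ty x₁ = c → ty x₂ = c → ty y₁ = d → ty y₂ = d → G.Adj x₁ y₁ →
      G.Adj x₂ y₂ → x₁ ≠ x₂ → y₁ ≠ y₂ → y₁ ∈ X → y₂ ∉ X →
      ((x₂ ∈ X → x₂ = u₁ ∨ x₂ = u₂) → x₁ ∉ X → HasBase G ty X X₁) → HasBase G ty X X₁ := by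
    intro x₁ x₂ y₁ y₂ hx₁ hx₂ hy₁ hy₂ e2 e3 hx hy k1 k2 hD
    by_cases k3 : x₁ ∈ X
    · obtain ⟨a, a', ha, ha', e, e', haX, haX', -, -, -, -, m5⟩ :=
        fresh x₁ y₁ k3 (hx₁ ▸ hc) k1 (hy₁ ▸ hd)
      refine hX.hasBase_of_triangle hM hX₁ hXX hcd (.inl ha) (.inl ha') hx₁ hx₂ hy₁ hy₂ e e' e3 m5
        hx.symm hy.symm ?_ ?_
      · rw [ha, ind_of_notMem haX, ind_of_mem k3, sA]
        norm_num
      · rw [ha', ind_of_notMem haX', ind_of_mem k1, sA]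
        norm_num
    by_cases k4 : x₂ ∈ X ∧ x₂ ≠ u₁ ∧ x₂ ≠ u₂
    · obtain ⟨k4, k5, k6⟩ := k4
      obtain ⟨a, a', ha, ha', e, e', haX, haX', m1, m2, m3, m4, m5⟩ :=
        fresh x₂ y₁ k4 (hx₂ ▸ hc) k1 (hy₁ ▸ hd)
      refine (hasTour_five_two_paths hcd hw₁ hw₂ (.inl ha) (.inl ha') hu₁ hu₂ hx₂ hy₂ hy₁ e0 e1 e e3
        e' hu k5.symm k6.symm hy hw m1.symm m2.symm m3.symm m4.symm m5).hasBase (i := [x₂])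
        (l' := [w₁, u₁, w₂, u₂, x₂, y₁]) (by simp) (by simp) (by simp [hcX, hx₂]) ?_ ?_ ?_ ?_
        (even_sgn_add_four hw₁ hw₂ (.inl ha) (.inl ha'))
      · intro v hv hvX
        simp only [List.mem_cons, List.not_mem_nil, or_false] at hv ⊢
        rcases hv with h | h | h | h | h | h | h | h | h <;>
        first
        | exact absurd (Eq.subst (motive := (· ∈ X)) h hvX) k2
        | exact absurd (Eq.subst (motive := (· ∈ X)) h hvX) haX
        | exact absurd (Eq.subst (motive := (· ∈ X)) h hvX) haX'
        | simp [h]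
      all_goals
        simp only [List.map_cons, List.map_nil, List.sum_cons, List.sum_nil, ind_of_mem k4,
          ind_of_mem k1, ha, ha', sA]
        push_cast
        linarith
    · refine hD (fun h => ?_) k3
      by_contra h'
      exact k4 ⟨h, not_or.1 h'⟩
  by_cases k1 : y₁ ∈ X
  · have k2 : y₂ ∉ X := fun h => hyX ⟨k1, h⟩
    refine half hx₁ hx₂ hy₁ hy₂ e2 e3 hx hy k1 k2 fun h h' => double [y₁] ?_ ?_
    · intro v hv hvX
      simp only [List.mem_cons, List.not_mem_nil, or_false] at hv ⊢
      rcases hv with h₁ | h₁ | h₁ | h₁ | h₁ | h₁ | h₁ | h₁ <;>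
        first
        | exact absurd (Eq.subst (motive := (· ∈ X)) h₁ hvX) k2
        | exact absurd (Eq.subst (motive := (· ∈ X)) h₁ hvX) h'
        | (simp [h₁]; done)
        | (rcases h (h₁ ▸ hvX) with h₂ | h₂ <;> simp [h₁, h₂])
    · simp [ind_of_mem k1]
  by_cases k2 : y₂ ∈ X
  · refine half hx₂ hx₁ hy₂ hy₁ e3 e2 hx.symm hy.symm k2 k1 fun h h' => double [y₂] ?_ ?_
    · intro v hv hvX
      simp only [List.mem_cons, List.not_mem_nil, or_false] at hv ⊢
      rcases hv with h₁ | h₁ | h₁ | h₁ | h₁ | h₁ | h₁ | h₁ <;>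
        first
        | exact absurd (Eq.subst (motive := (· ∈ X)) h₁ hvX) k1
        | exact absurd (Eq.subst (motive := (· ∈ X)) h₁ hvX) h'
        | (simp [h₁]; done)
        | (rcases h (h₁ ▸ hvX) with h₂ | h₂ <;> simp [h₁, h₂])
    · simp [ind_of_mem k2]
  have cov : ∀ {x : V}, ¬ (x ∈ X ∧ x ≠ u₁ ∧ x ≠ u₂) → x ∈ X → x = u₁ ∨ x = u₂ := by
    intro x h hx
    by_contra h'
    exact h ⟨hx, not_or.1 h'⟩
  by_cases k3 : x₁ ∈ X ∧ x₁ ≠ u₁ ∧ x₁ ≠ u₂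
  swap
  · refine double [x₂] ?_ ?_
    · intro v hv hvX
      simp only [List.mem_cons, List.not_mem_nil, or_false] at hv ⊢
      rcases hv with h₁ | h₁ | h₁ | h₁ | h₁ | h₁ | h₁ | h₁ <;>
        first
        | exact absurd (Eq.subst (motive := (· ∈ X)) h₁ hvX) k1
        | exact absurd (Eq.subst (motive := (· ∈ X)) h₁ hvX) k2
        | (simp [h₁]; done)
        | (rcases cov k3 (h₁ ▸ hvX) with h₂ | h₂ <;> simp [h₁, h₂])
    · unfold ind
      simp
      split <;> simp
  by_cases k4 : x₂ ∈ X ∧ x₂ ≠ u₁ ∧ x₂ ≠ u₂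
  swap
  · refine double [x₁] ?_ ?_
    · intro v hv hvX
      simp only [List.mem_cons, List.not_mem_nil, or_false] at hv ⊢
      rcases hv with h₁ | h₁ | h₁ | h₁ | h₁ | h₁ | h₁ | h₁ <;>
        first
        | exact absurd (Eq.subst (motive := (· ∈ X)) h₁ hvX) k1
        | exact absurd (Eq.subst (motive := (· ∈ X)) h₁ hvX) k2
        | (simp [h₁]; done)
        | (rcases cov k4 (h₁ ▸ hvX) with h₂ | h₂ <;> simp [h₁, h₂])
    · unfold ind
      simp
      split <;> simp
  obtain ⟨a, a', ha, ha', e, e', haX, haX', m1, m2, m3, m4, m5⟩ :=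
    fresh x₁ x₂ k3.1 (hx₁ ▸ hc) k4.1 (hx₂ ▸ hc)
  refine (hasTour_six_paths hcd hw₁ hw₂ (.inl ha) (.inl ha') hu₁ hu₂ hx₁ hx₂ hy₁ hy₂ e0 e1 e e' e2 e3
    hu k3.2.1.symm k4.2.1.symm k3.2.2.symm k4.2.2.symm hx hw m1.symm m2.symm m3.symm m4.symm m5
    hy).hasBase (i := [x₁, x₂]) (l' := [w₁, u₁, w₂, u₂, x₁, x₂]) (by simp) (by simp)
    (by simp [hcX, hx₁, hx₂]) ?_ ?_ ?_ ?_ (even_sgn_add_four hw₁ hw₂ (.inl ha) (.inl ha'))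
  · intro v hv hvX
    simp only [List.mem_cons, List.not_mem_nil, or_false] at hv ⊢
    rcases hv with h | h | h | h | h | h | h | h | h | h <;>
      first
      | exact absurd (Eq.subst (motive := (· ∈ X)) h hvX) k1
      | exact absurd (Eq.subst (motive := (· ∈ X)) h hvX) k2
      | exact absurd (Eq.subst (motive := (· ∈ X)) h hvX) haX
      | exact absurd (Eq.subst (motive := (· ∈ X)) h hvX) haX'
      | simp [h]
  all_goals
    simp only [List.map_cons, List.map_nil, List.sum_cons, List.sum_nil, ind_of_mem k3.1,
      ind_of_mem k4.1, ha, ha', sA]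
    push_cast
    linarith

/-- `IsBig.exists_clean` changes only the ends in W, so the shape of the connector survives. -/
theorem IsBig.hasBase_of_isConn (hX : IsBig G ty M X) (hM : 4 ≤ M) (hX₁ : ∀ v ∈ X₁, ty v = A)
    (hXX : X₁ ⊆ X) {w w' : V} (h : IsConn G ty w w') : HasBase G ty X X₁ := by
  obtain ⟨hw, hw', hne, c, d, u, u', hcd, e, e', hu, hcase⟩ := h
  obtain ⟨hc, hd⟩ := hcd.not_isW
  have hu' : ¬ IsW (ty u') := by
    rcases hcase with ⟨h, -⟩ | ⟨h, -⟩
    exacts [h ▸ hd, h ▸ hc]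
  obtain ⟨w₁, e₁, hw₁, n1, s₁, -⟩ := hX.exists_clean e hw (hu ▸ hc) {w, w'}
    ((Finset.card_le_two).trans (by omega))
  obtain ⟨w₂, e₂, hw₂, n2, s₂, -⟩ := hX.exists_clean e' hw' hu' {w, w', w₁}
    ((Finset.card_le_three).trans (by omega))
  simp only [Finset.mem_insert, Finset.mem_singleton, not_or] at n1 n2
  have hne' : w₁ ≠ w₂ := by grind
  rcases hcase with ⟨hu', x, y, hx, hy, f, n1, n2⟩ |
    ⟨hu', huu, x₁, x₂, y₁, y₂, hx₁, hx₂, hy₁, hy₂, f1, f2, n1, n2, n3, n4⟩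
  · exact hX.hasBase_of_triangle hM hX₁ hXX hcd hw₁ hw₂ hu hx hu' hy e₁ e₂ f hne' n1 n2 s₁ s₂
  · exact hX.hasBase_of_double hM hX₁ hXX hcd hw₁ hw₂ hu hu' hx₁ hx₂ hy₁ hy₂ e₁ e₂ f1 f2 hne' huu
      n1 n2 n3 n4 s₁ s₂

theorem IsBig.hasBase_of_isQuad (hX : IsBig G ty M X) (hM : 8 ≤ M) (hX₁ : ∀ v ∈ X₁, ty v = A)
    (hXX : X₁ ⊆ X) {w₁ w₂ w₃ w₄ : V} (h : IsQuad G ty w₁ w₂ w₃ w₄)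
    (hA : ty w₁ = A ∨ ∀ w u, ¬ OutEdge G ty A w u) : HasBase G ty X X₁ := by
  obtain ⟨c, d, hcd, ⟨hw₁, hw₂, hw, u₁, u₂, hu, hu₁, hu₂, e0, e1⟩,
    ⟨hw₃, hw₄, hw', v₃, v₄, hv, hv₃, hv₄, e2, e3⟩, h1, h2⟩ := h
  obtain ⟨hc, hd⟩ := hcd.not_isW
  have cd : ∀ a b c d e f g : V, #({a, b, c, d, e, f, g} : Finset V) ≤ M := fun a b c d e f g =>
    (Finset.card_insert_le _ _).trans ((Nat.add_le_add_right Finset.card_le_six 1).trans (by omega))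
  obtain ⟨a₁, f0, ha₁, m1, s₁, hA₁⟩ := hX.exists_clean e0 hw₁ (hu₁ ▸ hc) {w₁, w₁, w₁, w₁, w₂, w₃, w₄}
    (cd _ _ _ _ _ _ _)
  obtain ⟨a₂, f1, ha₂, m2, s₂, -⟩ := hX.exists_clean e1 hw₂ (hu₂ ▸ hc) {w₁, w₁, w₁, a₁, w₂, w₃, w₄}
    (cd _ _ _ _ _ _ _)
  obtain ⟨a₃, f2, ha₃, m3, s₃, -⟩ := hX.exists_clean e2 hw₃ (hv₃ ▸ hd) {w₁, w₁, a₂, a₁, w₂, w₃, w₄}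
    (cd _ _ _ _ _ _ _)
  obtain ⟨a₄, f3, ha₄, m4, s₄, -⟩ := hX.exists_clean e3 hw₄ (hv₄ ▸ hd) {w₁, a₃, a₂, a₁, w₂, w₃, w₄}
    (cd _ _ _ _ _ _ _)
  simp only [Finset.mem_insert, Finset.mem_singleton, not_or] at m1 m2 m3 m4
  refine hasBase_square hcd hX₁ hXX ha₁ ha₂ ha₃ ha₄ hu₁ hu₂ hv₃ hv₄ f0 f1 f2 f3 hu hv (by grind)
    (by grind) (by grind) (by grind) (by linarith) ?_
  rcases hA with h | h
  · exact .inl (hA₁ h)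
  · exact .inr (.inr (.inr (.inr h)))

/-- A connector if there is a cross edge, a quadruple otherwise. Without cross edges the quadruple
is started at an edge from A whenever there is one, as required for the bound on the number of edges
in `HasBase`. -/
theorem IsSep.hasBase (hsep : IsSep G ty) [Nonempty V] (hX : IsBig G ty M X) (hM : 8 ≤ M)
    (hX₁ : ∀ v ∈ X₁, ty v = A) (hXX : X₁ ⊆ X) : HasBase G ty X X₁ := by
  by_cases hno : NoCross G ty
  · by_cases h : ∀ w u, ¬ OutEdge G ty A w u
    · obtain ⟨v⟩ := ‹Nonempty V›
      obtain ⟨w, u, e, hw, hu, -⟩ := hsep.exists_bip v v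
      obtain ⟨d, hcd⟩ := VClass.Opp.class_cases hu
      obtain ⟨w₂, w₃, w₄, hQ⟩ := hsep.exists_quad_of_edge hno hcd e hw rfl
      exact hX.hasBase_of_isQuad hM hX₁ hXX hQ (.inr h)
    · push Not at h
      obtain ⟨w, u, e, hw, hu⟩ := h
      obtain ⟨d, hcd⟩ := VClass.Opp.class_cases hu
      obtain ⟨w₂, w₃, w₄, hQ⟩ := hsep.exists_quad_of_edge hno hcd e (.inl hw) rfl
      exact hX.hasBase_of_isQuad hM hX₁ hXX hQ (.inl hw)
  · obtain ⟨w, w', h⟩ := hsep.exists_isConn_of_cross hno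
    exact hX.hasBase_of_isConn (by omega) hX₁ hXX h

end SimpleGraph

/-! ### Extending a base to the required balance. -/

namespace SimpleGraph

open VClass

variable {V : Type*} {G : SimpleGraph V} {ty : V → VClass}

theorem HasTour.inner_and {k : ℕ} {c : ℤ} {S I : V → Prop} (h : HasTour G ty k c S I) :
    HasTour G ty k c S (fun v => I v ∧ S v) := by
  obtain ⟨L, h, hS, hI⟩ := h
  refine ⟨L, h, hS, fun v hv => ⟨hI v hv, hS v ?_⟩⟩
  rw [inner, List.mem_flatMap] at hv
  obtain ⟨p, hp, hv⟩ := hv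
  exact List.mem_flatten.2 ⟨p, hp, List.mem_of_mem_tail (List.mem_of_mem_dropLast hv)⟩

variable [DecidableEq V] {X X₁ X₂ : Finset V} {M : ℕ}

/-- There is an Eulerian path system with `k` edges, twice the balance `c` and at most `s` vertices
to which `C` edges ending at `X₁` and `L` short paths through `X₂` can be added. -/
def HasSupply (G : SimpleGraph V) (ty : V → VClass) (X₁ X₂ : Finset V) (k : ℕ) (c : ℤ)
    (s C L : ℕ) : Prop :=
  ∃ S I : Finset V, HasTour G ty k c (· ∈ S) (· ∈ I) ∧ I ⊆ S ∧ #S ≤ s ∧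
    C + #(X₁ ∩ S) + #(X₁ ∩ I) ≤ 2 * #X₁ ∧ L + #(X₂ ∩ S) ≤ #X₂

theorem card_inter_insert_le (X S : Finset V) (a : V) : #(X ∩ insert a S) ≤ #(X ∩ S) + 1 := by
  by_cases h : a ∈ X
  · rw [Finset.inter_insert_of_mem h]
    exact Finset.card_insert_le _ _
  · rw [Finset.inter_insert_of_notMem h]
    omega

theorem card_insert_two_le (S : Finset V) (a b : V) : #(insert a (insert b S)) ≤ #S + 2 := by
  have := Finset.card_insert_le a (insert b S)
  have := Finset.card_insert_le b S
  omega

/-- Adding an edge in `A` outside `X₁`. -/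
theorem HasSupply.add_inEdge {k s C L : ℕ} {c : ℤ} (h : HasSupply G ty X₁ X₂ k c s C L)
    (hE : ∀ F : Finset V, #F ≤ s → ∃ a a', InEdge G ty A a a' ∧ a ∉ X₁ ∧ a ∉ F ∧ a' ∉ X₁ ∧ a' ∉ F) :
    HasSupply G ty X₁ X₂ (k + 1) (c + 2) (s + 2) C (L - 2) := by
  obtain ⟨S, I, h, hIS, hs, hC, hL⟩ := h
  obtain ⟨a, a', ⟨haa, ha, ha'⟩, h1, h2, h3, h4⟩ := hE S hs
  refine ⟨insert a (insert a' S), insert a' I, (h.add_edge haa (by rw [ha, ha']) h2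
    (fun h => h4 (hIS h))).of_eq rfl (by rw [ha, ha']; rfl) ?_ ?_, ?_, ?_, ?_, ?_⟩
  · intro v hv
    simp only [Finset.mem_insert]
    tauto
  · intro v hv
    simp only [Finset.mem_insert]
    tauto
  · exact fun v hv => by
      rw [Finset.mem_insert] at hv
      simp only [Finset.mem_insert]
      exact .inr (hv.imp_right fun h => hIS h)
  · have := card_insert_two_le S a a'
    omega
  · rwa [Finset.inter_insert_of_notMem h1, Finset.inter_insert_of_notMem h3,
      Finset.inter_insert_of_notMem h3]
  · have := card_inter_insert_le X₂ (insert a' S) a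
    have := card_inter_insert_le X₂ S a'
    have : #(X₂ ∩ insert a (insert a' S)) ≤ #X₂ := Finset.card_le_card Finset.inter_subset_left
    omega

/-- Adding an edge in `A` outside `X₁ ∪ X₂`. -/
theorem HasSupply.add_free_inEdge {k s C L : ℕ} {c : ℤ} (h : HasSupply G ty X₁ X₂ k c s C L)
    (hE : ∀ F : Finset V, #F ≤ s → ∃ a a', InEdge G ty A a a' ∧ a ∉ X₁ ∪ X₂ ∧ a ∉ F ∧
      a' ∉ X₁ ∪ X₂ ∧ a' ∉ F) :
    HasSupply G ty X₁ X₂ (k + 1) (c + 2) (s + 2) C L := by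
  obtain ⟨S, I, h, hIS, hs, hC, hL⟩ := h
  obtain ⟨a, a', ⟨haa, ha, ha'⟩, h1, h2, h3, h4⟩ := hE S hs
  rw [Finset.mem_union, not_or] at h1 h3
  refine ⟨insert a (insert a' S), insert a' I, (h.add_edge haa (by rw [ha, ha']) h2
    (fun h => h4 (hIS h))).of_eq rfl (by rw [ha, ha']; rfl) ?_ ?_, ?_, ?_, ?_, ?_⟩
  · intro v hv
    simp only [Finset.mem_insert]
    tauto
  · intro v hv
    simp only [Finset.mem_insert]
    tauto
  · exact fun v hv => by
      rw [Finset.mem_insert] at hv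
      simp only [Finset.mem_insert]
      exact .inr (hv.imp_right fun h => hIS h)
  · have := card_insert_two_le S a a'
    omega
  · rwa [Finset.inter_insert_of_notMem h1.1, Finset.inter_insert_of_notMem h3.1,
      Finset.inter_insert_of_notMem h3.1]
  · rwa [Finset.inter_insert_of_notMem h1.2, Finset.inter_insert_of_notMem h3.2]

/-- Adding an edge ending at a vertex of `X₁`. -/
theorem HasSupply.add_leaf {k s C L : ℕ} {c : ℤ} (h : HasSupply G ty X₁ X₂ k c s (C + 1) L)
    (hdisj : Disjoint X₁ X₂)
    (hX₁ : ∀ x ∈ X₁, ∀ F : Finset V, #F ≤ s → ∃ a, InEdge G ty A x a ∧ a ∉ X₁ ∪ X₂ ∧ a ∉ F) :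
    HasSupply G ty X₁ X₂ (k + 1) (c + 2) (s + 2) C L := by
  obtain ⟨S, I, h, hIS, hs, hC, hL⟩ := h
  -- Each vertex of `X₁` can be used twice, first as a new vertex and then as an end turned into an
  -- inner vertex. The count `C + 1` ensures that one of these uses is left.
  by_cases hall : ∃ x ∈ X₁, x ∉ S
  · obtain ⟨x, hx, hxS⟩ := hall
    obtain ⟨a, ⟨hxa, hx', ha⟩, haX, haS⟩ := hX₁ x hx S hs
    rw [Finset.mem_union, not_or] at haX
    refine ⟨insert x (insert a S), insert a I, (h.add_edge hxa (by rw [ha, hx']) hxS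
      (fun h => haS (hIS h))).of_eq rfl (by rw [ha, hx']; rfl) ?_ ?_, ?_, ?_, ?_, ?_⟩
    · intro v hv
      simp only [Finset.mem_insert]
      tauto
    · intro v hv
      simp only [Finset.mem_insert]
      tauto
    · exact fun v hv => by
        rw [Finset.mem_insert] at hv
        simp only [Finset.mem_insert]
        exact .inr (hv.imp_right fun h => hIS h)
    · have := card_insert_two_le S x a
      omega
    · have := card_inter_insert_le X₁ (insert a S) x
      rw [Finset.inter_insert_of_notMem haX.1] at this ⊢
      omega
    · rwa [Finset.inter_insert_of_notMem (Finset.disjoint_left.1 hdisj hx),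
        Finset.inter_insert_of_notMem haX.2]
  · push Not at hall
    obtain ⟨x, hx, hxI⟩ : ∃ x ∈ X₁, x ∉ I := by
      by_contra hcon
      push Not at hcon
      rw [Finset.inter_eq_left.2 hall, Finset.inter_eq_left.2 hcon] at hC
      omega
    obtain ⟨a, ⟨hxa, hx', ha⟩, haX, haS⟩ := hX₁ x hx S hs
    rw [Finset.mem_union, not_or] at haX
    refine ⟨insert a S, insert x I, (h.add_edge hxa.symm (by rw [ha, hx']) haS
      hxI).of_eq rfl (by rw [ha, hx']; rfl) ?_ ?_, ?_, ?_, ?_, ?_⟩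
    · intro v hv
      simp only [Finset.mem_insert]
      rcases hv with hv | rfl | rfl
      exacts [.inr hv, .inl rfl, .inr (hall _ hx)]
    · intro v hv
      simp only [Finset.mem_insert]
      tauto
    · intro v hv
      rcases Finset.mem_insert.1 hv with rfl | hv
      exacts [Finset.mem_insert_of_mem (hall _ hx), Finset.mem_insert_of_mem (hIS hv)]
    · have := Finset.card_insert_le a S
      omega
    · have := card_inter_insert_le X₁ I x
      rw [Finset.inter_insert_of_notMem haX.1]
      omega
    · rwa [Finset.inter_insert_of_notMem haX.2]

/-- Adding a path with two edges through a vertex of `X₂`. -/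
theorem HasSupply.add_loop {k s C L : ℕ} {c : ℤ} (h : HasSupply G ty X₁ X₂ k c s C (L + 1))
    (hdisj : Disjoint X₁ X₂)
    (hX₂ : ∀ x ∈ X₂, ∀ F : Finset V, #F ≤ s → ∃ u u', G.Adj u x ∧ G.Adj x u' ∧ u ≠ u' ∧
      (ty u).part = (ty u').part ∧ u ∉ X₁ ∪ X₂ ∧ u ∉ F ∧ u' ∉ X₁ ∪ X₂ ∧ u' ∉ F ∧
      wt (ty u) (ty x) + wt (ty x) (ty u') = 2) :
    HasSupply G ty X₁ X₂ (k + 2) (c + 2) (s + 4) C L := by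
  obtain ⟨S, I, h, hIS, hs, hC, hL⟩ := h
  obtain ⟨x, hx, hxS⟩ : ∃ x ∈ X₂, x ∉ S := by
    by_contra hcon
    push Not at hcon
    rw [Finset.inter_eq_left.2 hcon] at hL
    omega
  obtain ⟨u, u', e, e', hne, hp, h1, h2, h3, h4, hw⟩ := hX₂ x hx S hs
  rw [Finset.mem_union, not_or] at h1 h3
  have hx₁ : x ∉ X₁ := Finset.disjoint_right.1 hdisj hx
  refine ⟨insert u (insert x (insert u' S)), insert x I,
    (h.add_cherry e e' hne h2 hxS h4 hp).of_eq rfl (by rw [hw]) ?_ ?_, ?_, ?_, ?_, ?_⟩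
  · intro v hv
    simp only [List.mem_cons, List.not_mem_nil, or_false] at hv
    simp only [Finset.mem_insert]
    tauto
  · intro v hv
    simp only [Finset.mem_insert]
    tauto
  · exact fun v hv => by
      rw [Finset.mem_insert] at hv
      simp only [Finset.mem_insert]
      rcases hv with hv | hv
      exacts [.inr (.inl hv), .inr (.inr (.inr (hIS hv)))]
  · have := card_insert_two_le (insert u' S) u x
    have := Finset.card_insert_le u' S
    omega
  · rwa [Finset.inter_insert_of_notMem h1.1, Finset.inter_insert_of_notMem hx₁,
      Finset.inter_insert_of_notMem h3.1, Finset.inter_insert_of_notMem hx₁]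
  · have := card_inter_insert_le X₂ (insert u' S) x
    rw [Finset.inter_insert_of_notMem h3.2] at this
    rw [Finset.inter_insert_of_notMem h1.2]
    omega

/-- Adding two edges between `A` and one of `V₁` and `V₂`. -/
theorem HasSupply.add_outEdges {k s C L : ℕ} {c : ℤ} (h : HasSupply G ty X₁ X₂ k c s C L)
    (hE : ∀ F : Finset V, #F ≤ s + 4 → ∃ a u, OutEdge G ty A a u ∧ a ∉ X₁ ∪ X₂ ∧ a ∉ F ∧
      u ∉ X₁ ∪ X₂ ∧ u ∉ F) :
    HasSupply G ty X₁ X₂ (k + 2) (c + 2) (s + 4) C L := by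
  obtain ⟨S, I, h, hIS, hs, hC, hL⟩ := h
  have pair : ∀ {a u a' u' : V}, OutEdge G ty A a u → OutEdge G ty A a' u' → a ∉ X₁ ∪ X₂ →
      u ∉ X₁ ∪ X₂ → a' ∉ X₁ ∪ X₂ → u' ∉ X₁ ∪ X₂ → a ∉ S → u ∉ S → a' ∉ S → u' ∉ S → a ≠ a' →
      u ≠ u' → (ty u).part = (ty u').part → HasSupply G ty X₁ X₂ (k + 2) (c + 2) (s + 4) C L := by
    intro a u a' u' e e' h1 h2 h3 h4 k1 k2 k3 k4 n1 n2 hp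
    have hA : ∀ {x y}, ty x = A → ¬ IsW (ty y) → x ≠ y := fun hx hy hxy => hy (hxy ▸ .inl hx)
    have hwt : ∀ {d}, ¬ IsW d → wt A d = 1 := by
      intro d
      cases d <;> simp [IsW, wt]
    rw [Finset.mem_union, not_or] at h1 h2 h3 h4
    refine ⟨insert a (insert u (insert a' (insert u' S))), I,
      (h.add_pair e.1 e'.1 ?_ ?_ (by rw [e.2.1, e'.2.1]) hp).of_eq rfl ?_ ?_ fun _ => id,
      ?_, ?_, ?_, ?_⟩
    · simp only [List.nodup_cons, List.mem_cons, List.not_mem_nil, or_false, not_or,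
        not_false_eq_true, List.nodup_nil, and_true]
      exact ⟨⟨hA e.2.1 e.2.2, n1, hA e.2.1 e'.2.2⟩, ⟨(hA e'.2.1 e.2.2).symm, n2⟩, hA e'.2.1 e'.2.2⟩
    · simp [k1, k2, k3, k4]
    · rw [e.2.1, e'.2.1, hwt e.2.2, hwt e'.2.2]
      rfl
    · intro v hv
      simp only [List.mem_cons, List.not_mem_nil, or_false] at hv
      simp only [Finset.mem_insert]
      tauto
    · intro v hv
      simp [hIS hv]
    · have := card_insert_two_le (insert a' (insert u' S)) a u
      have := card_insert_two_le S a' u'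
      omega
    · rwa [Finset.inter_insert_of_notMem h1.1, Finset.inter_insert_of_notMem h2.1,
        Finset.inter_insert_of_notMem h3.1, Finset.inter_insert_of_notMem h4.1]
    · rwa [Finset.inter_insert_of_notMem h1.2, Finset.inter_insert_of_notMem h2.2,
        Finset.inter_insert_of_notMem h3.2, Finset.inter_insert_of_notMem h4.2]
  -- Among three disjoint edges, two go to the same one of V₁ and V₂ and so preserve the parities.
  obtain ⟨a₁, u₁, e₁, p₁, q₁, r₁, s₁⟩ := hE S (by omega)
  obtain ⟨a₂, u₂, e₂, p₂, q₂, r₂, s₂⟩ := hE (insert a₁ (insert u₁ S))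
    ((card_insert_two_le _ _ _).trans (by omega))
  obtain ⟨a₃, u₃, e₃, p₃, q₃, r₃, s₃⟩ := hE (insert a₂ (insert u₂ (insert a₁ (insert u₁ S))))
    ((card_insert_two_le _ _ _).trans (by have := card_insert_two_le S a₁ u₁; omega))
  simp only [Finset.mem_insert, not_or] at q₂ s₂ q₃ s₃
  have hpart : ∀ {x y z : V}, ¬ IsW (ty x) → ¬ IsW (ty y) → ¬ IsW (ty z) →
      (ty x).part = (ty y).part ∨ (ty x).part = (ty z).part ∨ (ty y).part = (ty z).part := by
    intro x y z
    cases ty x <;> cases ty y <;> cases ty z <;> simp [IsW, part]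
  rcases hpart e₁.2.2 e₂.2.2 e₃.2.2 with h | h | h
  · exact pair e₁ e₂ p₁ r₁ p₂ r₂ q₁ s₁ q₂.2.2 s₂.2.2 (Ne.symm q₂.1) (Ne.symm s₂.2.1) h
  · exact pair e₁ e₃ p₁ r₁ p₃ r₃ q₁ s₁ q₃.2.2.2.2 s₃.2.2.2.2 (Ne.symm q₃.2.2.1)
      (Ne.symm s₃.2.2.2.1) h
  · exact pair e₂ e₃ p₂ r₂ p₃ r₃ q₂.2.2 s₂.2.2 q₃.2.2.2.2 s₃.2.2.2.2 (Ne.symm q₃.1)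
      (Ne.symm s₃.2.1) h

theorem HasSupply.tourLE {k s C L E : ℕ} {c c' : ℤ} (h : HasSupply G ty X₁ X₂ k c s C L)
    (hk : k ≤ E) (hc : c = c') : TourLE G ty E c' := by
  obtain ⟨S, I, h, -⟩ := h
  exact h.tourLE hk hc

theorem HasSupply.of_eq {k k' s s' C C' L L' : ℕ} {c c' : ℤ} (h : HasSupply G ty X₁ X₂ k c s C L)
    (hk : k = k') (hc : c = c') (hs : s ≤ s') (hC : C' ≤ C) (hL : L' ≤ L) :
    HasSupply G ty X₁ X₂ k' c' s' C' L' := by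
  subst hk hc
  obtain ⟨S, I, h, h1, h2, h3, h4⟩ := h
  exact ⟨S, I, h, h1, h2.trans hs, by omega, by omega⟩

/-- Completing a base to a path system of balance `t`. -/
theorem HasBase.tourLE (hbase : HasBase G ty (X₁ ∪ X₂) X₁) (hdisj : Disjoint X₁ X₂) {t ℓ m M : ℕ}
    (ht : 2 ≤ t) (htm : 2 * t ≤ 2 * ℓ + m) (hM : 4 * t + 50 ≤ M)
    (hX₁ : ∀ x ∈ X₁, ∀ F : Finset V, #F ≤ M → ∃ a, InEdge G ty A x a ∧ a ∉ X₁ ∪ X₂ ∧ a ∉ F)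
    (hX₂ : ∀ x ∈ X₂, ∀ F : Finset V, #F ≤ M → ∃ u u', G.Adj u x ∧ G.Adj x u' ∧ u ≠ u' ∧
      (ty u).part = (ty u').part ∧ u ∉ X₁ ∪ X₂ ∧ u ∉ F ∧ u' ∉ X₁ ∪ X₂ ∧ u' ∉ F ∧
      wt (ty u) (ty x) + wt (ty x) (ty u') = 2)
    (hout : (∀ w u, ¬ OutEdge G ty A w u) → X₂ = ∅)
    (hE : ∀ F : Finset V, #F + #X₁ + #X₁ + 2 ≤ 16 + ℓ + ℓ → #X₁ < ℓ →
      ∃ a a', InEdge G ty A a a' ∧ a ∉ X₁ ∧ a ∉ F ∧ a' ∉ X₁ ∧ a' ∉ F)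
    (hpoor : ∀ F F' : Finset V, #F ≤ M → #F' ≤ M →
      (∀ a a', InEdge G ty A a a' → a ∈ X₁ ∪ X₂ ∨ a ∈ F ∨ a' ∈ X₁ ∪ X₂ ∨ a' ∈ F) →
      (∀ a u, OutEdge G ty A a u → a ∈ X₁ ∪ X₂ ∨ a ∈ F' ∨ u ∈ X₁ ∪ X₂ ∨ u ∈ F') →
      t + 2 + (ℓ - #X₁) ≤ 2 * #X₁ + #X₂) : TourLE G ty (ℓ + m + 6) (2 * t) := by
  obtain ⟨k, c, S, I, h, hS, hXS, hk, hk', hev, hc4⟩ := hbase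
  obtain ⟨c, rfl⟩ := hev
  have hI : #(X₁ ∩ (I ∩ S)) ≤ #(X₁ ∩ I) :=
    Finset.card_le_card (Finset.inter_subset_inter_left Finset.inter_subset_left)
  have hle₁ : #(X₁ ∩ S) ≤ #X₁ := Finset.card_le_card Finset.inter_subset_left
  have hle₁' : #(X₁ ∩ (I ∩ S)) ≤ #X₁ := Finset.card_le_card Finset.inter_subset_left
  have hle₂ : #(X₂ ∩ S) ≤ #X₂ := Finset.card_le_card Finset.inter_subset_left
  have hunion : #((X₁ ∪ X₂) ∩ S) = #(X₁ ∩ S) + #(X₂ ∩ S) := by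
    rw [Finset.union_inter_distrib_right, Finset.card_union_of_disjoint]
    exact hdisj.mono Finset.inter_subset_left Finset.inter_subset_left
  obtain ⟨C, hC⟩ : ∃ C, C + #(X₁ ∩ S) + #(X₁ ∩ (I ∩ S)) = 2 * #X₁ :=
    ⟨2 * #X₁ - #(X₁ ∩ S) - #(X₁ ∩ (I ∩ S)), by omega⟩
  obtain ⟨L, hL⟩ : ∃ L, L + #(X₂ ∩ S) = #X₂ := ⟨#X₂ - #(X₂ ∩ S), by omega⟩
  have h0 : HasSupply G ty X₁ X₂ k (c + c) 16 C L :=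
    ⟨S, I ∩ S, h.inner_and.mono (fun _ => id) (by simp), Finset.inter_subset_right, hS, by omega,
      by omega⟩
  -- `N` is the balance still missing.
  obtain ⟨N, hN⟩ : ∃ N : ℕ, (N : ℤ) = t - c := ⟨(t - c).toNat, by omega⟩
  have hNt : N ≤ t + 6 := by omega
  -- Spread-out edges inside A cost one edge per unit of balance: the total is at most 6 + t ≤ 6 + ℓ
  -- + m.
  by_cases hA : ∀ F : Finset V, #F ≤ M → ∃ a a', InEdge G ty A a a' ∧ a ∉ X₁ ∪ X₂ ∧ a ∉ F ∧
      a' ∉ X₁ ∪ X₂ ∧ a' ∉ F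
  · have step : ∀ j ≤ N, HasSupply G ty X₁ X₂ (k + j) (c + c + 2 * j) (16 + 2 * j) C L := by
      intro j
      induction j with
      | zero => exact fun _ => h0.of_eq rfl (by simp) le_rfl le_rfl le_rfl
      | succ j ih =>
        intro hj
        exact ((ih (by omega)).add_free_inEdge fun F hF => hA F (by omega)).of_eq rfl
          (by push_cast; ring) (by omega) le_rfl le_rfl
    exact (step N le_rfl).tourLE (by omega) (by rw [hN]; ring)
  -- Otherwise up to ℓ − |X₁| edges inside A are taken outside `X₁`, each of which may destroy two
  -- vertices of `X₂`; next come the edges at `X₁`, and then steps of two edges per unit of balance.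
  have extra : ∀ j ≤ ℓ - #X₁, HasSupply G ty X₁ X₂ (k + j) (c + c + 2 * j) (16 + 2 * j) C
      (L - 2 * j) := by
    intro j
    induction j with
    | zero => exact fun _ => h0.of_eq rfl (by simp) le_rfl le_rfl le_rfl
    | succ j ih =>
      intro hj
      exact ((ih (by omega)).add_inEdge fun F hF => hE F (by omega) (by omega)).of_eq rfl
        (by push_cast; ring) (by omega) le_rfl (by omega)
  by_cases hg : N ≤ ℓ - #X₁
  · exact (extra N hg).tourLE (by omega) (by rw [hN]; ring)
  push Not at hg
  obtain ⟨g, hgdef⟩ : ∃ g, g = ℓ - #X₁ := ⟨_, rfl⟩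
  have h1 := extra g hgdef.le
  have leaf : ∀ j ≤ C, g + j ≤ N → HasSupply G ty X₁ X₂ (k + g + j) (c + c + 2 * g + 2 * j)
      (16 + 2 * g + 2 * j) (C - j) (L - 2 * g) := by
    intro j
    induction j with
    | zero => exact fun _ _ => h1.of_eq rfl (by simp) le_rfl le_rfl le_rfl
    | succ j ih =>
      intro hj hj'
      exact (((ih (by omega) (by omega)).of_eq (C' := C - (j + 1) + 1) rfl rfl le_rfl (by omega)
        le_rfl).add_leaf hdisj fun x hx F hF => hX₁ x hx F (by omega)).of_eq rfl
        (by push_cast; ring) (by omega) le_rfl le_rfl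
  by_cases hC' : N ≤ g + C
  · exact (leaf (N - g) (by omega) (by omega)).tourLE (by omega) (by push_cast [show g ≤ N by omega]; rw [hN]; ring)
  push Not at hC'
  have h2 := leaf C le_rfl hC'.le
  obtain ⟨r, hr⟩ : ∃ r, N = g + C + r := ⟨N - (g + C), by omega⟩
  -- The one-edge steps, together with the inner vertices of `X₁` in the base, number at least ℓ.
  -- Hence the total is at most 6 + 2t − ℓ ≤ 6 + ℓ + m.
  have hcount : ¬ (∀ w u, ¬ OutEdge G ty A w u) → k + g + C + 2 * r ≤ ℓ + m + 6 := by
    intro hno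
    have := hk.resolve_right hno
    omega
  by_cases hU : ∀ F : Finset V, #F ≤ M → ∃ a u, OutEdge G ty A a u ∧ a ∉ X₁ ∪ X₂ ∧ a ∉ F ∧
      u ∉ X₁ ∪ X₂ ∧ u ∉ F
  · have hno : ¬ (∀ w u, ¬ OutEdge G ty A w u) := fun hno => by
      obtain ⟨a, u, e, -⟩ := hU ∅ (by simp)
      exact hno a u e
    have step : ∀ j ≤ r, HasSupply G ty X₁ X₂ (k + g + C + 2 * j)
        (c + c + 2 * g + 2 * C + 2 * j) (16 + 2 * g + 2 * C + 4 * j) 0 0 := by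
      intro j
      induction j with
      | zero => exact fun _ => h2.of_eq rfl (by simp) le_rfl (by omega) (by omega)
      | succ j ih =>
        intro hj
        exact ((ih (by omega)).add_outEdges fun F hF => hU F (by omega)).of_eq rfl
          (by push_cast; ring) (by omega) le_rfl le_rfl
    exact (step r le_rfl).tourLE (hcount hno) (by rw [hr] at hN; push_cast at hN; linarith)
  push Not at hA hU
  obtain ⟨F, hF, hA⟩ := hA
  obtain ⟨F', hF', hU⟩ := hU
  have hp := hpoor F F' hF hF' (fun a a' e => by have := hA a a' e; tauto)
    (fun a u e => by have := hU a u e; tauto)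
  -- The base uses at most 2 plus its balance of the capacity 2|X₁| + |X₂|; `hpoor` supplies the 2
  -- and the loss from the extra edges.
  have hrL : r ≤ L - 2 * g := by
    zify at hC hL hunion hI
    omega
  have hno : ¬ (∀ w u, ¬ OutEdge G ty A w u) := fun hno => by
    rw [hout hno, Finset.card_empty] at hL
    omega
  have step : ∀ j ≤ r, HasSupply G ty X₁ X₂ (k + g + C + 2 * j)
      (c + c + 2 * g + 2 * C + 2 * j) (16 + 2 * g + 2 * C + 4 * j) 0 (L - 2 * g - j) := by
    intro j
    induction j with
    | zero => exact fun _ => h2.of_eq rfl (by simp) le_rfl (by omega) (by omega)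
    | succ j ih =>
      intro hj
      exact (((ih (by omega)).of_eq (L' := L - 2 * g - (j + 1) + 1) rfl rfl le_rfl le_rfl
        (by omega)).add_loop hdisj fun x hx F hF => hX₂ x hx F (by omega)).of_eq rfl
        (by push_cast; ring) (by omega) le_rfl le_rfl
  exact (step r le_rfl).tourLE (hcount hno) (by rw [hr] at hN; push_cast at hN; linarith)

end SimpleGraph

/-! ### Counting edges by degrees. -/

namespace SimpleGraph

open VClass

variable {V : Type*} [Fintype V] {G : SimpleGraph V} {ty : V → VClass}

instance (c : VClass) : Decidable (IsW c) := inferInstanceAs (Decidable (c = A ∨ c = B))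

open scoped Classical in
/-- The vertices of a class. -/
noncomputable def cls (ty : V → VClass) (p : VClass) : Finset V := {v | ty v = p}

open scoped Classical in
/-- The number of neighbours of a vertex in a class. -/
noncomputable def dg (G : SimpleGraph V) (ty : V → VClass) (v : V) (p : VClass) : ℕ :=
  #{w | G.Adj v w ∧ ty w = p}

open scoped Classical in
/-- The ordered pairs of adjacent vertices of the classes `p` and `q`. -/
noncomputable def pairs (G : SimpleGraph V) (ty : V → VClass) (p q : VClass) : Finset (V × V) :=
  {e | G.Adj e.1 e.2 ∧ ty e.1 = p ∧ ty e.2 = q}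

theorem mem_cls {p : VClass} {v : V} : v ∈ cls ty p ↔ ty v = p := by simp [cls]

theorem mem_pairs {p q : VClass} {e : V × V} :
    e ∈ pairs G ty p q ↔ G.Adj e.1 e.2 ∧ ty e.1 = p ∧ ty e.2 = q := by simp [pairs]

theorem card_pairs (p q : VClass) : #(pairs G ty p q) = ∑ v ∈ cls ty p, dg G ty v q := by
  classical
  rw [pairs, Finset.card_filter, Fintype.sum_prod_type, cls, Finset.sum_filter]
  refine Finset.sum_congr rfl fun v _ => ?_
  by_cases h : ty v = p
  · simp only [h, if_true, dg, Finset.card_filter, true_and]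
  · simp [h]

theorem card_pairs_comm (p q : VClass) : #(pairs G ty p q) = #(pairs G ty q p) := by
  refine Finset.card_bij (fun e _ => e.swap) ?_ ?_ ?_
  · intro e
    simp only [mem_pairs, Prod.fst_swap, Prod.snd_swap]
    exact fun h => ⟨h.1.symm, h.2.2, h.2.1⟩
  · exact fun e _ e' _ h => Prod.swap_injective h
  · intro e he
    rw [mem_pairs] at he
    exact ⟨e.swap, by simpa [mem_pairs] using ⟨he.1.symm, he.2.2, he.2.1⟩, by simp⟩

theorem card_cls_sum : #(cls ty V₁) + #(cls ty V₂) + #(cls ty A) + #(cls ty B) =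
    Fintype.card V := by
  classical
  have h : Fintype.card V = ∑ v : V, ((if ty v = V₁ then 1 else 0) + (if ty v = V₂ then 1 else 0) +
      (if ty v = A then 1 else 0) + if ty v = B then 1 else 0) := by
    rw [← Finset.card_univ, Finset.card_eq_sum_ones]
    refine Finset.sum_congr rfl fun v _ => ?_
    cases ty v <;> simp
  rw [h]
  simp only [Finset.sum_add_distrib, cls, Finset.card_filter]

theorem dg_sum (v : V) [DecidableRel G.Adj] : dg G ty v V₁ + dg G ty v V₂ + dg G ty v A +
    dg G ty v B = G.degree v := by
  classical
  rw [← card_neighborFinset_eq_degree, neighborFinset_eq_filter]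
  simp only [dg, Finset.card_filter, ← Finset.sum_add_distrib]
  refine Finset.sum_congr rfl fun w _ => ?_
  by_cases h : G.Adj v w <;> cases ty w <;> simp [h]

theorem dg_pos {v w : V} (h : G.Adj v w) : 0 < dg G ty v (ty w) :=
  Finset.card_pos.2 ⟨w, by simp [h]⟩

/-- The pairs that meet a given set are counted by the degrees of its elements. -/
theorem card_pairs_le_of_cover {p q : VClass} {F : Finset V}
    (h : ∀ x y, G.Adj x y → ty x = p → ty y = q → x ∈ F ∨ y ∈ F) :
    #(pairs G ty p q) ≤ ∑ v ∈ F with ty v = p, dg G ty v q + ∑ v ∈ F with ty v = q, dg G ty v p := by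
  classical
  have h1 : pairs G ty p q ⊆ ({v ∈ F | ty v = p}.biUnion fun v =>
      ({w | G.Adj v w ∧ ty w = q} : Finset V).image fun w => (v, w)) ∪
      ({v ∈ F | ty v = q}.biUnion fun v =>
      ({w | G.Adj v w ∧ ty w = p} : Finset V).image fun w => (w, v)) := by
    rintro ⟨x, y⟩ he
    obtain ⟨h1, h2, h3⟩ := mem_pairs.1 he
    simp only [Finset.mem_union, Finset.mem_biUnion, Finset.mem_filter, Finset.mem_image,
      Finset.mem_univ, true_and, Prod.mk.injEq]
    rcases h x y h1 h2 h3 with h | h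
    · exact .inl ⟨x, ⟨h, h2⟩, y, ⟨h1, h3⟩, rfl, rfl⟩
    · exact .inr ⟨y, ⟨h, h3⟩, x, ⟨h1.symm, h2⟩, rfl, rfl⟩
  refine (Finset.card_le_card h1).trans ((Finset.card_union_le _ _).trans (Nat.add_le_add ?_ ?_))
  · exact Finset.card_biUnion_le.trans (Finset.sum_le_sum fun v _ => Finset.card_image_le)
  · exact Finset.card_biUnion_le.trans (Finset.sum_le_sum fun v _ => Finset.card_image_le)

/-- The number of ordered pairs of adjacent vertices of the class `p`. -/
noncomputable def nIn (G : SimpleGraph V) (ty : V → VClass) (p : VClass) : ℕ := #(pairs G ty p p)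

/-- The number of edges between the class `p` and `V₁ ∪ V₂`. -/
noncomputable def nOut (G : SimpleGraph V) (ty : V → VClass) (p : VClass) : ℕ :=
  #(pairs G ty p V₁) + #(pairs G ty p V₂)

theorem nIn_pos {p : VClass} {a a' : V} (h : InEdge G ty p a a') : 0 < nIn G ty p :=
  Finset.card_pos.2 ⟨(a, a'), mem_pairs.2 h⟩

theorem VClass.not_isW_iff {c : VClass} : ¬ IsW c ↔ c = V₁ ∨ c = V₂ := by
  cases c <;> simp [IsW]

theorem nOut_pos {p : VClass} {w u : V} (h : OutEdge G ty p w u) : 0 < nOut G ty p := by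
  obtain ⟨h1, h2, h3⟩ := h
  rcases VClass.not_isW_iff.1 h3 with h | h
  · exact Nat.add_pos_left (Finset.card_pos.2 ⟨(w, u), mem_pairs.2 ⟨h1, h2, h⟩⟩) _
  · exact Nat.add_pos_right _ (Finset.card_pos.2 ⟨(w, u), mem_pairs.2 ⟨h1, h2, h⟩⟩)

theorem nIn_le_of_cover {p : VClass} {F : Finset V}
    (h : ∀ a a', InEdge G ty p a a' → a ∈ F ∨ a' ∈ F) :
    nIn G ty p ≤ 2 * ∑ v ∈ F with ty v = p, dg G ty v p := by
  have := card_pairs_le_of_cover (G := G) (ty := ty) (p := p) (q := p) (F := F)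
    fun x y hxy hx hy => h x y ⟨hxy, hx, hy⟩
  rw [nIn]
  omega

theorem nOut_le_of_cover {p : VClass} (hp : IsW p) {F : Finset V}
    (h : ∀ w u, OutEdge G ty p w u → w ∈ F ∨ u ∈ F) :
    nOut G ty p ≤ ∑ v ∈ F with ty v = p, (dg G ty v V₁ + dg G ty v V₂) +
      ∑ v ∈ F with ¬ IsW (ty v), dg G ty v p := by
  classical
  have h1 := card_pairs_le_of_cover (G := G) (ty := ty) (p := p) (q := V₁) (F := F)
    fun x y hxy hx hy => h x y ⟨hxy, hx, by simp [hy, IsW]⟩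
  have h2 := card_pairs_le_of_cover (G := G) (ty := ty) (p := p) (q := V₂) (F := F)
    fun x y hxy hx hy => h x y ⟨hxy, hx, by simp [hy, IsW]⟩
  have h3 : (∑ v ∈ F with ¬ IsW (ty v), dg G ty v p) =
      ∑ v ∈ F with ty v = V₁, dg G ty v p + ∑ v ∈ F with ty v = V₂, dg G ty v p := by
    simp only [Finset.sum_filter, ← Finset.sum_add_distrib]
    refine Finset.sum_congr rfl fun v _ => ?_
    cases ty v <;> simp [IsW]
  rw [nOut, h3, Finset.sum_add_distrib]
  omega

theorem nOut_eq_sum (p : VClass) : nOut G ty p =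
    ∑ v ∈ cls ty V₁, dg G ty v p + ∑ v ∈ cls ty V₂, dg G ty v p := by
  rw [nOut, card_pairs_comm p V₁, card_pairs_comm p V₂, card_pairs, card_pairs]

/-- Counting the edges at the classes `A` and `B`. -/
theorem nIn_add_nOut [DecidableRel G.Adj] {D : ℕ} (hD : G.IsRegularOfDegree D) :
    nIn G ty A + nOut G ty A + D * #(cls ty B) = nIn G ty B + nOut G ty B + D * #(cls ty A) := by
  -- Degree sums over A and over B; the edges between A and B appear in both and cancel.
  have key : ∀ p, #(pairs G ty p V₁) + #(pairs G ty p V₂) + #(pairs G ty p A) + #(pairs G ty p B) =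
      D * #(cls ty p) := by
    intro p
    simp only [card_pairs, ← Finset.sum_add_distrib, dg_sum]
    rw [Finset.sum_congr rfl fun v _ => hD v, Finset.sum_const, smul_eq_mul, mul_comm]
  have hA := key A
  have hB := key B
  have hAB := card_pairs_comm (G := G) (ty := ty) A B
  rw [nIn, nOut, nIn, nOut]
  omega

end SimpleGraph

/-! ### Degree conditions, and the counts for |A| = |B|. -/

namespace SimpleGraph

open VClass

variable {V : Type*} [Fintype V] {G : SimpleGraph V} {ty : V → VClass}

/-- The size and degree conditions on the four classes of vertices of a `D`-regular graph. -/
structure IsFrame (G : SimpleGraph V) (ty : V → VClass) (D : ℕ) : Prop where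
  sep : IsSep G ty
  large : 1000 ≤ D
  degree : ∀ v, dg G ty v V₁ + dg G ty v V₂ + dg G ty v A + dg G ty v B = D
  card_le : #(cls ty V₁) + #(cls ty V₂) + #(cls ty A) + #(cls ty B) ≤ 4 * D
  card_one : D ≤ 2 * #(cls ty V₁)
  card_two : D ≤ 2 * #(cls ty V₂)
  card_B : 99 * D ≤ 100 * #(cls ty B)
  count : nIn G ty A + nOut G ty A + D * #(cls ty B) = nIn G ty B + nOut G ty B + D * #(cls ty A)
  in_le : ∀ v, ty v = A → dg G ty v A ≤ dg G ty v B
  out_le : ∀ v, ty v = A → 2 * (dg G ty v V₁ + dg G ty v V₂) ≤ D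
  left_le : ∀ v, ¬ IsW (ty v) → 2 * dg G ty v A ≤ D
  degree_B : ∀ v, ty v = B → D ≤ 32 * dg G ty v A
  degree_own : ∀ v, ¬ IsW (ty v) → D ≤ 16 * dg G ty v (ty v)

theorem VClass.IsW.exists_oppW {p : VClass} (hp : IsW p) : ∃ q, OppW p q := by
  rcases hp with rfl | rfl
  exacts [⟨B, .inl ⟨rfl, rfl⟩⟩, ⟨A, .inr ⟨rfl, rfl⟩⟩]

namespace IsFrame

variable {D : ℕ}

theorem nonempty (h : IsFrame G ty D) : Nonempty V := by
  have := h.card_B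
  have := h.large
  obtain ⟨v, -⟩ := Finset.card_pos.1 (show 0 < #(cls ty B) by omega)
  exact ⟨v⟩

/-- From d_A ≤ d_B on A: one vertex of A covers at most D of the count `nIn + nOut`, in which edges
inside A count twice. -/
theorem inner_le (h : IsFrame G ty D) {v : V} (hv : ty v = A) :
    2 * dg G ty v A + (dg G ty v V₁ + dg G ty v V₂) ≤ D := by
  have := h.degree v
  have := h.in_le v hv
  omega

theorem degree_opp (h : IsFrame G ty D) {c d : VClass} (hcd : Opp c d) (v : V) :
    dg G ty v c + dg G ty v d + dg G ty v A + dg G ty v B = D := by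
  have := h.degree v
  rcases hcd with ⟨rfl, rfl⟩ | ⟨rfl, rfl⟩ <;> omega

/-- A vertex of `V₁ ∪ V₂` has few neighbours in the bipartite part. -/
theorem left_W_le (h : IsFrame G ty D) {p : VClass} (hp : IsW p) {v : V} (hv : ¬ IsW (ty v)) :
    16 * dg G ty v p ≤ 15 * D := by
  have h1 := h.degree v
  have h2 := h.degree_own v hv
  rcases VClass.not_isW_iff.1 hv with h3 | h3 <;> rw [h3] at h2 <;> rcases hp with rfl | rfl <;>
    omega

theorem out_W_le (h : IsFrame G ty D) {p : VClass} (hp : IsW p) {v : V} (hv : ty v = p) :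
    32 * (dg G ty v V₁ + dg G ty v V₂) ≤ 31 * D := by
  have h1 := h.degree v
  rcases hp with rfl | rfl
  · have := h.out_le v hv
    omega
  · have := h.degree_B v hv
    omega

theorem nOut_le_of_star (h : IsFrame G ty D) {p : VClass} (hp : IsW p) {z : V}
    (hz : ∀ w u, OutEdge G ty p w u → w = z ∨ u = z) : 32 * nOut G ty p ≤ 31 * D := by
  have h1 := nOut_le_of_cover (F := {z}) hp fun w u e => by simpa using hz w u e
  rw [Finset.sum_filter, Finset.sum_singleton, Finset.sum_filter, Finset.sum_singleton] at h1
  by_cases hzp : ty z = p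
  · have h2 := h.out_W_le hp hzp
    rw [if_pos hzp, if_neg (by rw [hzp]; simpa using hp)] at h1
    omega
  · rw [if_neg hzp] at h1
    split at h1
    · have := h.left_W_le hp (v := z) ‹_›
      omega
    · omega

/-- By the bound on Δ(G[A, V₁ ∪ V₂]), each vertex covers at most D/2 of these edges. -/
theorem nOut_A_le_of_cover (h : IsFrame G ty D) {s t : V}
    (hc : ∀ a u, OutEdge G ty A a u → a = s ∨ a = t ∨ u = s ∨ u = t) : nOut G ty A ≤ D := by
  classical
  have h1 := nOut_le_of_cover (F := {s, t}) (.inl rfl) fun w u e => by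
    have := hc w u e
    simp only [Finset.mem_insert, Finset.mem_singleton]
    tauto
  have key : ∀ z, (if ty z = A then dg G ty z V₁ + dg G ty z V₂ else 0) +
      (if ¬ IsW (ty z) then dg G ty z A else 0) ≤ D / 2 := by
    intro z
    by_cases hz : ty z = A
    · have := h.out_le z hz
      rw [if_pos hz, if_neg (by rw [hz]; simp [IsW])]
      omega
    · rw [if_neg hz]
      split
      · have := h.left_le z ‹_›
        omega
      · omega
  rw [Finset.sum_filter, Finset.sum_filter, ← Finset.sum_add_distrib] at h1
  have h2 := Finset.sum_le_card_nsmul {s, t} _ (D / 2) fun z _ => key z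
  have h3 : #{s, t} ≤ 2 := Finset.card_le_two
  have h4 : #{s, t} • (D / 2) ≤ 2 * (D / 2) := by
    rw [smul_eq_mul]
    exact Nat.mul_le_mul_right _ h3
  omega

theorem exists_two_inEdges {p : VClass} (h : 3 ≤ nIn G ty p) :
    ∃ a₁ a₂ a₃ a₄, InEdge G ty p a₁ a₂ ∧ InEdge G ty p a₃ a₄ ∧ ¬ (a₁ = a₃ ∧ a₂ = a₄) ∧
      ¬ (a₁ = a₄ ∧ a₂ = a₃) := by
  classical
  obtain ⟨⟨a, a'⟩, h1⟩ := Finset.card_pos.1 (show 0 < #(pairs G ty p p) by rw [nIn] at h; omega)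
  have h2 : #({(a, a'), (a', a)} : Finset (V × V)) < #(pairs G ty p p) :=
    lt_of_le_of_lt Finset.card_le_two h
  obtain ⟨⟨b, b'⟩, h3, h4⟩ := Finset.exists_mem_notMem_of_card_lt_card h2
  simp only [Finset.mem_insert, Finset.mem_singleton, Prod.mk.injEq, not_or] at h4
  exact ⟨a, a', b, b', mem_pairs.1 h1, mem_pairs.1 h3, fun h => h4.1 ⟨h.1.symm, h.2.symm⟩,
    fun h => h4.2 ⟨h.2.symm, h.1.symm⟩⟩

theorem nIn_eq_zero {p : VClass} (h : ∀ a a', ¬ InEdge G ty p a a') : nIn G ty p = 0 := by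
  rw [nIn, Finset.card_eq_zero, Finset.eq_empty_iff_forall_notMem]
  rintro ⟨a, a'⟩ he
  exact h a a' (mem_pairs.1 he)

theorem nOut_eq_zero {p : VClass} (h : ∀ a u, ¬ OutEdge G ty p a u) : nOut G ty p = 0 := by
  rw [nOut, Nat.add_eq_zero_iff]
  constructor <;> rw [Finset.card_eq_zero, Finset.eq_empty_iff_forall_notMem] <;>
    rintro ⟨a, a'⟩ he <;> rw [mem_pairs] at he
  · exact h a a' ⟨he.1, he.2.1, by rw [he.2.2]; simp [IsW]⟩
  · exact h a a' ⟨he.1, he.2.1, by rw [he.2.2]; simp [IsW]⟩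

/-- The number of neighbours of a vertex in its own class. -/
theorem dg_own_lt {v : V} {c : VClass} (hv : ty v = c) : dg G ty v c + 1 ≤ #(cls ty c) := by
  classical
  rw [dg, Nat.succ_le_iff]
  refine Finset.card_lt_card ⟨fun w hw => ?_, fun h => ?_⟩
  · rw [mem_cls]
    simpa using (Finset.mem_filter.1 hw).2.2
  · have := h (mem_cls.2 hv)
    simp at this

/-- A lower bound for the number of edges leaving a class `c` of `V₁ ∪ V₂`. -/
theorem card_mul_le (h : IsFrame G ty D) {c d : VClass} (hcd : Opp c d) {T : Finset V}
    (hT : T ⊆ cls ty c) : #T * (D + 1 - #(cls ty c)) ≤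
      ∑ v ∈ T, (dg G ty v d + dg G ty v A + dg G ty v B) := by
  rw [← smul_eq_mul]
  refine Finset.card_nsmul_le_sum _ _ _ fun v hv => ?_
  have h1 := dg_own_lt (G := G) (mem_cls.1 (hT hv))
  have h2 := h.degree_opp hcd v
  omega

theorem dg_le_card (v : V) (p : VClass) : dg G ty v p ≤ #(cls ty p) := by
  classical
  exact Finset.card_le_card fun w hw => mem_cls.2 (Finset.mem_filter.1 hw).2.2

/-- The product is concave in `x`, so only the ends of the range matter. It bounds the number of
edges leaving a class of `x` vertices, one vertex being disregarded. -/
theorem sub_one_mul_ge {D x : ℕ} (h1 : D ≤ 2 * x) (h2 : x ≤ D) (hD : 1000 ≤ D) :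
    D - 1 ≤ (x - 1) * (D + 1 - x) ∧ (x < D → 2 * D - 4 ≤ (x - 1) * (D + 1 - x)) := by
  obtain ⟨y, rfl⟩ := Nat.exists_eq_add_of_le h2
  obtain ⟨x, rfl⟩ := Nat.exists_eq_add_of_le (show 1 ≤ x by omega)
  rw [show 1 + x + y + 1 - (1 + x) = y + 1 by omega, show 1 + x + y - 1 = x + y by omega,
    show 1 + x - 1 = x by omega]
  constructor
  · nlinarith
  · intro hy
    have : 2 * (1 + x + y) - 4 = 2 * x + 2 * y - 2 := by omega
    rw [this, Nat.sub_le_iff_le_add]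
    have hy : 1 ≤ y := by omega
    nlinarith

/-- The number of edges leaving `V₁` and `V₂` and avoiding a vertex, if `V₁ ∪ V₂` is small. -/
theorem sum_leaving_ge [DecidableEq V] (h : IsFrame G ty D)
    (hs : #(cls ty V₁) + #(cls ty V₂) ≤ 2 * D) {c d : VClass} (hcd : Opp c d) (z : V)
    (hz : ty z ≠ d) : 2 * D - 4 ≤
      ∑ v ∈ (cls ty c).erase z, (dg G ty v d + dg G ty v A + dg G ty v B) +
      ∑ v ∈ cls ty d, (dg G ty v c + dg G ty v A + dg G ty v B) := by
  have k1 : D ≤ 2 * #(cls ty c) ∧ D ≤ 2 * #(cls ty d) ∧ #(cls ty c) + #(cls ty d) ≤ 2 * D := by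
    have := h.card_one
    have := h.card_two
    rcases hcd with ⟨rfl, rfl⟩ | ⟨rfl, rfl⟩ <;> omega
  have h1 := h.card_mul_le hcd ((cls ty c).erase_subset z)
  have h2 := h.card_mul_le hcd.symm (Finset.Subset.refl (cls ty d))
  have h3 := Finset.pred_card_le_card_erase (s := cls ty c) (a := z)
  have h4 := (Nat.mul_le_mul_right (D + 1 - #(cls ty c)) h3).trans h1
  have h5 := (Nat.mul_le_mul_right (D + 1 - #(cls ty d)) (Nat.sub_le (#(cls ty d)) 1)).trans h2
  have hD := h.large
  obtain ⟨k1, k2, k3⟩ := k1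
  -- Either both classes have at most D vertices and contribute D − 1 each, or one has more than D,
  -- and then the other has fewer than D and contributes 2D − 4 alone.
  by_cases h6 : #(cls ty c) ≤ D
  · have h7 := sub_one_mul_ge k1 h6 hD
    by_cases h8 : #(cls ty d) ≤ D
    · have h9 := sub_one_mul_ge k2 h8 hD
      omega
    · have := h7.2 (by omega)
      omega
  · have h9 := (sub_one_mul_ge k2 (by omega) hD).2 (by omega)
    omega

theorem dg_eq_zero {v : V} {p : VClass} (h : ∀ w, G.Adj v w → ty w ≠ p) : dg G ty v p = 0 := by
  classical
  rw [dg, Finset.card_eq_zero, Finset.filter_eq_empty_iff]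
  exact fun w _ hw => h w hw.1 hw.2

theorem nOut_add_nOut {c d : VClass} (hcd : Opp c d) : nOut G ty A + nOut G ty B =
    ∑ v ∈ cls ty c, (dg G ty v A + dg G ty v B) + ∑ v ∈ cls ty d, (dg G ty v A + dg G ty v B) := by
  rw [nOut_eq_sum, nOut_eq_sum, Finset.sum_add_distrib, Finset.sum_add_distrib]
  rcases hcd with ⟨rfl, rfl⟩ | ⟨rfl, rfl⟩ <;> ring

theorem nIn_add_nOut_eq_sum (p : VClass) : nIn G ty p + nOut G ty p =
    ∑ v ∈ cls ty p, (dg G ty v p + (dg G ty v V₁ + dg G ty v V₂)) := by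
  rw [nIn, nOut, card_pairs, card_pairs, card_pairs, ← Finset.sum_add_distrib,
    ← Finset.sum_add_distrib]

/-- If the other class has fewer than `D` vertices, each vertex of a class has an edge that does not
go to the other class. -/
theorem card_le_nIn_add_nOut (h : IsFrame G ty D) {p q : VClass} (hpq : OppW p q)
    (hq : #(cls ty q) < D) : #(cls ty p) ≤ nIn G ty p + nOut G ty p := by
  rw [nIn_add_nOut_eq_sum, Finset.card_eq_sum_ones]
  refine Finset.sum_le_sum fun v _ => ?_
  have h1 := h.degree v
  have h2 := dg_le_card (G := G) (ty := ty) v q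
  rcases hpq with ⟨rfl, rfl⟩ | ⟨rfl, rfl⟩ <;> omega

theorem count_eq (h : IsFrame G ty D) (heq : #(cls ty A) = #(cls ty B)) {p q : VClass}
    (hpq : OppW p q) : nIn G ty p + nOut G ty p = nIn G ty q + nOut G ty q := by
  have := h.count
  rw [heq] at this
  rcases hpq with ⟨rfl, rfl⟩ | ⟨rfl, rfl⟩ <;> omega

/-- If the opposite class has fewer than D vertices, every vertex of `p` has an edge not going
there. Otherwise A and B fill half of the graph, so V₁ and V₂ are small and send at least 2D − 4
edges to W, of which `p` accounts for about half by the counting identity. -/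
theorem nIn_add_nOut_ge (h : IsFrame G ty D) (heq : #(cls ty A) = #(cls ty B))
    (hno : NoCross G ty) {p : VClass} (hp : IsW p) : 99 * D ≤ 100 * (nIn G ty p + nOut G ty p) := by
  classical
  obtain ⟨q, hpq⟩ := hp.exists_oppW
  have hc := h.count_eq heq hpq
  have hD := h.large
  have hB := h.card_B
  have hqq : #(cls ty q) = #(cls ty B) ∧ #(cls ty p) = #(cls ty B) := by
    rcases hpq with ⟨rfl, rfl⟩ | ⟨rfl, rfl⟩ <;> simp [heq]
  by_cases hlt : #(cls ty q) < D
  · have := h.card_le_nIn_add_nOut hpq hlt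
    omega
  · have hcd : Opp V₁ V₂ := .inl ⟨rfl, rfl⟩
    obtain ⟨z, hz⟩ : ∃ z, ty z = B := by
      have : 0 < #(cls ty B) := by omega
      obtain ⟨v, hv⟩ := Finset.card_pos.1 this
      exact ⟨v, mem_cls.1 hv⟩
    have h1 := h.sum_leaving_ge (by have := h.card_le; omega) hcd z (by rw [hz]; simp)
    rw [Finset.erase_eq_of_notMem (by simp [mem_cls, hz])] at h1
    have h2 := nOut_add_nOut (G := G) (ty := ty) hcd
    have h3 : ∑ v ∈ cls ty V₁, (dg G ty v V₂ + dg G ty v A + dg G ty v B) =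
        ∑ v ∈ cls ty V₁, (dg G ty v A + dg G ty v B) := Finset.sum_congr rfl fun v hv => by
      rw [dg_eq_zero fun w hw hw' => hno v w (mem_cls.1 hv) hw' hw, zero_add]
    have h4 : ∑ v ∈ cls ty V₂, (dg G ty v V₁ + dg G ty v A + dg G ty v B) =
        ∑ v ∈ cls ty V₂, (dg G ty v A + dg G ty v B) := Finset.sum_congr rfl fun v hv => by
      rw [dg_eq_zero fun w hw hw' => hno w v hw' (mem_cls.1 hv) hw.symm, zero_add]
    rw [h3, h4, ← h2] at h1
    have : nOut G ty A + nOut G ty B ≤ 2 * (nIn G ty p + nOut G ty p) := by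
      rcases hpq with ⟨rfl, rfl⟩ | ⟨rfl, rfl⟩ <;> omega
    omega

/-- Otherwise the degree of `z` into `p` would be the whole count at `p`, and by `count_eq` at the
opposite class as well. If that class is small, the count is at least 99D/100, more than 15D/16. If
not, the edges leaving V₁ and V₂ apart from those of `z` number at least 2D − 4, too many since `z`
has D/16 neighbours in its own class. -/
theorem not_star (h : IsFrame G ty D) (heq : #(cls ty A) = #(cls ty B)) {p : VClass} (hp : IsW p)
    (hin : ∀ a a', ¬ InEdge G ty p a a') {z : V} (hz : ¬ IsW (ty z))
    (hout : ∀ w u, OutEdge G ty p w u → u = z)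
    (hcross : ∀ x y, ty x = V₁ → ty y = V₂ → G.Adj x y → x = z ∨ y = z) : False := by
  classical
  obtain ⟨q, hpq⟩ := hp.exists_oppW
  have hc := h.count_eq heq hpq
  have hD := h.large
  have hB := h.card_B
  have hqq : #(cls ty q) = #(cls ty B) ∧ #(cls ty p) = #(cls ty B) := by
    rcases hpq with ⟨rfl, rfl⟩ | ⟨rfl, rfl⟩ <;> simp [heq]
  have hstar : nOut G ty p ≤ dg G ty z p := by
    have h1 := nOut_le_of_cover (F := {z}) hp fun w u e => .inr (by simpa using hout w u e)
    rw [Finset.sum_filter, Finset.sum_singleton, Finset.sum_filter, Finset.sum_singleton,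
      if_neg (by rintro rfl; exact hz hp), if_pos hz, zero_add] at h1
    exact h1
  have h0 := nIn_eq_zero hin
  by_cases hlt : #(cls ty q) < D
  · have h1 := h.card_le_nIn_add_nOut hpq hlt
    have h2 := h.left_W_le hp hz
    omega
  obtain ⟨d, hcd⟩ := VClass.Opp.class_cases hz
  have h1 := h.sum_leaving_ge (by have := h.card_le; omega) hcd z hcd.ne
  have hcross' : ∀ {x y : V}, ty x = ty z → ty y = d → G.Adj x y → x = z := by
    intro x y hx hy hxy
    rcases hcd with ⟨hc, rfl⟩ | ⟨hc, rfl⟩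
    · exact (hcross x y (hx.trans hc) hy hxy).resolve_right fun h => by simp [← h, hy] at hc
    · exact (hcross y x hy (hx.trans hc) hxy.symm).resolve_left fun h => by simp [← h, hy] at hc
  have h2 := nOut_add_nOut (G := G) (ty := ty) hcd
  have hzmem : z ∈ cls ty (ty z) := mem_cls.2 rfl
  have h3 : ∑ v ∈ (cls ty (ty z)).erase z, (dg G ty v d + dg G ty v A + dg G ty v B) =
      ∑ v ∈ (cls ty (ty z)).erase z, (dg G ty v A + dg G ty v B) :=
    Finset.sum_congr rfl fun v hv => by
      rw [dg_eq_zero fun w hw hw' => Finset.ne_of_mem_erase hv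
        (hcross' (mem_cls.1 (Finset.mem_of_mem_erase hv)) hw' hw), zero_add]
  have h4 : ∑ v ∈ cls ty d, dg G ty v (ty z) = dg G ty z d := by
    rw [← card_pairs, card_pairs_comm, card_pairs]
    refine Finset.sum_eq_single_of_mem z hzmem fun v hv hvz => dg_eq_zero fun w hw hw' => ?_
    exact hvz (hcross' (mem_cls.1 hv) hw' hw)
  have h5 := Finset.sum_erase_add (cls ty (ty z)) (fun v => dg G ty v A + dg G ty v B) hzmem
  have h6 := h.degree_opp hcd z
  simp only [add_assoc] at h1 h3
  rw [h3, Finset.sum_add_distrib (f := fun v => dg G ty v (ty z)), h4] at h1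
  rcases hpq with ⟨rfl, rfl⟩ | ⟨rfl, rfl⟩ <;> omega

/-- The balanced case. -/
theorem tourLE_zero (h : IsFrame G ty D) (heq : #(cls ty A) = #(cls ty B)) : TourLE G ty 6 0 := by
  have hD := h.large
  refine h.sep.tourLE_zero ?_ ?_ ?_ ?_
  · intro hno p hp hin
    have h1 := h.nIn_add_nOut_ge heq hno hp
    rw [nIn_eq_zero hin] at h1
    obtain ⟨v⟩ := h.nonempty
    suffices ∃ a₁ u₁ a₂ u₂, OutEdge G ty p a₁ u₁ ∧ OutEdge G ty p a₂ u₂ ∧ a₁ ≠ a₂ ∧ u₁ ≠ u₂ by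
      obtain ⟨a₁, u₁, a₂, u₂, hh⟩ := this
      exact ⟨a₁, a₂, u₁, u₂, hh⟩
    refine exists_disjoint_outEdges hp v fun z => ?_
    by_contra! hz
    have h2 := h.nOut_le_of_star hp (z := z) fun w u e => or_iff_not_imp_left.2 (hz w u e)
    omega
  · intro hno p hp hout
    have h1 := h.nIn_add_nOut_ge heq hno hp
    rw [nOut_eq_zero hout] at h1
    exact exists_two_inEdges (by omega)
  · intro p hp hout
    by_contra! hin
    obtain ⟨q, hpq⟩ := hp.exists_oppW
    have hc := h.count_eq heq hpq
    rw [nIn_eq_zero hin, nOut_eq_zero hout] at hc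
    obtain ⟨v⟩ := h.nonempty
    obtain ⟨w, u, e, hw, hu, -⟩ := h.sep.exists_bip v v
    rcases hpq.isW_iff.1 hw with hw | hw
    · exact hout w u ⟨e, hw, hu⟩
    · have := nOut_pos (G := G) ⟨e, hw, hu⟩
      omega
  · intro p hp
    by_contra! hcon
    obtain ⟨hin, z, hz, hout, hcross⟩ := hcon
    exact h.not_star heq hp hin hz hout fun x y hx hy e => by
      by_contra! hne
      exact hne.2 (hcross x y hx hy e hne.1)

end IsFrame

end SimpleGraph

/-! ### The counts for |A| = |B| + 1. -/

namespace SimpleGraph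

open VClass

variable {V : Type*} [Fintype V] {G : SimpleGraph V} {ty : V → VClass}

namespace IsFrame

variable {D : ℕ}

theorem count_one (h : IsFrame G ty D) (heq : #(cls ty A) = #(cls ty B) + 1) :
    nIn G ty A + nOut G ty A = nIn G ty B + nOut G ty B + D := by
  have := h.count
  rw [heq, Nat.mul_add] at this
  omega

/-- If the sizes of `A` and `B` differ by one and there are no edges between `V₁` and `V₂`, then
some edge at `B` does not go to `A`. -/
theorem exists_edge_B (h : IsFrame G ty D) (heq : #(cls ty A) = #(cls ty B) + 1)
    (hno : NoCross G ty) : (∃ b b', InEdge G ty B b b') ∨ ∃ b u, OutEdge G ty B b u := by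
  by_contra! hcon
  obtain ⟨hin, hout⟩ := hcon
  have hc := h.count_one heq
  rw [nIn_eq_zero hin, nOut_eq_zero hout] at hc
  have hD := h.large
  -- A vertex of B would have all its neighbours in A.
  have hA : D ≤ #(cls ty A) := by
    obtain ⟨v, hv⟩ := Finset.card_pos.1 (show 0 < #(cls ty B) by have := h.card_B; omega)
    rw [mem_cls] at hv
    have h1 := h.degree v
    rw [dg_eq_zero fun w e hw => hout v w ⟨e, hv, by simp [hw, IsW]⟩,
      dg_eq_zero fun w e hw => hout v w ⟨e, hv, by simp [hw, IsW]⟩,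
      dg_eq_zero (p := B) fun w e hw => hin v w ⟨e, hv, hw⟩] at h1
    have := dg_le_card (G := G) (ty := ty) v A
    omega
  -- Since |A| + |B| ≥ 2D − 1, one of V₁ and V₂ has at most D vertices. It sends at least D edges to
  -- A, and the other sends at least one more, whereas the counting identity allows only D.
  have key : ∀ {c d : VClass}, Opp c d → #(cls ty c) ≤ D → False := by
    intro c d hcd hle
    have hle' : D ≤ 2 * #(cls ty c) := by
      rcases hcd with ⟨rfl, -⟩ | ⟨rfl, -⟩
      exacts [h.card_one, h.card_two]
    have h1 := nOut_add_nOut (G := G) (ty := ty) hcd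
    have h2 := h.card_mul_le hcd (Finset.Subset.refl _)
    have hcross : ∀ {x y : V}, ty x = c → ty y = d → ¬ G.Adj x y := by
      intro x y hx hy hxy
      rcases hcd with ⟨rfl, rfl⟩ | ⟨rfl, rfl⟩
      exacts [hno x y hx hy hxy, hno y x hy hx hxy.symm]
    have h3 : ∑ v ∈ cls ty c, (dg G ty v d + dg G ty v A + dg G ty v B) =
        ∑ v ∈ cls ty c, (dg G ty v A + dg G ty v B) := Finset.sum_congr rfl fun v hv => by
      rw [dg_eq_zero fun w hw hw' => hcross (mem_cls.1 hv) hw' hw, zero_add]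
    have h4 : D ≤ #(cls ty c) * (D + 1 - #(cls ty c)) := by
      obtain ⟨y, hy⟩ := Nat.exists_eq_add_of_le hle
      rw [show D + 1 - #(cls ty c) = y + 1 by omega]
      nlinarith
    have h5 : 1 ≤ ∑ v ∈ cls ty d, (dg G ty v A + dg G ty v B) := by
      obtain ⟨v⟩ := h.nonempty
      obtain ⟨w, u, e, hw, hu, -⟩ := h.sep.exists_outEdge hno hcd.symm v v
      refine le_trans ?_ (Finset.single_le_sum (fun _ _ => Nat.zero_le _) (mem_cls.2 hu))
      have := dg_pos (ty := ty) e.symm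
      rcases hw with hw | hw <;> rw [hw] at this <;> omega
    have h6 := nOut_eq_zero hout
    omega
  have := h.card_le
  by_cases h1 : #(cls ty V₁) ≤ D
  · exact key (.inl ⟨rfl, rfl⟩) h1
  · exact key (.inr ⟨rfl, rfl⟩) (by omega)

open scoped Classical in
/-- The ordered pairs that are edges between `p` and `V₁ ∪ V₂`. -/
noncomputable def outPairs (G : SimpleGraph V) (ty : V → VClass) (p : VClass) : Finset (V × V) :=
  pairs G ty p V₁ ∪ pairs G ty p V₂

theorem mem_outPairs {p : VClass} {e : V × V} :
    e ∈ outPairs G ty p ↔ OutEdge G ty p e.1 e.2 := by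
  classical
  rw [outPairs, Finset.mem_union, mem_pairs, mem_pairs, OutEdge, VClass.not_isW_iff]
  tauto

theorem card_outPairs (p : VClass) : #(outPairs G ty p) = nOut G ty p := by
  classical
  rw [outPairs, Finset.card_union_of_disjoint, nOut]
  rw [Finset.disjoint_left]
  intro e h h'
  rw [mem_pairs] at h h'
  have := h.2.2.symm.trans h'.2.2
  simp at this

theorem three_le_nOut {p : VClass} (h : ∃ b₁ u₁ b₂ u₂ b₃ u₃, OutEdge G ty p b₁ u₁ ∧
    OutEdge G ty p b₂ u₂ ∧ OutEdge G ty p b₃ u₃ ∧ (b₁, u₁) ≠ (b₂, u₂) ∧ (b₁, u₁) ≠ (b₃, u₃) ∧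
    (b₂, u₂) ≠ (b₃, u₃)) : 3 ≤ nOut G ty p := by
  classical
  obtain ⟨b₁, u₁, b₂, u₂, b₃, u₃, e₁, e₂, e₃, n₁, n₂, n₃⟩ := h
  rw [← card_outPairs, ← Finset.card_eq_three.2 ⟨_, _, _, n₁, n₂, n₃, rfl⟩]
  refine Finset.card_le_card fun e he => ?_
  simp only [Finset.mem_insert, Finset.mem_singleton] at he
  rcases he with rfl | rfl | rfl
  exacts [mem_outPairs.2 e₁, mem_outPairs.2 e₂, mem_outPairs.2 e₃]

theorem nIn_le_of_not_twoIn {p : VClass} (h : ¬ TwoIn G ty p) : nIn G ty p ≤ 2 := by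
  by_contra! hlt
  obtain ⟨a₁, a₂, a₃, a₄, h1, h2, h3, h4⟩ := exists_two_inEdges hlt
  exact h ⟨a₁, a₂, a₃, a₄, h1, h2, h3, h4⟩

/-- The case in which the sizes of `A` and `B` differ by one. -/
theorem tourLE_two (h : IsFrame G ty D) (heq : #(cls ty A) = #(cls ty B) + 1) :
    TourLE G ty 7 2 := by
  classical
  have hD := h.large
  have hc := h.count_one heq
  have := h.nonempty
  have hpos : ((∃ b b', InEdge G ty B b b') ∨ ∃ b u, OutEdge G ty B b u) →
      1 ≤ nIn G ty B + nOut G ty B := by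
    rintro (⟨b, b', e⟩ | ⟨b, u, e⟩)
    · have := nIn_pos e
      omega
    · have := nOut_pos e
      omega
  refine h.sep.tourLE_two (h.exists_edge_B heq) ?_ ?_ ?_ ?_ ?_
  · rintro hin hB ⟨s, t, hst⟩
    have h1 := h.nOut_A_le_of_cover hst
    have h2 := hpos hB
    rw [nIn_eq_zero hin] at hc
    omega
  · rintro hT hB ⟨s, t, hst⟩
    have h1 := h.nOut_A_le_of_cover hst
    have h2 := three_le_nOut hB
    have h3 := nIn_le_of_not_twoIn hT
    omega
  · intro _ hT z
    have h3 := nIn_le_of_not_twoIn hT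
    -- At most one edge lies inside A, so at least D − 2 edges leave A for V₁ ∪ V₂, and `z` covers
    -- at most D/2 of them.
    have hpick : ∀ F : Finset (V × V), #F ≤ 2 → ∃ a u, OutEdge G ty A a u ∧ (a, u) ∉ F ∧ a ≠ z ∧
        u ≠ z := by
      intro F hF
      by_contra! hcon
      have h1 : outPairs G ty A ⊆ F ∪ {e ∈ outPairs G ty A | e.1 = z ∨ e.2 = z} := by
        rintro ⟨a, u⟩ he
        rw [Finset.mem_union, Finset.mem_filter]
        by_contra! hne
        have h2 := hne.2 he
        exact h2.2 (hcon a u (mem_outPairs.1 he) hne.1 h2.1)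
      have h2 := (Finset.card_le_card h1).trans (Finset.card_union_le _ _)
      rw [card_outPairs] at h2
      have h4 : 2 * #{e ∈ outPairs G ty A | e.1 = z ∨ e.2 = z} ≤ D := by
        by_cases hz : IsW (ty z)
        · by_cases hzA : ty z = A
          · refine le_trans (Nat.mul_le_mul_left 2 ?_) (h.out_le z hzA)
            have : ({e ∈ outPairs G ty A | e.1 = z ∨ e.2 = z} : Finset (V × V)) ⊆
                (({w | G.Adj z w ∧ ty w = V₁} : Finset V) ∪
                ({w | G.Adj z w ∧ ty w = V₂} : Finset V)).image fun w => (z, w) := by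
              rintro ⟨a, u⟩ he
              rw [Finset.mem_filter, mem_outPairs] at he
              obtain ⟨⟨e, ha, hu⟩, he⟩ := he
              have haz : a = z := he.resolve_right fun h => hu (by
                change u = z at h
                exact h ▸ hz)
              subst haz
              rw [VClass.not_isW_iff] at hu
              simp only [Finset.mem_image, Finset.mem_union, Finset.mem_filter, Finset.mem_univ,
                true_and, Prod.mk.injEq]
              exact ⟨u, hu.imp (fun h => ⟨e, h⟩) (fun h => ⟨e, h⟩), by simp⟩
            exact (Finset.card_le_card this).trans (Finset.card_image_le.trans
              (Finset.card_union_le _ _))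
          · rw [Finset.filter_eq_empty_iff.2]
            · simp
            · rintro ⟨a, u⟩ he (h | h)
              · exact hzA (h ▸ (mem_outPairs.1 he).2.1)
              · exact (mem_outPairs.1 he).2.2 (by
                  change u = z at h
                  exact h ▸ hz)
        · refine le_trans (Nat.mul_le_mul_left 2 ?_) (h.left_le z hz)
          have : ({e ∈ outPairs G ty A | e.1 = z ∨ e.2 = z} : Finset (V × V)) ⊆
              ({w | G.Adj z w ∧ ty w = A} : Finset V).image fun w => (w, z) := by
            rintro ⟨a, u⟩ he
            rw [Finset.mem_filter, mem_outPairs] at he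
            obtain ⟨⟨e, ha, hu⟩, he⟩ := he
            have huz : u = z := he.resolve_left fun h => hz (by
              change a = z at h
              exact h ▸ .inl ha)
            subst huz
            simp only [Finset.mem_image, Finset.mem_filter, Finset.mem_univ, true_and,
              Prod.mk.injEq]
            exact ⟨a, ⟨e.symm, ha⟩, by simp⟩
          exact (Finset.card_le_card this).trans Finset.card_image_le
      omega
    obtain ⟨a₁, u₁, e₁, -, m₁, m₁'⟩ := hpick ∅ (by simp)
    obtain ⟨a₂, u₂, e₂, n₂, m₂, m₂'⟩ := hpick {(a₁, u₁)} (by simp)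
    obtain ⟨a₃, u₃, e₃, n₃, m₃, m₃'⟩ := hpick {(a₁, u₁), (a₂, u₂)} Finset.card_le_two
    simp only [Finset.mem_insert, Finset.mem_singleton, not_or] at n₂ n₃
    exact ⟨a₁, u₁, a₂, u₂, a₃, u₃, e₁, e₂, e₃, Ne.symm n₂, Ne.symm n₃.1, Ne.symm n₃.2,
      ⟨m₁, m₁'⟩, ⟨m₂, m₂'⟩, m₃, m₃'⟩
  · intro hout y s t
    -- All W–U edges start in B, and `IsSep` gives three of them. Hence `nIn` of A is at least D +
    -- 3, more than the D + 2 ordered pairs covered by `y` and the edge `st`.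
    have h3 : 3 ≤ nOut G ty B := by
      have pick : ∀ s t : V, ∃ w u, OutEdge G ty B w u ∧ w ≠ s ∧ w ≠ t ∧ u ≠ s ∧ u ≠ t := by
        intro s t
        obtain ⟨w, u, e, hw, hu, hne⟩ := h.sep.exists_bip s t
        exact ⟨w, u, ⟨e, hw.resolve_left fun hA => hout w u ⟨e, hA, hu⟩, hu⟩, hne⟩
      obtain ⟨v⟩ := h.nonempty
      obtain ⟨b₁, u₁, e₁, -⟩ := pick v v
      obtain ⟨b₂, u₂, e₂, n₁, n₂, n₃, n₄⟩ := pick b₁ u₁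
      obtain ⟨b₃, u₃, e₃, m₁, m₂, m₃, m₄⟩ := pick b₁ u₂
      exact three_le_nOut ⟨b₁, u₁, b₂, u₂, b₃, u₃, e₁, e₂, e₃, by simp [Ne.symm n₁],
        by simp [Ne.symm m₁], by simp [Ne.symm m₄]⟩
    rw [nOut_eq_zero hout] at hc
    by_contra! hcon
    have h1 : pairs G ty A A ⊆ {(s, t), (t, s)} ∪
        ((({w | G.Adj y w ∧ ty w = A} : Finset V).image fun w => (y, w)) ∪
        (({w | G.Adj y w ∧ ty w = A} : Finset V).image fun w => (w, y))) := by
      rintro ⟨a, a'⟩ he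
      have hin : InEdge G ty A a a' := mem_pairs.1 he
      simp only [Finset.mem_union, Finset.mem_insert, Finset.mem_singleton, Prod.mk.injEq,
        Finset.mem_image, Finset.mem_filter, Finset.mem_univ, true_and]
      by_cases h1 : a = y
      · subst h1
        exact .inr (.inl ⟨a', ⟨hin.1, hin.2.2⟩, rfl, rfl⟩)
      by_cases h2 : a' = y
      · subst h2
        exact .inr (.inr ⟨a, ⟨hin.1.symm, hin.2.1⟩, rfl, rfl⟩)
      left
      by_cases h4 : a = s ∧ a' = t
      · exact .inl h4
      · exact .inr (hcon a a' hin h1 h2 fun h5 h6 => h4 ⟨h5, h6⟩)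
    have h2 : nIn G ty A ≤ 2 + (dg G ty y A + dg G ty y A) :=
      (Finset.card_le_card h1).trans ((Finset.card_union_le _ _).trans (Nat.add_le_add
        Finset.card_le_two ((Finset.card_union_le _ _).trans (Nat.add_le_add Finset.card_image_le
        Finset.card_image_le))))
    by_cases hy : ty y = A
    · have := h.inner_le hy
      omega
    · have h4 : pairs G ty A A ⊆ {(s, t), (t, s)} := by
        rintro ⟨a, a'⟩ he
        have hin : InEdge G ty A a a' := mem_pairs.1 he
        simp only [Finset.mem_insert, Finset.mem_singleton, Prod.mk.injEq]
        by_cases h4 : a = s ∧ a' = t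
        · exact .inl h4
        · exact .inr (hcon a a' hin (fun h => hy (h ▸ hin.2.1)) (fun h => hy (h ▸ hin.2.2))
            fun h5 h6 => h4 ⟨h5, h6⟩)
      have h5 : nIn G ty A ≤ 2 := (Finset.card_le_card h4).trans Finset.card_le_two
      omega
  · rintro hno hT ⟨a, u, e⟩
    by_contra! hcon
    have h1 : ∀ {a u x x'}, OutEdge G ty A a u → InEdge G ty A x x' → x = a ∨ x' = a := by
      intro a u x x' e hx
      exact or_iff_not_imp_left.2 (hcon a u x x' e hx)
    -- With a second starting vertex, every edge inside A would join the same two vertices. So `a`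
    -- covers all edges at A not going to B, which is at most D by `inner_le`, while the count
    -- exceeds D.
    have h2 : ∀ a' u', OutEdge G ty A a' u' → a' = a := by
      intro a' u' e'
      by_contra hne
      obtain ⟨a₁, a₂, a₃, a₄, i1, i2, n1, n2⟩ := hT
      have := h1 e i1
      have := h1 e i2
      have := h1 e' i1
      have := h1 e' i2
      grind
    have h3 := nIn_le_of_cover (F := {a}) fun x x' hx => by simpa using h1 e hx
    have h4 := nOut_le_of_cover (F := {a}) (.inl rfl) fun w u' e' => .inl (by simpa using h2 w u' e')
    rw [Finset.sum_filter, Finset.sum_singleton, if_pos e.2.1] at h3 h4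
    rw [Finset.sum_filter, Finset.sum_singleton, if_neg (by rw [e.2.1]; simp [IsW])] at h4
    have h5 := h.inner_le e.2.1
    have h6 := hpos (h.exists_edge_B heq hno)
    omega

end IsFrame

end SimpleGraph

/-! ### Hubs, and the case |A| ≥ |B| + 2. -/

namespace SimpleGraph

open VClass

variable {V : Type*} [Fintype V] {G : SimpleGraph V} {ty : V → VClass}

open scoped Classical in
/-- The vertices of `A` with many neighbours in `A`. -/
noncomputable def hubs (G : SimpleGraph V) (ty : V → VClass) (K : ℕ) : Finset V :=
  {v | ty v = A ∧ K ≤ dg G ty v A}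

open scoped Classical in
/-- The other vertices that are incident with many edges between `A` and `V₁ ∪ V₂`. -/
noncomputable def sideHubs (G : SimpleGraph V) (ty : V → VClass) (K : ℕ) : Finset V :=
  {v | (ty v = A ∧ dg G ty v A < K ∧ (K ≤ dg G ty v V₁ ∨ K ≤ dg G ty v V₂)) ∨
    (¬ IsW (ty v) ∧ K ≤ dg G ty v A)}

variable {K M D : ℕ}

theorem mem_hubs {v : V} : v ∈ hubs G ty K ↔ ty v = A ∧ K ≤ dg G ty v A := by simp [hubs]

theorem mem_sideHubs {v : V} : v ∈ sideHubs G ty K ↔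
    (ty v = A ∧ dg G ty v A < K ∧ (K ≤ dg G ty v V₁ ∨ K ≤ dg G ty v V₂)) ∨
    (¬ IsW (ty v) ∧ K ≤ dg G ty v A) := by simp [sideHubs]

theorem disjoint_hubs : Disjoint (hubs G ty K) (sideHubs G ty K) := by
  rw [Finset.disjoint_left]
  intro v h h'
  rw [mem_hubs] at h
  rw [mem_sideHubs] at h'
  rcases h' with h' | h'
  · omega
  · exact h'.1 (.inl h.1)

theorem card_hubs_mul_le : #(hubs G ty K) * K ≤ nIn G ty A := by
  rw [nIn, card_pairs, ← smul_eq_mul]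
  refine (Finset.card_nsmul_le_sum _ (fun v => dg G ty v A) _ fun v hv => (mem_hubs.1 hv).2).trans
    (Finset.sum_le_sum_of_subset fun v hv => mem_cls.2 (mem_hubs.1 hv).1)

/-- The factor 2 arises because an edge may be counted at both of its ends. -/
theorem card_sideHubs_mul_le : #(sideHubs G ty K) * K ≤ 2 * nOut G ty A := by
  classical
  have h1 : sideHubs G ty K ⊆ ({v ∈ sideHubs G ty K | ty v = A} ∪
      ({v ∈ sideHubs G ty K | ty v = V₁} ∪ {v ∈ sideHubs G ty K | ty v = V₂})) := by
    intro v hv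
    simp only [Finset.mem_union, Finset.mem_filter, hv, true_and]
    rcases mem_sideHubs.1 hv with h | h
    · exact .inl h.1
    · exact .inr (VClass.not_isW_iff.1 h.1)
  have h2 := (Finset.card_le_card h1).trans ((Finset.card_union_le _ _).trans
    (Nat.add_le_add_left (Finset.card_union_le _ _) _))
  have hA : #{v ∈ sideHubs G ty K | ty v = A} * K ≤ nOut G ty A := by
    rw [nOut, card_pairs, card_pairs, ← Finset.sum_add_distrib, ← smul_eq_mul]
    refine (Finset.card_nsmul_le_sum _ (fun v => dg G ty v V₁ + dg G ty v V₂) _ fun v hv => ?_).trans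
      (Finset.sum_le_sum_of_subset fun v hv => mem_cls.2 (Finset.mem_filter.1 hv).2)
    obtain ⟨h, h'⟩ := Finset.mem_filter.1 hv
    rcases mem_sideHubs.1 h with h | h
    · omega
    · exact absurd (.inl h') h.1
  have hU : ∀ c, ¬ IsW c → #{v ∈ sideHubs G ty K | ty v = c} * K ≤ #(pairs G ty A c) := by
    intro c hc
    rw [card_pairs_comm, card_pairs, ← smul_eq_mul]
    refine (Finset.card_nsmul_le_sum _ (fun v => dg G ty v A) _ fun v hv => ?_).trans
      (Finset.sum_le_sum_of_subset fun v hv => mem_cls.2 (Finset.mem_filter.1 hv).2)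
    obtain ⟨h, h'⟩ := Finset.mem_filter.1 hv
    rcases mem_sideHubs.1 h with h | h
    · exact absurd (h'.symm.trans h.1) (fun h => hc (h ▸ .inl rfl))
    · exact h.2
  have h3 := hU V₁ (by simp [IsW])
  have h4 := hU V₂ (by simp [IsW])
  have h5 := Nat.mul_le_mul_right K h2
  rw [Nat.add_mul, Nat.add_mul] at h5
  rw [nOut] at hA ⊢
  omega

/-- A vertex with many neighbours in a class has a neighbour there outside any small set. -/
theorem exists_fresh_neighbor {v : V} {p : VClass} {Z : Finset V} (h : #Z < dg G ty v p) :
    ∃ w ∉ Z, G.Adj v w ∧ ty w = p := by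
  classical
  obtain ⟨w, hw, hwZ⟩ := Finset.exists_mem_notMem_of_card_lt_card h
  exact ⟨w, hwZ, (Finset.mem_filter.1 hw).2⟩

section

variable [DecidableEq V]

theorem isBig_hubs (hK : #(hubs G ty K ∪ sideHubs G ty K) + M + 2 ≤ K) :
    IsBig G ty M (hubs G ty K ∪ sideHubs G ty K) := by
  constructor
  · intro v hv hB
    rcases Finset.mem_union.1 hv with h | h
    · have := (mem_hubs.1 h).1.symm.trans hB
      simp at this
    · rcases mem_sideHubs.1 h with h | h
      · have := h.1.symm.trans hB
        simp at this
      · exact h.1 (.inr hB)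
  · intro u hu huW F hF
    have hdeg : K ≤ dg G ty u A := by
      rcases Finset.mem_union.1 hu with h | h
      · exact (mem_hubs.1 h).2
      · rcases mem_sideHubs.1 h with h | h
        · exact absurd (.inl h.1) huW
        · exact h.2
    obtain ⟨a, ha, hua, hA⟩ := exists_fresh_neighbor (G := G) (ty := ty) (v := u) (p := A)
      (Z := (hubs G ty K ∪ sideHubs G ty K) ∪ F)
      (lt_of_le_of_lt (Finset.card_union_le _ _) (by omega))
    rw [Finset.mem_union, not_or] at ha
    exact ⟨a, hA, hua.symm, ha.1, ha.2⟩

theorem exists_leaf_of_mem_hubs (hK : #(hubs G ty K ∪ sideHubs G ty K) + M + 2 ≤ K) {x : V}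
    (hx : x ∈ hubs G ty K) {F : Finset V} (hF : #F ≤ M) :
    ∃ a, InEdge G ty A x a ∧ a ∉ hubs G ty K ∪ sideHubs G ty K ∧ a ∉ F := by
  obtain ⟨hA, hd⟩ := mem_hubs.1 hx
  obtain ⟨a, ha, hxa, haA⟩ := exists_fresh_neighbor (G := G) (ty := ty) (v := x) (p := A)
    (Z := (hubs G ty K ∪ sideHubs G ty K) ∪ F)
    (lt_of_le_of_lt (Finset.card_union_le _ _) (by omega))
  rw [Finset.mem_union, not_or] at ha
  exact ⟨a, ⟨hxa, hA, haA⟩, ha.1, ha.2⟩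

theorem exists_loop_of_mem_sideHubs (hK : #(hubs G ty K ∪ sideHubs G ty K) + M + 2 ≤ K) {x : V}
    (hx : x ∈ sideHubs G ty K) {F : Finset V} (hF : #F ≤ M) :
    ∃ u u', G.Adj u x ∧ G.Adj x u' ∧ u ≠ u' ∧ (ty u).part = (ty u').part ∧
      u ∉ hubs G ty K ∪ sideHubs G ty K ∧ u ∉ F ∧ u' ∉ hubs G ty K ∪ sideHubs G ty K ∧ u' ∉ F ∧
      wt (ty u) (ty x) + wt (ty x) (ty u') = 2 := by
  have key : ∀ p, K ≤ dg G ty x p → wt p (ty x) + wt (ty x) p = 2 →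
      ∃ u u', G.Adj u x ∧ G.Adj x u' ∧ u ≠ u' ∧ (ty u).part = (ty u').part ∧
      u ∉ hubs G ty K ∪ sideHubs G ty K ∧ u ∉ F ∧ u' ∉ hubs G ty K ∪ sideHubs G ty K ∧ u' ∉ F ∧
      wt (ty u) (ty x) + wt (ty x) (ty u') = 2 := by
    intro p hp hw
    obtain ⟨u, hu, hxu, hup⟩ := exists_fresh_neighbor (G := G) (ty := ty) (v := x) (p := p)
      (Z := (hubs G ty K ∪ sideHubs G ty K) ∪ F)
      (lt_of_le_of_lt (Finset.card_union_le _ _) (by omega))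
    obtain ⟨u', hu', hxu', hup'⟩ := exists_fresh_neighbor (G := G) (ty := ty) (v := x) (p := p)
      (Z := (hubs G ty K ∪ sideHubs G ty K) ∪ insert u F)
      (lt_of_le_of_lt (Finset.card_union_le _ _)
        (by have := Finset.card_insert_le u F; omega))
    rw [Finset.mem_union, not_or] at hu hu'
    rw [Finset.mem_insert, not_or] at hu'
    exact ⟨u, u', hxu.symm, hxu', Ne.symm hu'.2.1, by rw [hup, hup'], hu.1, hu.2, hu'.1, hu'.2.2,
      by rw [hup, hup', hw]⟩
  rcases mem_sideHubs.1 hx with ⟨hA, -, h | h⟩ | ⟨hU, h⟩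
  · exact key V₁ h (by rw [hA]; rfl)
  · exact key V₂ h (by rw [hA]; rfl)
  · refine key A h ?_
    rcases VClass.not_isW_iff.1 hU with h | h <;> rw [h] <;> rfl

theorem sideHubs_eq_empty (hK : 0 < K) (hout : ∀ w u, ¬ OutEdge G ty A w u) :
    sideHubs G ty K = ∅ := by
  rw [Finset.eq_empty_iff_forall_notMem]
  intro v hv
  have key : ∀ p, K ≤ dg G ty v p → ∃ w, G.Adj v w ∧ ty w = p := fun p hp => by
    obtain ⟨w, -, h⟩ := exists_fresh_neighbor (G := G) (ty := ty) (v := v) (p := p) (Z := ∅)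
      (by rw [Finset.card_empty]; omega)
    exact ⟨w, h⟩
  rcases mem_sideHubs.1 hv with ⟨hA, -, h | h⟩ | ⟨hU, h⟩
  · obtain ⟨w, e, hw⟩ := key _ h
    exact hout v w ⟨e, hA, by simp [hw, IsW]⟩
  · obtain ⟨w, e, hw⟩ := key _ h
    exact hout v w ⟨e, hA, by simp [hw, IsW]⟩
  · obtain ⟨w, e, hw⟩ := key _ h
    exact hout w v ⟨e.symm, hw, hU⟩

/-- Vertices outside `X` have value at most `c`, so the few extra vertices in `F` hardly matter. -/
theorem sum_union_filter_le {X F : Finset V} {P : V → Prop} [DecidablePred P] {f : V → ℕ} {c : ℕ}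
    (h : ∀ v ∉ X, P v → f v ≤ c) : ∑ v ∈ X ∪ F with P v, f v ≤ ∑ v ∈ X with P v, f v + #F * c := by
  have h1 : {v ∈ X ∪ F | P v} ⊆ {v ∈ X | P v} ∪ {v ∈ F | P v ∧ v ∉ X} := by
    intro v hv
    simp only [Finset.mem_union, Finset.mem_filter] at hv ⊢
    tauto
  refine (Finset.sum_le_sum_of_subset h1).trans (le_trans ?_ (Nat.add_le_add_left
    (Nat.mul_le_mul_right c (Finset.card_filter_le F fun v => P v ∧ v ∉ X)) _))
  rw [Finset.sum_union]
  · refine Nat.add_le_add_left ?_ _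
    rw [← smul_eq_mul]
    refine Finset.sum_le_card_nsmul _ _ _ fun v hv => ?_
    obtain ⟨-, h2, h3⟩ := Finset.mem_filter.1 hv
    exact h v h3 h2
  · rw [Finset.disjoint_left]
    intro v h2 h3
    exact (Finset.mem_filter.1 h3).2.2 (Finset.mem_filter.1 h2).1

end

namespace IsFrame

variable [DecidableEq V]

/-- The number of edges in `A` if these edges are covered by hubs and few other vertices. -/
theorem nIn_le_of_hubs (h : IsFrame G ty D) {F : Finset V}
    (hF : ∀ a a', InEdge G ty A a a' → a ∈ hubs G ty K ∪ F ∨ a' ∈ hubs G ty K ∪ F) :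
    nIn G ty A ≤ #(hubs G ty K) * D + 2 * (#F * K) := by
  have h1 := nIn_le_of_cover hF
  have h2 := sum_union_filter_le (X := hubs G ty K) (F := F) (P := fun v => ty v = A)
    (f := fun v => dg G ty v A) (c := K) fun v hv hA => by
      by_contra! hlt
      exact hv (mem_hubs.2 ⟨hA, hlt.le⟩)
  have h3 : 2 * ∑ v ∈ hubs G ty K with ty v = A, dg G ty v A ≤ #(hubs G ty K) * D := by
    rw [Finset.mul_sum]
    refine (Finset.sum_le_card_nsmul _ _ D fun v hv => ?_).trans ?_
    · have := h.inner_le (Finset.mem_filter.1 hv).2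
      omega
    · rw [smul_eq_mul]
      exact Nat.mul_le_mul_right _ (Finset.card_filter_le _ _)
  omega

/-- The number of edges at `A` that do not go to `B` if these edges are covered by hubs and few
other vertices. -/
theorem nIn_add_nOut_le_of_hubs (h : IsFrame G ty D) {F F' : Finset V}
    (hF : ∀ a a', InEdge G ty A a a' → a ∈ (hubs G ty K ∪ sideHubs G ty K) ∪ F ∨
      a' ∈ (hubs G ty K ∪ sideHubs G ty K) ∪ F)
    (hF' : ∀ a u, OutEdge G ty A a u → a ∈ (hubs G ty K ∪ sideHubs G ty K) ∪ F' ∨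
      u ∈ (hubs G ty K ∪ sideHubs G ty K) ∪ F') :
    2 * (nIn G ty A + nOut G ty A) ≤ (2 * #(hubs G ty K) + #(sideHubs G ty K)) * D +
      (4 * #(sideHubs G ty K) + 4 * #F + 6 * #F') * K := by
  have hd := disjoint_hubs (G := G) (ty := ty) (K := K)
  have h1 := nIn_le_of_cover hF
  have h2 := nOut_le_of_cover (.inl rfl) hF'
  have b1 := sum_union_filter_le (X := hubs G ty K ∪ sideHubs G ty K) (F := F)
    (P := fun v => ty v = A) (f := fun v => dg G ty v A) (c := K) fun v hv hA => by
      by_contra! hlt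
      exact hv (Finset.mem_union_left _ (mem_hubs.2 ⟨hA, hlt.le⟩))
  have b2 := sum_union_filter_le (X := hubs G ty K ∪ sideHubs G ty K) (F := F')
    (P := fun v => ty v = A) (f := fun v => dg G ty v V₁ + dg G ty v V₂) (c := 2 * K)
    fun v hv hA => by
      by_contra! hlt
      rw [Finset.mem_union, mem_hubs, mem_sideHubs, not_or] at hv
      refine hv.2 (.inl ⟨hA, ?_, by omega⟩)
      by_contra! hlt'
      exact hv.1 ⟨hA, hlt'⟩
  have b3 := sum_union_filter_le (X := hubs G ty K ∪ sideHubs G ty K) (F := F')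
    (P := fun v => ¬ IsW (ty v)) (f := fun v => dg G ty v A) (c := K) fun v hv hA => by
      by_contra! hlt
      exact hv (Finset.mem_union_right _ (mem_sideHubs.2 (.inr ⟨hA, hlt.le⟩)))
  have split : ∀ (P : V → Prop) [DecidablePred P] (f : V → ℕ),
      ∑ v ∈ hubs G ty K ∪ sideHubs G ty K with P v, f v =
        (∑ v ∈ hubs G ty K, if P v then f v else 0) + ∑ v ∈ sideHubs G ty K, if P v then f v else 0 := by
    intro P _ f
    rw [Finset.sum_filter, Finset.sum_union hd]
  rw [split] at b1 b2 b3
  -- A hub contributes at most D, by `inner_le`.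
  have c1 : 2 * (2 * (∑ v ∈ hubs G ty K, if ty v = A then dg G ty v A else 0) +
      (∑ v ∈ hubs G ty K, if ty v = A then dg G ty v V₁ + dg G ty v V₂ else 0) +
      ∑ v ∈ hubs G ty K, if ¬ IsW (ty v) then dg G ty v A else 0) ≤ 2 * (#(hubs G ty K) * D) := by
    refine Nat.mul_le_mul_left 2 ?_
    rw [Finset.mul_sum, ← Finset.sum_add_distrib, ← Finset.sum_add_distrib, ← smul_eq_mul]
    refine Finset.sum_le_card_nsmul _ _ _ fun v hv => ?_
    obtain ⟨hA, -⟩ := mem_hubs.1 hv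
    have := h.inner_le hA
    rw [if_pos hA, if_pos hA, if_neg (by rw [hA]; simp [IsW])]
    omega
  -- A side hub contributes at most D/2, plus at most 2K for its fewer than K neighbours in A if it
  -- lies in A.
  have c2 : 2 * (2 * (∑ v ∈ sideHubs G ty K, if ty v = A then dg G ty v A else 0) +
      (∑ v ∈ sideHubs G ty K, if ty v = A then dg G ty v V₁ + dg G ty v V₂ else 0) +
      ∑ v ∈ sideHubs G ty K, if ¬ IsW (ty v) then dg G ty v A else 0) ≤
      #(sideHubs G ty K) * (D + 4 * K) := by
    rw [Finset.mul_sum, ← Finset.sum_add_distrib, ← Finset.sum_add_distrib, Finset.mul_sum,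
      ← smul_eq_mul]
    refine Finset.sum_le_card_nsmul _ _ _ fun v hv => ?_
    rcases mem_sideHubs.1 hv with ⟨hA, hK, -⟩ | ⟨hU, -⟩
    · have := h.out_le v hA
      rw [if_pos hA, if_pos hA, if_neg (by rw [hA]; simp [IsW])]
      omega
    · have := h.left_le v hU
      have hA : ty v ≠ A := fun h => hU (.inl h)
      rw [if_neg hA, if_neg hA, if_pos hU]
      omega
  nlinarith

/-- The case in which `A` has at least two vertices more than `B`. -/
theorem tourLE_of_two_le (h : IsFrame G ty D) {t ℓ m : ℕ} {τ ε : ℝ} (ht : 2 ≤ t)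
    (heq : #(cls ty A) = #(cls ty B) + t) (htm : 2 * t ≤ 2 * ℓ + m)
    (hK : #(hubs G ty K) + #(sideHubs G ty K) + (4 * t + 50) + 2 ≤ K)
    (hKτ : (K : ℝ) ≤ τ * D) (hτ0 : 0 < τ) (hτ : τ ≤ ε ^ 2 / 1000) (hε : 0 < ε) (hε1 : ε ≤ 1 / 1000)
    (hℓ : ((ℓ : ℝ) - 1 + ε) * D < nIn G ty A) : TourLE G ty (ℓ + m + 6) (2 * t) := by
  have hcard := Finset.card_union_le (hubs G ty K) (sideHubs G ty K)
  have hK' : #(hubs G ty K ∪ sideHubs G ty K) + (4 * t + 50) + 2 ≤ K := by omega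
  have hbig := isBig_hubs hK'
  have := h.nonempty
  have hbase := h.sep.hasBase hbig (X₁ := hubs G ty K) (by omega) (fun v hv => (mem_hubs.1 hv).1)
    Finset.subset_union_left
  have hD : (0 : ℝ) < D := by
    have := h.large
    exact_mod_cast (by omega : 0 < D)
  have hτ' : τ ≤ ε / 1000000 := by nlinarith
  have hτ1 : τ ≤ 1 / 1000 := by nlinarith
  refine hbase.tourLE disjoint_hubs ht htm le_rfl
    (fun x hx F hF => exists_leaf_of_mem_hubs hK' hx hF)
    (fun x hx F hF => exists_loop_of_mem_sideHubs hK' hx hF)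
    (sideHubs_eq_empty (by omega)) ?_ ?_
  -- If `F` and the hubs covered all edges inside A, then `nIn` would be at most |hubs|·D plus an
  -- error that `τ ≪ ε` keeps below the lower bound (ℓ − 1 + ε)D from the characteristic.
  · intro F hF hlt
    by_contra! hcon
    have h1 := h.nIn_le_of_hubs (K := K) (F := F) fun a a' e => by
      rw [Finset.mem_union, Finset.mem_union]
      have := hcon a a' e
      tauto
    have h2 : (nIn G ty A : ℝ) ≤ #(hubs G ty K) * D + 2 * (#F * K) := by exact_mod_cast h1
    have h3 : (#F : ℝ) * K ≤ #F * (τ * D) := by gcongr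
    have h4 : ((ℓ : ℝ) - 1 + ε) * D < (#(hubs G ty K) + 2 * (#F * τ)) * D := by linarith
    have h5 := lt_of_mul_lt_mul_right h4 hD.le
    have h6 : (#F : ℝ) ≤ 14 + 2 * (ℓ - #(hubs G ty K)) := by
      have : (#F : ℝ) + #(hubs G ty K) + #(hubs G ty K) + 2 ≤ 16 + ℓ + ℓ := by exact_mod_cast hF
      linarith
    have h7 : (1 : ℝ) ≤ ℓ - #(hubs G ty K) := by
      have : (#(hubs G ty K) : ℝ) + 1 ≤ ℓ := by exact_mod_cast hlt
      linarith
    have h8 : (#F : ℝ) * τ ≤ (14 + 2 * (ℓ - #(hubs G ty K))) * τ := by gcongr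
    nlinarith
  -- With `x` hubs and `y` side hubs covering nearly everything, 2t ≤ 2x + y and ℓ − 1 + ε < x hold
  -- up to error terms with factor τ.
  · intro F F' hF hF' hc hc'
    have h1 := h.nIn_add_nOut_le_of_hubs (K := K) (F := F) (F' := F')
      (fun a a' e => by
        rw [Finset.mem_union, Finset.mem_union (s := hubs G ty K ∪ sideHubs G ty K)]
        have := hc a a' e
        tauto)
      (fun a u e => by
        rw [Finset.mem_union, Finset.mem_union (s := hubs G ty K ∪ sideHubs G ty K)]
        have := hc' a u e
        tauto)
    have h2 := h.nIn_le_of_hubs (K := K) (F := sideHubs G ty K ∪ F) fun a a' e => by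
      rw [← Finset.union_assoc, Finset.mem_union,
        Finset.mem_union (s := hubs G ty K ∪ sideHubs G ty K)]
      have := hc a a' e
      tauto
    have h3 : D * t ≤ nIn G ty A + nOut G ty A := by
      have := h.count
      rw [heq, Nat.mul_add] at this
      omega
    have hsF := Finset.card_union_le (sideHubs G ty K) F
    obtain ⟨x, hx⟩ : ∃ x, x = #(hubs G ty K) := ⟨_, rfl⟩
    obtain ⟨y, hy⟩ : ∃ y, y = #(sideHubs G ty K) := ⟨_, rfl⟩
    rw [← hx, ← hy] at h1 ⊢
    rw [← hx] at h2
    rw [← hy] at hsF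
    have hM : ((4 * #F + 6 * #F' : ℕ) : ℝ) ≤ 40 * t + 500 := by
      have : 4 * #F + 6 * #F' ≤ 40 * t + 500 := by omega
      exact_mod_cast this
    have hM' : (#(sideHubs G ty K ∪ F) : ℝ) ≤ y + 4 * t + 50 := by
      have : #(sideHubs G ty K ∪ F) ≤ y + 4 * t + 50 := by omega
      exact_mod_cast this
    have k1 : 2 * (t : ℝ) ≤ 2 * x + y + (4 * y + (40 * t + 500)) * τ := by
      have e1 : 2 * ((D : ℝ) * t) ≤ (2 * x + y) * D + (4 * y + (4 * #F + 6 * #F')) * K := by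
        have : 2 * (D * t) ≤ (2 * x + y) * D + (4 * y + (4 * #F + 6 * #F')) * K := by
          rw [← add_assoc (4 * y)]
          omega
        exact_mod_cast this
      have e2 : ((4 : ℝ) * y + (4 * #F + 6 * #F')) * K ≤ (4 * y + (40 * t + 500)) * (τ * D) := by
        push_cast at hM
        gcongr
      have e3 : 2 * (t : ℝ) * D ≤ (2 * x + y + (4 * y + (40 * t + 500)) * τ) * D := by linarith
      exact le_of_mul_le_mul_right e3 hD
    have k2 : (ℓ : ℝ) - 1 + ε < x + 2 * ((y + 4 * t + 50) * τ) := by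
      have e1 : (nIn G ty A : ℝ) ≤ x * D + 2 * (#(sideHubs G ty K ∪ F) * K) := by
        exact_mod_cast h2
      have e2 : (#(sideHubs G ty K ∪ F) : ℝ) * K ≤ (y + 4 * t + 50) * (τ * D) := by gcongr
      have e3 : ((ℓ : ℝ) - 1 + ε) * D < (x + 2 * ((y + 4 * t + 50) * τ)) * D := by linarith
      exact lt_of_mul_lt_mul_right e3 hD.le
    have ht' : (2 : ℝ) ≤ t := by exact_mod_cast ht
    have hy0 : (0 : ℝ) ≤ y := Nat.cast_nonneg y
    have hx0 : (0 : ℝ) ≤ x := Nat.cast_nonneg x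
    have k3 : (4 * (y : ℝ) + (40 * t + 500)) * τ ≤ (4 * y + (40 * t + 500)) * (1 / 1000) := by
      gcongr
    have k4 : ((y : ℝ) + 4 * t + 50) * τ ≤ (y + 4 * t + 50) * (1 / 1000) := by gcongr
    -- Here 2x + y ≤ t + 1 would force t < 2.
    by_cases hlx : ℓ ≤ x
    · rw [Nat.sub_eq_zero_of_le hlx]
      by_contra! hcon
      have : (2 * x + y : ℝ) ≤ t + 1 := by exact_mod_cast (by omega : 2 * x + y ≤ t + 1)
      linarith
    · have k5 : (1 : ℝ) ≤ ℓ - x := by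
        have : (x : ℝ) + 1 ≤ ℓ := by exact_mod_cast (by omega : x + 1 ≤ ℓ)
        linarith
      have k6 : ((y : ℝ) + 4 * t + 50) * τ ≤ (y + 4 * t + 50) * (ε / 1000000) := by gcongr
      -- If x < ℓ, the error term must exceed ε, so y + t is huge and the additive constants in the
      -- claim become negligible.
      have k7 : (500000 : ℝ) ≤ y + 4 * t + 50 := by
        by_contra! hlt
        have : ((y : ℝ) + 4 * t + 50) * (ε / 1000000) ≤ 500000 * (ε / 1000000) := by gcongr
        linarith
      by_contra! hcon
      have : (2 * x + y : ℝ) ≤ t + 1 + (ℓ - x) := by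
        have : 2 * x + y + x ≤ t + 1 + ℓ := by omega
        have : (2 * x + y + x : ℝ) ≤ t + 1 + ℓ := by exact_mod_cast this
        linarith
      linarith

end IsFrame

end SimpleGraph

/-! ### From edge counts and 3-connectivity to the counts by classes. -/

namespace SimpleGraph

open VClass

variable {V : Type*} [Fintype V] [DecidableEq V] {G : SimpleGraph V} {ty : V → VClass}

theorem degIn_eq_dg [DecidableRel G.Adj] {S : Finset V} {p : VClass} (hS : ∀ v, v ∈ S ↔ ty v = p)
    (v : V) : G.degIn v S = dg G ty v p := by
  rw [degIn, dg]
  congr 1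
  ext w
  simp only [Finset.mem_filter, Finset.mem_univ, true_and, hS]
  exact and_comm

theorem degIn_union [DecidableRel G.Adj] {S T : Finset V} (h : Disjoint S T) (v : V) :
    G.degIn v (S ∪ T) = G.degIn v S + G.degIn v T := by
  rw [degIn, Finset.filter_union, Finset.card_union_of_disjoint (Finset.disjoint_filter_filter h)]
  rfl

theorem card_cls_eq {S : Finset V} {p : VClass} (hS : ∀ v, v ∈ S ↔ ty v = p) :
    #(cls ty p) = #S := by
  congr 1
  ext v
  rw [mem_cls, hS]

theorem two_mul_eWithin [DecidableRel G.Adj] {S : Finset V} {p : VClass}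
    (hS : ∀ v, v ∈ S ↔ ty v = p) : 2 * eWithin G.edgeFinset S = nIn G ty p := by
  let H : SimpleGraph V :=
    { Adj := fun v w => G.Adj v w ∧ v ∈ S ∧ w ∈ S
      symm := ⟨fun v w h => ⟨h.1.symm, h.2.2, h.2.1⟩⟩
      loopless := ⟨fun v h => h.1.ne rfl⟩ }
  have : DecidableRel H.Adj := fun v w => inferInstanceAs (Decidable (G.Adj v w ∧ v ∈ S ∧ w ∈ S))
  have h1 : eWithin G.edgeFinset S = #H.edgeFinset := by
    rw [eWithin]
    congr 1
    ext e
    induction e with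
    | _ v w =>
      rw [Finset.mem_filter, mem_edgeFinset, mem_edgeFinset, mem_edgeSet, mem_edgeSet,
        Finset.mk_mem_sym2_iff]
  have h2 := H.sum_degrees_eq_twice_card_edges
  rw [h1, ← h2, nIn, card_pairs, cls, Finset.sum_filter]
  refine Finset.sum_congr rfl fun v _ => ?_
  rw [← card_neighborFinset_eq_degree, neighborFinset_eq_filter]
  split_ifs with hv
  · rw [dg]
    congr 1
    ext w
    simp only [Finset.mem_filter, Finset.mem_univ, true_and]
    exact ⟨fun h => ⟨h.1, (hS w).1 h.2.2⟩, fun h => ⟨h.1, (hS v).2 hv, (hS w).2 h.2⟩⟩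
  · rw [Finset.card_eq_zero, Finset.filter_eq_empty_iff]
    exact fun w _ h => hv ((hS v).1 h.2.1)

theorem eBetween_eq_nOut [DecidableRel G.Adj] {S U : Finset V} {p : VClass} (hp : IsW p)
    (hS : ∀ v, v ∈ S ↔ ty v = p) (hU : ∀ v, v ∈ U ↔ ty v = V₁ ∨ ty v = V₂) :
    eBetween G.edgeFinset S U = nOut G ty p := by
  have hU' : ∀ v, v ∈ U ↔ ¬ IsW (ty v) := fun v => by rw [hU, VClass.not_isW_iff]
  rw [← IsFrame.card_outPairs, eBetween]
  symm
  refine Finset.card_bij (fun e _ => s(e.1, e.2)) ?_ ?_ ?_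
  · intro e he
    rw [IsFrame.mem_outPairs] at he
    rw [Finset.mem_filter, mem_edgeFinset, mem_edgeSet]
    exact ⟨he.1, e.1, (hS _).2 he.2.1, e.2, (hU' _).2 he.2.2, rfl⟩
  · rintro ⟨a, u⟩ he ⟨a', u'⟩ he' h
    rw [IsFrame.mem_outPairs] at he he'
    rcases Sym2.eq_iff.1 h with ⟨h1, h2⟩ | ⟨h1, h2⟩
    · simp only at h1 h2
      rw [h1, h2]
    · simp only at h1 h2
      subst h1 h2
      exact absurd (he.2.1 ▸ hp) he'.2.2
  · intro e he
    obtain ⟨he, a, ha, u, hu, rfl⟩ := Finset.mem_filter.1 he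
    rw [mem_edgeFinset, mem_edgeSet] at he
    exact ⟨(a, u), IsFrame.mem_outPairs.2 ⟨he, (hS a).1 ha, (hU' u).1 hu⟩, rfl⟩

theorem nIn_add_nOut_le_eBetween [DecidableRel G.Adj] {S T : Finset V}
    (hS : ∀ v, v ∈ S ↔ ty v = A) (hT : ∀ v, v ∈ T ↔ ty v = B) :
    nIn G ty A + nOut G ty A ≤ 2 * eBetween G.edgeFinset S Tᶜ := by
  classical
  have hdis : Disjoint (pairs G ty A A) (IsFrame.outPairs G ty A) := by
    rw [Finset.disjoint_left]
    intro e h h'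
    rw [mem_pairs] at h
    rw [IsFrame.mem_outPairs] at h'
    exact h'.2.2 (.inl h.2.2)
  rw [nIn, ← IsFrame.card_outPairs, ← Finset.card_union_of_disjoint hdis]
  have key : ∀ e ∈ pairs G ty A A ∪ IsFrame.outPairs G ty A, G.Adj e.1 e.2 ∧ ty e.1 = A ∧
      ty e.2 ≠ B := by
    intro e he
    rw [Finset.mem_union, mem_pairs, IsFrame.mem_outPairs] at he
    rcases he with he | he
    · exact ⟨he.1, he.2.1, by rw [he.2.2]; simp⟩
    · exact ⟨he.1, he.2.1, fun h => he.2.2 (.inr h)⟩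
  refine Finset.card_le_mul_card_image_of_maps_to (f := fun e => s(e.1, e.2)) ?_ 2 ?_
  · intro e he
    obtain ⟨h1, h2, h3⟩ := key e he
    rw [Finset.mem_filter, mem_edgeFinset, mem_edgeSet]
    exact ⟨h1, e.1, (hS _).2 h2, e.2, Finset.mem_compl.2 fun h => h3 ((hT _).1 h), rfl⟩
  · intro b _
    induction b with
    | _ x y =>
      refine (Finset.card_le_card (t := {(x, y), (y, x)}) fun e he => ?_).trans Finset.card_le_two
      rcases Sym2.eq_iff.1 (Finset.mem_filter.1 he).2 with ⟨h1, h2⟩ | ⟨h1, h2⟩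
      · simp [← h1, ← h2]
      · simp [← h1, ← h2]

/-- In a `3`-connected graph the edges leaving a part of a partition into large parts cannot be
covered by two vertices. -/
theorem IsKConnected.isSep (hG : G.IsKConnected 3) (hty : ∀ r : Fin 3, ∀ s t : V,
    ∃ x, (ty x).part = r ∧ x ≠ s ∧ x ≠ t) : IsSep G ty := by
  intro r s t
  obtain ⟨x, hx, hxs, hxt⟩ := hty r s t
  obtain ⟨y, hy, hys, hyt⟩ := hty (r + 1) s t
  have hconn := hG.2 {s, t} (lt_of_le_of_lt Finset.card_le_two (by norm_num))
  have hmem : ∀ {v : V}, v ∈ (((({s, t} : Finset V) : Set V))ᶜ : Set V) ↔ v ≠ s ∧ v ≠ t := by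
    intro v
    simp
  -- A walk avoiding `s` and `t` from part `r` to the next part has to leave part `r` somewhere.
  obtain ⟨p⟩ := hconn.preconnected ⟨x, hmem.2 ⟨hxs, hxt⟩⟩ ⟨y, hmem.2 ⟨hys, hyt⟩⟩
  obtain ⟨d, -, h1, h2⟩ := p.exists_boundary_dart {v | (ty v.1).part = r} hx (by
    simp only [Set.mem_ofPred_eq, hy]
    intro h
    fin_cases r <;> simp at h)
  have h3 := hmem.1 d.fst.2
  have h4 := hmem.1 d.snd.2
  exact ⟨d.fst.1, d.snd.1, d.adj, h1, h2, h3.1, h3.2, h4.1, h4.2⟩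

end SimpleGraph

/-! ### From the hypotheses to a frame; the characteristic; the number of hubs. -/

namespace SimpleGraph

open VClass

variable {V : Type*} [Fintype V] [DecidableEq V] {G : SimpleGraph V} {ty : V → VClass}

/-- The class of a vertex with respect to four sets that partition the vertices. -/
def classOf (S₁ S₂ S₃ : Finset V) (v : V) : VClass :=
  if v ∈ S₁ then V₁ else if v ∈ S₂ then V₂ else if v ∈ S₃ then A else B

theorem IsWeakRobustPartition.classOf_iff [DecidableRel G.Adj]
    {𝒱 : Finpartition (Finset.univ : Finset V)} {S₁ S₂ S T : Finset V} {ρ ν τ η : ℝ}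
    (h : G.IsWeakRobustPartition 𝒱 S₁ S₂ S T ρ ν τ η) (v : V) :
    (v ∈ S₁ ↔ classOf S₁ S₂ S v = V₁) ∧ (v ∈ S₂ ↔ classOf S₁ S₂ S v = V₂) ∧
      (v ∈ S ↔ classOf S₁ S₂ S v = A) ∧ (v ∈ T ↔ classOf S₁ S₂ S v = B) := by
  have h12 : v ∈ S₁ → v ∉ S₂ := fun hv => Finset.disjoint_left.1 h.disjoint₁₂ hv
  have h1 : v ∈ S₁ → v ∉ S ∪ T := fun hv => Finset.disjoint_left.1 h.disjoint₁ hv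
  have h2 : v ∈ S₂ → v ∉ S ∪ T := fun hv => Finset.disjoint_left.1 h.disjoint₂ hv
  have hAB : v ∈ S → v ∉ T := fun hv => Finset.disjoint_left.1 h.bipExpander.1.disjoint hv
  have hcov : v ∈ S₁ ∨ v ∈ S₂ ∨ v ∈ S ∨ v ∈ T := by
    obtain ⟨X, hX, hv⟩ := 𝒱.exists_mem (Finset.mem_univ v)
    rw [h.parts_eq] at hX
    simp only [Finset.mem_insert, Finset.mem_singleton] at hX
    rcases hX with rfl | rfl | rfl
    · exact .inl hv
    · exact .inr (.inl hv)
    · exact .inr (.inr (Finset.mem_union.1 hv))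
  rw [Finset.mem_union, not_or] at h1 h2
  unfold classOf
  split_ifs <;> simp_all

theorem nIn_add_nOut_le_of_isCloseToBipartite [DecidableRel G.Adj] {S T : Finset V} {ρ : ℝ}
    (hS : ∀ v, v ∈ S ↔ ty v = A) (hT : ∀ v, v ∈ T ↔ ty v = B) (h : G.IsCloseToBipartite S T ρ) :
    ((nIn G ty A + nOut G ty A : ℕ) : ℝ) ≤ 2 * (ρ * Fintype.card V ^ 2) := by
  have h1 : ((nIn G ty A + nOut G ty A : ℕ) : ℝ) ≤ 2 * eBetween G.edgeFinset S Tᶜ := by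
    exact_mod_cast nIn_add_nOut_le_eBetween (G := G) hS hT
  have h2 := h.edges
  have h3 : (0 : ℝ) ≤ eBetween G.edgeFinset T Sᶜ := Nat.cast_nonneg _
  linarith

/-- If the graph is close to bipartite on `S ∪ T`, then `T` has almost `D` vertices. -/
theorem card_ge_of_isCloseToBipartite [DecidableRel G.Adj] {S T : Finset V} {ρ : ℝ} {D n : ℕ}
    (hS : ∀ v, v ∈ S ↔ ty v = A) (hT : ∀ v, v ∈ T ↔ ty v = B) (hn : Fintype.card V = n)
    (hreg : G.IsRegularOfDegree D) (hnD : n ≤ 4 * D) (hn0 : 0 < n)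
    (h : G.IsCloseToBipartite S T ρ) (hρ0 : 0 < ρ) (hρ : ρ ≤ 1 / 1000000) :
    99 * D ≤ 100 * #T := by
  have hα := nIn_add_nOut_le_of_isCloseToBipartite hS hT h
  rw [hn] at hα
  have hcount : D * #S ≤ nIn G ty A + nOut G ty A + #S * #T := by
    have h1 : nIn G ty A + nOut G ty A + #(pairs G ty A B) = #S * D := by
      rw [nIn, nOut, card_pairs, card_pairs, card_pairs, card_pairs, ← Finset.sum_add_distrib,
        ← Finset.sum_add_distrib, ← Finset.sum_add_distrib, ← card_cls_eq hS, ← smul_eq_mul,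
        ← Finset.sum_const]
      refine Finset.sum_congr rfl fun v _ => ?_
      have := dg_sum (G := G) (ty := ty) v
      have := hreg v
      omega
    have h2 : #(pairs G ty A B) ≤ #S * #T := by
      rw [card_pairs, ← smul_eq_mul, ← card_cls_eq hS, ← card_cls_eq hT]
      exact Finset.sum_le_card_nsmul _ _ _ fun v _ => IsFrame.dg_le_card v B
    rw [mul_comm D]
    omega
  -- If B had fewer than 99D/100 vertices, each vertex of A would send D/100 edges elsewhere. With
  -- |A| ≥ √ρ n this exceeds the permitted 2ρn², as ρ is small.
  by_contra! hlt
  have hcount' : (D : ℝ) * #S ≤ (nIn G ty A + nOut G ty A : ℕ) + #S * #T := by exact_mod_cast hcount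
  have hlt' : (100 : ℝ) * #T ≤ 99 * D := by exact_mod_cast hlt.le
  have hl := h.card_left
  rw [hn] at hl
  have hn0' : (0 : ℝ) < n := by exact_mod_cast hn0
  have hnD' : (n : ℝ) ≤ 4 * D := by exact_mod_cast hnD
  have hs := Real.sq_sqrt hρ0.le
  have hs0 := Real.sqrt_pos.2 hρ0
  have hs1 : √ρ ≤ 1 / 1000 := by
    rw [Real.sqrt_le_left (by norm_num)]
    linarith
  have h1 : (#S : ℝ) * D ≤ 200 * (ρ * n ^ 2) := by nlinarith [Nat.cast_nonneg (α := ℝ) #S]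
  have h2 : √ρ * n * (n / 4) ≤ #S * D := by
    have : (n : ℝ) / 4 ≤ D := by linarith
    gcongr
  have h3 : √ρ * n * (n / 4) ≤ 200 * (√ρ ^ 2 * n ^ 2) := by
    rw [hs]
    linarith
  have h4 : (0 : ℝ) < √ρ * n ^ 2 := by positivity
  nlinarith

theorem IsWeakRobustPartition.isFrame [DecidableRel G.Adj]
    {𝒱 : Finpartition (Finset.univ : Finset V)} {S₁ S₂ S T : Finset V} {ρ ν τ : ℝ} {D n : ℕ}
    (h : G.IsWeakRobustPartition 𝒱 S₁ S₂ S T ρ ν τ (1 / 16)) (hn : Fintype.card V = n)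
    (hG : G.IsKConnected 3) (hreg : G.IsRegularOfDegree D) (hnD : n ≤ 4 * D) (hD : 1000 ≤ D)
    (hρ0 : 0 < ρ) (hρ : ρ ≤ 1 / 1000000)
    (hS₁ : (D : ℝ) / 2 ≤ #S₁) (hS₂ : (D : ℝ) / 2 ≤ #S₂)
    (hmax : G.MaxDegreeBetweenLE S (S₁ ∪ S₂) ((D : ℝ) / 2))
    (hin : ∀ a ∈ S, G.degIn a S ≤ G.degIn a T) : IsFrame G (classOf S₁ S₂ S) D := by
  have m₁ : ∀ v, v ∈ S₁ ↔ classOf S₁ S₂ S v = V₁ := fun v => (h.classOf_iff v).1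
  have m₂ : ∀ v, v ∈ S₂ ↔ classOf S₁ S₂ S v = V₂ := fun v => (h.classOf_iff v).2.1
  have m₃ : ∀ v, v ∈ S ↔ classOf S₁ S₂ S v = A := fun v => (h.classOf_iff v).2.2.1
  have m₄ : ∀ v, v ∈ T ↔ classOf S₁ S₂ S v = B := fun v => (h.classOf_iff v).2.2.2
  have hc₁ : D ≤ 2 * #S₁ := by
    have : (D : ℝ) ≤ 2 * #S₁ := by linarith
    exact_mod_cast this
  have hc₂ : D ≤ 2 * #S₂ := by
    have : (D : ℝ) ≤ 2 * #S₂ := by linarith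
    exact_mod_cast this
  have hT := card_ge_of_isCloseToBipartite m₃ m₄ hn hreg hnD (by rw [← hn]; have := hG.1; omega)
    h.bipExpander.1 hρ0 hρ
  have hDn : D ≤ n := by
    obtain ⟨v, -⟩ := Finset.card_pos.1 (show 0 < #S₁ by omega)
    have := G.degree_lt_card_verts v
    rw [hreg v, hn] at this
    exact this.le
  have hDn' : (D : ℝ) ≤ n := by exact_mod_cast hDn
  refine ⟨hG.isSep ?_, hD, ?_, ?_, ?_, ?_, ?_, nIn_add_nOut hreg, ?_, ?_, ?_, ?_, ?_⟩
  · have pick : ∀ {X : Finset V} {p : VClass}, (∀ v, v ∈ X ↔ classOf S₁ S₂ S v = p) → 2 < #X →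
        ∀ s t : V, ∃ x, (classOf S₁ S₂ S x).part = p.part ∧ x ≠ s ∧ x ≠ t := by
      intro X p hX hcard s t
      obtain ⟨x, hx, hx'⟩ := Finset.exists_mem_notMem_of_card_lt_card
        (lt_of_le_of_lt (Finset.card_le_two (a := s) (b := t)) hcard)
      simp only [Finset.mem_insert, Finset.mem_singleton, not_or] at hx'
      exact ⟨x, by rw [(hX x).1 hx], hx'.1, hx'.2⟩
    intro r
    fin_cases r
    · exact pick m₁ (by omega)
    · exact pick m₂ (by omega)
    · exact pick m₄ (by omega)
  · intro v
    rw [dg_sum, hreg v]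
  · rw [card_cls_sum, hn]
    exact hnD
  · rw [card_cls_eq m₁]
    exact hc₁
  · rw [card_cls_eq m₂]
    exact hc₂
  · rw [card_cls_eq m₄]
    exact hT
  · intro v hv
    rw [← degIn_eq_dg m₃, ← degIn_eq_dg m₄]
    exact hin v ((m₃ v).2 hv)
  · intro v hv
    have := hmax.1 v ((m₃ v).2 hv)
    rw [degIn_union h.disjoint₁₂, degIn_eq_dg m₁, degIn_eq_dg m₂] at this
    have : (2 : ℝ) * ((dg G (classOf S₁ S₂ S) v V₁ + dg G (classOf S₁ S₂ S) v V₂ : ℕ) : ℝ) ≤ D := by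
      linarith
    exact_mod_cast this
  · intro v hv
    rw [VClass.not_isW_iff, ← m₁, ← m₂] at hv
    have := hmax.2 v (Finset.mem_union.2 hv)
    rw [degIn_eq_dg m₃] at this
    have : (2 : ℝ) * (dg G (classOf S₁ S₂ S) v A : ℝ) ≤ D := by linarith
    exact_mod_cast this
  · intro v hv
    have := h.minDegree_right v ((m₄ v).2 hv)
    rw [degIn_eq_dg m₃, hn] at this
    have : (D : ℝ) ≤ 32 * (dg G (classOf S₁ S₂ S) v A : ℝ) := by linarith
    exact_mod_cast this
  · intro v hv
    have hown : ∀ {X : Finset V} {p : VClass}, (∀ v, v ∈ X ↔ classOf S₁ S₂ S v = p) →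
        X ∈ 𝒱.parts → classOf S₁ S₂ S v = p → D ≤ 16 * dg G (classOf S₁ S₂ S) v p := by
      intro X p hX hXp hvp
      have := h.minDegree X hXp v ((hX v).2 hvp)
      rw [degIn_eq_dg hX, hn] at this
      have : (D : ℝ) ≤ 16 * (dg G (classOf S₁ S₂ S) v p : ℝ) := by linarith
      exact_mod_cast this
    rcases VClass.not_isW_iff.1 hv with h' | h' <;> rw [h']
    · exact hown m₁ (by rw [h.parts_eq]; simp) h'
    · exact hown m₂ (by rw [h.parts_eq]; simp) h'

/-- The characteristic of the graph bounds the difference of the sizes of the bipartition. -/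
theorem IsChar.two_mul_le [DecidableRel G.Adj] {S U : Finset V} {D t ℓ m : ℕ} {ε : ℝ}
    (h : G.IsChar S U ((D : ℝ) / 2) ε ℓ m) (hD : 0 < D) (hε : ε ≤ 1 / 4)
    (ht : D * t ≤ 2 * eWithin G.edgeFinset S + eBetween G.edgeFinset S U) : 2 * t ≤ 2 * ℓ + m := by
  obtain ⟨h1, ⟨hm, -⟩, h2⟩ := h
  have hD' : (0 : ℝ) < D := by exact_mod_cast hD
  set p : ℝ := (eWithin G.edgeFinset S : ℝ) / ((D : ℝ) / 2) with hp
  set q : ℝ := (eBetween G.edgeFinset S U : ℝ) / ((D : ℝ) / 2) with hq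
  have hℓ : p - ε ≤ ℓ := by
    have := Int.le_ceil (p - ε)
    rw [← h1] at this
    exact_mod_cast this
  -- Rounding down to an even number loses at most one.
  have hm' : ⌈q - ε⌉ ≤ m + 1 := by
    rcases Int.even_or_odd ⌈q - ε⌉ with he | ho
    · have := h2 ⟨he, le_rfl⟩
      omega
    · have := h2 (show ⌈q - ε⌉ - 1 ∈ {k : ℤ | Even k ∧ k ≤ ⌈q - ε⌉} from
        ⟨ho.sub_odd odd_one, by omega⟩)
      omega
  have hq' : q - ε ≤ m + 1 := by
    have := (Int.le_ceil (q - ε)).trans (Int.cast_le.2 hm')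
    push_cast at this
    exact this
  have hpe : (eWithin G.edgeFinset S : ℝ) = p * (D / 2) := by
    rw [hp]
    field_simp
  have hqe : (eBetween G.edgeFinset S U : ℝ) = q * (D / 2) := by
    rw [hq]
    field_simp
  have ht' : (D : ℝ) * t ≤ 2 * eWithin G.edgeFinset S + eBetween G.edgeFinset S U := by
    exact_mod_cast ht
  rw [hpe, hqe] at ht'
  have h3 : (t : ℝ) ≤ p + q / 2 := by
    have : (t : ℝ) * D ≤ (p + q / 2) * D := by linarith
    exact le_of_mul_le_mul_right this hD'
  -- The errors add up to 1 + 3ε < 2, and the evenness of `m` then improves this bound to the claim.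
  have h4 : (2 * t : ℝ) < 2 * ℓ + m + 2 := by linarith
  have h5 : 2 * t < 2 * ℓ + m + 2 := by exact_mod_cast h4
  obtain ⟨k, hk⟩ := hm
  omega

theorem IsChar.lt_mul [DecidableRel G.Adj] {S U : Finset V} {D ℓ m : ℕ} {ε : ℝ}
    (h : G.IsChar S U ((D : ℝ) / 2) ε ℓ m) (hD : 0 < D) :
    ((ℓ : ℝ) - 1 + ε) * D < 2 * eWithin G.edgeFinset S := by
  have hD' : (0 : ℝ) < D := by exact_mod_cast hD
  have h1 := Int.ceil_lt_add_one ((eWithin G.edgeFinset S : ℝ) / ((D : ℝ) / 2) - ε)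
  rw [← h.1] at h1
  push_cast at h1
  have h2 : (ℓ : ℝ) - 1 + ε < eWithin G.edgeFinset S / ((D : ℝ) / 2) := by linarith
  rw [lt_div_iff₀ (by positivity)] at h2
  linarith

/-- At most 2ρn² ≤ 32ρD² is available for `nIn + nOut`, so there are at most 64ρD²/K hubs. With K
about τD and ρ much smaller than τ², this and t ≤ 4ρD are far below K, so a hub has fresh neighbours
throughout the construction. -/
theorem card_hubs_add_le [DecidableRel G.Adj] {S T : Finset V} {ρ τ : ℝ} {D n t : ℕ}
    (hS : ∀ v, v ∈ S ↔ ty v = A) (hT : ∀ v, v ∈ T ↔ ty v = B) (hn : Fintype.card V = n)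
    (h : G.IsCloseToBipartite S T ρ) (hnD : n ≤ 4 * D) (hρ0 : 0 < ρ) (hτ0 : 0 < τ)
    (hρτ : ρ ≤ τ ^ 2 / 1000000) (hτ1 : τ ≤ 1) (hρD : 250000 ≤ ρ * D) (ht : #S = #T + t) :
    #(hubs G ty ⌊τ * D⌋₊) + #(sideHubs G ty ⌊τ * D⌋₊) + (4 * t + 50) + 2 ≤ ⌊τ * D⌋₊ := by
  set K := ⌊τ * D⌋₊ with hK
  have hα := nIn_add_nOut_le_of_isCloseToBipartite hS hT h
  rw [hn] at hα
  have hnD' : (n : ℝ) ≤ 4 * D := by exact_mod_cast hnD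
  have hD0 : (0 : ℝ) ≤ D := Nat.cast_nonneg D
  have hn2 : (n : ℝ) ^ 2 ≤ (4 * D) ^ 2 := by gcongr
  have hα' : ((nIn G ty A + nOut G ty A : ℕ) : ℝ) ≤ 32 * ρ * D * D := by nlinarith
  have hρτ' : ρ ≤ τ / 1000000 := by nlinarith
  have hτD : 250000 ≤ τ * D := by nlinarith
  have hKτ : τ * D - 1 < K := by
    have := Nat.lt_floor_add_one (τ * (D : ℝ))
    linarith
  have ht' : (t : ℝ) ≤ 4 * ρ * D := by
    have h1 := (abs_le.1 h.card_diff).2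
    rw [ht, hn] at h1
    push_cast at h1
    have : ρ * n ≤ ρ * (4 * D) := by gcongr
    linarith
  have h1 : (#(hubs G ty K) + #(sideHubs G ty K)) * K ≤ 2 * (nIn G ty A + nOut G ty A) := by
    have := card_hubs_mul_le (G := G) (ty := ty) (K := K)
    have := card_sideHubs_mul_le (G := G) (ty := ty) (K := K)
    rw [Nat.add_mul]
    omega
  have h2 : ((#(hubs G ty K) + #(sideHubs G ty K) : ℕ) : ℝ) * K ≤ 64 * ρ * D * D := by
    have : ((#(hubs G ty K) + #(sideHubs G ty K) : ℕ) : ℝ) * K ≤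
        2 * (nIn G ty A + nOut G ty A : ℕ) := by exact_mod_cast h1
    linarith
  have h3 : ((#(hubs G ty K) + #(sideHubs G ty K) : ℕ) : ℝ) ≤ τ * D / 1000 := by
    by_contra! hlt
    have h4 : τ * D / 1000 * (τ * D / 2) ≤
        ((#(hubs G ty K) + #(sideHubs G ty K) : ℕ) : ℝ) * K := by
      have : τ * D / 2 ≤ K := by linarith
      gcongr
    have h5 : 64 * ρ * D * D ≤ 64 * (τ ^ 2 / 1000000) * D * D := by gcongr
    have h6 : 0 < (τ * D) ^ 2 := by positivity
    nlinarith
  have h4 : 4 * ρ * D ≤ 4 * (τ / 1000000) * D := by gcongr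
  have h5 : ((#(hubs G ty K) + #(sideHubs G ty K) + (4 * t + 50) + 2 : ℕ) : ℝ) ≤ K := by
    push_cast at h3 ⊢
    linarith
  exact_mod_cast h5

theorem TourLE.exists_pathSystem [DecidableRel G.Adj] {E : ℕ} {c : ℤ}
    {𝒱 : Finpartition (Finset.univ : Finset V)} {S₁ S₂ S T : Finset V} {ρ ν τ η : ℝ}
    (h : G.IsWeakRobustPartition 𝒱 S₁ S₂ S T ρ ν τ η) (ht : TourLE G (classOf S₁ S₂ S) E c) :
    ∃ P : G.PathSystem, #P.edges ≤ E ∧ P.bal S T (S₁ ∪ S₂) = (c : ℝ) / 2 ∧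
      (P.reducedMultigraph 𝒱).HasEulerTour := by
  obtain ⟨k, hk, ht⟩ := ht
  have hφ : ∀ v, 𝒱.part v = ![S₁, S₂, S ∪ T] (classOf S₁ S₂ S v).part := by
    intro v
    have hpart : ∀ X ∈ 𝒱.parts, v ∈ X → 𝒱.part v = X := fun X hX hv => 𝒱.part_eq_of_mem hX hv
    rw [h.parts_eq] at hpart
    obtain ⟨m₁, m₂, m₃, m₄⟩ := h.classOf_iff v
    cases hv : classOf S₁ S₂ S v
    · exact hpart S₁ (by simp) (m₁.2 hv)
    · exact hpart S₂ (by simp) (m₂.2 hv)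
    · exact hpart (S ∪ T) (by simp) (Finset.mem_union_left _ (m₃.2 hv))
    · exact hpart (S ∪ T) (by simp) (Finset.mem_union_right _ (m₄.2 hv))
  have hparts : ∀ X, X ∈ 𝒱.parts ↔ ∃ r, ![S₁, S₂, S ∪ T] r = X := by
    intro X
    rw [h.parts_eq, Finset.mem_insert, Finset.mem_insert, Finset.mem_singleton]
    constructor
    · rintro (rfl | rfl | rfl)
      exacts [⟨0, rfl⟩, ⟨1, rfl⟩, ⟨2, rfl⟩]
    · rintro ⟨r, rfl⟩
      fin_cases r <;> simp
  obtain ⟨P, h1, h2, h3⟩ := ht.exists_pathSystem (A := S) (B := T) (U := S₁ ∪ S₂)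
    (fun v => (h.classOf_iff v).2.2.1) (fun v => (h.classOf_iff v).2.2.2)
    (fun v => by rw [Finset.mem_union, (h.classOf_iff v).1, (h.classOf_iff v).2.1]) 𝒱
    ![S₁, S₂, S ∪ T] hφ hparts
  exact ⟨P, h1 ▸ hk, h2, h3⟩

end SimpleGraph

/-! ### The choice of constants and the three cases for |A| − |B|. -/

theorem lemma7p3 :
    ∃ f : ℝ → ℝ,
      (∀ x ∈ Set.Ioc (0 : ℝ) 1, f x ∈ Set.Ioc (0 : ℝ) 1) ∧
      MonotoneOn f (Set.Ioc (0 : ℝ) 1) ∧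
      ∀ (n D ℓ m : ℕ) (ρ ν τ ε : ℝ),
        0 < n → 0 < ρ → 0 < ν → 0 < τ → 0 < ε →
        1 / (n : ℝ) ≤ f ρ → ρ ≤ f ν → ν ≤ f τ → τ ≤ f ε → ε ≤ f 1 →
        ∀ (V : Type*) [Fintype V] [DecidableEq V] (G : SimpleGraph V) [DecidableRel G.Adj]
          (𝒱 : Finpartition (Finset.univ : Finset V)) (V₁ V₂ A B : Finset V),
          Fintype.card V = n →
          G.IsKConnected 3 →
          G.IsRegularOfDegree D →
          (n : ℝ) / 4 ≤ D →
          G.IsWeakRobustPartition 𝒱 V₁ V₂ A B ρ ν τ (1 / 16) →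
          (D : ℝ) / 2 ≤ V₁.card →
          (D : ℝ) / 2 ≤ V₂.card →
          G.MaxDegreeBetweenLE A (V₁ ∪ V₂) ((D : ℝ) / 2) →
          (∀ x ∈ V₁, G.degIn x V₂ ≤ G.degIn x V₁) →
          (∀ x ∈ V₂, G.degIn x V₁ ≤ G.degIn x V₂) →
          (∀ a ∈ A, G.degIn a A ≤ G.degIn a B) →
          G.IsChar A (V₁ ∪ V₂) ((D : ℝ) / 2) ε ℓ m →
          ∃ P : G.PathSystem,
            P.edges.card ≤ ℓ + m + 6 ∧
            P.bal A B (V₁ ∪ V₂) = (A.card : ℝ) - B.card ∧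
            (P.reducedMultigraph 𝒱).HasEulerTour := by
  -- A quadratic function is enough: the hub count needs ρ ≪ τ², the error terms need τ ≪ ε, and 1/n
  -- ≪ ρ² makes ρn large.
  refine ⟨fun x => x ^ 2 / 1000000, fun x hx => ⟨by have := hx.1; positivity, ?_⟩,
    fun x hx y hy hxy => ?_, ?_⟩
  · have : x ^ 2 ≤ 1 := pow_le_one₀ hx.1.le hx.2
    linarith
  · have : x ^ 2 ≤ y ^ 2 := pow_le_pow_left₀ hx.1.le hxy 2
    linarith
  intro n D ℓ m ρ ν τ ε hn0 hρ0 hν0 hτ0 hε0 hnρ hρν hντ hτε hε1 V _ _ G _ 𝒱 V₁ V₂ A B hn hG hreg hnD h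
    hV₁ hV₂ hmax _ _ hin hchar
  simp only [one_pow] at hnρ hρν hντ hτε hε1
  have hτ1 : τ ≤ 1 / 1000000 := by nlinarith
  have hν1 : ν ≤ 1 / 1000000 := by nlinarith
  have hρ1 : ρ ≤ 1 / 1000000 := by nlinarith
  have hρτ : ρ ≤ τ ^ 2 / 1000000 := by nlinarith
  have hn0' : (0 : ℝ) < n := by exact_mod_cast hn0
  have hρn : 1000000 ≤ ρ * n := by
    rw [div_le_div_iff₀ hn0' (by norm_num)] at hnρ
    nlinarith [mul_pos hρ0 hn0']
  have hnD' : n ≤ 4 * D := by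
    have : (n : ℝ) ≤ 4 * D := by linarith
    exact_mod_cast this
  have hρD : 250000 ≤ ρ * D := by nlinarith
  have hD : 1000 ≤ D := by
    have : (1000 : ℝ) ≤ D := by nlinarith [Nat.cast_nonneg (α := ℝ) D]
    exact_mod_cast this
  have m₃ := fun v => (h.classOf_iff v).2.2.1
  have m₄ := fun v => (h.classOf_iff v).2.2.2
  have hframe := h.isFrame hn hG hreg hnD' hD hρ0 hρ1 hV₁ hV₂ hmax hin
  obtain ⟨t, ht⟩ := Nat.exists_eq_add_of_le h.card_le
  have hcA := SimpleGraph.card_cls_eq m₃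
  have hcB := SimpleGraph.card_cls_eq m₄
  have heW := SimpleGraph.two_mul_eWithin (G := G) m₃
  have heB := SimpleGraph.eBetween_eq_nOut (G := G) (U := V₁ ∪ V₂) (.inl rfl) m₃ fun v => by
    rw [Finset.mem_union, (h.classOf_iff v).1, (h.classOf_iff v).2.1]
  have htm : 2 * t ≤ 2 * ℓ + m := by
    refine hchar.two_mul_le (by omega) (by linarith) ?_
    have := hframe.count
    rw [hcA, hcB, ht, Nat.mul_add] at this
    omega
  have key : SimpleGraph.TourLE G (SimpleGraph.classOf V₁ V₂ A) (ℓ + m + 6) (2 * t) := by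
    -- For t = 1, `htm` gives ℓ + m ≥ 1, so the seven edges of `tourLE_two` are within the bound.
    rcases Nat.lt_or_ge t 2 with h2 | h2
    · interval_cases t
      · exact (hframe.tourLE_zero (by omega)).of_le (by omega) (by norm_num)
      · exact (hframe.tourLE_two (by omega)).of_le (by omega) (by norm_num)
    · refine hframe.tourLE_of_two_le (K := ⌊τ * D⌋₊) (τ := τ) (ε := ε) h2 (by omega) htm
        (SimpleGraph.card_hubs_add_le m₃ m₄ hn h.bipExpander.1 hnD' hρ0 hτ0 hρτ (by linarith) hρD ht)
        (Nat.floor_le (by positivity)) hτ0 (by nlinarith) hε0 (by linarith) ?_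
      rw [← heW]
      push_cast
      exact hchar.lt_mul (by omega)
  obtain ⟨P, h1, h2, h3⟩ := key.exists_pathSystem h
  refine ⟨P, h1, ?_, h3⟩
  rw [h2, ht]
  push_cast
  ring
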